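/- Let $\Lambda\subset\mathbb R^4_{(x,p)}$ be an embedded smooth Lagrangian surface with a smooth nowhere vanishing volume form $d\mu$. In local coordinates write $x=X$, $p=P$ on $\Lambda$. For $\varepsilon\ge0$ let $\mathcal J^\varepsilon=D(X-i\varepsilon P)/D\mu$ and $\mathcal J=\mathcal J^0$; points with $\mathcal J\ne0$ are called regular, points with $\mathcal J=0$ focal. Fix a regular point $\alpha_0$. The Maslov index of a regular point $\alpha$ (depending on a path from $\alpha_0$ to $\alpha$) is $m(\alpha)=\frac1\pi\lim_{\varepsilon\to+0}\Delta\operatorname{Arg}\mathcal J^\varepsilon$, the increment being taken along the path. *Singular chart.* Let $U\subset\Lambda$ be a connected open set containing a focal point and contained in the domain of coordinates $(\tau,\psi)$ on $\Lambda$ such that $d\tau=P\,dX$ (eikonal coordinates), and let $d\mu=\mu\,d\tau\wedge d\psi$. Let $\tau(x,\psi)$ be a smooth function on an open set $W\subset\mathbb R^2_x\times\mathbb R_\psi$, with $(\tau(x,\psi),\psi)$ in the range of the coordinates, such that, for $\tau=\tau(x,\psi)$, one has $\langle P(\tau,\psi),x-X(\tau,\psi)\rangle=0$ and $\det(P,P_\psi)\neq0$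 on $W$, and such that $(x,\psi)\mapsto(x,\tau_x(x,\psi))$ maps $\{(x,\psi)\in W:\tau_\psi(x,\psi)=0\}$ diffeomorphically onto $U$. Fix a path $\gamma$ from $\alpha_0$ to a point of $U$; for regular $\alpha\in U$, the index $m(\alpha)$ is taken along $\gamma$ continued by a path inside $U$. Assume that $U$ contains a regular point $\alpha$, and let the Maslov index of the singular chart be $m=m(\alpha)$ if $\det(X_\tau,X_\psi)$ and $\det(P,P_\psi)$ have the same sign at $\alpha$, and $m=m(\alpha)+1$ if the signs are opposite. *Angle-integral operator.* For $A\in C_0^\infty(U)$ let $$[KA](x,h)=\Bigl(\frac{i}{2\pi h}\Bigr)^{1/2}e^{-i\pi m/2}\int\Bigl[\chi(x,\psi)\,e^{\frac ih\tau}A(\tau,\psi)\sqrt{|\mu\det(P,P_\psi)|}\Bigr]_{\tau=\tau(x,\psi)}d\psi ,\qquad \arg i=\tfrac\pi2,$$ where the integral is over those $\psi$ for which $(x,\psi)\in W$, and $x$ ranges over a measurable set $N\subset\mathbb R^2$. Here $\chi$ is any smooth function on $W$ which equals $1$ near $\{(X(\alpha),\psi(\alpha)):\alpha\in\operatorname{supp}A\}$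 and is such that $\{(x,\psi)\in W: x\in N,\ (x,\psi)\in\operatorname{supp}\chi,\ (\tau(x,\psi),\psi)\in\operatorname{supp}A\}$ is compact (for instance $\chi\in C_0^\infty(W)$ with $N=\mathbb R^2$; or $\chi\equiv1$, i.e. no cut-off, with $N$ such that the set is compact). *Standard operator.* A standard canonical chart $V\subset U$ is a connected open set containing a regular point, on which one of the following systems of functions is a coordinate system $q$: $(x_1,x_2)$; $(x_1,p_2)$ in some rotated orthonormal coordinate system of $\mathbb R^2_x$ (with the same rotation of $\mathbb R^2_p$; this includes $(p_1,x_2)$ up to sign); $(p_1,p_2)$. Let $p''$ be the vector of the momenta occurring in $q$, let $k\in\{0,1,2\}$ be their number, and let $x''$ be the vector of conjugate positions, with values $X''$ on $\Lambda$. The index of $V$ is $m_V=m(\alpha)+\sigma_-(\partial x''/\partial p'')(\alpha)$, where $\alpha\in V$ is a regular point and $\sigma_-$ is the negative index of inertia, the derivatives being taken with the positions in $q$ fixed. For $A\in C_0^\infty(V)$, $$[K_VA](x,h)=\Bigl(\frac{i}{2\pi h}\Bigr)^{k/2}e^{-i\pi m_V/2}\int e^{\frac ih(\tau+\langle p'',x''-X''\rangle)}A\,\Bigl|\frac{d\mu}{dq}\Bigr|^{1/2}dp''$$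 (no integration if $k=0$), the integrand being extended by zero outside the range of $q$ on $V$. **Theorem.** Modulo $O(h)$ in $L^2(N)$ as $h\to+0$, the following hold. 1. For every standard canonical chart $V\subset U$ and every $A\in C_0^\infty(V)$, one has $KA=K_VA+O(h)$. 2. For every cover of $U$ by standard canonical charts $V_k\subset U$, every smooth locally finite partition of unity $\{e_k\}$ on $U$ subordinate to it, and every $A\in C_0^\infty(U)$, one has $KA=\sum_kK_{V_k}(e_kA)+O(h)$. Moreover, 3. For every standard canonical chart $V\subset U$ with coordinates of the form $(x_1,p_2)$ (in some rotated orthonormal coordinate system) that contains a focal point, one has $m\equiv m_V\pmod 4$. -/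

import Mathlib

open Set Filter Topology MeasureTheory
open scoped ContDiff

noncomputable section

namespace MaslovOperator

/-- The plane `ℝ²`; used for positions `x`, momenta `p` and coordinates `(τ, ψ)`. -/
abbrev Plane : Type := ℝ × ℝ

/-- The phase space `ℝ⁴` with points `(x, p)`. -/
abbrev Phase : Type := Plane × Plane

/-- The bilinear form `⟨ξ, η⟩ = ξ₁ η₁ + ξ₂ η₂`. -/
def dot (u v : Plane) : ℝ := u.1 * v.1 + u.2 * v.2

/-- The determinant of the `2 × 2` matrix with columns `u`, `v`. -/
def det2 (u v : Plane) : ℝ := u.1 * v.2 - v.1 * u.2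

/-- The determinant of the derivative of a map of the plane. -/
def jacDet (f : Plane → Plane) (y : Plane) : ℝ :=
  det2 (fderiv ℝ f y (1, 0)) (fderiv ℝ f y (0, 1))

/-! ### Lagrangian surfaces with a volume form -/

/-- `r`, restricted to the open set `D`, is a regular smooth local parametrization of the subset
`S` of the phase space: a smooth injective immersion which is a homeomorphism of `D` onto a
relatively open subset of `S`. -/
structure IsRegularParam (S : Set Phase) (D : Set Plane) (r : Plane → Phase) : Prop where
  isOpen : IsOpen D
  smooth : ContDiffOn ℝ ∞ r D
  injOn : InjOn r D
  immersion : ∀ y ∈ D, Function.Injective (fderiv ℝ r y)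
  image_open : ∀ O ⊆ D, IsOpen O → ∃ O' : Set Phase, IsOpen O' ∧ r '' O = S ∩ O'

/-- An embedded smooth Lagrangian surface in the phase space, with a smooth nowhere vanishing
volume form. The volume form at a point is recorded by an alternating form `vol` on `ℝ⁴`, of which
only the restriction to the tangent plane matters. -/
structure LagrangianSurface where
  carrier : Set Phase
  vol : Phase → Phase [⋀^Fin 2]→ₗ[ℝ] ℝ
  exists_param : ∀ a ∈ carrier, ∃ D r, IsRegularParam carrier D r ∧ a ∈ r '' D
  lagrangian : ∀ D r, IsRegularParam carrier D r → ∀ y ∈ D, ∀ v w : Plane,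
    dot (fderiv ℝ r y v).2 (fderiv ℝ r y w).1 = dot (fderiv ℝ r y w).2 (fderiv ℝ r y v).1
  vol_smooth : ∀ D r, IsRegularParam carrier D r →
    ContDiffOn ℝ ∞ (fun y => vol (r y) ![fderiv ℝ r y (1, 0), fderiv ℝ r y (0, 1)]) D
  vol_ne_zero : ∀ D r, IsRegularParam carrier D r → ∀ y ∈ D,
    vol (r y) ![fderiv ℝ r y (1, 0), fderiv ℝ r y (0, 1)] ≠ 0

namespace LagrangianSurface

variable (L : LagrangianSurface)

/-- The tangent plane at a point of the surface. -/
def tangent (a : Phase) : Set Phase :=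
  {v | ∃ D r, IsRegularParam L.carrier D r ∧ ∃ y ∈ D, r y = a ∧ ∃ w, fderiv ℝ r y w = v}

/-- The density of the volume form in the coordinates given by the parametrization `r`. -/
def density (r : Plane → Phase) (y : Plane) : ℝ :=
  L.vol (r y) ![fderiv ℝ r y (1, 0), fderiv ℝ r y (0, 1)]

/-- A regular (nonsingular) point: the projection to the `x`-plane is a local diffeomorphism. -/
def IsRegularPt (a : Phase) : Prop :=
  a ∈ L.carrier ∧ ∃ u ∈ L.tangent a, ∃ v ∈ L.tangent a, det2 u.1 v.1 ≠ 0

/-- A focal (singular) point: the Jacobian of the projection to the `x`-plane vanishes. -/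
def IsFocalPt (a : Phase) : Prop :=
  a ∈ L.carrier ∧ ∀ u ∈ L.tangent a, ∀ v ∈ L.tangent a, det2 u.1 v.1 = 0

end LagrangianSurface

/-- The value of the complex two-form `d(x₁ - iεp₁) ∧ d(x₂ - iεp₂)` on the pair `(u, v)`. -/
def complexArea (ε : ℝ) (u v : Phase) : ℂ :=
  ((u.1.1 : ℂ) - Complex.I * ε * u.2.1) * ((v.1.2 : ℂ) - Complex.I * ε * v.2.2) -
    ((v.1.1 : ℂ) - Complex.I * ε * v.2.1) * ((u.1.2 : ℂ) - Complex.I * ε * u.2.2)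

namespace LagrangianSurface

variable (L : LagrangianSurface)

/-- `z` is the value at the point `a` of the Jacobian `𝒥^ε = D(X - iεP)/Dμ`. -/
def IsJacobian (ε : ℝ) (a : Phase) (z : ℂ) : Prop :=
  ∀ u ∈ L.tangent a, ∀ v ∈ L.tangent a, complexArea ε u v = z * L.vol a ![u, v]

/-- The Maslov index of a path on the surface is `m`: `m` is `1/π` times the limit as `ε → +0`
of the increment along the path of a continuous branch `Θ ε` of the argument of `𝒥^ε`. -/
def HasMaslovIndex {a b : L.carrier} (γ : Path a b) (m : ℤ) : Prop :=
  ∃ Θ : ℝ → C(unitInterval, ℝ),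
    (∀ ε > 0, ∀ t : unitInterval, ∃ ρ : ℝ, 0 < ρ ∧
      L.IsJacobian ε (γ t : Phase) (ρ * Complex.exp (Complex.I * Θ ε t))) ∧
    Tendsto (fun ε => (Θ ε 1 - Θ ε 0) / Real.pi) (𝓝[>] 0) (𝓝 (m : ℝ))

/-- `m` is the Maslov index of the point `b`, for a path that first follows `γ` and then stays in
the subset `U` of the surface. -/
def HasPointIndex (U : Set Phase) {a₀ u₀ : L.carrier} (γ : Path a₀ u₀) (b : Phase) (m : ℤ) :
    Prop :=
  ∃ (b' : L.carrier) (δ : Path u₀ b'), (b' : Phase) = b ∧ (∀ t, (δ t : Phase) ∈ U) ∧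
    L.HasMaslovIndex (γ.trans δ) m

end LagrangianSurface

/-! ### Singular charts and the angle-integral canonical operator -/

/-- The critical set `Π` of the function `τ(x, ψ)` on `W`, where `τ_ψ = 0`. -/
def critSet (W : Set (Plane × ℝ)) (tau : Plane × ℝ → ℝ) : Set (Plane × ℝ) :=
  {z ∈ W | fderiv ℝ tau z (0, 1) = 0}

/-- The map `(x, ψ) ↦ (x, τ_x(x, ψ))`. -/
def gradMap (tau : Plane × ℝ → ℝ) (z : Plane × ℝ) : Phase :=
  (z.1, (fderiv ℝ tau z ((1, 0), 0), fderiv ℝ tau z ((0, 1), 0)))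

/-- A singular chart. The map `r = (X, P)` on `D` expresses points of the surface through
eikonal coordinates `(τ, ψ)`; the chart itself is the set `r '' G`. Since `(X, P)` and `tau` are
smooth, the bijection `bijOn` is a diffeomorphism. -/
structure SingularChart (L : LagrangianSurface) where
  D : Set Plane
  r : Plane → Phase
  param : IsRegularParam L.carrier D r
  /-- The Pfaff equation `dτ = P dX`. -/
  eikonal : ∀ y ∈ D, ∀ w : Plane, dot (r y).2 (fderiv ℝ r y w).1 = w.1
  G : Set Plane
  G_subset : G ⊆ D
  G_open : IsOpen G
  G_connected : IsConnected G
  focal : ∃ y ∈ G, L.IsFocalPt (r y)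
  W : Set (Plane × ℝ)
  W_open : IsOpen W
  tau : Plane × ℝ → ℝ
  tau_smooth : ContDiffOn ℝ ∞ tau W
  tau_mem : ∀ z ∈ W, (tau z, z.2) ∈ D
  /-- The equation `⟨P(τ, ψ), x - X(τ, ψ)⟩ = 0` for `τ = τ(x, ψ)`. -/
  tau_eq : ∀ z ∈ W, dot (r (tau z, z.2)).2 (z.1 - (r (tau z, z.2)).1) = 0
  bijOn : BijOn (gradMap tau) (critSet W tau) (r '' G)
  det_ne_zero : ∀ z ∈ W,
    det2 (r (tau z, z.2)).2 (fderiv ℝ r (tau z, z.2) (0, 1)).2 ≠ 0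

namespace SingularChart

variable {L : LagrangianSurface} (C : SingularChart L)

/-- The function `X(τ, ψ)`. -/
def X (y : Plane) : Plane := (C.r y).1

/-- The function `P(τ, ψ)`. -/
def P (y : Plane) : Plane := (C.r y).2

/-- The density `μ(τ, ψ)` of the volume form. -/
def mu (y : Plane) : ℝ := L.density C.r y

/-- The determinant `det(P, P_ψ)`. -/
def detP (y : Plane) : ℝ := det2 (C.P y) (fderiv ℝ C.P y (0, 1))

/-- `m` is the Maslov index of the singular chart: for some nonsingular point of the chart, `m` is
the Maslov index of that point if `det(X_τ, X_ψ)` and `det(P, P_ψ)` have the same sign there, and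
exceeds it by `1` if they have opposite signs. -/
def HasIndex {a₀ u₀ : L.carrier} (γ : Path a₀ u₀) (m : ℤ) : Prop :=
  ∃ y ∈ C.G, L.IsRegularPt (C.r y) ∧ ∃ k : ℤ, L.HasPointIndex (C.r '' C.G) γ (C.r y) k ∧
    m = k + (if jacDet C.X y * C.detP y < 0 then 1 else 0)

/-- The angle-integral canonical operator in the singular chart,
`(i/2πh)^{1/2} e^{-iπm/2} ∫ [χ e^{iτ/h} A √|μ det(P, P_ψ)|]_{τ = τ(x, ψ)} dψ`,
the integral being over all `ψ` with `(x, ψ) ∈ W`. For `χ = 1` there is no cut-off. -/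
def angleOp (χ : Plane × ℝ → ℝ) (m : ℤ) (A : Plane → ℂ) (h : ℝ) (x : Plane) : ℂ :=
  (Complex.I / (2 * Real.pi * h)) ^ ((1 : ℂ) / 2) *
    Complex.exp (-Complex.I * Real.pi * m / 2) *
    ∫ ψ : ℝ, C.W.indicator (fun z : Plane × ℝ =>
      (χ z : ℂ) * Complex.exp (Complex.I / h * C.tau z) * A (C.tau z, z.2) *
        (Real.sqrt |C.mu (C.tau z, z.2) * C.detP (C.tau z, z.2)| : ℂ)) (x, ψ)

/-- The cut-off `χ` and the set `N` of points `x` are admissible for `A`: `χ` is smooth on `W`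
and equals `1` near every point `(X(α), ψ(α))` with `α ∈ supp A`, and, for `x ∈ N`, the integrand
of the angle integral is supported in a compact subset of `W`. This allows `χ ∈ C₀^∞(W)` with
`N = ℝ²`, and `χ = 1` with `N` a small neighbourhood if `supp A` is small. -/
structure Admissible (A : Plane → ℂ) (χ : Plane × ℝ → ℝ) (N : Set Plane) : Prop where
  measurable : MeasurableSet N
  smooth : ContDiffOn ℝ ∞ χ C.W
  eq_one : ∀ y ∈ tsupport A, ∀ᶠ z in 𝓝 (C.X y, y.2), χ z = 1
  compact : IsCompact
    {z ∈ C.W | z.1 ∈ N ∧ z ∈ tsupport χ ∧ (C.tau z, z.2) ∈ tsupport A}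

end SingularChart

/-- `A ∈ C₀^∞(G)`, for an open subset `G` of the coordinate plane. -/
structure IsTestFun (G : Set Plane) (A : Plane → ℂ) : Prop where
  smooth : ContDiff ℝ ∞ A
  compact : HasCompactSupport A
  subset : tsupport A ⊆ G

/-! ### The standard canonical operator -/

/-- The types of standard canonical charts, according to the variables used as coordinates:
`(x₁, x₂)`; `(x₁', p₂')` in the orthonormal coordinate system rotated by the angle `θ` (so that
`θ = 0` gives `(x₁, p₂)`, and `θ = π/2` gives `(x₂, -p₁)`); `(p₁, p₂)`. -/
inductive ChartType where
  | position
  | mixed (θ : ℝ)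
  | momentum

/-- The first vector of the rotated frame. -/
def frame₁ (θ : ℝ) : Plane := (Real.cos θ, Real.sin θ)

/-- The second vector of the rotated frame. -/
def frame₂ (θ : ℝ) : Plane := (-Real.sin θ, Real.cos θ)

/-- The coordinates used in a chart of the given type, as functions on the phase space. -/
def ChartType.coord : ChartType → Phase → Plane
  | position, a => a.1
  | mixed θ, a => (dot (frame₁ θ) a.1, dot (frame₂ θ) a.2)
  | momentum, a => a.2

/-- The form `⟨ξ, η⟩` as a bilinear form. -/
def dotForm : LinearMap.BilinForm ℝ Plane :=
  LinearMap.mk₂ ℝ dot (fun _ _ _ => by simp only [dot, Prod.fst_add, Prod.snd_add]; ring)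
    (fun _ _ _ => by simp only [dot, Prod.smul_fst, Prod.smul_snd, smul_eq_mul]; ring)
    (fun _ _ _ => by simp only [dot, Prod.fst_add, Prod.snd_add]; ring)
    (fun _ _ _ => by simp only [dot, Prod.smul_fst, Prod.smul_snd, smul_eq_mul]; ring)

/-- The space of those `x` whose components belonging to the coordinates of the chart vanish. -/
def ChartType.fixedPos : ChartType → Submodule ℝ Plane
  | position => ⊥
  | mixed θ => LinearMap.ker (dotForm (frame₁ θ))
  | momentum => ⊤

namespace SingularChart

variable {L : LagrangianSurface} (C : SingularChart L)

/-- The coordinates of a standard chart as functions of `(τ, ψ)`. -/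
def stdCoord (κ : ChartType) (y : Plane) : Plane := κ.coord (C.r y)

/-- `V` is (in the coordinates `(τ, ψ)`) a standard canonical chart of type `κ`, contained in
the given singular chart: a nonempty connected open set on which the functions `κ.coord` form a
coordinate system. -/
structure IsStdChart (κ : ChartType) (V : Set Plane) : Prop where
  subset : V ⊆ C.G
  isOpen : IsOpen V
  connected : IsConnected V
  injOn : InjOn (C.stdCoord κ) V
  jac_ne_zero : ∀ y ∈ V, jacDet (C.stdCoord κ) y ≠ 0

/-- The quadratic form `w ↦ ⟨dX w, dP w⟩` on tangent vectors. -/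
def tangentForm (y : Plane) : QuadraticForm ℝ Plane :=
  LinearMap.BilinMap.toQuadraticMap (dotForm.compl₁₂ (fderiv ℝ C.X y : Plane →ₗ[ℝ] Plane)
    (fderiv ℝ C.P y : Plane →ₗ[ℝ] Plane))

/-- The negative index of inertia of the symmetric matrix `∂x''/∂p''`, where `p''` are the momenta
among the coordinates of the chart, `x''` the conjugate positions, and the positions among the
coordinates are kept fixed. On tangent vectors `w` with fixed positions, `dp''` is a coordinate
and `⟨dX w, dP w⟩ = ⟨(∂x''/∂p'') dp'', dp''⟩`. -/
def negIndex (κ : ChartType) (y : Plane) : ℕ :=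
  sigNeg ((C.tangentForm y).restrict
    (κ.fixedPos.comap (fderiv ℝ C.X y : Plane →ₗ[ℝ] Plane)))

/-- `m` is the Maslov index of the standard chart `V`: the Maslov index of some nonsingular point
of the chart plus the negative index of inertia at that point. -/
def HasStdIndex (κ : ChartType) (V : Set Plane) {a₀ u₀ : L.carrier} (γ : Path a₀ u₀) (m : ℤ) :
    Prop :=
  ∃ y ∈ V, L.IsRegularPt (C.r y) ∧ ∃ k : ℤ, L.HasPointIndex (C.r '' C.G) γ (C.r y) k ∧
    m = k + C.negIndex κ y

/-- The inverse of the coordinate map of a standard chart. -/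
def stdInv (κ : ChartType) (V : Set Plane) (q : Plane) : Plane :=
  Function.invFunOn (C.stdCoord κ) V q

/-- The amplitude `A √|dμ/dq|` of the standard canonical operator as a function of the coordinates
`q` of the chart, multiplied by `e^{(i/h)(τ + ⟨p'', x'' - X''⟩)}` (with `p''`, `x''` the momenta
among the coordinates and the conjugate positions), and extended by zero. Here `phase` is
`⟨p'', x'' - X''⟩` as a function on the coordinate plane. -/
def stdIntegrand (κ : ChartType) (V : Set Plane) (A : Plane → ℂ) (h : ℝ) (phase : Plane → ℝ) :
    Plane → ℂ :=
  (C.stdCoord κ '' V).indicator fun q =>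
    let y := C.stdInv κ V q
    Complex.exp (Complex.I / h * ((y.1 + phase y : ℝ) : ℂ)) * A y *
      (Real.sqrt |C.mu y / jacDet (C.stdCoord κ) y| : ℂ)

/-- The standard local canonical operator in the standard chart `V` with Maslov index `m`. -/
def stdOp (κ : ChartType) (V : Set Plane) (m : ℤ) (A : Plane → ℂ) (h : ℝ) (x : Plane) : ℂ :=
  Complex.exp (-Complex.I * Real.pi * m / 2) *
    match κ with
    | .position => C.stdIntegrand .position V A h (fun _ => 0) x
    | .mixed θ => (Complex.I / (2 * Real.pi * h)) ^ ((1 : ℂ) / 2) *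
        ∫ η : ℝ, C.stdIntegrand (.mixed θ) V A h
          (fun y => dot (frame₂ θ) (C.P y) * dot (frame₂ θ) (x - C.X y))
          (dot (frame₁ θ) x, η)
    | .momentum => (Complex.I / (2 * Real.pi * h)) *
        ∫ p : Plane, C.stdIntegrand .momentum V A h
          (fun y => dot (C.P y) (x - C.X y)) p

end SingularChart

/-- `e` is a smooth locally finite partition of unity on `G` subordinate to the family `V`. -/
structure IsPartition {ι : Type*} (G : Set Plane) (V : ι → Set Plane) (e : ι → Plane → ℝ) :
    Prop where
  smooth : ∀ k, ContDiffOn ℝ ∞ (e k) G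
  nonneg : ∀ k, ∀ y ∈ G, 0 ≤ e k y
  subordinate : ∀ k, tsupport (e k) ∩ G ⊆ V k
  locallyFinite : ∀ y ∈ G, ∃ O ∈ 𝓝 y, {k | ∃ z ∈ O, e k z ≠ 0}.Finite
  sum_eq_one : ∀ y ∈ G, ∑ᶠ k, e k y = 1

namespace SingularChart

variable {L : LagrangianSurface} (C : SingularChart L)

/-- The standard canonical operator on functions supported in the singular chart, glued from the
local ones by means of a partition of unity. -/
def stdGlobalOp {ι : Type*} (κ : ι → ChartType) (V : ι → Set Plane) (m : ι → ℤ)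
    (e : ι → Plane → ℝ) (A : Plane → ℂ) (h : ℝ) (x : Plane) : ℂ :=
  ∑ᶠ k, C.stdOp (κ k) (V k) (m k) (fun y => (e k y : ℂ) * A y) h x

end SingularChart

/-- `u = v + O(h)` as `h → +0` in `L²(N)`. -/
def EqModO (N : Set Plane) (u v : ℝ → Plane → ℂ) : Prop :=
  ∃ c h₀ : ℝ, 0 < h₀ ∧ ∀ h, 0 < h → h < h₀ →
    eLpNorm (fun x => u h x - v h x) 2 (volume.restrict N) ≤ ENNReal.ofReal (c * h)

end MaslovOperator

end

noncomputable section

namespace MaslovOperator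

/-! Notation: J = det(X_τ, X_ψ), d = det(P, P_ψ), and Q is the Jacobian of mixed coordinates s =
⟨f₁, x⟩, η = ⟨f₂, p⟩ in a rotated frame (f₁, f₂). A bracket [·] is 1 if the inequality holds and 0
otherwise. Near each point of the chart every operator is compared with a mixed one, whose phase is
S(s, η) + ηx, where x now denotes the coordinate ⟨f₂, x⟩. On the critical set x = −S_η of this
phase, (s, η) are coordinates, whether or not the point is focal.

Analysis. Integrals with the phase S + ηx are bounded in L² uniformly in h, by Plancherel
(`bddL2_oscInt_mixedPhase`). One integration by parts then shows that modulo O(h) only the amplitude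
on the critical set matters (`asymp_oscInt_mixedPhase`). A phase φ that agrees with S + ηx to first
order there has the form S + ηx + w²g, where w is the η-derivative of S + ηx. Along the deformation
S + ηx + σw²g, with the amplitude multiplied by the root of a suitable positive factor, the
σ-derivative of the integrand is an exact derivative in the integration variable up to O(h)
(`exists_homotopy_remainder`). Hence φ may be replaced by the mixed phase if φ_ηx > 0 on the
critical set, the amplitude being divided by √φ_ηx (`exists_mixed_amplitude`). The second derivative
in η may vanish, so focal points are no exception.

Angle integral. The substitution ψ = ψ(s, η) turns τ(x, ψ) into such a phase with φ_ηx = ⟨f₁, X_τ⟩²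
d/Q. Therefore the angle integral equals the mixed one, with the same phase factor, near any point
where ⟨f₁, X_τ⟩ ≠ 0 and dQ > 0 (`exists_asymp_angle_mixed`). At a focal point X_ψ = 0, and both
conditions hold in every mixed chart (`mixed_at_focal`). At an arbitrary point they hold in the
frame with f₁ along P (`exists_adapted_mixed`).

Other standard charts. The same reduction, applied to the phase T − σ(η − H)²/2, whose η-integral is
Gaussian, eliminates one integration variable (`asymp_oscInt_legendre`). This relates the mixed
operator to the position one and, under a partial Fourier transform, the momentum operator to the
mixed one. The sign of a ratio of Jacobians decides whether the factor i appears.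

Indices. The Jacobian of X − iεP in (τ, ψ), multiplied by id, has positive real part at focal points
and, for small ε, avoids the negative half-axis on compact subsets of the chart. At regular points
its argument tends to ±π/2 according to the sign of Jd. So the index of a regular point plus [Jd <
0] is the same throughout the chart (`pointIndex_sub`). At a regular point the negative indices of
inertia are 0, [JQ < 0] and [Jd < 0] + [d det(P_τ, P_ψ) < 0], and the comparison of indices becomes
a comparison of signs on a connected set (`exists_asymp_angleInt_stdOp`).

The local statements are glued by cut-offs on the surface (`testFun_induction`), and the global
operator is a finite sum on the support of the amplitude. -/

section

/-! ### Integrals with parameters, division by a coordinate, test functions. -/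

section Smooth

/-- A smooth function with compact support contained in `U`. -/
structure TestFun {E : Type*} [NormedAddCommGroup E] [NormedSpace ℝ E] (U : Set E) (a : E → ℂ) :
    Prop where
  smooth : ContDiff ℝ ∞ a
  compact : HasCompactSupport a
  subset : tsupport a ⊆ U

/-- Domination comes from compactness of the unit ball about `x` times [0, 1]. -/
theorem hasFDerivAt_unitIntegral {E F : Type*} [NormedAddCommGroup E] [NormedSpace ℝ E]
    [ProperSpace E] [NormedAddCommGroup F] [NormedSpace ℝ F] [CompleteSpace F]
    {f : E × ℝ → F} (hf : ContDiff ℝ 1 f) (x : E) :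
    HasFDerivAt (fun x => ∫ t in (0 : ℝ)..1, f (x, t))
      (∫ t in (0 : ℝ)..1, (fderiv ℝ f (x, t)).comp (ContinuousLinearMap.inl ℝ E ℝ)) x := by
  have hc : Continuous fun z : E × ℝ => (fderiv ℝ f z).comp (ContinuousLinearMap.inl ℝ E ℝ) :=
    (hf.continuous_fderiv one_ne_zero).clm_comp continuous_const
  obtain ⟨C, hC⟩ := ((isCompact_closedBall x 1).prod (isCompact_Icc (a := (0 : ℝ)) (b := 1))).exists_bound_of_continuousOn
    hc.continuousOn
  refine (intervalIntegral.hasFDerivAt_integral_of_dominated_of_fderiv_le (bound := fun _ => C)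
    (F' := fun x t => (fderiv ℝ f (x, t)).comp (ContinuousLinearMap.inl ℝ E ℝ))
    (Metric.ball_mem_nhds x one_pos) ?_ ?_ ?_ ?_ ?_ ?_)
  · exact Eventually.of_forall fun y =>
      (hf.continuous.comp (Continuous.prodMk_right y)).aestronglyMeasurable
  · exact (hf.continuous.comp (Continuous.prodMk_right x)).intervalIntegrable _ _
  · exact (hc.comp (Continuous.prodMk_right x)).aestronglyMeasurable
  · refine Eventually.of_forall fun t ht y hy => hC (y, t) ⟨Metric.ball_subset_closedBall hy, ?_⟩
    rw [uIoc_of_le zero_le_one] at ht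
    exact ⟨ht.1.le, ht.2⟩
  · exact intervalIntegrable_const
  · refine Eventually.of_forall fun t _ y _ => ?_
    have h1 : HasFDerivAt (fun y : E => (y, t)) (ContinuousLinearMap.inl ℝ E ℝ) y :=
      hasFDerivAt_prodMk_left y t
    exact ((hf.differentiable one_ne_zero).differentiableAt.hasFDerivAt).comp y h1

/-- The codomain is quantified inside the induction: the derivative is an integral of the same kind,
with values in `E →L[ℝ] F`. -/
theorem contDiff_unitIntegral_nat {E : Type} [NormedAddCommGroup E] [NormedSpace ℝ E]
    [ProperSpace E] (n : ℕ) : ∀ {F : Type} [NormedAddCommGroup F] [NormedSpace ℝ F]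
    [CompleteSpace F] {f : E × ℝ → F}, ContDiff ℝ n f →
    ContDiff ℝ n (fun x => ∫ t in (0 : ℝ)..1, f (x, t)) := by
  induction n with
  | zero =>
    intro F _ _ _ f hf
    rw [Nat.cast_zero, contDiff_zero] at hf ⊢
    exact intervalIntegral.continuous_parametric_intervalIntegral_of_continuous'
      (f := fun x t => f (x, t)) hf 0 1
  | succ n ih =>
    intro F _ _ _ f hf
    have h1 : ContDiff ℝ 1 f := hf.of_le (by exact_mod_cast Nat.le_add_left 1 n)
    rw [Nat.cast_succ, contDiff_succ_iff_fderiv]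
    refine ⟨fun x => (hasFDerivAt_unitIntegral h1 x).differentiableAt, by simp, ?_⟩
    have : fderiv ℝ (fun x => ∫ t in (0 : ℝ)..1, f (x, t)) = fun x => ∫ t in (0 : ℝ)..1,
        (fderiv ℝ f (x, t)).comp (ContinuousLinearMap.inl ℝ E ℝ) :=
      funext fun x => (hasFDerivAt_unitIntegral h1 x).fderiv
    rw [this]
    exact ih (f := fun z => (fderiv ℝ f z).comp (ContinuousLinearMap.inl ℝ E ℝ))
      ((hf.fderiv_right (by exact_mod_cast le_rfl)).clm_comp contDiff_const)

theorem contDiff_unitIntegral {E F : Type} [NormedAddCommGroup E] [NormedSpace ℝ E]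
    [ProperSpace E] [NormedAddCommGroup F] [NormedSpace ℝ F]
    [CompleteSpace F] {f : E × ℝ → F} (hf : ContDiff ℝ ∞ f) :
    ContDiff ℝ ∞ (fun x => ∫ t in (0 : ℝ)..1, f (x, t)) :=
  contDiff_infty.2 fun n => contDiff_unitIntegral_nat n (contDiff_infty.1 hf n)

theorem hasDerivAt_slice {P F : Type*} [NormedAddCommGroup P] [NormedSpace ℝ P]
    [NormedAddCommGroup F] [NormedSpace ℝ F] {f : P × ℝ → F} {p : P} {t : ℝ}
    (hf : DifferentiableAt ℝ f (p, t)) :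
    HasDerivAt (fun t => f (p, t)) (fderiv ℝ f (p, t) (0, 1)) t := by
  have h1 : HasDerivAt (fun t : ℝ => (p, t)) ((0 : P), (1 : ℝ)) t :=
    (hasDerivAt_const t p).prodMk (hasDerivAt_id t)
  exact hf.hasFDerivAt.comp_hasDerivAt t h1

/-- Hadamard's lemma: division by a coordinate. -/
theorem exists_smooth_div {P F : Type} [NormedAddCommGroup P] [NormedSpace ℝ P] [ProperSpace P]
    [NormedAddCommGroup F] [NormedSpace ℝ F] [CompleteSpace F] {f : P × ℝ → F}
    (hf : ContDiff ℝ ∞ f) :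
    ∃ g : P × ℝ → F, ContDiff ℝ ∞ g ∧ ∀ p t, f (p, t) = f (p, 0) + t • g (p, t) := by
  have hD : ContDiff ℝ ∞ (fun z => fderiv ℝ f z (0, 1)) :=
    (hf.fderiv_right (m := ∞) (by simp)).clm_apply contDiff_const
  -- The quotient is the mean of the t-derivative over the segment from (p, 0) to (p, t).
  refine ⟨fun z => ∫ r in (0 : ℝ)..1, fderiv ℝ f (z.1, r * z.2) (0, 1),
    contDiff_unitIntegral (f := fun q : (P × ℝ) × ℝ => fderiv ℝ f (q.1.1, q.2 * q.1.2) (0, 1))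
      (hD.comp (by fun_prop)), fun p t => ?_⟩
  have h1 : ∀ r ∈ uIcc (0 : ℝ) 1, HasDerivAt (fun r : ℝ => f (p, r * t))
      (t • fderiv ℝ f (p, r * t) (0, 1)) r := fun r _ => by
    have h2 := hasDerivAt_slice (p := p) (t := r * t)
      (hf.differentiable (by simp)).differentiableAt
    have h3 : HasDerivAt (fun r : ℝ => r * t) t r := by
      simpa using (hasDerivAt_id r).mul_const t
    exact h2.scomp r h3
  have h4 := intervalIntegral.integral_eq_sub_of_hasDerivAt h1
    (((hD.continuous.comp (by fun_prop : Continuous fun r : ℝ => (p, r * t))).const_smul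
      t).intervalIntegrable 0 1)
  rw [intervalIntegral.integral_smul] at h4
  simp only [h4, one_mul, zero_mul]
  abel

/-- Second-order division by a coordinate. -/
theorem exists_smooth_div_sq {P F : Type} [NormedAddCommGroup P] [NormedSpace ℝ P]
    [ProperSpace P] [NormedAddCommGroup F] [NormedSpace ℝ F] [CompleteSpace F] {f : P × ℝ → F}
    (hf : ContDiff ℝ ∞ f) :
    ∃ g : P × ℝ → F, ContDiff ℝ ∞ g ∧
      ∀ p t, f (p, t) = f (p, 0) + t • fderiv ℝ f (p, 0) (0, 1) + (t ^ 2) • g (p, t) := by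
  obtain ⟨g, hg, h⟩ := exists_smooth_div hf
  obtain ⟨g', hg', h'⟩ := exists_smooth_div hg
  refine ⟨g', hg', fun p t => ?_⟩
  -- The first quotient at t = 0 is the derivative of `f`, so a second division leaves the remainder
  -- of second order.
  have h0 : fderiv ℝ f (p, 0) (0, 1) = g (p, 0) := by
    have h1 := hasDerivAt_slice (p := p) (t := 0) (hf.differentiable (by simp)).differentiableAt
    have h2 : HasDerivAt (fun t : ℝ => f (p, t)) (g (p, 0)) 0 := by
      have h3 := (hasDerivAt_id (0 : ℝ)).smul (hasDerivAt_slice (p := p) (t := 0)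
        (hg.differentiable (by simp)).differentiableAt)
      have h4 := h3.const_add (f (p, 0))
      simp only [id, zero_smul, one_smul, zero_add] at h4
      refine h4.congr_of_eventuallyEq (Eventually.of_forall fun t => ?_)
      simpa using h p t
    exact h1.unique h2
  rw [h0, h p t, h' p t, smul_add, smul_smul, sq, add_assoc]

/-- A smooth function on an open set coincides near a given point with a globally smooth one. -/
theorem exists_smooth_extension {E F : Type*} [NormedAddCommGroup E] [NormedSpace ℝ E]
    [FiniteDimensional ℝ E] [NormedAddCommGroup F] [NormedSpace ℝ F] {f : E → F} {U : Set E}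
    (hU : IsOpen U) (hf : ContDiffOn ℝ ∞ f U) {x : E} (hx : x ∈ U) :
    ∃ g : E → F, ContDiff ℝ ∞ g ∧ g =ᶠ[𝓝 x] f := by
  obtain ⟨b, hb⟩ : ∃ b : ContDiffBump x, tsupport b ⊆ U := by
    obtain ⟨r, hr, hrU⟩ := Metric.isOpen_iff.1 hU x hx
    refine ⟨⟨r / 4, r / 2, by positivity, by linarith⟩, ?_⟩
    rw [ContDiffBump.tsupport_eq]
    exact (Metric.closedBall_subset_ball (by linarith)).trans hrU
  refine ⟨fun y => b y • f y, ?_, ?_⟩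
  · rw [contDiff_iff_contDiffAt]
    intro y
    by_cases hy : y ∈ tsupport b
    · exact b.contDiff.contDiffAt.smul (hf.contDiffAt (hU.mem_nhds (hb hy)))
    · have : (fun y => b y • f y) =ᶠ[𝓝 y] fun _ => 0 := by
        filter_upwards [(isClosed_tsupport b).isOpen_compl.mem_nhds hy] with u hu
        rw [image_eq_zero_of_notMem_tsupport hu, zero_smul]
      exact contDiffAt_const.congr_of_eventuallyEq this
  · filter_upwards [b.eventuallyEq_one] with y hy
    rw [hy]
    simp

end Smooth

namespace TestFun

variable {E : Type*} [NormedAddCommGroup E] [NormedSpace ℝ E] {U : Set E} {a b : E → ℂ}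

theorem mono {V : Set E} (ha : TestFun U a) (h : U ⊆ V) : TestFun V a :=
  ⟨ha.smooth, ha.compact, ha.subset.trans h⟩

theorem of_tsupport_subset (ha : TestFun U a) (hb : ContDiff ℝ ∞ b) (h : tsupport b ⊆ tsupport a) :
    TestFun U b :=
  ⟨hb, ha.compact.of_isClosed_subset (isClosed_tsupport _) h, h.trans ha.subset⟩

theorem self (ha : TestFun U a) : TestFun (tsupport a) a := ⟨ha.smooth, ha.compact, le_rfl⟩

/-- Off the support of `a` the product vanishes near each point, whatever values `f` takes outside
`U`. -/
theorem mul_smoothOn (ha : TestFun U a) (hU : IsOpen U) {f : E → ℂ} (hf : ContDiffOn ℝ ∞ f U) :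
    TestFun U (fun x => f x * a x) := by
  refine ha.of_tsupport_subset ?_ (tsupport_mul_subset_right)
  rw [contDiff_iff_contDiffAt]
  intro y
  by_cases hy : y ∈ tsupport a
  · exact (hf.contDiffAt (hU.mem_nhds (ha.subset hy))).mul ha.smooth.contDiffAt
  · have : (fun y => f y * a y) =ᶠ[𝓝 y] fun _ => 0 := by
      filter_upwards [(isClosed_tsupport a).isOpen_compl.mem_nhds hy] with u hu
      rw [image_eq_zero_of_notMem_tsupport hu, mul_zero]
    exact contDiffAt_const.congr_of_eventuallyEq this

theorem mul_realOn (ha : TestFun U a) (hU : IsOpen U) {f : E → ℝ} (hf : ContDiffOn ℝ ∞ f U) :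
    TestFun U (fun x => (f x : ℂ) * a x) :=
  ha.mul_smoothOn hU (Complex.ofRealCLM.contDiff.comp_contDiffOn hf)

theorem mul_smooth (ha : TestFun U a) {f : E → ℂ} (hf : ContDiff ℝ ∞ f) :
    TestFun U (fun x => f x * a x) :=
  ha.of_tsupport_subset (hf.mul ha.smooth) (tsupport_mul_subset_right)

theorem mul_real (ha : TestFun U a) {f : E → ℝ} (hf : ContDiff ℝ ∞ f) :
    TestFun U (fun x => (f x : ℂ) * a x) :=
  ha.mul_smooth (Complex.ofRealCLM.contDiff.comp hf)

theorem fderiv_apply (ha : TestFun U a) (v : E) : TestFun U (fun x => fderiv ℝ a x v) :=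
  ha.of_tsupport_subset ((ha.smooth.fderiv_right (m := ∞) (by simp)).clm_apply contDiff_const)
    (tsupport_fderiv_apply_subset ℝ v)

theorem add (ha : TestFun U a) (hb : TestFun U b) : TestFun U (fun x => a x + b x) := by
  have h : tsupport (fun x => a x + b x) ⊆ tsupport a ∪ tsupport b := tsupport_add a b
  exact ⟨ha.smooth.add hb.smooth, (ha.compact.isCompact.union hb.compact.isCompact).of_isClosed_subset
    (isClosed_tsupport _) h, h.trans (union_subset ha.subset hb.subset)⟩

theorem neg (ha : TestFun U a) : TestFun U (fun x => - a x) := by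
  simpa using ha.mul_smooth (contDiff_const (c := (-1 : ℂ)))

theorem sub (ha : TestFun U a) (hb : TestFun U b) : TestFun U (fun x => a x - b x) := by
  simpa [sub_eq_add_neg] using ha.add hb.neg

theorem eq_zero (ha : TestFun U a) {x : E} (hx : x ∉ U) : a x = 0 :=
  image_eq_zero_of_notMem_tsupport fun h => hx (ha.subset h)

theorem exists_bound (ha : TestFun U a) : ∃ C, ∀ x, ‖a x‖ ≤ C :=
  ha.compact.exists_bound_of_continuous ha.smooth.continuous

variable {P : Type*} [NormedAddCommGroup P] [NormedSpace ℝ P] {W : Set (P × ℝ)} {c : P × ℝ → ℂ}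

theorem slice_compact (hc : TestFun W c) (p : P) : HasCompactSupport (fun t => c (p, t)) := by
  refine HasCompactSupport.intro (hc.compact.isCompact.image continuous_snd) fun t ht => ?_
  by_contra h
  exact ht ⟨(p, t), subset_tsupport _ h, rfl⟩

theorem slice_integrable (hc : TestFun W c) (p : P) : Integrable (fun t => c (p, t)) :=
  (hc.smooth.continuous.comp (Continuous.prodMk_right p)).integrable_of_hasCompactSupport
    (hc.slice_compact p)

theorem hasDerivAt (hc : TestFun W c) (p : P) (t : ℝ) :
    HasDerivAt (fun t => c (p, t)) (fderiv ℝ c (p, t) (0, 1)) t :=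
  hasDerivAt_slice (hc.smooth.differentiable (by simp)).differentiableAt

theorem integral_deriv (hc : TestFun W c) (p : P) : ∫ t, fderiv ℝ c (p, t) (0, 1) = 0 :=
  integral_eq_zero_of_hasDerivAt_of_integrable (fun t => hc.hasDerivAt p t)
    ((hc.fderiv_apply (0, 1)).slice_integrable p) (hc.slice_integrable p)

end TestFun

end

/-! ### The exponential e^{it/h} and the deformation of phase functions. -/

section

/-- The oscillating exponential `e^{it/h}`. -/
def osc (h t : ℝ) : ℂ := Complex.exp (Complex.I / h * (t : ℂ))

theorem norm_osc (h t : ℝ) : ‖osc h t‖ = 1 := by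
  have : Complex.I / h * (t : ℂ) = ((t / h : ℝ) : ℂ) * Complex.I := by push_cast; ring
  rw [osc, this, Complex.norm_exp_ofReal_mul_I]

theorem osc_add (h s t : ℝ) : osc h (s + t) = osc h s * osc h t := by
  rw [osc, osc, osc, ← Complex.exp_add]
  push_cast
  ring_nf

theorem contDiff_osc (h : ℝ) : ContDiff ℝ ∞ (osc h) :=
  (contDiff_const.mul Complex.ofRealCLM.contDiff).cexp

theorem hasDerivAt_osc_comp (h : ℝ) {f : ℝ → ℝ} {f' t : ℝ} (hf : HasDerivAt f f' t) :
    HasDerivAt (fun t => osc h (f t)) (osc h (f t) * (Complex.I / h * (f' : ℂ))) t :=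
  (hf.ofReal_comp.const_mul (Complex.I / (h : ℂ))).cexp

section Homotopy

variable {P : Type*} [NormedAddCommGroup P] [NormedSpace ℝ P]

/-- The product of a test function and a test function of an additional parameter. -/
theorem TestFun.mul_mid {U : Set (P × ℝ)} {β : P × ℝ → ℂ} (hβ : TestFun U β) {V : Set ℝ}
    {κ : ℝ → ℂ} (hκ : TestFun V κ) :
    TestFun {Z : (P × ℝ) × ℝ | (Z.1.1, Z.2) ∈ U ∧ Z.1.2 ∈ V}
      (fun Z => κ Z.1.2 * β (Z.1.1, Z.2)) := by
  let F : (P × ℝ) × ℝ → (P × ℝ) × ℝ := fun Z => ((Z.1.1, Z.2), Z.1.2)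
  have hF : Continuous F := by fun_prop
  have hc := (hβ.compact.isCompact.prod hκ.compact.isCompact).image hF
  have hsub : tsupport (fun Z : (P × ℝ) × ℝ => κ Z.1.2 * β (Z.1.1, Z.2)) ⊆
      F '' (tsupport β ×ˢ tsupport κ) := by
    refine closure_minimal (fun Z hZ => ?_) hc.isClosed
    have hZ' : κ Z.1.2 * β (Z.1.1, Z.2) ≠ 0 := hZ
    exact ⟨((Z.1.1, Z.2), Z.1.2), ⟨subset_tsupport _ (right_ne_zero_of_mul hZ'),
      subset_tsupport _ (left_ne_zero_of_mul hZ')⟩, rfl⟩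
  refine ⟨(hκ.smooth.comp (by fun_prop)).mul (hβ.smooth.comp (by fun_prop)),
    hc.of_isClosed_subset (isClosed_tsupport _) hsub, ?_⟩
  rintro Z hZ
  obtain ⟨Y, hY, rfl⟩ := hsub hZ
  exact ⟨hβ.subset hY.1, hκ.subset hY.2⟩

/-- A cut-off function on the real line. -/
theorem exists_cutoff (x : ℝ) {r R : ℝ} (hr : 0 < r) (hrR : r < R) :
    ∃ κ : ℝ → ℂ, TestFun (Ioo (x - R) (x + R)) κ ∧ (∀ t, |t - x| ≤ r → κ t = 1) ∧
      ∀ t, ‖κ t‖ ≤ 1 := by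
  let κ : ContDiffBump x := ⟨r, (r + R) / 2, hr, by linarith⟩
  refine ⟨fun t => (κ t : ℂ), ⟨Complex.ofRealCLM.contDiff.comp κ.contDiff, ?_, ?_⟩,
    fun t ht => ?_, fun t => ?_⟩
  · exact κ.hasCompactSupport.comp_left (g := fun y : ℝ => (y : ℂ)) Complex.ofReal_zero
  · have h1 : tsupport (fun t => (κ t : ℂ)) ⊆ tsupport κ :=
      closure_mono fun t ht => by simpa using ht
    refine h1.trans ?_
    rw [κ.tsupport_eq, Real.closedBall_eq_Icc]
    intro y hy
    have h1 : x - (r + R) / 2 ≤ y := hy.1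
    have h2 : y ≤ x + (r + R) / 2 := hy.2
    exact ⟨by linarith, by linarith⟩
  · have : κ t = 1 := κ.one_of_mem_closedBall (by rwa [Metric.mem_closedBall, Real.dist_eq])
    simp [this]
  · rw [Complex.norm_real, Real.norm_of_nonneg κ.nonneg]
    exact κ.le_one

/-- Adjoins a parameter σ on which nothing depends for σ in [0, 1]; the cut-off, supported in a
slightly larger interval, keeps the support compact. -/
theorem TestFun.mul_bump {U : Set (P × ℝ)} {β : P × ℝ → ℂ} (hβ : TestFun U β) {δ : ℝ}
    (hδ : 0 < δ) : ∃ B : (P × ℝ) × ℝ → ℂ,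
      TestFun {Z | (Z.1.1, Z.2) ∈ U ∧ Z.1.2 ∈ Ioo (-δ) (1 + δ)} B ∧
      ∀ p σ ξ, σ ∈ Icc (0 : ℝ) 1 → B ((p, σ), ξ) = β (p, ξ) := by
  obtain ⟨κ, hκ, h1, -⟩ := exists_cutoff (1 / 2) (by norm_num : (0 : ℝ) < 1 / 2)
    (by linarith : (1 / 2 : ℝ) < 1 / 2 + δ)
  refine ⟨_, (hβ.mul_mid (hκ.mono ?_)), fun p σ ξ hσ => ?_⟩
  · exact Ioo_subset_Ioo (by linarith) (by linarith)
  · rw [h1 σ (abs_le.2 ⟨by linarith [hσ.1], by linarith [hσ.2]⟩), one_mul]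

theorem integral_intervalIntegral_swap {f : ℝ × ℝ → ℂ} (hf : Continuous f)
    (hc : HasCompactSupport f) :
    ∫ ξ, (∫ σ in (0 : ℝ)..1, f (σ, ξ)) = ∫ σ in (0 : ℝ)..1, ∫ ξ, f (σ, ξ) := by
  simp only [intervalIntegral.integral_of_le zero_le_one]
  rw [integral_integral_swap]
  have h1 : Integrable f (volume.prod volume) := hf.integrable_of_hasCompactSupport hc
  have h2 : Integrable f ((volume.restrict (Ioc 0 1)).prod volume) := by
    have := h1.restrict (s := Ioc 0 1 ×ˢ univ)
    rwa [← Measure.prod_restrict, Measure.restrict_univ] at this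
  exact h2.swap

variable {φ w g μ : P × ℝ → ℝ}

/-- The integral `∫ e^{iφ/h} a dξ` along the homotopy of phase functions `φ + σ w² g`, where
`∂φ/∂ξ = w μ`. -/
theorem exists_homotopy_remainder (hφ : ContDiff ℝ ∞ φ) (hw : ContDiff ℝ ∞ w)
    (hg : ContDiff ℝ ∞ g) (hμ : ContDiff ℝ ∞ μ) {U : Set (P × ℝ)} (hU : IsOpen U)
    (hφw : ∀ z ∈ U, fderiv ℝ φ z (0, 1) = w z * μ z) {δ : ℝ} (hδ : 0 < δ)
    (hM : ∀ z ∈ U, ∀ σ ∈ Ioo (-δ) (1 + δ),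
      0 < μ z + σ * (2 * fderiv ℝ w z (0, 1) * g z + w z * fderiv ℝ g z (0, 1)))
    {β : P × ℝ → ℂ} (hβ : TestFun U β) :
    ∃ γ : (P × ℝ) × ℝ → ℂ,
      TestFun {Z | (Z.1.1, Z.2) ∈ U ∧ Z.1.2 ∈ Ioo (-δ) (1 + δ)} γ ∧
      ∀ (p : P) (h : ℝ), h ≠ 0 →
        (∫ ξ, osc h (φ (p, ξ) + w (p, ξ) ^ 2 * g (p, ξ)) *
          ((Real.sqrt (μ (p, ξ) + (2 * fderiv ℝ w (p, ξ) (0, 1) * g (p, ξ) +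
            w (p, ξ) * fderiv ℝ g (p, ξ) (0, 1))) : ℂ) * β (p, ξ))) -
        (∫ ξ, osc h (φ (p, ξ)) * ((Real.sqrt (μ (p, ξ)) : ℂ) * β (p, ξ))) =
        h * ∫ σ in (0 : ℝ)..1, ∫ ξ, osc h (φ (p, ξ) + σ * (w (p, ξ) ^ 2 * g (p, ξ))) *
          γ ((p, σ), ξ) := by
  obtain ⟨B, hB, hBβ⟩ := hβ.mul_bump hδ
  set Ω : Set ((P × ℝ) × ℝ) := {Z | (Z.1.1, Z.2) ∈ U ∧ Z.1.2 ∈ Ioo (-δ) (1 + δ)} with hΩdef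
  have hΩ : IsOpen Ω := (hU.preimage (by fun_prop : Continuous fun Z : (P × ℝ) × ℝ =>
    (Z.1.1, Z.2))).inter (isOpen_Ioo.preimage (by fun_prop : Continuous fun Z : (P × ℝ) × ℝ =>
    Z.1.2))
  have hwξ : ContDiff ℝ ∞ (fun z => fderiv ℝ w z (0, 1)) :=
    (hw.fderiv_right (m := ∞) (by simp)).clm_apply contDiff_const
  have hgξ : ContDiff ℝ ∞ (fun z => fderiv ℝ g z (0, 1)) :=
    (hg.fderiv_right (m := ∞) (by simp)).clm_apply contDiff_const
  set wξ : P × ℝ → ℝ := fun z => fderiv ℝ w z (0, 1) with hwξdef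
  set gξ : P × ℝ → ℝ := fun z => fderiv ℝ g z (0, 1) with hgξdef
  set m' : P × ℝ → ℝ := fun z => 2 * wξ z * g z + w z * gξ z with hm'
  have hpr : ContDiff ℝ ∞ (fun Z : (P × ℝ) × ℝ => (Z.1.1, Z.2)) := by fun_prop
  -- On `U` the ξ-derivative of the phase φ + σw²g is wM, and the amplitude √M β follows this factor
  -- along the deformation.
  set M : (P × ℝ) × ℝ → ℝ := fun Z => μ (Z.1.1, Z.2) + Z.1.2 * m' (Z.1.1, Z.2) with hMdef
  have hMs : ContDiff ℝ ∞ M := by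
    refine (hμ.comp hpr).add ((by fun_prop : ContDiff ℝ ∞ fun Z : (P × ℝ) × ℝ => Z.1.2).mul ?_)
    exact (((contDiff_const.mul (hwξ.comp hpr)).mul (hg.comp hpr)).add
      ((hw.comp hpr).mul (hgξ.comp hpr)))
  have hMpos : ∀ Z ∈ Ω, 0 < M Z := fun Z hZ => hM _ hZ.1 _ hZ.2
  set b : (P × ℝ) × ℝ → ℂ := fun Z => (((Real.sqrt (M Z))⁻¹ : ℝ) : ℂ) * B Z with hbdef
  have hsq : ContDiffOn ℝ ∞ (fun Z => (Real.sqrt (M Z))⁻¹) Ω :=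
    (hMs.contDiffOn.sqrt fun Z hZ => (hMpos Z hZ).ne').inv
      fun Z hZ => (Real.sqrt_pos.2 (hMpos Z hZ)).ne'
  have hb : TestFun Ω b := hB.mul_realOn hΩ hsq
  set q : (P × ℝ) × ℝ → ℂ := fun Z => (g (Z.1.1, Z.2) : ℂ) * b Z with hqdef
  have hq : TestFun Ω q := hb.mul_real (hg.comp hpr)
  -- Solves Mρ = g_ξ b/2 − q_ξ. With this choice the terms of order zero in the ξ-derivative of `G`
  -- below add up to m'b/2, which is the σ-derivative of √M times β.
  set ρ : (P × ℝ) × ℝ → ℂ := fun Z => (((M Z)⁻¹ : ℝ) : ℂ) *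
    ((((1 / 2) * gξ (Z.1.1, Z.2) : ℝ) : ℂ) * b Z - fderiv ℝ q Z (0, 1)) with hρdef
  have hρ : TestFun Ω ρ := by
    refine TestFun.mul_realOn ?_ hΩ (hMs.contDiffOn.inv fun Z hZ => (hMpos Z hZ).ne')
    exact (hb.mul_real (contDiff_const.mul (hgξ.comp hpr))).sub (hq.fderiv_apply _)
  have hγ : TestFun Ω (fun Z => Complex.I * fderiv ℝ ρ Z (0, 1)) :=
    (hρ.fderiv_apply _).mul_smooth contDiff_const
  refine ⟨fun Z => Complex.I * fderiv ℝ ρ Z (0, 1), hγ, fun p h hh => ?_⟩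
  have hph : ContDiff ℝ ∞ (fun Z : (P × ℝ) × ℝ => φ (Z.1.1, Z.2) +
      Z.1.2 * (w (Z.1.1, Z.2) ^ 2 * g (Z.1.1, Z.2))) :=
    (hφ.comp hpr).add ((by fun_prop : ContDiff ℝ ∞ fun Z : (P × ℝ) × ℝ => Z.1.2).mul
      (((hw.comp hpr).pow 2).mul (hg.comp hpr)))
  set e : (P × ℝ) × ℝ → ℂ := fun Z => osc h (φ (Z.1.1, Z.2) +
      Z.1.2 * (w (Z.1.1, Z.2) ^ 2 * g (Z.1.1, Z.2))) with hedef
  have hes : ContDiff ℝ ∞ e := (contDiff_osc h).comp hph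
  set G : (P × ℝ) × ℝ → ℂ := fun Z => e Z * ((w (Z.1.1, Z.2) : ℂ) * q Z +
    (h / Complex.I) * ρ Z) with hGdef
  have hG : TestFun Ω G := ((hq.mul_real (hw.comp hpr)).add
    (hρ.mul_smooth contDiff_const)).mul_smooth hes
  have hhc : (h : ℂ) ≠ 0 := by exact_mod_cast hh
  -- The σ-derivative of the integrand is exact in ξ up to a term with the factor h. The part of
  -- order 1/h is matched by the summand wq of `G`, because w²g√M β = (wM)(wq). Outside `U`
  -- everything vanishes.
  have key : ∀ ξ : ℝ, ∀ σ ∈ Icc (0 : ℝ) 1,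
      HasDerivAt (fun σ => e ((p, σ), ξ) * ((Real.sqrt (M ((p, σ), ξ)) : ℂ) * β (p, ξ)))
        (fderiv ℝ G ((p, σ), ξ) (0, 1) + h * (e ((p, σ), ξ) *
          (Complex.I * fderiv ℝ ρ ((p, σ), ξ) (0, 1)))) σ := by
    intro ξ σ hσ
    by_cases hz : (p, ξ) ∈ U
    · have hZ : ((p, σ), ξ) ∈ Ω := ⟨hz, by constructor <;> linarith [hσ.1, hσ.2]⟩
      have hMp := hMpos _ hZ
      have hMM : M ((p, σ), ξ) = μ (p, ξ) + σ * m' (p, ξ) := rfl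
      have dG := hG.hasDerivAt (p, σ) ξ
      have dq := hq.hasDerivAt (p, σ) ξ
      have dρ := hρ.hasDerivAt (p, σ) ξ
      have dw := hasDerivAt_slice (p := p) (t := ξ) (hw.differentiable (by simp)).differentiableAt
      have dg := hasDerivAt_slice (p := p) (t := ξ) (hg.differentiable (by simp)).differentiableAt
      have dφ := hasDerivAt_slice (p := p) (t := ξ) (hφ.differentiable (by simp)).differentiableAt
      rw [hφw _ hz] at dφ
      have dphase : HasDerivAt (fun ξ => φ (p, ξ) + σ * (w (p, ξ) ^ 2 * g (p, ξ)))
          (w (p, ξ) * M ((p, σ), ξ)) ξ := by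
        refine (dφ.add (((dw.pow 2).mul dg).const_mul σ)).congr_deriv ?_
        simp only [hMM, hm', hwξdef, hgξdef]
        simp
        ring
      have dG' := (hasDerivAt_osc_comp h dphase).mul
        ((dw.ofReal_comp.mul dq).add (dρ.const_mul ((h : ℂ) / Complex.I)))
      have eG := dG.unique dG'
      have dσ : HasDerivAt (fun σ => φ (p, ξ) + σ * (w (p, ξ) ^ 2 * g (p, ξ)))
          (w (p, ξ) ^ 2 * g (p, ξ)) σ := by
        simpa using ((hasDerivAt_id σ).mul_const (w (p, ξ) ^ 2 * g (p, ξ))).const_add (φ (p, ξ))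
      have dM : HasDerivAt (fun σ => M ((p, σ), ξ)) (m' (p, ξ)) σ := by
        refine (((hasDerivAt_id σ).mul_const (m' (p, ξ))).const_add (μ (p, ξ))).congr_deriv ?_
        ring
      have dE := (hasDerivAt_osc_comp h dσ).mul
        ((dM.sqrt hMp.ne').ofReal_comp.mul_const (β (p, ξ)))
      refine dE.congr_deriv ?_
      rw [eG]
      have hR : 0 < Real.sqrt (M ((p, σ), ξ)) := Real.sqrt_pos.2 hMp
      have hR2 : Real.sqrt (M ((p, σ), ξ)) ^ 2 = M ((p, σ), ξ) := Real.sq_sqrt hMp.le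
      have hρM : ρ ((p, σ), ξ) = (((M ((p, σ), ξ))⁻¹ : ℝ) : ℂ) *
        ((((1 / 2) * gξ (p, ξ) : ℝ) : ℂ) * b ((p, σ), ξ) - fderiv ℝ q ((p, σ), ξ) (0, 1)) := rfl
      have hqb : q ((p, σ), ξ) = (g (p, ξ) : ℂ) * b ((p, σ), ξ) := rfl
      have hbb : b ((p, σ), ξ) = (((Real.sqrt (M ((p, σ), ξ)))⁻¹ : ℝ) : ℂ) * β (p, ξ) := by
        rw [← hBβ p σ ξ hσ]
      have hm'' : m' (p, ξ) = 2 * fderiv ℝ w (p, ξ) (0, 1) * g (p, ξ) + w (p, ξ) * gξ (p, ξ) := rfl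
      have hee : e ((p, σ), ξ) = osc h (φ (p, ξ) + σ * (w (p, ξ) ^ 2 * g (p, ξ))) := rfl
      simp only [Pi.mul_apply, Pi.add_apply, hee, hρM, hqb, hbb, hm'']
      generalize Real.sqrt (M ((p, σ), ξ)) = R at hR hR2 ⊢
      rw [← hR2]
      generalize fderiv ℝ q ((p, σ), ξ) (0, 1) = qξ
      generalize fderiv ℝ ρ ((p, σ), ξ) (0, 1) = ρξ
      generalize osc h (φ (p, ξ) + σ * (w (p, ξ) ^ 2 * g (p, ξ))) = ee
      have hRc : (R : ℂ) ≠ 0 := by exact_mod_cast hR.ne'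
      push_cast
      field_simp
      ring_nf
      simp only [Complex.I_sq]
      ring
    · have hZ : ((p, σ), ξ) ∉ Ω := fun h => hz h.1
      rw [(hG.fderiv_apply _).eq_zero hZ, (hρ.fderiv_apply _).eq_zero hZ, hβ.eq_zero hz]
      simpa using hasDerivAt_const σ (0 : ℂ)
  set Ψ : (P × ℝ) × ℝ → ℂ := fun Z => fderiv ℝ G Z (0, 1) + h * (e Z *
    (Complex.I * fderiv ℝ ρ Z (0, 1))) with hΨdef
  have hΨ : TestFun Ω Ψ := (hG.fderiv_apply _).add
    ((hγ.mul_smooth hes).mul_smooth contDiff_const)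
  have hΨ2 : TestFun univ (fun x : ℝ × ℝ => Ψ ((p, x.1), x.2)) := by
    refine ⟨hΨ.smooth.comp (by fun_prop), ?_, subset_univ _⟩
    refine HasCompactSupport.intro (hΨ.compact.isCompact.image
      (by fun_prop : Continuous fun Z : (P × ℝ) × ℝ => (Z.1.2, Z.2))) fun x hx => ?_
    by_contra hne
    exact hx ⟨((p, x.1), x.2), subset_tsupport _ hne, rfl⟩
  have ftc : ∀ ξ : ℝ, ∫ σ in (0 : ℝ)..1, Ψ ((p, σ), ξ) =
      e ((p, 1), ξ) * ((Real.sqrt (M ((p, 1), ξ)) : ℂ) * β (p, ξ)) -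
      e ((p, 0), ξ) * ((Real.sqrt (M ((p, 0), ξ)) : ℂ) * β (p, ξ)) := by
    intro ξ
    refine intervalIntegral.integral_eq_sub_of_hasDerivAt (fun σ hσ => key ξ σ ?_) ?_
    · rwa [uIcc_of_le zero_le_one] at hσ
    · exact (hΨ.smooth.continuous.comp
        (by fun_prop : Continuous fun σ : ℝ => ((p, σ), ξ))).intervalIntegrable 0 1
  have swap := integral_intervalIntegral_swap hΨ2.smooth.continuous hΨ2.compact
  simp only [ftc] at swap
  have int : ∀ σ ∈ Icc (0 : ℝ) 1, Integrable fun ξ => e ((p, σ), ξ) *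
      ((Real.sqrt (M ((p, σ), ξ)) : ℂ) * β (p, ξ)) := by
    intro σ _
    refine Continuous.integrable_of_hasCompactSupport ?_ ?_
    · exact (hes.continuous.comp (by fun_prop : Continuous fun ξ : ℝ => ((p, σ), ξ))).mul
        ((Complex.continuous_ofReal.comp (Real.continuous_sqrt.comp (hMs.continuous.comp
          (by fun_prop : Continuous fun ξ : ℝ => ((p, σ), ξ))))).mul
          (hβ.smooth.continuous.comp (by fun_prop)))
    · exact ((hβ.slice_compact p).mul_left).mul_left
  rw [integral_sub (int 1 (by simp)) (int 0 (by simp))] at swap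
  -- The exact derivative integrates to zero over ξ.
  have hin : ∀ σ : ℝ, ∫ ξ, Ψ ((p, σ), ξ) = h * ∫ ξ, e ((p, σ), ξ) *
      (Complex.I * fderiv ℝ ρ ((p, σ), ξ) (0, 1)) := by
    intro σ
    simp only [hΨdef]
    rw [integral_add ((hG.fderiv_apply _).slice_integrable _)
      (((hγ.mul_smooth hes).mul_smooth contDiff_const).slice_integrable _), hG.integral_deriv,
      zero_add, integral_const_mul]
  simp only [hin] at swap
  rw [intervalIntegral.integral_const_mul] at swap
  rw [← swap]
  simp only [hedef, hMdef, one_mul, zero_mul, add_zero, hm', hwξdef, hgξdef]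

end Homotopy

end

/-! ### Families in L² modulo O(h), and Plancherel's identity. -/

section

section L2

theorem eLpNorm_two_le {X : Type*} [MeasurableSpace X] {μ : Measure X} {u : X → ℂ} {C : ℝ}
    (hC : 0 ≤ C) (h : ∫⁻ x, ‖u x‖ₑ ^ 2 ∂μ ≤ ENNReal.ofReal (C ^ 2)) :
    eLpNorm u 2 μ ≤ ENNReal.ofReal C := by
  rw [eLpNorm_eq_lintegral_rpow_enorm_toReal (by simp) (by simp)]
  simp only [ENNReal.toReal_ofNat, ENNReal.rpow_two]
  calc (∫⁻ x, ‖u x‖ₑ ^ 2 ∂μ) ^ (1 / 2 : ℝ) ≤ (ENNReal.ofReal (C ^ 2)) ^ (1 / 2 : ℝ) :=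
        ENNReal.rpow_le_rpow h (by norm_num)
    _ = ENNReal.ofReal C := by
        rw [ENNReal.ofReal_pow hC, ← ENNReal.rpow_natCast, ← ENNReal.rpow_mul]
        norm_num

theorem lintegral_sq_le_of_eLpNorm {X : Type*} [MeasurableSpace X] {μ : Measure X} {u : X → ℂ}
    {C : ℝ} (hC : 0 ≤ C) (h : eLpNorm u 2 μ ≤ ENNReal.ofReal C) :
    ∫⁻ x, ‖u x‖ₑ ^ 2 ∂μ ≤ ENNReal.ofReal (C ^ 2) := by
  rw [eLpNorm_eq_lintegral_rpow_enorm_toReal (by simp) (by simp)] at h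
  simp only [ENNReal.toReal_ofNat, ENNReal.rpow_two] at h
  have h2 := ENNReal.rpow_le_rpow h (by norm_num : (0 : ℝ) ≤ 2)
  rw [← ENNReal.rpow_mul] at h2
  norm_num at h2
  rwa [ENNReal.ofReal_pow hC]

/-- Families bounded in `L²`. -/
def BddL2 (u : ℝ → Plane → ℂ) : Prop :=
  ∃ C : ℝ, 0 ≤ C ∧ ∀ h, 0 < h → h ≤ 1 → eLpNorm (u h) 2 volume ≤ ENNReal.ofReal C

/-- Families of norm `O(h)` in `L²`. -/
def SmallL2 (u : ℝ → Plane → ℂ) : Prop :=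
  ∃ C : ℝ, 0 ≤ C ∧ ∀ h, 0 < h → h ≤ 1 → eLpNorm (u h) 2 volume ≤ ENNReal.ofReal (C * h)

/-- Equality of continuous families modulo `O(h)` in `L²`. -/
structure Asymp (u v : ℝ → Plane → ℂ) : Prop where
  left : ∀ h, 0 < h → Continuous (u h)
  right : ∀ h, 0 < h → Continuous (v h)
  small : SmallL2 fun h p => u h p - v h p

theorem BddL2.smul_h {u : ℝ → Plane → ℂ} (hu : BddL2 u) (c : ℂ) :
    SmallL2 fun h p => c * h * u h p := by
  obtain ⟨C, hC, H⟩ := hu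
  refine ⟨‖c‖ * C, by positivity, fun h h0 h1 => ?_⟩
  have : (fun p => c * h * u h p) = (c * (h : ℂ)) • u h := rfl
  beta_reduce
  rw [this, eLpNorm_const_smul]
  calc ‖c * (h : ℂ)‖ₑ * eLpNorm (u h) 2 volume
      ≤ ENNReal.ofReal (‖c‖ * h) * ENNReal.ofReal C := by
        refine mul_le_mul' ?_ (H h h0 h1)
        rw [← ofReal_norm, norm_mul, Complex.norm_real, Real.norm_of_nonneg h0.le]
    _ = ENNReal.ofReal (‖c‖ * C * h) := by
        rw [← ENNReal.ofReal_mul (by positivity)]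
        ring_nf

theorem SmallL2.congr {u v : ℝ → Plane → ℂ} (hu : SmallL2 u)
    (h : ∀ h, 0 < h → ∀ p, v h p = u h p) : SmallL2 v := by
  obtain ⟨C, hC, H⟩ := hu
  refine ⟨C, hC, fun t h0 h1 => ?_⟩
  rw [show v t = u t from funext (h t h0)]
  exact H t h0 h1

theorem SmallL2.zero : SmallL2 fun _ _ => 0 := ⟨0, le_rfl, fun h _ _ => by simp⟩

theorem SmallL2.neg {u : ℝ → Plane → ℂ} (hu : SmallL2 u) : SmallL2 fun h p => - u h p := by
  obtain ⟨C, hC, H⟩ := hu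
  refine ⟨C, hC, fun h h0 h1 => ?_⟩
  have : (fun p => - u h p) = - u h := rfl
  beta_reduce
  rw [this, eLpNorm_neg]
  exact H h h0 h1

theorem SmallL2.add {u v : ℝ → Plane → ℂ} (hu : SmallL2 u) (hv : SmallL2 v)
    (cu : ∀ h, 0 < h → Continuous (u h)) (cv : ∀ h, 0 < h → Continuous (v h)) :
    SmallL2 fun h p => u h p + v h p := by
  obtain ⟨C, hC, H⟩ := hu
  obtain ⟨C', hC', H'⟩ := hv
  refine ⟨C + C', by positivity, fun h h0 h1 => ?_⟩
  have : (fun p => u h p + v h p) = u h + v h := rfl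
  beta_reduce
  rw [this, add_mul, ENNReal.ofReal_add (by positivity) (by positivity)]
  exact (eLpNorm_add_le (cu h h0).aestronglyMeasurable (cv h h0).aestronglyMeasurable
    (by norm_num)).trans (add_le_add (H h h0 h1) (H' h h0 h1))

/-- A family dominated by `h` times a fixed square-integrable function. -/
theorem SmallL2.of_pointwise {u : ℝ → Plane → ℂ} {G : Plane → ℝ} (hG : MemLp G 2 volume)
    (h : ∀ h, 0 < h → h ≤ 1 → ∀ p, ‖u h p‖ ≤ h * G p) : SmallL2 u := by
  refine ⟨(eLpNorm G 2 volume).toReal, ENNReal.toReal_nonneg, fun t h0 h1 => ?_⟩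
  have h2 : eLpNorm (u t) 2 volume ≤ ENNReal.ofReal t * eLpNorm G 2 volume :=
    eLpNorm_le_mul_eLpNorm_of_ae_le_mul (Eventually.of_forall fun p =>
      (h t h0 h1 p).trans (mul_le_mul_of_nonneg_left (le_abs_self _) h0.le)) 2
  refine h2.trans_eq ?_
  rw [ENNReal.ofReal_mul ENNReal.toReal_nonneg, ENNReal.ofReal_toReal hG.eLpNorm_lt_top.ne,
    mul_comm]

/-- A family supported in a fixed compact set and bounded there by a multiple of `h`. -/
theorem SmallL2.of_bound {u : ℝ → Plane → ℂ} {K : Set Plane} (hK : IsCompact K) {C : ℝ}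
    (hC : ∀ h, 0 < h → h ≤ 1 → ∀ p, ‖u h p‖ ≤ C * h) (h0 : ∀ h, 0 < h → ∀ p, p ∉ K → u h p = 0) :
    SmallL2 u := by
  refine SmallL2.of_pointwise (G := K.indicator fun _ => C)
    (memLp_indicator_const 2 hK.measurableSet C (Or.inr hK.measure_lt_top.ne)) fun h hh h1 p => ?_
  by_cases hp : p ∈ K
  · rw [indicator_of_mem hp, mul_comm]
    exact hC h hh h1 p
  · rw [h0 h hh p hp]
    simp [hp]

namespace Asymp

variable {u v w u' v' : ℝ → Plane → ℂ}

theorem refl (hu : ∀ h, 0 < h → Continuous (u h)) : Asymp u u :=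
  ⟨hu, hu, SmallL2.zero.congr fun _ _ _ => sub_self _⟩

theorem symm (h : Asymp u v) : Asymp v u :=
  ⟨h.right, h.left, h.small.neg.congr fun t _ p => by ring⟩

theorem trans (h : Asymp u v) (h' : Asymp v w) : Asymp u w :=
  ⟨h.left, h'.right, (h.small.add h'.small (fun t ht => (h.left t ht).sub (h.right t ht))
    (fun t ht => (h'.left t ht).sub (h'.right t ht))).congr fun t _ p => by ring⟩

theorem add (h : Asymp u v) (h' : Asymp u' v') :
    Asymp (fun h p => u h p + u' h p) (fun h p => v h p + v' h p) :=
  ⟨fun t ht => (h.left t ht).add (h'.left t ht), fun t ht => (h.right t ht).add (h'.right t ht),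
    (h.small.add h'.small (fun t ht => (h.left t ht).sub (h.right t ht))
    (fun t ht => (h'.left t ht).sub (h'.right t ht))).congr fun t _ p => by ring⟩

theorem congr (h : Asymp u v) (hu : ∀ h, 0 < h → ∀ p, u' h p = u h p)
    (hv : ∀ h, 0 < h → ∀ p, v' h p = v h p) : Asymp u' v' := by
  refine ⟨fun t ht => ?_, fun t ht => ?_, h.small.congr fun t ht p => ?_⟩
  · rw [show u' t = u t from funext (hu t ht)]
    exact h.left t ht
  · rw [show v' t = v t from funext (hv t ht)]
    exact h.right t ht
  · rw [hu t ht, hv t ht]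

theorem const_mul (h : Asymp u v) (c : ℂ) :
    Asymp (fun h p => c * u h p) (fun h p => c * v h p) := by
  refine ⟨fun t ht => continuous_const.mul (h.left t ht),
    fun t ht => continuous_const.mul (h.right t ht), ?_⟩
  obtain ⟨C, hC, H⟩ := h.small
  refine ⟨‖c‖ * C, by positivity, fun t h0 h1 => ?_⟩
  have : (fun p => c * u t p - c * v t p) = c • fun p => u t p - v t p := by
    ext p
    simp [mul_sub]
  beta_reduce
  rw [this, eLpNorm_const_smul, mul_assoc, ENNReal.ofReal_mul (norm_nonneg _),
    ofReal_norm]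
  exact mul_le_mul' le_rfl (H t h0 h1)

end Asymp

end L2

section Plancherel

/-- Plancherel's identity for the semiclassical Fourier transform. -/
theorem lintegral_fourier_sq {f : ℝ → ℂ} (hf : TestFun univ f) {h : ℝ} (hh : 0 < h) :
    ∫⁻ x : ℝ, ‖∫ η : ℝ, osc h (η * x) * f η‖ₑ ^ 2 =
      ENNReal.ofReal (2 * Real.pi * h) * ∫⁻ η, ‖f η‖ₑ ^ 2 := by
  set F := hf.compact.toSchwartzMap hf.smooth with hF
  set FF := FourierTransform.fourier F with hFF
  have hP := SchwartzMap.integral_norm_sq_fourier F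
  have hconv : ∀ G : SchwartzMap ℝ ℂ, ENNReal.ofReal (∫ x, ‖G x‖ ^ 2) = ∫⁻ x, ‖G x‖ₑ ^ 2 := by
    intro G
    rw [ofReal_integral_eq_lintegral_ofReal]
    · refine lintegral_congr fun x => ?_
      rw [ENNReal.ofReal_pow (norm_nonneg _), ofReal_norm]
    · exact (memLp_two_iff_integrable_sq_norm G.continuous.aestronglyMeasurable).1 (G.memLp 2)
    · exact Eventually.of_forall fun x => by positivity
  -- The Fourier transform has the kernel e^{−2πivη}, so v = −x/(2πh); this scaling produces the
  -- factor 2πh.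
  have h1 : ∀ x : ℝ, ∫ η : ℝ, osc h (η * x) * f η = FF (x * (-(2 * Real.pi * h))⁻¹) := by
    intro x
    rw [hFF, SchwartzMap.fourier_coe, Real.fourier_eq']
    refine integral_congr_ae (Eventually.of_forall fun η => ?_)
    simp only [hF, HasCompactSupport.toSchwartzMap_toFun, smul_eq_mul, osc]
    congr 2
    have : (h : ℂ) ≠ 0 := by exact_mod_cast hh.ne'
    have hpi : (Real.pi : ℂ) ≠ 0 := by exact_mod_cast Real.pi_ne_zero
    simp only [RCLike.inner_apply, conj_trivial]
    push_cast
    field_simp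
  simp only [h1]
  have h2 : ∫⁻ x : ℝ, ‖FF (x * (-(2 * Real.pi * h))⁻¹)‖ₑ ^ 2 =
      ENNReal.ofReal (2 * Real.pi * h) * ∫⁻ x, ‖FF x‖ₑ ^ 2 := by
    have hne : (-(2 * Real.pi * h))⁻¹ ≠ 0 := by
      have := Real.pi_pos
      exact inv_ne_zero (by nlinarith [mul_pos this hh])
    have hm := Real.map_volume_mul_right hne
    have h3 : ∫⁻ x : ℝ, ‖FF (x * (-(2 * Real.pi * h))⁻¹)‖ₑ ^ 2 =
        ∫⁻ y, ‖FF y‖ₑ ^ 2 ∂(Measure.map (· * (-(2 * Real.pi * h))⁻¹) volume) := by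
      rw [lintegral_map (by fun_prop) (by fun_prop)]
    rw [h3, hm, lintegral_smul_measure, inv_inv, abs_neg, abs_of_pos (by positivity)]
    rfl
  rw [h2, ← hconv, hP, hconv]
  rfl

end Plancherel

end

/-! ### One-dimensional oscillating integrals: normalization and noncritical points. -/

section

section OscInt

/-- The normalizing factor `(i/2πh)^{1/2}`. -/
def amp (h : ℝ) : ℂ := (Complex.I / (2 * Real.pi * h)) ^ ((1 : ℂ) / 2)

/-- The principal power realizes the convention arg i = π/2, which gives the phase π/4. -/
theorem amp_eq {h : ℝ} (hh : 0 < h) :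
    amp h = (((Real.sqrt (2 * Real.pi * h))⁻¹ : ℝ) : ℂ) * Complex.exp (Complex.I * Real.pi / 4) := by
  have hp : 0 < (2 * Real.pi * h)⁻¹ := by positivity
  have h1 : Complex.I / (2 * Real.pi * h) = (((2 * Real.pi * h)⁻¹ : ℝ) : ℂ) * Complex.I := by
    push_cast
    rw [div_eq_inv_mul]
  have h2 : (((2 * Real.pi * h)⁻¹ : ℝ) : ℂ) * Complex.I ≠ 0 := by
    exact mul_ne_zero (by exact_mod_cast hp.ne') Complex.I_ne_zero
  rw [amp, h1, Complex.cpow_def_of_ne_zero h2, Complex.log_ofReal_mul hp Complex.I_ne_zero,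
    Complex.log_I, add_mul, Complex.exp_add]
  congr 1
  · rw [← Real.sqrt_inv, Real.sqrt_eq_rpow, Real.rpow_def_of_pos hp, Complex.ofReal_exp]
    push_cast
    rfl
  · congr 1
    ring

theorem norm_amp {h : ℝ} (hh : 0 < h) : ‖amp h‖ = (Real.sqrt (2 * Real.pi * h))⁻¹ := by
  rw [amp_eq hh, norm_mul, Complex.norm_real, Real.norm_of_nonneg (by positivity)]
  have : Complex.I * Real.pi / 4 = ((Real.pi / 4 : ℝ) : ℂ) * Complex.I := by push_cast; ring
  rw [this, Complex.norm_exp_ofReal_mul_I, mul_one]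

/-- The normalization has size h^{−1/2}. With this crude bound half-powers need not be tracked: an
integral that is O(h²) becomes O(h). -/
theorem norm_amp_mul_le {h : ℝ} (hh : 0 < h) (h1 : h ≤ 1) : ‖amp h‖ * h ≤ 1 := by
  rw [norm_amp hh, inv_mul_le_iff₀ (by positivity), mul_one]
  refine Real.le_sqrt_of_sq_le ?_
  nlinarith [Real.pi_gt_three]

theorem continuous_integral_of_bounded_support {X : Type*} [TopologicalSpace X]
    [FirstCountableTopology X] [LocallyCompactSpace X] {f : X × ℝ → ℂ} (hf : Continuous f)
    {R : ℝ} (hR : ∀ x t, f (x, t) ≠ 0 → |t| ≤ R) : Continuous fun x => ∫ t, f (x, t) := by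
  have h := continuous_parametric_integral_of_continuous (μ := volume)
    (f := fun (x : X) (t : ℝ) => f (x, t)) (by exact hf) (isCompact_Icc (a := -R) (b := R))
  convert h using 2 with x
  refine (setIntegral_eq_integral_of_forall_compl_eq_zero fun t ht => ?_).symm
  by_contra hne
  exact ht (abs_le.1 (hR x t hne))

section

variable {P : Type*} [NormedAddCommGroup P] [NormedSpace ℝ P] {W : Set (P × ℝ)} {c : P × ℝ → ℂ}

theorem TestFun.exists_radius {E : Type*} [NormedAddCommGroup E] [NormedSpace ℝ E] {U : Set E}
    {a : E → ℂ} (ha : TestFun U a) : ∃ R : ℝ, 0 < R ∧ ∀ x ∈ tsupport a, ‖x‖ ≤ R := by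
  obtain ⟨R, hR⟩ := ha.compact.isCompact.isBounded.exists_norm_le
  exact ⟨max R 1, by positivity, fun x hx => (hR x hx).trans (le_max_left _ _)⟩

theorem TestFun.continuous_integral [ProperSpace P] (hc : TestFun W c) :
    Continuous fun p => ∫ t, c (p, t) := by
  obtain ⟨R, -, hR⟩ := hc.exists_radius
  exact continuous_integral_of_bounded_support hc.smooth.continuous
    (R := R) fun p t h => (norm_snd_le (p, t)).trans (hR _ (subset_tsupport _ h))

theorem TestFun.exists_integral_bound [ProperSpace P] (hc : TestFun W c) :
    ∃ C : ℝ, 0 ≤ C ∧ ∀ p, ∫ t, ‖c (p, t)‖ ≤ C := by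
  obtain ⟨R, hR0, hR⟩ := hc.exists_radius
  obtain ⟨C, hC⟩ := hc.exists_bound
  have hC0 : 0 ≤ C := (norm_nonneg _).trans (hC 0)
  refine ⟨C * (2 * R), by positivity, fun p => ?_⟩
  have h1 : ∫ t, ‖c (p, t)‖ = ∫ t in Icc (-R) R, ‖c (p, t)‖ := by
    refine (setIntegral_eq_integral_of_forall_compl_eq_zero fun t ht => ?_).symm
    by_contra hne
    exact ht (abs_le.1 ((norm_snd_le (p, t)).trans
      (hR _ (subset_tsupport _ (norm_ne_zero_iff.1 hne)))))
  rw [h1]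
  have h2 := norm_setIntegral_le_of_norm_le_const (μ := volume) (s := Icc (-R) R)
    (f := fun t => ‖c (p, t)‖) (C := C) (by simp) (fun t _ => by simpa using hC (p, t))
  refine (le_abs_self _).trans (h2.trans_eq ?_)
  rw [Real.volume_real_Icc_of_le (by linarith)]
  ring

theorem norm_integral_osc_le {Q : Type*} {c : Q × ℝ → ℂ} (φ : Q × ℝ → ℝ) (h : ℝ) (p : Q) :
    ‖∫ t, osc h (φ (p, t)) * c (p, t)‖ ≤ ∫ t, ‖c (p, t)‖ := by
  refine (norm_integral_le_integral_norm _).trans_eq ?_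
  refine integral_congr_ae (Eventually.of_forall fun t => ?_)
  simp [norm_osc]

theorem TestFun.osc_mul (hc : TestFun W c) (hW : IsOpen W) {φ : P × ℝ → ℝ}
    (hφ : ContDiffOn ℝ ∞ φ W) (h : ℝ) : TestFun W (fun z => osc h (φ z) * c z) :=
  hc.mul_smoothOn hW ((contDiff_osc h).comp_contDiffOn hφ)

/-- Integration by parts in an oscillating integral. -/
theorem integral_osc_mul_deriv (hW : IsOpen W) {φ : P × ℝ → ℝ} (hφ : ContDiffOn ℝ ∞ φ W)
    (hc : TestFun W c) {h : ℝ} (hh : h ≠ 0) (p : P) :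
    ∫ t, osc h (φ (p, t)) * ((fderiv ℝ φ (p, t) (0, 1) : ℂ) * c (p, t)) =
      Complex.I * h * ∫ t, osc h (φ (p, t)) * fderiv ℝ c (p, t) (0, 1) := by
  have hG := hc.osc_mul hW hφ h
  have hφ' : ContDiffOn ℝ ∞ (fun z => fderiv ℝ φ z (0, 1)) W :=
    (hφ.fderiv_of_isOpen hW (m := ∞) (by simp)).clm_apply contDiffOn_const
  have hA := (hc.mul_realOn hW hφ').osc_mul hW hφ h
  have hB := (hc.fderiv_apply (0, 1)).osc_mul hW hφ h
  have key : ∀ t, fderiv ℝ (fun z => osc h (φ z) * c z) (p, t) (0, 1) =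
      Complex.I / h * (osc h (φ (p, t)) * ((fderiv ℝ φ (p, t) (0, 1) : ℂ) * c (p, t))) +
      osc h (φ (p, t)) * fderiv ℝ c (p, t) (0, 1) := by
    intro t
    by_cases hz : (p, t) ∈ W
    · have d1 := hasDerivAt_slice (p := p) (t := t)
        ((hφ.contDiffAt (hW.mem_nhds hz)).differentiableAt (by simp))
      have d2 := (hasDerivAt_osc_comp h d1).mul (hc.hasDerivAt p t)
      rw [(hG.hasDerivAt p t).unique d2]
      ring
    · rw [(hG.fderiv_apply _).eq_zero hz, hc.eq_zero hz, (hc.fderiv_apply _).eq_zero hz]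
      simp
  have h0 := hG.integral_deriv p
  simp only [key] at h0
  rw [integral_add ((hA.slice_integrable p).const_mul _) (hB.slice_integrable p),
    integral_const_mul] at h0
  have hhc : (h : ℂ) ≠ 0 := by exact_mod_cast hh
  have h1 : ∀ a b : ℂ, Complex.I / h * a + b = 0 → a = Complex.I * h * b := by
    intro a b hab
    have : a = Complex.I * h * (Complex.I / h * a) * (-1) := by
      field_simp
      rw [Complex.I_sq]
      ring
    rw [this, eq_neg_of_add_eq_zero_left hab]
    ring
  exact h1 _ _ h0

end

/-- The oscillating integral with one integration variable. -/
def oscInt (φ : Plane × ℝ → ℝ) (a : Plane × ℝ → ℂ) (h : ℝ) (p : Plane) : ℂ :=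
  amp h * ∫ ξ, osc h (φ (p, ξ)) * a (p, ξ)

theorem continuous_oscInt {U : Set (Plane × ℝ)} (hU : IsOpen U) {φ : Plane × ℝ → ℝ}
    (hφ : ContDiffOn ℝ ∞ φ U) {a : Plane × ℝ → ℂ} (ha : TestFun U a) (h : ℝ) :
    Continuous (oscInt φ a h) :=
  continuous_const.mul (ha.osc_mul hU hφ h).continuous_integral

theorem oscInt_add {U : Set (Plane × ℝ)} (hU : IsOpen U) {φ : Plane × ℝ → ℝ}
    (hφ : ContDiffOn ℝ ∞ φ U) {a b : Plane × ℝ → ℂ} (ha : TestFun U a) (hb : TestFun U b) (h : ℝ)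
    (p : Plane) : oscInt φ (fun z => a z + b z) h p = oscInt φ a h p + oscInt φ b h p := by
  simp only [oscInt, mul_add]
  rw [integral_add ((ha.osc_mul hU hφ h).slice_integrable p)
    ((hb.osc_mul hU hφ h).slice_integrable p), mul_add]

theorem oscInt_congr {φ φ' : Plane × ℝ → ℝ} {a : Plane × ℝ → ℂ}
    (h : ∀ z, a z ≠ 0 → φ z = φ' z) : oscInt φ a = oscInt φ' a := by
  ext t p
  simp only [oscInt]
  congr 2
  ext ξ
  by_cases hz : a (p, ξ) = 0
  · simp [hz]
  · rw [h _ hz]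

/-- The contribution of the noncritical points. -/
theorem smallL2_oscInt_of_deriv_ne_zero {U : Set (Plane × ℝ)} (hU : IsOpen U) {φ : Plane × ℝ → ℝ}
    (hφ : ContDiffOn ℝ ∞ φ U) {a : Plane × ℝ → ℂ} (ha : TestFun U a)
    (hne : ∀ z ∈ tsupport a, fderiv ℝ φ z (0, 1) ≠ 0) : SmallL2 (oscInt φ a) := by
  have hφ' : ContDiffOn ℝ ∞ (fun z => fderiv ℝ φ z (0, 1)) U :=
    (hφ.fderiv_of_isOpen hU (m := ∞) (by simp)).clm_apply contDiffOn_const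
  set V : Set (Plane × ℝ) := U ∩ (fun z => fderiv ℝ φ z (0, 1)) ⁻¹' {0}ᶜ with hVdef
  have hV : IsOpen V := hφ'.continuousOn.isOpen_inter_preimage hU isOpen_compl_singleton
  have haV : TestFun V a := ⟨ha.smooth, ha.compact, fun z hz => ⟨ha.subset hz, hne z hz⟩⟩
  have hφV : ContDiffOn ℝ ∞ φ V := hφ.mono inter_subset_left
  have hinv : ContDiffOn ℝ ∞ (fun z => (fderiv ℝ φ z (0, 1))⁻¹) V :=
    (hφ'.mono inter_subset_left).inv fun z hz => hz.2
  -- Dividing by the derivative of the phase and integrating by parts gains a factor h and yields a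
  -- test function on the same set, so it can be repeated. Two factors absorb the normalization.
  have hdiv : ∀ {r : Plane × ℝ → ℂ}, TestFun V r → ∃ r', TestFun V r' ∧
      ∀ h : ℝ, h ≠ 0 → ∀ p, ∫ t, osc h (φ (p, t)) * r (p, t) =
        Complex.I * h * ∫ t, osc h (φ (p, t)) * r' (p, t) := by
    intro r hr
    have hr1 := hr.mul_realOn hV hinv
    refine ⟨_, hr1.fderiv_apply (0, 1), fun h hh p => ?_⟩
    rw [← integral_osc_mul_deriv hV hφV hr1 hh p]
    congr 1
    ext t
    by_cases hz : (p, t) ∈ V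
    · have : (fderiv ℝ φ (p, t) (0, 1) : ℂ) ≠ 0 := by exact_mod_cast hz.2
      push_cast
      field_simp
    · rw [hr.eq_zero hz]
      simp
  obtain ⟨r, hr, h1⟩ := hdiv haV
  obtain ⟨r', hr', h2⟩ := hdiv hr
  obtain ⟨C, hC0, hC⟩ := hr'.exists_integral_bound
  refine SmallL2.of_bound (ha.compact.isCompact.image continuous_fst) (C := C)
    (fun h hh hh1 p => ?_) fun h hh p hp => ?_
  · rw [oscInt, h1 h hh.ne', h2 h hh.ne']
    simp only [norm_mul, Complex.norm_I, Complex.norm_real, Real.norm_of_nonneg hh.le, one_mul]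
    have h3 := (norm_integral_osc_le (c := r') φ h p).trans (hC p)
    have h4 := norm_amp_mul_le hh hh1
    calc ‖amp h‖ * (h * (h * ‖∫ t, osc h (φ (p, t)) * r' (p, t)‖))
        = (‖amp h‖ * h) * (h * ‖∫ t, osc h (φ (p, t)) * r' (p, t)‖) := by ring
      _ ≤ 1 * (h * C) := by gcongr
      _ = C * h := by ring
  · have : ∀ t, a (p, t) = 0 := fun t => by
      by_contra hne
      exact hp ⟨(p, t), subset_tsupport _ hne, rfl⟩
    simp [oscInt, this]

end OscInt

/-! ### Uniform L² bounds for integrals with the phase S(s, η) + ηx. -/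

section MixedPhase

/-- The phase function `S(s, η) + ηx`. -/
def mixedPhase (S : Plane → ℝ) (z : Plane × ℝ) : ℝ := S (z.1.1, z.2) + z.2 * z.1.2

theorem contDiff_mixedPhase {S : Plane → ℝ} (hS : ContDiff ℝ ∞ S) :
    ContDiff ℝ ∞ (mixedPhase S) :=
  (hS.comp (by fun_prop : ContDiff ℝ ∞ fun z : Plane × ℝ => (z.1.1, z.2))).add (by fun_prop)

theorem sq_setLIntegral_le {X : Type*} [MeasurableSpace X] {μ : Measure X} {I : Set X}
    {f : X → ENNReal} (hf : AEMeasurable f (μ.restrict I)) :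
    (∫⁻ x in I, f x ∂μ) ^ 2 ≤ μ I * ∫⁻ x in I, f x ^ 2 ∂μ := by
  have h := ENNReal.lintegral_mul_le_Lp_mul_Lq (μ.restrict I)
    (Real.HolderConjugate.two_two) hf (aemeasurable_const (b := 1))
  simp only [Pi.mul_apply, mul_one, ENNReal.rpow_two, one_pow, lintegral_const,
    Measure.restrict_apply_univ, one_mul] at h
  calc (∫⁻ x in I, f x ∂μ) ^ 2
      ≤ ((∫⁻ x in I, f x ^ 2 ∂μ) ^ (1 / 2 : ℝ) * (μ I) ^ (1 / 2 : ℝ)) ^ 2 := by gcongr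
    _ = μ I * ∫⁻ x in I, f x ^ 2 ∂μ := by
        rw [mul_pow, ← ENNReal.rpow_natCast, ← ENNReal.rpow_natCast, ← ENNReal.rpow_mul,
          ← ENNReal.rpow_mul]
        norm_num
        rw [mul_comm]

/-- Uniform boundedness in `L²` of oscillating integrals with the phase function `S(s, η) + ηx`. -/
theorem bddL2_oscInt_mixedPhase {S : Plane → ℝ} (hS : ContDiff ℝ ∞ S) {b : Plane × ℝ → ℂ}
    (hb : TestFun univ b) : BddL2 (oscInt (mixedPhase S) b) := by
  obtain ⟨R, hR0, hR⟩ := hb.exists_radius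
  have hD := hb.fderiv_apply ((0, 1), 0)
  set D : Plane × ℝ → ℂ := fun z => fderiv ℝ b z ((0, 1), 0) with hDdef
  have hDb : tsupport D ⊆ tsupport b := tsupport_fderiv_apply_subset ℝ _
  obtain ⟨C, hC⟩ := hD.exists_bound
  have hC0 : 0 ≤ C := (norm_nonneg _).trans (hC 0)
  have hDR : ∀ z, D z ≠ 0 → |z.1.1| ≤ R ∧ |z.1.2| ≤ R ∧ |z.2| ≤ R := fun z hz => by
    have h := hR z (hDb (subset_tsupport _ hz))
    exact ⟨((norm_fst_le z.1).trans (norm_fst_le z)).trans h,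
      ((norm_snd_le z.1).trans (norm_fst_le z)).trans h, (norm_snd_le z).trans h⟩
  have hbR : ∀ z, b z ≠ 0 → |z.1.1| ≤ R ∧ |z.1.2| ≤ R ∧ |z.2| ≤ R := fun z hz => by
    have h := hR z (subset_tsupport _ hz)
    exact ⟨((norm_fst_le z.1).trans (norm_fst_le z)).trans h,
      ((norm_snd_le z.1).trans (norm_fst_le z)).trans h, (norm_snd_le z).trans h⟩
  -- the integrals with frozen amplitude
  set Q : ℝ → ℝ × ℝ × ℝ → ℂ := fun h y =>
    ∫ η, osc h (S (y.1, η) + η * y.2.1) * D ((y.1, y.2.2), η) with hQdef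
  have hQc : ∀ h, Continuous (Q h) := fun h => by
    refine continuous_integral_of_bounded_support (R := R)
      (f := fun u : (ℝ × ℝ × ℝ) × ℝ => osc h (S (u.1.1, u.2) + u.2 * u.1.2.1) *
        D ((u.1.1, u.1.2.2), u.2)) ?_ fun y t ht => (hDR _ (right_ne_zero_of_mul ht)).2.2
    exact ((contDiff_osc h).continuous.comp ((hS.continuous.comp (by fun_prop)).add
      (by fun_prop))).mul (hD.smooth.continuous.comp (by fun_prop))
  have hJQ : ∀ h (p : Plane), ‖∫ η, osc h (mixedPhase S (p, η)) * b (p, η)‖ₑ ≤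
      ∫⁻ t in Icc (-R) R, ‖Q h (p.1, p.2, t)‖ₑ := by
    intro h p
    by_cases hp : |p.2| ≤ R
    · have hp' := abs_le.1 hp
      -- The amplitude is the integral of its own x-derivative from the edge of the support. For
      -- each fixed t the new amplitude no longer depends on x.
      have h1 : ∀ η, b (p, η) = ∫ t in Ioc (-R) p.2, D ((p.1, t), η) := by
        intro η
        rw [← intervalIntegral.integral_of_le hp'.1]
        have hder : ∀ t ∈ uIcc (-R) p.2, HasDerivAt (fun t => b ((p.1, t), η))
            (D ((p.1, t), η)) t := fun t _ => by
          have d1 : HasDerivAt (fun t : ℝ => ((p.1, t), η)) (((0 : ℝ), (1 : ℝ)), (0 : ℝ)) t :=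
            ((hasDerivAt_const t p.1).prodMk (hasDerivAt_id t)).prodMk (hasDerivAt_const t η)
          exact (hb.smooth.differentiable (by simp)).differentiableAt.hasFDerivAt.comp_hasDerivAt
            t d1
        rw [intervalIntegral.integral_eq_sub_of_hasDerivAt_of_le hp'.1 ?_
          (fun t ht => hder t (by rw [uIcc_of_le hp'.1]; exact Ioo_subset_Icc_self ht)) ?_]
        · have : b ((p.1, -R), η) = 0 := by
            by_contra hne
            -- the amplitude vanishes on the boundary of its support
            have hopen : ∀ᶠ t in 𝓝 (-R), b ((p.1, t), η) ≠ 0 :=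
              (hb.smooth.continuous.comp (by fun_prop :
                Continuous fun t : ℝ => ((p.1, t), η))).continuousAt.eventually_ne hne
            obtain ⟨ε, hε, hball⟩ := Metric.eventually_nhds_iff.1 hopen
            have h2 := (hbR _ (hball (y := -R - ε / 2) (by
              rw [Real.dist_eq]
              rw [show -R - ε / 2 - -R = -(ε / 2) by ring, abs_neg, abs_of_pos (by positivity)]
              linarith))).2.1
            have h3 := (abs_le.1 h2).1
            simp only at h3
            linarith
          rw [this, sub_zero]
        · exact (hb.smooth.continuous.comp (by fun_prop)).continuousOn
        · exact (hD.smooth.continuous.comp (by fun_prop :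
            Continuous fun t : ℝ => ((p.1, t), η))).intervalIntegrable _ _
      have h2 : ∫ η, osc h (mixedPhase S (p, η)) * b (p, η) =
          ∫ t in Ioc (-R) p.2, Q h (p.1, p.2, t) := by
        simp only [h1, ← integral_const_mul]
        rw [integral_integral_swap]
        · rfl
        · have hF : TestFun univ (fun x : ℝ × ℝ => osc h (mixedPhase S (p, x.1)) *
              D ((p.1, x.2), x.1)) := by
            refine ⟨((contDiff_osc h).comp ((contDiff_mixedPhase hS).comp (by fun_prop))).mul
              (hD.smooth.comp (by fun_prop)), ?_, subset_univ _⟩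
            refine HasCompactSupport.intro (hD.compact.isCompact.image
              (by fun_prop : Continuous fun Z : Plane × ℝ => (Z.2, Z.1.2))) fun x hx => ?_
            by_contra hne
            exact hx ⟨((p.1, x.2), x.1), subset_tsupport _ (right_ne_zero_of_mul hne), rfl⟩
          have h1 : Integrable (fun x : ℝ × ℝ => osc h (mixedPhase S (p, x.1)) *
              D ((p.1, x.2), x.1)) (volume.prod volume) :=
            hF.smooth.continuous.integrable_of_hasCompactSupport hF.compact
          have := h1.restrict (s := univ ×ˢ Ioc (-R) p.2)
          rwa [← Measure.prod_restrict, Measure.restrict_univ] at this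
      rw [h2]
      refine (enorm_integral_le_lintegral_enorm _).trans (lintegral_mono_set ?_)
      exact fun t ht => ⟨ht.1.le, ht.2.trans hp'.2⟩
    · have : ∀ η, b (p, η) = 0 := fun η => by
        by_contra hne
        exact hp (hbR _ hne).2.1
      simp [this]
  -- With t frozen the integral over η is a Fourier transform at x, and Plancherel applies without
  -- any condition on the second derivatives of `S`.
  have hinner : ∀ h, 0 < h → ∀ s t, ∫⁻ x, ‖Q h (s, x, t)‖ₑ ^ 2 ≤
      (Icc (-R) R).indicator (fun _ => ENNReal.ofReal (2 * Real.pi * h) *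
        (ENNReal.ofReal (C ^ 2) * ENNReal.ofReal (2 * R))) s := by
    intro h hh s t
    have hf : TestFun univ (fun η => osc h (S (s, η)) * D ((s, t), η)) := by
      refine ⟨((contDiff_osc h).comp (hS.comp (by fun_prop))).mul (hD.smooth.comp (by fun_prop)),
        (hD.slice_compact (s, t)).mul_left, subset_univ _⟩
    have h1 : ∀ x, Q h (s, x, t) = ∫ η, osc h (η * x) * (osc h (S (s, η)) * D ((s, t), η)) := by
      intro x
      simp only [hQdef, osc_add]
      congr 1
      ext η
      ring
    simp only [h1]
    rw [lintegral_fourier_sq hf hh]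
    by_cases hs : s ∈ Icc (-R) R
    · rw [indicator_of_mem hs]
      gcongr
      calc ∫⁻ η, ‖osc h (S (s, η)) * D ((s, t), η)‖ₑ ^ 2
          ≤ ∫⁻ η, (Icc (-R) R).indicator (fun _ => ENNReal.ofReal (C ^ 2)) η := by
            refine lintegral_mono fun η => ?_
            by_cases hη : η ∈ Icc (-R) R
            · rw [indicator_of_mem hη, ← ofReal_norm, norm_mul, norm_osc, one_mul,
                ← ENNReal.ofReal_pow (norm_nonneg _)]
              exact ENNReal.ofReal_le_ofReal (pow_le_pow_left₀ (norm_nonneg _) (hC _) 2)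
            · have : D ((s, t), η) = 0 := by
                by_contra hne
                exact hη (abs_le.1 (hDR _ hne).2.2)
              simp [this]
        _ = ENNReal.ofReal (C ^ 2) * ENNReal.ofReal (2 * R) := by
            rw [lintegral_indicator_const measurableSet_Icc, Real.volume_Icc]
            ring_nf
    · have : ∀ η, D ((s, t), η) = 0 := fun η => by
        by_contra hne
        exact hs (abs_le.1 (hDR _ hne).1)
      simp [this]
  refine ⟨C * (2 * R) ^ 2, by positivity, fun h hh hh1 => eLpNorm_two_le (by positivity) ?_⟩
  -- The squared normalization cancels the factor 2πh of Plancherel's identity exactly, hence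
  -- uniformity in h.
  have hamp : ‖amp h‖ₑ ^ 2 * ENNReal.ofReal (2 * Real.pi * h) = 1 := by
    rw [← ofReal_norm, norm_amp hh, ← ENNReal.ofReal_pow (by positivity),
      ← ENNReal.ofReal_mul (by positivity), inv_pow, Real.sq_sqrt (by positivity),
      inv_mul_cancel₀ (by positivity), ENNReal.ofReal_one]
  have hQm : Measurable fun y : ℝ × ℝ × ℝ => ‖Q h y‖ₑ := (hQc h).measurable.enorm
  -- Cauchy–Schwarz in t over [−R, R], then Tonelli in order to integrate over x first.
  calc ∫⁻ p, ‖oscInt (mixedPhase S) b h p‖ₑ ^ 2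
      ≤ ∫⁻ p : Plane, ‖amp h‖ₑ ^ 2 * (ENNReal.ofReal (2 * R) *
          ∫⁻ t in Icc (-R) R, ‖Q h (p.1, p.2, t)‖ₑ ^ 2) := by
        refine lintegral_mono fun p => ?_
        rw [oscInt, enorm_mul, mul_pow]
        gcongr
        refine (pow_le_pow_left' (hJQ h p) 2).trans ?_
        refine (sq_setLIntegral_le ?_).trans_eq ?_
        · exact (hQm.comp (by fun_prop)).aemeasurable
        · rw [Real.volume_Icc]
          ring_nf
    _ = ‖amp h‖ₑ ^ 2 * (ENNReal.ofReal (2 * R) *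
          ∫⁻ s : ℝ, ∫⁻ t in Icc (-R) R, ∫⁻ x : ℝ, ‖Q h (s, x, t)‖ₑ ^ 2) := by
        have hm : Measurable fun p : Plane => ∫⁻ t in Icc (-R) R, ‖Q h (p.1, p.2, t)‖ₑ ^ 2 := by
          refine Measurable.lintegral_prod_right' (f := fun u : Plane × ℝ =>
            ‖Q h (u.1.1, u.1.2, u.2)‖ₑ ^ 2) ?_
          exact (hQm.comp (by fun_prop)).pow_const 2
        rw [lintegral_const_mul _ (hm.const_mul _), lintegral_const_mul _ hm]
        congr 2
        rw [Measure.volume_eq_prod, lintegral_prod _ hm.aemeasurable]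
        refine lintegral_congr fun s => ?_
        rw [lintegral_lintegral_swap]
        exact ((hQm.comp (by fun_prop)).pow_const 2).aemeasurable
    _ ≤ ‖amp h‖ₑ ^ 2 * (ENNReal.ofReal (2 * R) *
          (ENNReal.ofReal (2 * R) * (ENNReal.ofReal (2 * R) * (ENNReal.ofReal (2 * Real.pi * h) *
          (ENNReal.ofReal (C ^ 2) * ENNReal.ofReal (2 * R)))))) := by
        gcongr
        calc ∫⁻ s : ℝ, ∫⁻ t in Icc (-R) R, ∫⁻ x : ℝ, ‖Q h (s, x, t)‖ₑ ^ 2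
            ≤ ∫⁻ s : ℝ, ∫⁻ t in Icc (-R) R, (Icc (-R) R).indicator (fun _ =>
              ENNReal.ofReal (2 * Real.pi * h) *
              (ENNReal.ofReal (C ^ 2) * ENNReal.ofReal (2 * R))) s :=
              lintegral_mono fun s => lintegral_mono fun t => hinner h hh s t
          _ = _ := by
              simp only [lintegral_const, Measure.restrict_apply_univ, Real.volume_Icc]
              rw [lintegral_mul_const _ (measurable_const.indicator measurableSet_Icc),
                lintegral_indicator_const measurableSet_Icc, Real.volume_Icc,
                show R - -R = 2 * R by ring]
              ring
    _ = (‖amp h‖ₑ ^ 2 * ENNReal.ofReal (2 * Real.pi * h)) * (ENNReal.ofReal (C ^ 2) *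
          ENNReal.ofReal (2 * R) ^ 4) := by ring
    _ = ENNReal.ofReal ((C * (2 * R) ^ 2) ^ 2) := by
        rw [hamp, one_mul, ← ENNReal.ofReal_pow (by positivity), ← ENNReal.ofReal_mul (by positivity)]
        congr 1
        ring

end MixedPhase

end

/-! ### Dependence of mixed integrals on the amplitude at critical points only. -/

section

section MixedAmplitude

variable {S : Plane → ℝ}

/-- The derivative of `S(s, η)` with respect to `η`. -/
def dEta (S : Plane → ℝ) (q : Plane) : ℝ := fderiv ℝ S q (0, 1)

theorem contDiff_dEta (hS : ContDiff ℝ ∞ S) : ContDiff ℝ ∞ (dEta S) :=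
  (hS.fderiv_right (m := ∞) (by simp)).clm_apply contDiff_const

/-- The critical point of the phase function `S(s, η) + ηx` with coordinates `(s, η)`. -/
def critPt (S : Plane → ℝ) (q : Plane) : Plane × ℝ := ((q.1, -dEta S q), q.2)

theorem continuous_critPt (hS : ContDiff ℝ ∞ S) : Continuous (critPt S) := by
  have := (contDiff_dEta hS).continuous
  unfold critPt
  fun_prop

/-- The derivative of the phase function `S(s, η) + ηx` with respect to `η`. -/
def mixedW (S : Plane → ℝ) (z : Plane × ℝ) : ℝ := z.1.2 + dEta S (z.1.1, z.2)

theorem contDiff_mixedW (hS : ContDiff ℝ ∞ S) : ContDiff ℝ ∞ (mixedW S) :=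
  (by fun_prop : ContDiff ℝ ∞ fun z : Plane × ℝ => z.1.2).add
    ((contDiff_dEta hS).comp (by fun_prop))

theorem fderiv_mixedPhase (hS : ContDiff ℝ ∞ S) (z : Plane × ℝ) :
    fderiv ℝ (mixedPhase S) z (0, 1) = mixedW S z := by
  obtain ⟨p, t⟩ := z
  have d1 := hasDerivAt_slice (p := p) (t := t)
    ((contDiff_mixedPhase hS).differentiable (by simp)).differentiableAt
  have d2 := hasDerivAt_slice (p := p.1) (t := t) (hS.differentiable (by simp)).differentiableAt
  have d3 : HasDerivAt (fun t => mixedPhase S (p, t))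
      (fderiv ℝ S (p.1, t) (0, 1) + 1 * p.2) t := d2.add ((hasDerivAt_id t).mul_const p.2)
  rw [d1.unique d3, mixedW, dEta]
  ring

/-- Decay of the mixed oscillating integral far from the support of its amplitude. -/
theorem exists_far_bound (hS : ContDiff ℝ ∞ S) {a : Plane → ℂ} (ha : TestFun univ a) :
    ∃ R C : ℝ, 1 ≤ R ∧ 0 ≤ C ∧ (∀ q, a q ≠ 0 → |q.1| ≤ R ∧ |dEta S q| ≤ R) ∧
      ∀ h, 0 < h → ∀ p : Plane, 2 * R ≤ |p.2| →
        ‖∫ η, osc h (mixedPhase S (p, η)) * a (p.1, η)‖ ≤ C * h ^ 2 / p.2 ^ 2 := by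
  obtain ⟨R₁, hR₁, hR₁'⟩ := ha.exists_radius
  obtain ⟨R₂, hR₂⟩ := ha.compact.isCompact.exists_bound_of_continuousOn
    (contDiff_dEta hS).continuous.continuousOn
  -- On the support of `a` this makes |S_η| ≤ R/2, so the derivative x + S_η of the phase is
  -- comparable with x once |x| ≥ 2R.
  set R := max (max R₁ (2 * R₂)) 1 with hRdef
  have hR1 : 1 ≤ R := le_max_right _ _
  have hR0 : 0 < R := by linarith
  have hRS : ∀ q ∈ tsupport a, |dEta S q| ≤ R / 2 := fun q hq => by
    have h1 : 2 * R₂ ≤ R := (le_max_right _ _).trans (le_max_left _ _)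
    have h2 : |dEta S q| ≤ R₂ := hR₂ q hq
    linarith
  obtain ⟨B, hB, hBa⟩ := ha.self.mul_bump (by norm_num : (0 : ℝ) < 1 / 2)
  -- This is (x + S_η)/x expressed through σ = 1/2 + R/x. The half-lines |x| ≥ 2R become part of the
  -- interval [0, 1] of σ, with x = ∞ at σ = 1/2, so compactness gives constants uniform in x.
  set k : Plane × ℝ → ℝ := fun Z => 1 + (Z.1.2 - 1 / 2) / R * dEta S (Z.1.1, Z.2) with hkdef
  have hk : ContDiff ℝ ∞ k := contDiff_const.add
    ((by fun_prop : ContDiff ℝ ∞ fun Z : Plane × ℝ => (Z.1.2 - 1 / 2) / R).mul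
      ((contDiff_dEta hS).comp (by fun_prop)))
  set V : Set (Plane × ℝ) := {Z | k Z ≠ 0} with hVdef
  have hV : IsOpen V := isOpen_ne_fun hk.continuous continuous_const
  have hBV : TestFun V B := by
    refine hB.mono fun Z hZ => ?_
    have h1 := abs_le.1 (hRS _ hZ.1)
    have h2 : |(Z.1.2 - 1 / 2) / R| < 1 / R := by
      rw [abs_div, abs_of_pos hR0, div_lt_div_iff_of_pos_right hR0, abs_lt]
      constructor <;> linarith [hZ.2.1, hZ.2.2]
    have h3 : |(Z.1.2 - 1 / 2) / R * dEta S (Z.1.1, Z.2)| ≤ 1 / R * (R / 2) := by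
      rw [abs_mul]
      exact mul_le_mul h2.le (hRS _ hZ.1) (abs_nonneg _) (by positivity)
    have h4 : 1 / R * (R / 2) = 1 / 2 := by field_simp
    have h5 : k Z = 1 + (Z.1.2 - 1 / 2) / R * dEta S (Z.1.1, Z.2) := rfl
    have h6 := (abs_le.1 (h3.trans_eq h4)).1
    change k Z ≠ 0
    rw [h5]
    linarith
  have hinv : ContDiffOn ℝ ∞ (fun Z => (k Z)⁻¹) V := hk.contDiffOn.inv fun Z hZ => hZ
  have hr₁ := hBV.mul_realOn hV hinv
  set r₁ : Plane × ℝ → ℂ := fun Z => (((k Z)⁻¹ : ℝ) : ℂ) * B Z with hr₁def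
  have hr₁' := hr₁.fderiv_apply (0, 1)
  have hr₂ := hr₁'.mul_realOn hV hinv
  set r₂ : Plane × ℝ → ℂ := fun Z => (((k Z)⁻¹ : ℝ) : ℂ) * fderiv ℝ r₁ Z (0, 1) with hr₂def
  have hr₂' := hr₂.fderiv_apply (0, 1)
  obtain ⟨C, hC0, hC⟩ := hr₂'.exists_integral_bound
  refine ⟨R, C, hR1, hC0, fun q hq => ?_, fun h hh p hp => ?_⟩
  · have hq' := subset_tsupport a hq
    refine ⟨?_, ?_⟩
    · exact ((norm_fst_le q).trans (hR₁' q hq')).trans ((le_max_left _ _).trans (le_max_left _ _))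
    · linarith [hRS q hq']
  · obtain ⟨s, x⟩ := p
    simp only at hp ⊢
    have hx : x ≠ 0 := by
      intro hx
      rw [hx, abs_zero] at hp
      linarith
    have hxc : (x : ℂ) ≠ 0 := by exact_mod_cast hx
    set σ : ℝ := 1 / 2 + R / x with hσdef
    have hRx : |R / x| ≤ 1 / 2 := by
      rw [abs_div, abs_of_pos hR0, div_le_iff₀ (abs_pos.2 hx)]
      linarith
    have hσ : σ ∈ Icc (0 : ℝ) 1 := by
      have := abs_le.1 hRx
      constructor <;> linarith [this.1, this.2]
    have hkx : ∀ η, k ((s, σ), η) = 1 + dEta S (s, η) / x := by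
      intro η
      simp only [hkdef, hσdef]
      field_simp
      ring
    let S' : Plane × ℝ → ℝ := fun Z => S (Z.1.1, Z.2) + Z.2 * x
    have hS' : ContDiff ℝ ∞ S' := (hS.comp (by fun_prop)).add (by fun_prop)
    have hS'd : ∀ η, fderiv ℝ S' ((s, σ), η) (0, 1) = x + dEta S (s, η) := by
      intro η
      have d1 := hasDerivAt_slice (p := (s, σ)) (t := η)
        (hS'.differentiable (by simp)).differentiableAt
      have d2 := hasDerivAt_slice (p := s) (t := η) (hS.differentiable (by simp)).differentiableAt
      have d3 : HasDerivAt (fun t => S' ((s, σ), t))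
        (fderiv ℝ S (s, η) (0, 1) + 1 * x) η := d2.add ((hasDerivAt_id η).mul_const x)
      rw [d1.unique d3, dEta]
      ring
    -- Each integration by parts divides by xk and gains h/x; two of them give h²/x².
    have step : ∀ {r : Plane × ℝ → ℂ}, TestFun V r →
        ∫ η, osc h (S' ((s, σ), η)) * r ((s, σ), η) = Complex.I * h / x *
          ∫ η, osc h (S' ((s, σ), η)) *
            fderiv ℝ (fun Z => (((k Z)⁻¹ : ℝ) : ℂ) * r Z) ((s, σ), η) (0, 1) := by
      intro r hr
      have h1 := integral_osc_mul_deriv hV hS'.contDiffOn (hr.mul_realOn hV hinv) hh.ne' (s, σ)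
      have h2 : ∀ η, osc h (S' ((s, σ), η)) * r ((s, σ), η) = (x : ℂ)⁻¹ *
          (osc h (S' ((s, σ), η)) * ((fderiv ℝ S' ((s, σ), η) (0, 1) : ℂ) *
            ((((k ((s, σ), η))⁻¹ : ℝ) : ℂ) * r ((s, σ), η)))) := by
        intro η
        by_cases hz : ((s, σ), η) ∈ V
        · have hz' : k ((s, σ), η) ≠ 0 := hz
          have h3 : x + dEta S (s, η) = x * k ((s, σ), η) := by
            rw [hkx]
            field_simp
          have hzc : (k ((s, σ), η) : ℂ) ≠ 0 := by exact_mod_cast hz'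
          rw [hS'd, h3]
          push_cast
          field_simp
        · rw [hr.eq_zero hz]
          simp
      simp only [h2]
      rw [integral_const_mul, h1]
      ring
    have h1 : ∫ η, osc h (mixedPhase S ((s, x), η)) * a (s, η) =
        ∫ η, osc h (S' ((s, σ), η)) * B ((s, σ), η) := by
      congr 1
      ext η
      rw [hBa s σ η hσ]
      rfl
    rw [h1, step hBV, step hr₁']
    have h2 := (norm_integral_osc_le (c := fun Z => fderiv ℝ r₂ Z (0, 1)) S' h (s, σ)).trans
      (hC (s, σ))
    simp only [norm_mul, norm_div, Complex.norm_I, Complex.norm_real, Real.norm_of_nonneg hh.le,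
      one_mul, Real.norm_eq_abs]
    calc h / |x| * (h / |x| * ‖∫ η, osc h (S' ((s, σ), η)) *
          fderiv ℝ (fun Z => (((k Z)⁻¹ : ℝ) : ℂ) * fderiv ℝ r₁ Z (0, 1)) ((s, σ), η) (0, 1)‖)
        ≤ h / |x| * (h / |x| * C) := by gcongr
      _ = C * h ^ 2 / |x| ^ 2 := by field_simp
      _ = C * h ^ 2 / x ^ 2 := by rw [sq_abs]

theorem continuous_oscInt_mixedPhase (hS : ContDiff ℝ ∞ S) {a : Plane → ℂ} (ha : TestFun univ a)
    (h : ℝ) : Continuous (oscInt (mixedPhase S) (fun z => a (z.1.1, z.2)) h) := by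
  obtain ⟨R, -, hR⟩ := ha.exists_radius
  refine continuous_const.mul (continuous_integral_of_bounded_support
    (f := fun z : Plane × ℝ => osc h (mixedPhase S z) * a (z.1.1, z.2)) (R := R) ?_ ?_)
  · exact ((contDiff_osc h).continuous.comp (contDiff_mixedPhase hS).continuous).mul
      (ha.smooth.continuous.comp (by fun_prop))
  · exact fun p t hne => (norm_snd_le (p.1, t)).trans
      (hR _ (subset_tsupport _ (right_ne_zero_of_mul hne)))

theorem memLp_decay (R C : ℝ) : MemLp (fun p : Plane =>
    (Icc (-R) R).indicator (fun _ => C) p.1 * (1 + p.2 ^ 2)⁻¹) 2 volume := by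
  have h1 : MemLp ((Icc (-R) R).indicator fun _ => C) 2 (volume : Measure ℝ) :=
    memLp_indicator_const 2 measurableSet_Icc C (Or.inr measure_Icc_lt_top.ne)
  have h2 : MemLp (fun x : ℝ => (1 + x ^ 2)⁻¹) 2 (volume : Measure ℝ) := by
    rw [memLp_two_iff_integrable_sq (by fun_prop (disch := intros; positivity))]
    refine Integrable.mono' integrable_inv_one_add_sq
      (by fun_prop (disch := intros; positivity)) ?_
    refine Eventually.of_forall fun x => ?_
    rw [Real.norm_of_nonneg (by positivity)]
    have h3 : (1 + x ^ 2)⁻¹ ≤ 1 := inv_le_one_of_one_le₀ (by nlinarith [sq_nonneg x])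
    have h4 : 0 ≤ (1 + x ^ 2)⁻¹ := by positivity
    nlinarith
  rw [memLp_two_iff_integrable_sq]
  · have := h1.integrable_sq.mul_prod h2.integrable_sq
    refine this.congr (Eventually.of_forall fun p => ?_)
    simp only
    ring
  · exact ((h1.1.comp_fst).mul (h2.1.comp_snd))

/-- The mixed oscillating integral depends, modulo `O(h)`, only on the restriction of the amplitude
to the critical set. -/
theorem asymp_oscInt_mixedPhase (hS : ContDiff ℝ ∞ S) {b : Plane × ℝ → ℂ} (hb : TestFun univ b)
    {a : Plane → ℂ} (ha : TestFun univ a) (hab : ∀ q, b (critPt S q) = a q) :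
    Asymp (oscInt (mixedPhase S) b) (oscInt (mixedPhase S) (fun z => a (z.1.1, z.2))) := by
  obtain ⟨R, C, hR1, hC0, hRa, hfar⟩ := exists_far_bound hS ha
  -- The amplitude `a` does not depend on x, so a cut-off in x is needed to make it a test function.
  -- It equals 1 for |x| ≤ 2R, in particular at the critical points where `a` is nonzero.
  obtain ⟨κ, hκ, hκ1, hκle⟩ := exists_cutoff 0 (by linarith : 0 < 2 * R)
    (by linarith : 2 * R < 3 * R)
  simp only [sub_zero] at hκ1
  have hcut := (ha.mul_mid hκ).mono (subset_univ _)
  have hD := hb.sub hcut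
  set D : Plane × ℝ → ℂ := fun z => b z - κ z.1.2 * a (z.1.1, z.2) with hDdef
  have hDcrit : ∀ q, D (critPt S q) = 0 := by
    intro q
    simp only [hDdef, hab]
    simp only [critPt]
    by_cases hq : a q = 0
    · simp [hq]
    · rw [hκ1 _ (by rw [abs_neg]; linarith [(hRa q hq).2]), one_mul, sub_self]
  have hSe := contDiff_dEta hS
  -- With w = x + S_η in place of x, the difference of amplitudes vanishes at w = 0 and can be
  -- divided by w.
  obtain ⟨g, hg, hgD⟩ := exists_smooth_div (P := Plane) (F := ℂ)
    (f := fun z => D ((z.1.1, z.2 - dEta S z.1), z.1.2))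
    (hD.smooth.comp (by fun_prop))
  set r : Plane × ℝ → ℂ := fun z => g ((z.1.1, z.2), mixedW S z) with hrdef
  have hrs : ContDiff ℝ ∞ r := hg.comp ((by fun_prop :
    ContDiff ℝ ∞ fun z : Plane × ℝ => (z.1.1, z.2)).prodMk (contDiff_mixedW hS))
  have hDr : ∀ z, D z = (mixedW S z : ℂ) * r z := by
    rintro ⟨⟨s, x⟩, η⟩
    have h1 := hgD (s, η) (mixedW S ((s, x), η))
    have h2 := hDcrit (s, η)
    simp only [critPt] at h2
    simp only [zero_sub, h2, zero_add, Complex.real_smul] at h1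
    rw [hrdef, ← h1]
    simp [mixedW]
  -- The quotient acquires no new support: off w = 0 this is clear, and at w = 0 one shifts x
  -- slightly and uses continuity.
  have hr : TestFun univ r := by
    refine hD.of_tsupport_subset hrs (closure_minimal (fun z hz => ?_) (isClosed_tsupport _))
    by_contra hzD
    have hopen : ∀ᶠ y in 𝓝 z, D y = 0 := by
      filter_upwards [(isClosed_tsupport D).isOpen_compl.mem_nhds hzD] with y hy
      exact image_eq_zero_of_notMem_tsupport hy
    obtain ⟨⟨s, x⟩, η⟩ := z
    have hc : Continuous fun t : ℝ => (((s, x + t), η) : Plane × ℝ) := by fun_prop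
    have h0 : Tendsto (fun t : ℝ => (((s, x + t), η) : Plane × ℝ)) (𝓝 0) (𝓝 ((s, x), η)) := by
      have := hc.tendsto 0
      simpa using this
    have h1 : ∀ᶠ t in 𝓝[≠] (0 : ℝ), r ((s, x + t), η) = 0 := by
      have h2 : ∀ᶠ t in 𝓝[≠] (0 : ℝ), mixedW S ((s, x + t), η) ≠ 0 := by
        by_cases hw : mixedW S ((s, x), η) = 0
        · filter_upwards [self_mem_nhdsWithin] with t ht
          have : mixedW S ((s, x + t), η) = mixedW S ((s, x), η) + t := by
            simp only [mixedW]
            ring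
          rw [this, hw, zero_add]
          exact ht
        · refine nhdsWithin_le_nhds ?_
          exact (((contDiff_mixedW hS).continuous.continuousAt.tendsto.comp h0).eventually_ne hw)
      filter_upwards [h2, nhdsWithin_le_nhds (h0.eventually hopen)] with t ht1 ht2
      have h3 := hDr ((s, x + t), η)
      rw [ht2] at h3
      have : (mixedW S ((s, x + t), η) : ℂ) ≠ 0 := by exact_mod_cast ht1
      exact (mul_eq_zero.1 h3.symm).resolve_left this
    have h2 : Tendsto (fun t : ℝ => r ((s, x + t), η)) (𝓝[≠] 0) (𝓝 (r ((s, x), η))) :=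
      (hrs.continuous.continuousAt.tendsto.comp h0).mono_left nhdsWithin_le_nhds
    have h3 : Tendsto (fun t : ℝ => r ((s, x + t), η)) (𝓝[≠] 0) (𝓝 0) :=
      tendsto_const_nhds.congr' (by filter_upwards [h1] with t ht using ht.symm)
    exact hz (tendsto_nhds_unique h2 h3)
  have hφ := contDiff_mixedPhase hS
  -- Since w is the η-derivative of the phase, one integration by parts leaves h times an integral
  -- bounded in L².
  have hsmallD : SmallL2 (oscInt (mixedPhase S) D) := by
    refine ((bddL2_oscInt_mixedPhase hS (hr.fderiv_apply (0, 1))).smul_h Complex.I).congr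
      fun h hh p => ?_
    have h1 := integral_osc_mul_deriv isOpen_univ hφ.contDiffOn hr hh.ne' p
    simp only [fderiv_mixedPhase hS] at h1
    simp only [oscInt, hDr]
    rw [h1]
    ring
  -- The part removed by κ lives where |x| > 2R; the decay h²/x² there absorbs the normalization and
  -- is square integrable in x.
  have hfarS : SmallL2 fun h p => (1 - κ p.2) *
      oscInt (mixedPhase S) (fun z => a (z.1.1, z.2)) h p := by
    refine SmallL2.of_pointwise (memLp_decay R (4 * C)) fun h hh hh1 p => ?_
    by_cases hx : |p.2| ≤ 2 * R
    · rw [hκ1 _ hx]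
      simp only [sub_self, zero_mul, norm_zero]
      exact mul_nonneg hh.le (mul_nonneg (indicator_nonneg (fun _ _ => by positivity) _)
        (by positivity))
    · push Not at hx
      by_cases hs : p.1 ∈ Icc (-R) R
      · rw [indicator_of_mem hs, norm_mul, oscInt, norm_mul]
        have h1 : ‖1 - κ p.2‖ ≤ 2 := by
          refine (norm_sub_le _ _).trans ?_
          rw [norm_one]
          linarith [hκle p.2]
        have h2 := hfar h hh p hx.le
        have h3 := norm_amp_mul_le hh hh1
        have hp0 : 1 ≤ p.2 ^ 2 := by
          rw [← sq_abs]
          nlinarith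
        have h4 : C * h ^ 2 / p.2 ^ 2 ≤ 2 * C * h ^ 2 * (1 + p.2 ^ 2)⁻¹ := by
          rw [div_le_iff₀ (by linarith), mul_assoc, inv_mul_eq_div]
          have : 1 / 2 ≤ p.2 ^ 2 / (1 + p.2 ^ 2) := by
            rw [le_div_iff₀ (by positivity)]
            linarith
          nlinarith [mul_nonneg hC0 (sq_nonneg h)]
        calc ‖1 - κ p.2‖ * (‖amp h‖ * ‖∫ ξ, osc h (mixedPhase S (p, ξ)) * a (p.1, ξ)‖)
            ≤ 2 * (‖amp h‖ * (2 * C * h ^ 2 * (1 + p.2 ^ 2)⁻¹)) := by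
              gcongr
              exact h2.trans h4
          _ = (‖amp h‖ * h) * (h * (4 * C * (1 + p.2 ^ 2)⁻¹)) := by ring
          _ ≤ 1 * (h * (4 * C * (1 + p.2 ^ 2)⁻¹)) := by gcongr
          _ = _ := one_mul _
      · have : ∀ η, a (p.1, η) = 0 := fun η => by
          by_contra hne
          exact hs (abs_le.1 (hRa _ hne).1)
        simp [oscInt, this, hs]
  have hca := fun h => continuous_oscInt_mixedPhase hS ha h
  refine ⟨fun h _ => continuous_oscInt isOpen_univ hφ.contDiffOn hb h, fun h _ => hca h, ?_⟩
  refine (hsmallD.add hfarS.neg (fun h _ => continuous_oscInt isOpen_univ hφ.contDiffOn hD h)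
    (fun h _ => ?_)).congr fun h hh p => ?_
  · exact ((continuous_const.sub (hκ.smooth.continuous.comp continuous_snd)).mul (hca h)).neg
  · have h1 := oscInt_add isOpen_univ hφ.contDiffOn hD hcut h p
    have h2 : oscInt (mixedPhase S) (fun z => κ z.1.2 * a (z.1.1, z.2)) h p =
        κ p.2 * oscInt (mixedPhase S) (fun z => a (z.1.1, z.2)) h p := by
      have h3 : ∀ ξ, osc h (mixedPhase S (p, ξ)) * (κ p.2 * a (p.1, ξ)) =
          κ p.2 * (osc h (mixedPhase S (p, ξ)) * a (p.1, ξ)) := fun ξ => by ring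
      simp only [oscInt, h3]
      rw [integral_const_mul]
      ring
    simp only [hDdef, sub_add_cancel] at h1
    rw [h2] at h1
    rw [h1]
    ring

end MixedAmplitude

end

/-! ### Replacing a phase by the mixed phase near a critical point. -/

section

section LocalReduction

variable {S : Plane → ℝ}

theorem fderiv_comp_mid {P : Type*} [NormedAddCommGroup P] [NormedSpace ℝ P] {w : P × ℝ → ℝ}
    (hw : ContDiff ℝ ∞ w) (Z : (P × ℝ) × ℝ) :
    fderiv ℝ (fun Z : (P × ℝ) × ℝ => w (Z.1.1, Z.2)) Z (0, 1) =
      fderiv ℝ w (Z.1.1, Z.2) (0, 1) := by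
  have hW : ContDiff ℝ ∞ (fun Z : (P × ℝ) × ℝ => w (Z.1.1, Z.2)) := hw.comp (by fun_prop)
  have d1 := hasDerivAt_slice (p := Z.1) (t := Z.2)
    (hW.differentiable (by simp)).differentiableAt
  have d2 := hasDerivAt_slice (p := Z.1.1) (t := Z.2)
    (hw.differentiable (by simp)).differentiableAt
  exact d1.unique d2

theorem fderiv_mul_mid {P : Type*} [NormedAddCommGroup P] [NormedSpace ℝ P] {g : P × ℝ → ℝ}
    (hg : ContDiff ℝ ∞ g) (Z : (P × ℝ) × ℝ) :
    fderiv ℝ (fun Z : (P × ℝ) × ℝ => Z.1.2 * g (Z.1.1, Z.2)) Z (0, 1) =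
      Z.1.2 * fderiv ℝ g (Z.1.1, Z.2) (0, 1) := by
  have hG : ContDiff ℝ ∞ (fun Z : (P × ℝ) × ℝ => Z.1.2 * g (Z.1.1, Z.2)) :=
    (by fun_prop : ContDiff ℝ ∞ fun Z : (P × ℝ) × ℝ => Z.1.2).mul (hg.comp (by fun_prop))
  have d1 := hasDerivAt_slice (p := Z.1) (t := Z.2)
    (hG.differentiable (by simp)).differentiableAt
  have d2 := (hasDerivAt_slice (p := Z.1.1) (t := Z.2)
    (hg.differentiable (by simp)).differentiableAt).const_mul Z.1.2
  exact d1.unique d2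

/-- On [0, 1] the value is a convex combination of 1 and 1 + m, hence at least c; leaving [0, 1] by
at most δ costs at most δL = c/2. -/
theorem homotopy_factor_pos {k L c δ m σ : ℝ} (hk : 0 < k) (hc : c = min 1 (k / 2)) (hL : 0 < L)
    (hm : k / 2 - 1 < m) (hmL : |m| ≤ L) (hδ : δ = c / (2 * L)) (hσ : σ ∈ Ioo (-δ) (1 + δ)) :
    0 < 1 + σ * m := by
  have hc0 : 0 < c := by rw [hc]; exact lt_min one_pos (by positivity)
  have hc1 : c ≤ 1 := by rw [hc]; exact min_le_left _ _
  have hc2 : c ≤ k / 2 := by rw [hc]; exact min_le_right _ _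
  have hδL : δ * L = c / 2 := by rw [hδ]; field_simp
  have hδ0 : 0 < δ := by rw [hδ]; positivity
  have hm' := abs_le.1 hmL
  by_cases h0 : σ < 0
  · have : -(σ * m) ≤ δ * L := by
      have h1 : -(σ * m) ≤ |σ * m| := neg_le_abs _
      rw [abs_mul, abs_of_neg h0] at h1
      refine h1.trans (mul_le_mul (by linarith [hσ.1]) hmL (abs_nonneg _) hδ0.le)
    nlinarith
  · push Not at h0
    by_cases h1 : σ ≤ 1
    · have : c ≤ 1 + σ * m := by nlinarith
      linarith
    · push Not at h1
      have h2 : -((σ - 1) * m) ≤ δ * L := by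
        have h3 : -((σ - 1) * m) ≤ |(σ - 1) * m| := neg_le_abs _
        rw [abs_mul, abs_of_pos (by linarith : 0 < σ - 1)] at h3
        exact h3.trans (mul_le_mul (by linarith [hσ.2]) hmL (abs_nonneg _) hδ0.le)
      nlinarith

/-- Integration of a test function over a parameter. -/
theorem TestFun.integral_mid {P : Type} [NormedAddCommGroup P] [NormedSpace ℝ P] [ProperSpace P]
    {U : Set ((P × ℝ) × ℝ)} {γ : (P × ℝ) × ℝ → ℂ} (hγ : TestFun U γ) :
    TestFun univ (fun z : P × ℝ => ∫ σ in (0 : ℝ)..1, γ ((z.1, σ), z.2)) := by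
  refine ⟨contDiff_unitIntegral (f := fun y : (P × ℝ) × ℝ => γ ((y.1.1, y.2), y.1.2))
    (hγ.smooth.comp (by fun_prop)), ?_, subset_univ _⟩
  refine HasCompactSupport.intro (hγ.compact.isCompact.image
    (by fun_prop : Continuous fun Z : (P × ℝ) × ℝ => (Z.1.1, Z.2))) fun z hz => ?_
  have : ∀ σ, γ ((z.1, σ), z.2) = 0 := fun σ => by
    by_contra hne
    exact hz ⟨((z.1, σ), z.2), subset_tsupport _ hne, rfl⟩
  simp [this]

/-- Replacement of the phase function `φ₀ + w² g`, with `φ₀ = S(s, η) + ηx` and `w = ∂φ₀/∂η`, by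
the phase function `φ₀`. -/
theorem smallL2_homotopy (hS : ContDiff ℝ ∞ S) {g : Plane × ℝ → ℝ} (hg : ContDiff ℝ ∞ g)
    {U : Set (Plane × ℝ)} (hU : IsOpen U) {δ : ℝ} (hδ : 0 < δ)
    (hM : ∀ z ∈ U, ∀ σ ∈ Ioo (-δ) (1 + δ), 0 < 1 + σ * (2 * fderiv ℝ (mixedW S) z (0, 1) * g z +
      mixedW S z * fderiv ℝ g z (0, 1)))
    {β : Plane × ℝ → ℂ} (hβ : TestFun U β) :
    SmallL2 fun h p =>
      oscInt (fun z => mixedPhase S z + mixedW S z ^ 2 * g z) (fun z =>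
        (Real.sqrt (1 + (2 * fderiv ℝ (mixedW S) z (0, 1) * g z +
          mixedW S z * fderiv ℝ g z (0, 1))) : ℂ) * β z) h p -
      oscInt (mixedPhase S) β h p := by
  have hφ := contDiff_mixedPhase hS
  have hw := contDiff_mixedW hS
  set m' : Plane × ℝ → ℝ := fun z => 2 * fderiv ℝ (mixedW S) z (0, 1) * g z +
      mixedW S z * fderiv ℝ g z (0, 1) with hm'
  have hm's : ContDiff ℝ ∞ m' := (((contDiff_const.mul ((hw.fderiv_right (m := ∞)
    (by simp)).clm_apply contDiff_const)).mul hg)).add (hw.mul ((hg.fderiv_right (m := ∞)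
    (by simp)).clm_apply contDiff_const))
  -- a smaller range for the parameter, stable under products
  set ε : ℝ := min 1 (δ / 4) with hε
  have hε0 : 0 < ε := lt_min one_pos (by positivity)
  have hε1 : ε ≤ 1 := min_le_left _ _
  have hε4 : ε ≤ δ / 4 := min_le_right _ _
  have hsub : Ioo (-ε) (1 + ε) ⊆ Ioo (-δ) (1 + δ) :=
    Ioo_subset_Ioo (by linarith) (by linarith)
  -- First deformation: the difference is h times an average of integrals with the phases φ₀ + σw²g.
  -- The L² bound is available for φ₀ only, so this does not suffice yet.
  obtain ⟨γ, hγ, hγeq⟩ := exists_homotopy_remainder (P := Plane) (φ := mixedPhase S)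
    (w := mixedW S) (g := g) (μ := fun _ => 1) hφ hw hg contDiff_const hU
    (fun z _ => by rw [fderiv_mixedPhase hS, mul_one]) hε0
    (fun z hz σ hσ => hM z hz σ (hsub hσ)) hβ
  set Ω : Set ((Plane × ℝ) × ℝ) := {Z | (Z.1.1, Z.2) ∈ U ∧ Z.1.2 ∈ Ioo (-ε) (1 + ε)} with hΩdef
  have hΩ : IsOpen Ω := (hU.preimage (by fun_prop : Continuous fun Z : (Plane × ℝ) × ℝ =>
    (Z.1.1, Z.2))).inter (isOpen_Ioo.preimage (by fun_prop : Continuous fun Z : (Plane × ℝ) × ℝ =>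
    Z.1.2))
  have hpr : ContDiff ℝ ∞ (fun Z : (Plane × ℝ) × ℝ => (Z.1.1, Z.2)) := by fun_prop
  have hmid : ContDiff ℝ ∞ (fun Z : (Plane × ℝ) × ℝ => Z.1.2) := by fun_prop
  set M : (Plane × ℝ) × ℝ → ℝ := fun Z => 1 + Z.1.2 * m' (Z.1.1, Z.2) with hMdef
  have hMs : ContDiff ℝ ∞ M := contDiff_const.add (hmid.mul (hm's.comp hpr))
  have hMpos : ∀ Z ∈ Ω, 0 < M Z := fun Z hZ => hM _ hZ.1 _ (hsub hZ.2)
  have hβ' : TestFun Ω fun Z => (((Real.sqrt (M Z))⁻¹ : ℝ) : ℂ) * γ Z := hγ.mul_realOn hΩ ((hMs.contDiffOn.sqrt fun Z hZ => (hMpos Z hZ).ne').inv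
      fun Z hZ => (Real.sqrt_pos.2 (hMpos Z hZ)).ne')
  set β' : (Plane × ℝ) × ℝ → ℂ := fun Z => (((Real.sqrt (M Z))⁻¹ : ℝ) : ℂ) * γ Z with hβ'def
  have hmulmem : ∀ σ ∈ Ioo (-ε) (1 + ε), ∀ τ ∈ Ioo (-ε) (1 + ε), τ * σ ∈ Ioo (-δ) (1 + δ) := by
    intro σ hσ τ hτ
    have hσ' : |σ| ≤ 1 + ε := abs_le.2 ⟨by linarith [hσ.1], hσ.2.le⟩
    have hτ' : |τ| ≤ 1 + ε := abs_le.2 ⟨by linarith [hτ.1], hτ.2.le⟩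
    have hle : τ * σ ≤ (1 + ε) * (1 + ε) := (le_abs_self _).trans (by
      rw [abs_mul]
      exact mul_le_mul hτ' hσ' (abs_nonneg _) (by linarith))
    refine ⟨?_, by nlinarith⟩
    rcases le_or_gt 0 σ with h1 | h1 <;> rcases le_or_gt 0 τ with h2 | h2 <;>
      nlinarith [hσ.1, hσ.2, hτ.1, hτ.2]
  -- Second deformation, with σ as a further parameter and σg instead of g: it brings the phase back
  -- to φ₀ at the price of another factor h, so its remainder can be estimated pointwise.
  obtain ⟨γ₂, hγ₂, hγ₂eq⟩ := exists_homotopy_remainder (P := Plane × ℝ)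
    (φ := fun Z : (Plane × ℝ) × ℝ => mixedPhase S (Z.1.1, Z.2))
    (w := fun Z : (Plane × ℝ) × ℝ => mixedW S (Z.1.1, Z.2))
    (g := fun Z : (Plane × ℝ) × ℝ => Z.1.2 * g (Z.1.1, Z.2)) (μ := fun _ => 1)
    (hφ.comp hpr) (hw.comp hpr) (hmid.mul (hg.comp hpr)) contDiff_const hΩ
    (fun Z _ => by rw [fderiv_comp_mid hφ, fderiv_mixedPhase hS, mul_one]) hε0
    (fun Z hZ τ hτ => by
      rw [fderiv_comp_mid hw, fderiv_mul_mid hg]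
      have := hM _ hZ.1 _ (hmulmem _ hZ.2 _ hτ)
      refine this.trans_eq ?_
      ring) hβ'
  have hb := hβ'.integral_mid
  set b : Plane × ℝ → ℂ := fun z => ∫ σ in (0 : ℝ)..1, β' ((z.1, σ), z.2) with hbdef
  obtain ⟨C, hC0, hC⟩ := hγ₂.exists_integral_bound
  -- the exact remainder formula
  set E : ℝ → Plane → ℂ := fun h p => ∫ σ in (0 : ℝ)..1, ∫ τ in (0 : ℝ)..1, ∫ ξ,
    osc h (mixedPhase S (p, ξ) + τ * (mixedW S (p, ξ) ^ 2 * (σ * g (p, ξ)))) *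
      γ₂ (((p, σ), τ), ξ) with hEdef
  have hEle : ∀ h p, ‖E h p‖ ≤ C := by
    intro h p
    have h1 : ∀ σ : ℝ, ‖∫ τ in (0 : ℝ)..1, ∫ ξ,
        osc h (mixedPhase S (p, ξ) + τ * (mixedW S (p, ξ) ^ 2 * (σ * g (p, ξ)))) *
        γ₂ (((p, σ), τ), ξ)‖ ≤ C := by
      intro σ
      have h2 := intervalIntegral.norm_integral_le_of_norm_le_const (a := (0 : ℝ)) (b := 1)
        (C := C) (f := fun τ => ∫ ξ,
        osc h (mixedPhase S (p, ξ) + τ * (mixedW S (p, ξ) ^ 2 * (σ * g (p, ξ)))) *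
        γ₂ (((p, σ), τ), ξ)) fun τ _ => (norm_integral_osc_le (c := γ₂)
          (fun Z => mixedPhase S (Z.1.1.1, Z.2) + Z.1.2 * (mixedW S (Z.1.1.1, Z.2) ^ 2 *
            (Z.1.1.2 * g (Z.1.1.1, Z.2)))) h ((p, σ), τ)).trans (hC ((p, σ), τ))
      simpa using h2
    have h2 := intervalIntegral.norm_integral_le_of_norm_le_const (a := (0 : ℝ)) (b := 1)
      fun σ _ => h1 σ
    simpa using h2
  have hcont : ∀ h, Continuous fun Z : Plane × ℝ => ∫ ξ, osc h (mixedPhase S (Z.1, ξ)) *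
      β' (Z, ξ) := fun h =>
    (hβ'.osc_mul hΩ (φ := fun Z => mixedPhase S (Z.1.1, Z.2)) (hφ.comp hpr).contDiffOn
      h).continuous_integral
  have hcont1 : ∀ h, Continuous fun Z : Plane × ℝ => ∫ ξ, osc h (mixedPhase S (Z.1, ξ) +
      Z.2 * (mixedW S (Z.1, ξ) ^ 2 * g (Z.1, ξ))) * γ (Z, ξ) := fun h =>
    (hγ.osc_mul hΩ (φ := fun Z => mixedPhase S (Z.1.1, Z.2) +
      Z.1.2 * (mixedW S (Z.1.1, Z.2) ^ 2 * g (Z.1.1, Z.2))) ((hφ.comp hpr).add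
        (hmid.mul (((hw.comp hpr).pow 2).mul (hg.comp hpr)))).contDiffOn h).continuous_integral
  have hγβ : ∀ Z, γ Z = (Real.sqrt (M Z) : ℂ) * β' Z := by
    intro Z
    by_cases hZ : Z ∈ Ω
    · have : (Real.sqrt (M Z) : ℂ) ≠ 0 := by
        exact_mod_cast (Real.sqrt_pos.2 (hMpos Z hZ)).ne'
      simp only [hβ'def]
      push_cast
      field_simp
    · simp [hβ'def, hγ.eq_zero hZ]
  have step : ∀ h, 0 < h → ∀ p σ, ∫ ξ, osc h (mixedPhase S (p, ξ) +
      σ * (mixedW S (p, ξ) ^ 2 * g (p, ξ))) * γ ((p, σ), ξ) =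
      (∫ ξ, osc h (mixedPhase S (p, ξ)) * β' ((p, σ), ξ)) + h * ∫ τ in (0 : ℝ)..1, ∫ ξ,
      osc h (mixedPhase S (p, ξ) + τ * (mixedW S (p, ξ) ^ 2 * (σ * g (p, ξ)))) *
        γ₂ (((p, σ), τ), ξ) := by
    intro h hh p σ
    have h1 := hγ₂eq (p, σ) h hh.ne'
    simp only [Real.sqrt_one, Complex.ofReal_one, one_mul, fderiv_comp_mid hw,
      fderiv_mul_mid hg] at h1
    rw [← h1, add_sub_cancel]
    congr 1
    ext ξ
    rw [hγβ]
    have h2 : M ((p, σ), ξ) = 1 + (2 * fderiv ℝ (mixedW S) (p, ξ) (0, 1) * (σ * g (p, ξ)) +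
        mixedW S (p, ξ) * (σ * fderiv ℝ g (p, ξ) (0, 1))) := by
      simp only [hMdef, hm']
      ring
    rw [h2]
    congr 2
    ring
  -- One factor h with an integral bounded in L², plus h² with a bounded function.
  have hmain : ∀ h, 0 < h → ∀ p,
      oscInt (fun z => mixedPhase S z + mixedW S z ^ 2 * g z) (fun z =>
        (Real.sqrt (1 + m' z) : ℂ) * β z) h p - oscInt (mixedPhase S) β h p =
      1 * h * oscInt (mixedPhase S) b h p + amp h * h ^ 2 * E h p := by
    intro h hh p
    have h1 := hγeq p h hh.ne'
    simp only [Real.sqrt_one, Complex.ofReal_one, one_mul] at h1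
    have hI1 : IntervalIntegrable (fun σ => ∫ ξ, osc h (mixedPhase S (p, ξ)) * β' ((p, σ), ξ))
        volume 0 1 := ((hcont h).comp (Continuous.prodMk_right p)).intervalIntegrable _ _
    have hI2 : IntervalIntegrable (fun σ => (h : ℂ) * ∫ τ in (0 : ℝ)..1, ∫ ξ,
        osc h (mixedPhase S (p, ξ) + τ * (mixedW S (p, ξ) ^ 2 * (σ * g (p, ξ)))) *
        γ₂ (((p, σ), τ), ξ)) volume 0 1 := by
      have h3 := ((hcont1 h).comp (Continuous.prodMk_right p)).sub
        ((hcont h).comp (Continuous.prodMk_right p))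
      refine (h3.intervalIntegrable 0 1).congr fun σ _ => ?_
      rw [Pi.sub_apply, Function.comp_apply, Function.comp_apply, step h hh p σ,
        add_sub_cancel_left]
    simp only [step h hh p] at h1
    rw [intervalIntegral.integral_add hI1 hI2, intervalIntegral.integral_const_mul] at h1
    have hswap : ∫ σ in (0 : ℝ)..1, ∫ ξ, osc h (mixedPhase S (p, ξ)) * β' ((p, σ), ξ) =
        ∫ ξ, osc h (mixedPhase S (p, ξ)) * b (p, ξ) := by
      have hT : TestFun univ (fun x : ℝ × ℝ => osc h (mixedPhase S (p, x.2)) *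
          β' ((p, x.1), x.2)) := by
        refine ⟨((contDiff_osc h).comp (hφ.comp (by fun_prop))).mul
          (hβ'.smooth.comp (by fun_prop)), ?_, subset_univ _⟩
        refine HasCompactSupport.intro (hβ'.compact.isCompact.image
          (by fun_prop : Continuous fun Z : (Plane × ℝ) × ℝ => (Z.1.2, Z.2))) fun x hx => ?_
        by_contra hne
        exact hx ⟨((p, x.1), x.2), subset_tsupport _ (right_ne_zero_of_mul hne), rfl⟩
      rw [← integral_intervalIntegral_swap hT.smooth.continuous hT.compact]
      congr 1
      ext ξ
      simp only [hbdef, intervalIntegral.integral_const_mul]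
    rw [hswap] at h1
    simp only [oscInt]
    rw [← mul_sub, hm', h1]
    simp only [hEdef]
    ring
  have hs1 := (bddL2_oscInt_mixedPhase hS hb).smul_h 1
  have hcu := fun h => continuous_oscInt isOpen_univ hφ.contDiffOn hb h
  have hsq : ContDiffOn ℝ ∞ (fun z => Real.sqrt (1 + m' z)) U :=
    (contDiff_const.add hm's).contDiffOn.sqrt fun z hz => by
      have := hM z hz 1 ⟨by linarith, by linarith⟩
      rw [one_mul] at this
      exact this.ne'
  have hβ1 := hβ.mul_realOn hU hsq
  have hφ1 : ContDiff ℝ ∞ (fun z => mixedPhase S z + mixedW S z ^ 2 * g z) :=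
    hφ.add ((hw.pow 2).mul hg)
  have hcE : ∀ h, 0 < h → Continuous fun p => amp h * h ^ 2 * E h p := by
    intro h hh
    have h3 : (fun p => amp h * (h : ℂ) ^ 2 * E h p) = fun p =>
        (oscInt (fun z => mixedPhase S z + mixedW S z ^ 2 * g z) (fun z =>
        (Real.sqrt (1 + m' z) : ℂ) * β z) h p - oscInt (mixedPhase S) β h p) -
        1 * h * oscInt (mixedPhase S) b h p := by
      ext p
      rw [hmain h hh p]
      ring
    rw [h3]
    exact ((continuous_oscInt hU hφ1.contDiffOn hβ1 h).sub
      (continuous_oscInt hU hφ.contDiffOn hβ h)).sub (continuous_const.mul (hcu h))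
  have hs2 : SmallL2 fun h p => amp h * h ^ 2 * E h p := by
    refine SmallL2.of_bound (hγ₂.compact.isCompact.image
      (by fun_prop : Continuous fun Z : ((Plane × ℝ) × ℝ) × ℝ => Z.1.1.1)) (C := C)
      (fun h hh hh1 p => ?_) fun h hh p hp => ?_
    · rw [norm_mul, norm_mul, norm_pow, Complex.norm_real, Real.norm_of_nonneg hh.le]
      calc ‖amp h‖ * h ^ 2 * ‖E h p‖ = (‖amp h‖ * h) * (h * ‖E h p‖) := by ring
        _ ≤ 1 * (h * C) := by
          gcongr
          · exact norm_amp_mul_le hh hh1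
          · exact hEle h p
        _ = C * h := by ring
    · have : ∀ σ τ ξ, γ₂ (((p, σ), τ), ξ) = 0 := fun σ τ ξ => by
        by_contra hne
        exact hp ⟨(((p, σ), τ), ξ), subset_tsupport _ hne, rfl⟩
      simp [hEdef, this]
  exact (hs1.add hs2 (fun h _ => continuous_const.mul (hcu h)) hcE).congr hmain

/-- Near a point of the critical set, a phase function with the same critical values and the
same `x`-derivatives as `S(s, η) + ηx` on the critical set of the latter may be replaced by it. -/
theorem exists_mixed_amplitude (hS : ContDiff ℝ ∞ S) {φ : Plane × ℝ → ℝ} (hφ : ContDiff ℝ ∞ φ)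
    {q₀ : Plane} (hcrit : ∀ᶠ q in 𝓝 q₀, φ (critPt S q) = mixedPhase S (critPt S q) ∧
      fderiv ℝ φ (critPt S q) ((0, 1), 0) = q.2)
    (hpos : 0 < fderiv ℝ (fun z => fderiv ℝ φ z (0, 1)) (critPt S q₀) ((0, 1), 0)) :
    ∃ U : Set (Plane × ℝ), IsOpen U ∧ critPt S q₀ ∈ U ∧
      (∀ q, critPt S q ∈ U →
        0 < fderiv ℝ (fun z => fderiv ℝ φ z (0, 1)) (critPt S q) ((0, 1), 0)) ∧
      ∀ a, TestFun U a → ∃ b, TestFun U b ∧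
        (∀ q, critPt S q ∈ U → a (critPt S q) = (Real.sqrt
          (fderiv ℝ (fun z => fderiv ℝ φ z (0, 1)) (critPt S q) ((0, 1), 0)) : ℂ) *
            b (critPt S q)) ∧
        Asymp (oscInt φ a) (oscInt (mixedPhase S) b) := by
  have hφ0 := contDiff_mixedPhase hS
  have hw := contDiff_mixedW hS
  have hSe := contDiff_dEta hS
  -- The difference of the phases in the coordinates (s, η, t) with t = w. For (s, η) near `q₀` it
  -- vanishes at t = 0 together with its t-derivative, hence is w²g.
  set f : Plane × ℝ → ℝ := fun y => φ ((y.1.1, y.2 - dEta S y.1), y.1.2) -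
    mixedPhase S ((y.1.1, y.2 - dEta S y.1), y.1.2) with hf
  have hsh : ContDiff ℝ ∞ (fun y : Plane × ℝ => (((y.1.1, y.2 - dEta S y.1), y.1.2) : Plane × ℝ)) :=
    by fun_prop
  have hfs : ContDiff ℝ ∞ f := (hφ.comp hsh).sub (hφ0.comp hsh)
  obtain ⟨G, hG, hGf⟩ := exists_smooth_div_sq hfs
  set g : Plane × ℝ → ℝ := fun z => G ((z.1.1, z.2), mixedW S z) with hgdef
  have hg : ContDiff ℝ ∞ g := hG.comp ((by fun_prop :
    ContDiff ℝ ∞ fun z : Plane × ℝ => (z.1.1, z.2)).prodMk hw)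
  -- the derivative in `x`
  have hdx : ∀ {ψ : Plane × ℝ → ℝ}, ContDiff ℝ ∞ ψ → ∀ s x η,
      HasDerivAt (fun t => ψ ((s, x + t), η)) (fderiv ℝ ψ ((s, x), η) ((0, 1), 0)) 0 := by
    intro ψ hψ s x η
    have d1 : HasDerivAt (fun t : ℝ => (((s, x + t), η) : Plane × ℝ)) (((0 : ℝ), (1 : ℝ)), (0 : ℝ)) 0 :=
      ((hasDerivAt_const (0 : ℝ) s).prodMk ((hasDerivAt_id (0 : ℝ)).const_add x)).prodMk
        (hasDerivAt_const (0 : ℝ) η)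
    have d2 : HasFDerivAt ψ (fderiv ℝ ψ ((s, x), η)) ((s, x + 0), η) := by
      rw [add_zero]
      exact (hψ.differentiable (by simp)).differentiableAt.hasFDerivAt
    exact d2.comp_hasDerivAt 0 d1
  have hf0 : ∀ q, φ (critPt S q) = mixedPhase S (critPt S q) →
      fderiv ℝ φ (critPt S q) ((0, 1), 0) = q.2 → f (q, 0) = 0 ∧ fderiv ℝ f (q, 0) (0, 1) = 0 := by
    intro q h1 h2
    refine ⟨by simp only [hf, zero_sub]; exact sub_eq_zero.2 h1, ?_⟩
    have d1 := hasDerivAt_slice (p := q) (t := 0) (hfs.differentiable (by simp)).differentiableAt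
    have d2 := hdx hφ q.1 (-dEta S q) q.2
    have d3 : HasDerivAt (fun t => mixedPhase S ((q.1, -dEta S q + t), q.2)) (q.2 * 1) 0 :=
      (((hasDerivAt_id (0 : ℝ)).const_add (-dEta S q)).const_mul q.2).const_add (S (q.1, q.2))
    have d4 : HasDerivAt (fun t => f (q, t)) (q.2 - q.2 * 1) 0 := by
      have h3 : fderiv ℝ φ ((q.1, -dEta S q), q.2) ((0, 1), 0) = q.2 := h2
      rw [h3] at d2
      refine (d2.sub d3).congr_of_eventuallyEq (Eventually.of_forall fun t => ?_)
      simp only [hf, Pi.sub_apply]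
      rw [show t - dEta S q = -dEta S q + t by ring]
    rw [d1.unique d4]
    ring
  have hq : ContinuousAt (fun z : Plane × ℝ => (z.1.1, z.2)) (critPt S q₀) := by fun_prop
  have hev : ∀ᶠ z in 𝓝 (critPt S q₀), φ z = mixedPhase S z + mixedW S z ^ 2 * g z := by
    have h1 : Tendsto (fun z : Plane × ℝ => (z.1.1, z.2)) (𝓝 (critPt S q₀)) (𝓝 q₀) := hq
    filter_upwards [h1.eventually hcrit] with z hz
    obtain ⟨⟨s, x⟩, η⟩ := z
    obtain ⟨h2, h3⟩ := hf0 _ hz.1 hz.2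
    have h4 := hGf (s, η) (mixedW S ((s, x), η))
    rw [h2, h3] at h4
    simp only [hf, smul_eq_mul, mul_zero, zero_add] at h4
    have h5 : mixedW S ((s, x), η) - dEta S (s, η) = x := by simp [mixedW]
    rw [h5] at h4
    rw [hgdef]
    linarith
  obtain ⟨U₁, hU₁sub, hU₁, hU₁mem⟩ := eventually_nhds_iff.1 hev
  set m' : Plane × ℝ → ℝ := fun z => 2 * fderiv ℝ (mixedW S) z (0, 1) * g z +
      mixedW S z * fderiv ℝ g z (0, 1) with hm'
  have hm's : ContDiff ℝ ∞ m' := (((contDiff_const.mul ((hw.fderiv_right (m := ∞)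
    (by simp)).clm_apply contDiff_const)).mul hg)).add (hw.mul ((hg.fderiv_right (m := ∞)
    (by simp)).clm_apply contDiff_const))
  have hφη : ContDiff ℝ ∞ (fun z => fderiv ℝ φ z (0, 1)) :=
    (hφ.fderiv_right (m := ∞) (by simp)).clm_apply contDiff_const
  have hφd : ∀ z ∈ U₁, fderiv ℝ φ z (0, 1) = mixedW S z * (1 + m' z) := by
    rintro ⟨p, t⟩ hz
    have d1 := hasDerivAt_slice (p := p) (t := t) (hφ.differentiable (by simp)).differentiableAt
    have d2 := hasDerivAt_slice (p := p) (t := t) (hφ0.differentiable (by simp)).differentiableAt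
    have d3 := hasDerivAt_slice (p := p) (t := t) (hw.differentiable (by simp)).differentiableAt
    have d4 := hasDerivAt_slice (p := p) (t := t) (hg.differentiable (by simp)).differentiableAt
    rw [fderiv_mixedPhase hS] at d2
    have d5 := d2.add ((d3.pow 2).mul d4)
    have heq : (fun t => φ (p, t)) =ᶠ[𝓝 t] ((fun t => mixedPhase S (p, t)) +
        ((fun t => mixedW S (p, t)) ^ 2 * fun t => g (p, t))) := by
      have hc : Continuous fun t : ℝ => (p, t) := by fun_prop
      filter_upwards [hc.continuousAt.preimage_mem_nhds (hU₁.mem_nhds hz)] with u hu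
      exact hU₁sub _ hu
    rw [d1.unique (d5.congr_of_eventuallyEq heq)]
    simp only [hm', Pi.pow_apply]
    simp
    ring
  -- From φ_η = w(1 + m') and w_x = 1: where w = 0, the mixed derivative of φ is 1 + m', the very
  -- factor whose root the deformation attaches to the amplitude.
  have hm1 : ∀ q, critPt S q ∈ U₁ →
      fderiv ℝ (fun z => fderiv ℝ φ z (0, 1)) (critPt S q) ((0, 1), 0) = 1 + m' (critPt S q) := by
    intro q hqU
    have d1 := hdx hφη q.1 (-dEta S q) q.2
    have d2 := hdx hm's q.1 (-dEta S q) q.2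
    have d3 : HasDerivAt (fun t => mixedW S ((q.1, -dEta S q + t), q.2)) 1 0 :=
      ((hasDerivAt_id (0 : ℝ)).const_add (-dEta S q)).add_const (dEta S (q.1, q.2))
    have d4 := d3.mul (d2.const_add 1)
    have heq : (fun t => fderiv ℝ φ ((q.1, -dEta S q + t), q.2) (0, 1)) =ᶠ[𝓝 0]
        ((fun t => mixedW S ((q.1, -dEta S q + t), q.2)) *
          fun t => 1 + m' ((q.1, -dEta S q + t), q.2)) := by
      have hc : Continuous fun t : ℝ => (((q.1, -dEta S q + t), q.2) : Plane × ℝ) := by fun_prop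
      have h0 : (((q.1, -dEta S q + 0), q.2) : Plane × ℝ) ∈ U₁ := by
        rw [add_zero]
        exact hqU
      filter_upwards [hc.continuousAt.preimage_mem_nhds (hU₁.mem_nhds h0)] with u hu
      exact hφd _ hu
    have h5 := d1.unique (d4.congr_of_eventuallyEq heq)
    have h6 : mixedW S ((q.1, -dEta S q + 0), q.2) = 0 := by simp [mixedW]
    rw [h6] at h5
    simp only [add_zero, one_mul, zero_mul] at h5
    exact h5
  have hk := hpos
  rw [hm1 q₀ hU₁mem] at hk
  set k := 1 + m' (critPt S q₀) with hkdef
  set L₀ := |m' (critPt S q₀)| + 1 with hL₀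
  have hL0 : 0 < L₀ := by positivity
  set c := min 1 (k / 2) with hc
  have hc0 : 0 < c := lt_min one_pos (by positivity)
  have hcont := hm's.continuous
  -- These bounds keep 1 + σm' positive for σ in a neighbourhood of [0, 1].
  set U := U₁ ∩ {z | k / 2 - 1 < m' z ∧ |m' z| < L₀} with hUdef
  have hUo : IsOpen U := hU₁.inter ((isOpen_lt continuous_const hcont).inter
    (isOpen_lt hcont.abs continuous_const))
  have hMU : ∀ z ∈ U, ∀ σ ∈ Ioo (-(c / (2 * L₀))) (1 + c / (2 * L₀)), 0 < 1 + σ * m' z :=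
    fun z hz σ hσ => homotopy_factor_pos hk hc hL0 hz.2.1 hz.2.2.le rfl hσ
  have hδ : 0 < c / (2 * L₀) := by positivity
  have hM1 : ∀ z ∈ U, 0 < 1 + m' z := fun z hz => by
    have := hMU z hz 1 ⟨by linarith, by linarith⟩
    rwa [one_mul] at this
  refine ⟨U, hUo, ⟨hU₁mem, by linarith, by linarith⟩, fun q hqU => ?_, fun a ha => ?_⟩
  · rw [hm1 q hqU.1]
    exact hM1 _ hqU
  · have hsq : ContDiffOn ℝ ∞ (fun z => Real.sqrt (1 + m' z)) U :=
      (contDiff_const.add hm's).contDiffOn.sqrt fun z hz => (hM1 z hz).ne'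
    have hb : TestFun U fun z => (((Real.sqrt (1 + m' z))⁻¹ : ℝ) : ℂ) * a z :=
      ha.mul_realOn hUo (hsq.inv fun z hz => (Real.sqrt_pos.2 (hM1 z hz)).ne')
    have hab : ∀ z, a z = (Real.sqrt (1 + m' z) : ℂ) *
        ((((Real.sqrt (1 + m' z))⁻¹ : ℝ) : ℂ) * a z) := by
      intro z
      by_cases hz : z ∈ U
      · have : (Real.sqrt (1 + m' z) : ℂ) ≠ 0 := by
          exact_mod_cast (Real.sqrt_pos.2 (hM1 z hz)).ne'
        push_cast
        field_simp
      · simp [ha.eq_zero hz]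
    refine ⟨_, hb, fun q hqU => ?_, ?_⟩
    · rw [hm1 q hqU.1]
      exact hab _
    · refine ⟨fun h _ => continuous_oscInt hUo hφ.contDiffOn ha h,
        fun h _ => continuous_oscInt hUo hφ0.contDiffOn hb h, ?_⟩
      refine (smallL2_homotopy hS hg hUo hδ hMU hb).congr fun h _ p => ?_
      have h1 : oscInt φ a = oscInt (fun z => mixedPhase S z + mixedW S z ^ 2 * g z) a :=
        oscInt_congr fun z hz => hU₁sub z (ha.subset (subset_tsupport _ hz)).1
      have h2 : a = fun z => (Real.sqrt (1 + m' z) : ℂ) *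
        ((((Real.sqrt (1 + m' z))⁻¹ : ℝ) : ℂ) * a z) := funext hab
      have h3 : oscInt (fun z => mixedPhase S z + mixedW S z ^ 2 * g z) (fun z =>
          (Real.sqrt (1 + m' z) : ℂ) * ((((Real.sqrt (1 + m' z))⁻¹ : ℝ) : ℂ) * a z)) h p =
          oscInt φ a h p := by rw [← h2, h1]
      rw [← h3]

end LocalReduction

end

/-! ### The quadratic phase with a uniform error bound. -/

section

section Gaussian

/-- The derivative in the last variable. -/
def dLast {P F : Type*} [NormedAddCommGroup P] [NormedSpace ℝ P] [NormedAddCommGroup F]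
    [NormedSpace ℝ F] (f : P × ℝ → F) (z : P × ℝ) : F := fderiv ℝ f z (0, 1)

theorem contDiff_dLast {P F : Type*} [NormedAddCommGroup P] [NormedSpace ℝ P]
    [NormedAddCommGroup F] [NormedSpace ℝ F] {f : P × ℝ → F} (hf : ContDiff ℝ ∞ f) :
    ContDiff ℝ ∞ (dLast f) :=
  (hf.fderiv_right (m := ∞) (by simp)).clm_apply contDiff_const

theorem contDiff_iterate_dLast {P F : Type*} [NormedAddCommGroup P] [NormedSpace ℝ P]
    [NormedAddCommGroup F] [NormedSpace ℝ F] {f : P × ℝ → F} (hf : ContDiff ℝ ∞ f) (k : ℕ) :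
    ContDiff ℝ ∞ (dLast^[k] f) := by
  induction k with
  | zero => exact hf
  | succ k ih =>
    rw [Function.iterate_succ_apply']
    exact contDiff_dLast ih

/-- Every derivative in the last variable brings one more factor r; since r ≤ 1, these weights are
harmless in estimates. -/
theorem dLast_unitIntegral {P F : Type} [NormedAddCommGroup P] [NormedSpace ℝ P] [ProperSpace P]
    [NormedAddCommGroup F] [NormedSpace ℝ F] [CompleteSpace F] {f : P × ℝ → F}
    (hf : ContDiff ℝ ∞ f) (k : ℕ) :
    dLast (fun z : P × ℝ => ∫ r in (0 : ℝ)..1, r ^ k • f (z.1, r * z.2)) =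
      fun z : P × ℝ => ∫ r in (0 : ℝ)..1, r ^ (k + 1) • dLast f (z.1, r * z.2) := by
  ext z
  set F' : (P × ℝ) × ℝ → F := fun y => y.2 ^ k • f (y.1.1, y.2 * y.1.2) with hF'
  have hF's : ContDiff ℝ ∞ F' := by
    refine ContDiff.smul (by fun_prop) (hf.comp (by fun_prop))
  have h1 := hasFDerivAt_unitIntegral (hF's.of_le (by simp)) z
  have h2 : ∀ r : ℝ, fderiv ℝ F' (z, r) ((0, 1), 0) = r ^ (k + 1) • dLast f (z.1, r * z.2) := by
    intro r
    have d1 : HasDerivAt (fun t : ℝ => (((z.1, t), r) : (P × ℝ) × ℝ)) (((0 : P), (1 : ℝ)), (0 : ℝ)) z.2 :=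
      ((hasDerivAt_const _ _).prodMk (hasDerivAt_id _)).prodMk (hasDerivAt_const _ _)
    have d2 : HasDerivAt (fun t : ℝ => F' ((z.1, t), r)) (fderiv ℝ F' (z, r) ((0, 1), 0)) z.2 :=
      (hF's.differentiable (by simp)).differentiableAt.hasFDerivAt.comp_hasDerivAt z.2 d1
    have d3 := (hasDerivAt_slice (p := z.1) (t := r * z.2)
      (hf.differentiable (by simp)).differentiableAt)
    have d4 : HasDerivAt (fun t : ℝ => r * t) r z.2 := by
      simpa using (hasDerivAt_id z.2).const_mul r
    have d5 := (d3.scomp z.2 d4).const_smul (r ^ k)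
    rw [d2.unique d5, smul_smul, pow_succ]
    rfl
  rw [dLast, h1.fderiv, ContinuousLinearMap.intervalIntegral_apply]
  · refine intervalIntegral.integral_congr fun r _ => ?_
    simp only [ContinuousLinearMap.comp_apply, ContinuousLinearMap.inl_apply]
    exact h2 r
  · exact (((hF's.continuous_fderiv (by simp)).clm_comp continuous_const).comp
      (by fun_prop : Continuous fun r : ℝ => (z, r))).intervalIntegrable _ _

/-- Hadamard's lemma with bounds for the derivatives of the quotient. -/
theorem exists_smooth_div_bound {P F : Type} [NormedAddCommGroup P] [NormedSpace ℝ P]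
    [ProperSpace P] [NormedAddCommGroup F] [NormedSpace ℝ F] [CompleteSpace F] {f : P × ℝ → F}
    (hf : ContDiff ℝ ∞ f) :
    ∃ g : P × ℝ → F, ContDiff ℝ ∞ g ∧ (∀ p t, f (p, t) = f (p, 0) + t • g (p, t)) ∧
      ∀ (k : ℕ) (p : P) (C : ℝ), (∀ t, ‖dLast^[k + 1] f (p, t)‖ ≤ C) →
        ∀ t, ‖dLast^[k] g (p, t)‖ ≤ C := by
  set g : P × ℝ → F := fun z => ∫ r in (0 : ℝ)..1, r ^ 0 • dLast f (z.1, r * z.2) with hgdef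
  have hD := contDiff_dLast hf
  refine ⟨g, ?_, fun p t => ?_, fun k p C hC t => ?_⟩
  · exact contDiff_unitIntegral (f := fun q : (P × ℝ) × ℝ => q.2 ^ 0 • dLast f (q.1.1, q.2 * q.1.2))
      (ContDiff.smul (by fun_prop) (hD.comp (by fun_prop)))
  · have h1 : ∀ r ∈ uIcc (0 : ℝ) 1, HasDerivAt (fun r : ℝ => f (p, r * t))
        (t • dLast f (p, r * t)) r := fun r _ => by
      have h2 := hasDerivAt_slice (p := p) (t := r * t)
        (hf.differentiable (by simp)).differentiableAt
      have h3 : HasDerivAt (fun r : ℝ => r * t) t r := by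
        simpa using (hasDerivAt_id r).mul_const t
      exact h2.scomp r h3
    have h4 := intervalIntegral.integral_eq_sub_of_hasDerivAt h1
      (((hD.continuous.comp (by fun_prop : Continuous fun r : ℝ => (p, r * t))).const_smul
        t).intervalIntegrable 0 1)
    rw [intervalIntegral.integral_smul] at h4
    simp only [hgdef, pow_zero, one_smul, h4, one_mul, zero_mul]
    abel
  · have h1 : ∀ k : ℕ, dLast^[k] g = fun z : P × ℝ => ∫ r in (0 : ℝ)..1,
        r ^ k • dLast^[k + 1] f (z.1, r * z.2) := by
      intro k
      induction k with
      | zero => rfl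
      | succ k ih =>
        rw [Function.iterate_succ_apply', ih,
          dLast_unitIntegral (contDiff_iterate_dLast hf (k + 1)) k,
          Function.iterate_succ_apply' dLast (k + 1)]
    rw [h1]
    have h2 := intervalIntegral.norm_integral_le_of_norm_le_const (a := (0 : ℝ)) (b := 1) (C := C)
      (f := fun r => r ^ k • dLast^[k + 1] f (p, r * t)) fun r hr => by
        rw [uIoc_of_le zero_le_one] at hr
        rw [norm_smul, norm_pow, Real.norm_of_nonneg hr.1.le]
        have h3 : r ^ k ≤ 1 := pow_le_one₀ hr.1.le hr.2
        calc r ^ k * ‖dLast^[k + 1] f (p, r * t)‖ ≤ 1 * ‖dLast^[k + 1] f (p, r * t)‖ := by gcongr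
          _ ≤ C := by rw [one_mul]; exact hC _
    simpa using h2

theorem TestFun.iterate_dLast {P : Type*} [NormedAddCommGroup P] [NormedSpace ℝ P]
    {U : Set (P × ℝ)} {a : P × ℝ → ℂ} (ha : TestFun U a) (k : ℕ) : TestFun U (dLast^[k] a) := by
  induction k with
  | zero => exact ha
  | succ k ih =>
    rw [Function.iterate_succ_apply']
    exact ih.fderiv_apply _

theorem integrable_gaussian_mul {z : ℂ} (hz : 0 < z.re) {r : ℝ → ℂ} (hr : Continuous r) {C : ℝ}
    (hC : ∀ v, ‖r v‖ ≤ C) : Integrable fun v : ℝ => Complex.exp (-(z / 2) * v ^ 2) * r v := by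
  have h1 : 0 < (z / 2).re := by simpa using hz
  exact (integrable_cexp_neg_mul_sq h1).mul_bdd hr.aestronglyMeasurable
    (Eventually.of_forall hC)

/-- As v e^{−zv²/2} is −1/z times a derivative, a factor v is worth a factor 1/z. -/
theorem integral_gaussian_mul_self {z : ℂ} (hz : 0 < z.re) {r r' : ℝ → ℂ} {C : ℝ}
    (hr : ∀ v, HasDerivAt r (r' v) v) (hr' : Continuous r') (hC : ∀ v, ‖r v‖ ≤ C)
    (hC' : ∀ v, ‖r' v‖ ≤ C) :
    ∫ v : ℝ, Complex.exp (-(z / 2) * v ^ 2) * (v * r v) =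
      z⁻¹ * ∫ v : ℝ, Complex.exp (-(z / 2) * v ^ 2) * r' v := by
  have hz0 : z ≠ 0 := fun h => by simp [h] at hz
  have h1 : 0 < (z / 2).re := by simpa using hz
  have hrc : Continuous r := continuous_iff_continuousAt.2 fun v => (hr v).continuousAt
  have i1 := integrable_gaussian_mul hz hrc hC
  have i2 := integrable_gaussian_mul hz hr' hC'
  have i3 : Integrable fun v : ℝ => Complex.exp (-(z / 2) * v ^ 2) * (v * r v) := by
    have := (integrable_mul_cexp_neg_mul_sq h1).mul_bdd hrc.aestronglyMeasurable
      (Eventually.of_forall hC)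
    refine this.congr (Eventually.of_forall fun v => ?_)
    simp only
    ring
  have hd : ∀ v : ℝ, HasDerivAt (fun v : ℝ => Complex.exp (-(z / 2) * v ^ 2) * r v)
      (-z * (Complex.exp (-(z / 2) * v ^ 2) * (v * r v)) +
        Complex.exp (-(z / 2) * v ^ 2) * r' v) v := by
    intro v
    have d1 : HasDerivAt (fun v : ℝ => (v : ℂ)) 1 v := Complex.ofRealCLM.hasDerivAt
    have d2 := (((d1.pow 2).const_mul (-(z / 2))).cexp).mul (hr v)
    refine d2.congr_deriv ?_
    simp only [Pi.pow_apply]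
    push_cast
    ring
  have h2 := integral_eq_zero_of_hasDerivAt_of_integrable hd ((i3.const_mul _).add i2) i1
  rw [integral_add (i3.const_mul _) i2, integral_const_mul] at h2
  have h3 : z * ∫ v : ℝ, Complex.exp (-(z / 2) * v ^ 2) * (v * r v) =
      ∫ v : ℝ, Complex.exp (-(z / 2) * v ^ 2) * r' v := by linear_combination -h2
  rw [← h3, inv_mul_cancel_left₀ hz0]

/-- The principal root halves an argument from (−π, π]. -/
theorem re_cpow_half_nonneg (z : ℂ) : 0 ≤ (z ^ ((1 : ℂ) / 2)).re := by
  by_cases hz : z = 0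
  · simp [hz]
  · rw [Complex.cpow_def_of_ne_zero hz, Complex.exp_re]
    refine mul_nonneg (Real.exp_pos _).le (Real.cos_nonneg_of_mem_Icc ?_)
    have h1 : (Complex.log z * (1 / 2)).im = z.arg / 2 := by
      simp [Complex.log_im]
      ring
    rw [h1]
    constructor <;> linarith [Complex.neg_pi_lt_arg z, Complex.arg_le_pi z]

/-- The normalized Gaussian integral. -/
theorem norm_amp_gaussian_sub_le {h σ : ℝ} (hh : 0 < h) (hσ : σ ^ 2 = 1) :
    ‖amp h * (∫ v : ℝ, Complex.exp (-((1 + Complex.I * σ / h) / 2) * v ^ 2)) -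
      Complex.exp (Complex.I * Real.pi * (1 - σ) / 4)‖ ≤ 2 * h := by
  have hhc : (h : ℂ) ≠ 0 := by exact_mod_cast hh.ne'
  have hσc : (σ : ℂ) ^ 2 = 1 := by exact_mod_cast hσ
  have hσ0 : (σ : ℂ) ≠ 0 := fun h0 => by simp [h0] at hσc
  set d : ℂ := h + Complex.I * σ with hd
  have hd0 : d ≠ 0 := fun h0 => by
    have := congrArg Complex.re h0
    simp [hd] at this
    exact hh.ne' this
  have hdn : 1 ≤ ‖d‖ := by
    have h1 : |d.im| ≤ ‖d‖ := Complex.abs_im_le_norm d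
    have h2 : d.im = σ := by simp [hd]
    rw [h2] at h1
    have : |σ| = 1 := by
      rw [← sq_eq_sq₀ (abs_nonneg _) zero_le_one, sq_abs, hσ, one_pow]
    rwa [this] at h1
  have hre : 0 < ((1 + Complex.I * σ / h) / 2 : ℂ).re := by
    have : (Complex.I * σ / h : ℂ) = ((σ / h : ℝ) : ℂ) * Complex.I := by push_cast; ring
    rw [this]
    simp
  rw [integral_gaussian_complex hre]
  have h1 : (Real.pi : ℂ) / ((1 + Complex.I * σ / h) / 2) =
      ((2 * Real.pi * h : ℝ) : ℂ) * d⁻¹ := by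
    push_cast
    have h2 : (1 + Complex.I * σ / h : ℂ) = d / h := by
      rw [hd]
      field_simp
    rw [h2]
    field_simp
  have hp : 0 < 2 * Real.pi * h := by positivity
  have h2 : (((2 * Real.pi * h : ℝ) : ℂ) * d⁻¹) ^ ((1 : ℂ) / 2) =
      ((Real.sqrt (2 * Real.pi * h) : ℝ) : ℂ) * (d⁻¹) ^ ((1 : ℂ) / 2) := by
    rw [Complex.cpow_def_of_ne_zero (mul_ne_zero (by exact_mod_cast hp.ne') (inv_ne_zero hd0)),
      Complex.log_ofReal_mul hp (inv_ne_zero hd0), add_mul, Complex.exp_add,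
      Complex.cpow_def_of_ne_zero (inv_ne_zero hd0)]
    congr 1
    rw [Real.sqrt_eq_rpow, Real.rpow_def_of_pos hp, Complex.ofReal_exp]
    push_cast
    rfl
  set F : ℂ := (d⁻¹) ^ ((1 : ℂ) / 2) with hF
  set F₀ : ℂ := Complex.exp (-Complex.I * Real.pi * σ / 4) with hF₀
  have hFsq : F ^ 2 = d⁻¹ := by
    rw [hF, ← Complex.cpow_nat_mul]
    simp
  have hexp : ∀ s : ℝ, s ^ 2 = 1 → Complex.exp (-Complex.I * Real.pi * s / 4) ^ 2 = -Complex.I * s ∧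
      1 / 2 ≤ (Complex.exp (-Complex.I * Real.pi * s / 4)).re := by
    intro s hs
    have hs' : s = 1 ∨ s = -1 := by
      have h0 : (s - 1) * (s + 1) = 0 := by linear_combination hs
      rcases mul_eq_zero.1 h0 with h1 | h1
      · left; linarith
      · right; linarith
    have hre : (Complex.exp (-Complex.I * Real.pi * s / 4)).re = Real.cos (Real.pi / 4) := by
      have : -Complex.I * Real.pi * s / 4 = ((-(Real.pi * s / 4) : ℝ) : ℂ) * Complex.I := by
        push_cast
        ring
      rw [this, Complex.exp_ofReal_mul_I_re, Real.cos_neg]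
      rcases hs' with rfl | rfl
      · rw [mul_one]
      · rw [mul_neg, mul_one, neg_div, Real.cos_neg]
    constructor
    · rw [← Complex.exp_nat_mul]
      rcases hs' with rfl | rfl
      · have : ((2 : ℕ) : ℂ) * (-Complex.I * Real.pi * ((1 : ℝ) : ℂ) / 4) =
          -(Real.pi / 2 * Complex.I) := by push_cast; ring
        rw [this, Complex.exp_neg, Complex.exp_pi_div_two_mul_I]
        simp
      · have : ((2 : ℕ) : ℂ) * (-Complex.I * Real.pi * ((-1 : ℝ) : ℂ) / 4) =
          (Real.pi / 2 * Complex.I) := by push_cast; ring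
        rw [this, Complex.exp_pi_div_two_mul_I]
        simp
    · rw [hre, Real.cos_pi_div_four]
      have : (1 : ℝ) ≤ Real.sqrt 2 := Real.one_le_sqrt.2 (by norm_num)
      linarith
  obtain ⟨hF₀sq, hF₀re⟩ := hexp σ hσ
  -- Two square roots are compared through the difference of their squares. F has nonnegative real
  -- part and F₀ real part at least 1/2, so the sum can be divided out.
  have hsum : 1 / 2 ≤ ‖F + F₀‖ := by
    refine le_trans ?_ (Complex.re_le_norm _)
    rw [Complex.add_re]
    linarith [re_cpow_half_nonneg d⁻¹]
  have hprod : (F - F₀) * (F + F₀) = Complex.I * σ * h * d⁻¹ := by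
    have h3 : (F - F₀) * (F + F₀) = F ^ 2 - F₀ ^ 2 := by ring
    rw [h3, hFsq, hF₀sq]
    field_simp
    rw [hd]
    have : (Complex.I * σ) * (Complex.I * σ) = -1 := by
      rw [← sq, mul_pow, Complex.I_sq, hσc]
      ring
    linear_combination this
  have hdiff : ‖F - F₀‖ ≤ 2 * h := by
    have h3 : ‖F - F₀‖ * ‖F + F₀‖ ≤ h := by
      rw [← norm_mul, hprod, norm_mul, norm_mul, norm_mul, Complex.norm_I, Complex.norm_real,
        Complex.norm_real, norm_inv, Real.norm_of_nonneg hh.le]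
      have h4 : ‖σ‖ = 1 := by
        rw [Real.norm_eq_abs, ← sq_eq_sq₀ (abs_nonneg _) zero_le_one, sq_abs, hσ, one_pow]
      rw [h4, one_mul, one_mul]
      exact mul_le_of_le_one_right hh.le (inv_le_one_of_one_le₀ hdn)
    nlinarith [norm_nonneg (F - F₀)]
  have hfin : amp h * (Real.pi / ((1 + Complex.I * σ / h) / 2)) ^ ((1 : ℂ) / 2) -
      Complex.exp (Complex.I * Real.pi * (1 - σ) / 4) =
      Complex.exp (Complex.I * Real.pi / 4) * (F - F₀) := by
    have h3 : (((Real.sqrt (2 * Real.pi * h))⁻¹ : ℝ) : ℂ) * ((Real.sqrt (2 * Real.pi * h) : ℝ) : ℂ) = 1 := by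
      rw [← Complex.ofReal_mul, inv_mul_cancel₀ (Real.sqrt_pos.2 hp).ne', Complex.ofReal_one]
    have h4 : Complex.I * Real.pi / 4 + -Complex.I * Real.pi * σ / 4 =
      Complex.I * Real.pi * (1 - σ) / 4 := by ring
    have h5 : Complex.exp (Complex.I * Real.pi / 4) * F₀ =
        Complex.exp (Complex.I * Real.pi * (1 - σ) / 4) := by
      rw [hF₀, ← Complex.exp_add, h4]
    rw [h1, h2, amp_eq hh, ← h5]
    linear_combination (Complex.exp (Complex.I * Real.pi / 4) * F) * h3
  rw [hfin, norm_mul]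
  have : Complex.I * Real.pi / 4 = ((Real.pi / 4 : ℝ) : ℂ) * Complex.I := by push_cast; ring
  rw [this, Complex.norm_exp_ofReal_mul_I, one_mul]
  exact hdiff

/-- Stationary phase for the exact quadratic phase. -/
theorem exists_gaussian_bound {P : Type} [NormedAddCommGroup P] [NormedSpace ℝ P] [ProperSpace P]
    {B : P × ℝ → ℂ} (hB : TestFun univ B) {σ : ℝ} (hσ : σ ^ 2 = 1) :
    ∃ C : ℝ, 0 ≤ C ∧ ∀ h, 0 < h → h ≤ 1 → ∀ p,
      ‖amp h * (∫ v, osc h (-σ / 2 * v ^ 2) * B (p, v)) -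
        Complex.exp (Complex.I * Real.pi * (1 - σ) / 4) * B (p, 0)‖ ≤ C * h := by
  -- A factor e^{−v²/2} is split off the compactly supported amplitude. The weight becomes
  -- e^{−zv²/2} with Re z = 1 and |1/z| ≤ h, integrable against bounded functions, such as the
  -- quotients below, that need not have compact support.
  set A : P × ℝ → ℂ := fun z => (Real.exp (z.2 ^ 2 / 2) : ℂ) * B z with hA
  have hAt : TestFun univ A := hB.mul_real (by fun_prop)
  have hbd : ∀ k : ℕ, ∃ C, 0 ≤ C ∧ ∀ z, ‖dLast^[k] A z‖ ≤ C := fun k => by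
    obtain ⟨C, hC⟩ := (hAt.iterate_dLast k).exists_bound
    exact ⟨C, (norm_nonneg _).trans (hC 0), hC⟩
  obtain ⟨C0, hC00, hC0⟩ := hbd 0
  obtain ⟨C1, hC10, hC1⟩ := hbd 1
  obtain ⟨C2, hC20, hC2⟩ := hbd 2
  obtain ⟨C3, hC30, hC3⟩ := hbd 3
  obtain ⟨C4, hC40, hC4⟩ := hbd 4
  -- The quotients of the two successive divisions are controlled by the derivatives of `A` up to
  -- order four.
  obtain ⟨g, hg, hgA, hgb⟩ := exists_smooth_div_bound hAt.smooth
  obtain ⟨g₂, hg₂, hg₂g, hg₂b⟩ := exists_smooth_div_bound (contDiff_dLast hg)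
  have bg0 : ∀ z, ‖g z‖ ≤ C1 := fun z => hgb 0 z.1 C1 (fun t => hC1 _) z.2
  have bg1 : ∀ z, ‖dLast g z‖ ≤ C2 := fun z => hgb 1 z.1 C2 (fun t => hC2 _) z.2
  have bg2 : ∀ z, ‖dLast (dLast g) z‖ ≤ C3 := fun z => hgb 2 z.1 C3 (fun t => hC3 _) z.2
  have bg3 : ∀ z, ‖dLast (dLast (dLast g)) z‖ ≤ C4 := fun z => hgb 3 z.1 C4 (fun t => hC4 _) z.2
  have bh0 : ∀ z, ‖g₂ z‖ ≤ C3 := fun z => hg₂b 0 z.1 C3 (fun t => bg2 _) z.2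
  have bh1 : ∀ z, ‖dLast g₂ z‖ ≤ C4 := fun z => hg₂b 1 z.1 C4 (fun t => bg3 _) z.2
  set K : ℝ := ∫ v : ℝ, ‖Complex.exp (-(((1 : ℝ) : ℂ) / 2) * v ^ 2)‖ with hK
  have hK0 : 0 ≤ K := integral_nonneg fun v => norm_nonneg _
  refine ⟨C0 * 2 + C2 * 3 + C4 * K, by positivity, fun h hh hh1 p => ?_⟩
  have hhc : (h : ℂ) ≠ 0 := by exact_mod_cast hh.ne'
  set z : ℂ := 1 + Complex.I * σ / h with hz
  have hz' : z = 1 + ((σ / h : ℝ) : ℂ) * Complex.I := by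
    rw [hz]
    push_cast
    ring
  have hzre : z.re = 1 := by rw [hz']; simp
  have hzim : z.im = σ / h := by rw [hz']; simp
  have hzpos : 0 < z.re := by rw [hzre]; exact one_pos
  have hσabs : |σ| = 1 := by
    rw [← sq_eq_sq₀ (abs_nonneg _) zero_le_one, sq_abs, hσ, one_pow]
  have hzinv : ‖z⁻¹‖ ≤ h := by
    rw [norm_inv]
    have h1 : 1 / h ≤ ‖z‖ := by
      refine le_trans ?_ (Complex.abs_im_le_norm z)
      rw [hzim, abs_div, hσabs, abs_of_pos hh]
    calc ‖z‖⁻¹ ≤ (1 / h)⁻¹ := inv_anti₀ (by positivity) h1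
      _ = h := by rw [one_div, inv_inv]
  have hosc : ∀ v : ℝ, osc h (-σ / 2 * v ^ 2) * B (p, v) =
      Complex.exp (-(z / 2) * v ^ 2) * A (p, v) := by
    intro v
    simp only [hA, osc]
    rw [← mul_assoc, Complex.ofReal_exp, ← Complex.exp_add]
    congr 2
    rw [hz]
    push_cast
    field_simp
    ring
  have hzero : A (p, 0) = B (p, 0) := by simp [hA]
  set c : ℂ := ∫ v : ℝ, Complex.exp (-(z / 2) * v ^ 2) with hc
  have hint : Integrable fun v : ℝ => Complex.exp (-(z / 2) * v ^ 2) := by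
    simpa using integrable_gaussian_mul hzpos (r := fun _ => 1) continuous_const (C := 1) (by simp)
  have hsl : ∀ {f : P × ℝ → ℂ}, ContDiff ℝ ∞ f → ∀ v, HasDerivAt (fun v => f (p, v))
      (dLast f (p, v)) v := fun hf v =>
    hasDerivAt_slice (hf.differentiable (by simp)).differentiableAt
  have hcs : ∀ {f : P × ℝ → ℂ}, ContDiff ℝ ∞ f → Continuous fun v => f (p, v) := fun hf =>
    hf.continuous.comp (Continuous.prodMk_right p)
  have hsplit : ∀ {f f₁ : P × ℝ → ℂ} {D D₁ : ℝ}, ContDiff ℝ ∞ f → ContDiff ℝ ∞ f₁ →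
      (∀ p t, f (p, t) = f (p, 0) + t • f₁ (p, t)) → (∀ z, ‖f z‖ ≤ D) →
      (∀ z, ‖f₁ z‖ ≤ D₁) → (∃ D₂, ∀ z, ‖dLast f₁ z‖ ≤ D₂) →
      ∫ v : ℝ, Complex.exp (-(z / 2) * v ^ 2) * f (p, v) =
        c * f (p, 0) + z⁻¹ * ∫ v : ℝ, Complex.exp (-(z / 2) * v ^ 2) * dLast f₁ (p, v) := by
    intro f f₁ D D₁ hf hf₁ heq hD hD₁ ⟨D₂, hD₂⟩
    rw [← integral_gaussian_mul_self hzpos (C := max D₁ D₂) (hsl hf₁) (hcs (contDiff_dLast hf₁))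
      (fun v => (hD₁ _).trans (le_max_left _ _)) (fun v => (hD₂ _).trans (le_max_right _ _)), hc,
      ← integral_mul_const, ← integral_add (hint.mul_const _)]
    · refine integral_congr_ae (Eventually.of_forall fun v => ?_)
      simp only
      rw [heq p v, Complex.real_smul]
      ring
    · have h1 := (integrable_gaussian_mul hzpos (hcs hf) (fun v => hD (p, v))).sub
        (hint.mul_const (f (p, 0)))
      refine h1.congr (Eventually.of_forall fun v => ?_)
      simp only [Pi.sub_apply]
      rw [heq p v, Complex.real_smul]
      ring
  -- The leading value, a term of order 1/z, and a remainder of order 1/z², which outweighs the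
  -- normalization.
  have hJ : ∫ v, osc h (-σ / 2 * v ^ 2) * B (p, v) = c * B (p, 0) + z⁻¹ * (c * dLast g (p, 0) +
      z⁻¹ * ∫ v : ℝ, Complex.exp (-(z / 2) * v ^ 2) * dLast g₂ (p, v)) := by
    simp only [hosc]
    rw [hsplit hAt.smooth hg hgA hC0 bg0 ⟨C2, bg1⟩,
      hsplit (contDiff_dLast hg) hg₂ hg₂g bg1 bh0 ⟨C4, bh1⟩, hzero]
  have hlast : ‖∫ v : ℝ, Complex.exp (-(z / 2) * v ^ 2) * dLast g₂ (p, v)‖ ≤ C4 * K := by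
    refine (norm_integral_le_integral_norm _).trans ?_
    rw [hK, ← integral_const_mul]
    have hn : ∀ v : ℝ, ‖Complex.exp (-(z / 2) * v ^ 2)‖ =
        ‖Complex.exp (-(((1 : ℝ) : ℂ) / 2) * v ^ 2)‖ := by
      intro v
      rw [Complex.norm_exp, Complex.norm_exp]
      congr 1
      have : ((v : ℂ) ^ 2) = ((v ^ 2 : ℝ) : ℂ) := by push_cast; ring
      rw [this, Complex.re_mul_ofReal, Complex.re_mul_ofReal]
      congr 1
      simp [hzre]
    have hi2 : Integrable fun v : ℝ => ‖Complex.exp (-(((1 : ℝ) : ℂ) / 2) * v ^ 2)‖ := by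
      simp only [← hn]
      exact hint.norm
    refine integral_mono (integrable_gaussian_mul hzpos (hcs (contDiff_dLast hg₂))
      (fun v => bh1 (p, v))).norm (hi2.const_mul _) fun v => ?_
    simp only [norm_mul, hn]
    rw [mul_comm]
    gcongr
    exact bh1 _
  have hmain := norm_amp_gaussian_sub_le hh hσ
  rw [← hz, ← hc] at hmain
  have hampc : ‖amp h * c‖ ≤ 3 := by
    have h1 : ‖Complex.exp (Complex.I * Real.pi * (1 - σ) / 4)‖ = 1 := by
      have : Complex.I * Real.pi * (1 - σ) / 4 = ((Real.pi * (1 - σ) / 4 : ℝ) : ℂ) * Complex.I := by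
        push_cast
        ring
      rw [this, Complex.norm_exp_ofReal_mul_I]
    have h2 := norm_sub_norm_le (amp h * c) (Complex.exp (Complex.I * Real.pi * (1 - σ) / 4))
    rw [h1] at h2
    linarith
  have hB0 : ‖B (p, 0)‖ ≤ C0 := by rw [← hzero]; exact hC0 _
  set W : ℂ := ∫ v : ℝ, Complex.exp (-(z / 2) * v ^ 2) * dLast g₂ (p, v) with hW
  have heq : amp h * (∫ v, osc h (-σ / 2 * v ^ 2) * B (p, v)) -
      Complex.exp (Complex.I * Real.pi * (1 - σ) / 4) * B (p, 0) =
      (amp h * c - Complex.exp (Complex.I * Real.pi * (1 - σ) / 4)) * B (p, 0) +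
      z⁻¹ * (amp h * c) * dLast g (p, 0) + amp h * z⁻¹ * z⁻¹ * W := by
    rw [hJ]
    ring
  rw [heq]
  refine (norm_add₃_le).trans ?_
  simp only [norm_mul] at hampc ⊢
  have e1 : ‖amp h * c - Complex.exp (Complex.I * Real.pi * (1 - σ) / 4)‖ * ‖B (p, 0)‖ ≤
      2 * h * C0 := by gcongr
  have e2 : ‖z⁻¹‖ * (‖amp h‖ * ‖c‖) * ‖dLast g (p, 0)‖ ≤ h * 3 * C2 := by
    gcongr
    exact bg1 _
  have e3 : ‖amp h‖ * ‖z⁻¹‖ * ‖z⁻¹‖ * ‖W‖ ≤ h * (C4 * K) := by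
    calc ‖amp h‖ * ‖z⁻¹‖ * ‖z⁻¹‖ * ‖W‖ ≤ ‖amp h‖ * h * h * (C4 * K) := by gcongr
      _ ≤ 1 * h * (C4 * K) := by
        gcongr
        exact norm_amp_mul_le hh hh1
      _ = h * (C4 * K) := by ring
  linarith

end Gaussian

end

/-! ### From a mixed integral to an exponential: the partial Legendre transform. -/

section

section Bump

variable {E F : Type*} [NormedAddCommGroup E] [NormedSpace ℝ E] [NormedAddCommGroup F]
  [NormedSpace ℝ F]

/-- A smooth bump supported in a given open set and equal to `1` near a given point. -/
theorem exists_bump [FiniteDimensional ℝ E] {U : Set E} (hU : IsOpen U) {x : E} (hx : x ∈ U) :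
    ∃ κ : E → ℂ, TestFun U κ ∧ ∃ N, IsOpen N ∧ x ∈ N ∧ N ⊆ U ∧ ∀ y ∈ N, κ y = 1 := by
  obtain ⟨r, hr, hrU⟩ := Metric.isOpen_iff.1 hU x hx
  let f : ContDiffBump x := ⟨r / 4, r / 2, by positivity, by linarith⟩
  have hs : tsupport f ⊆ U := by
    rw [f.tsupport_eq]
    exact (Metric.closedBall_subset_ball (by change r / 2 < r; linarith)).trans hrU
  have hts : tsupport (fun y => (f y : ℂ)) ⊆ tsupport f := by
    refine closure_mono fun y hy hy0 => hy ?_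
    simp [hy0]
  refine ⟨fun y => (f y : ℂ), ⟨Complex.ofRealCLM.contDiff.comp f.contDiff,
    f.hasCompactSupport.isCompact.of_isClosed_subset (isClosed_tsupport _) hts, hts.trans hs⟩,
    Metric.ball x (r / 4), Metric.isOpen_ball, Metric.mem_ball_self (by positivity),
    (Metric.ball_subset_ball (by linarith)).trans hrU, fun y hy => ?_⟩
  have : f y = 1 := f.one_of_mem_closedBall (Metric.ball_subset_closedBall hy)
  simp [this]

/-- The pull-back of a test function by a smooth map with a continuous left inverse. -/
theorem TestFun.comp {U : Set E} {a : E → ℂ} (ha : TestFun U a) {f : F → E}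
    (hf : ContDiff ℝ ∞ f) {g : E → F} (hg : Continuous g) (hgf : ∀ y, g (f y) = y) :
    TestFun (f ⁻¹' U) (fun y => a (f y)) := by
  have hs : tsupport (fun y => a (f y)) ⊆ f ⁻¹' (tsupport a) :=
    closure_minimal (fun y hy => subset_tsupport a hy)
      ((isClosed_tsupport a).preimage hf.continuous)
  refine ⟨ha.smooth.comp hf, ?_, fun y hy => ha.subset (hs hy)⟩
  refine (ha.compact.isCompact.image hg).of_isClosed_subset (isClosed_tsupport _) fun y hy => ?_
  exact ⟨f y, hs hy, hgf y⟩

end Bump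

variable {S T H : Plane → ℝ}

/-- The position of the critical point of the mixed phase. -/
def critPos (S : Plane → ℝ) (q : Plane) : Plane := (q.1, -dEta S q)

theorem continuous_critPos (hS : ContDiff ℝ ∞ S) : Continuous (critPos S) :=
  continuous_fst.prodMk (contDiff_dEta hS).continuous.neg

/-- If `T` is the partial Legendre transform of `S` and `H = T_x` is monotone in `x`, then the
mixed integral is a function with phase `T`. -/
theorem asymp_oscInt_legendre (hS : ContDiff ℝ ∞ S) (hT : ContDiff ℝ ∞ T) (hH : ContDiff ℝ ∞ H)
    {q₀ : Plane} {σ : ℝ} (hσ : σ ^ 2 = 1)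
    (h1 : ∀ᶠ q in 𝓝 q₀, T (critPos S q) = S q - q.2 * dEta S q ∧ H (critPos S q) = q.2)
    (h2 : ∀ᶠ p in 𝓝 (critPos S q₀), fderiv ℝ T p (0, 1) = H p)
    (h3 : 0 < σ * fderiv ℝ H (critPos S q₀) (0, 1)) :
    ∃ O V : Set Plane, IsOpen O ∧ q₀ ∈ O ∧ IsOpen V ∧ critPos S q₀ ∈ V ∧
      (∀ q ∈ O, H (critPos S q) = q.2) ∧ ∀ a b : Plane → ℂ, TestFun O a → TestFun V b →
        (∀ q ∈ O, a q * (Real.sqrt |fderiv ℝ H (critPos S q) (0, 1)| : ℂ) = b (critPos S q)) →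
        Asymp (oscInt (mixedPhase S) (fun z => a (z.1.1, z.2)))
          (fun h p => Complex.exp (Complex.I * Real.pi * (1 - σ) / 4) * osc h (T p) * b p) := by
  -- This phase can be read in two ways. In η it is exactly quadratic about H(p) with value T(p), so
  -- its integral is Gaussian. Near `q₀` it also agrees to first order with S + ηx on the critical
  -- set of the latter, with mixed derivative σH_x > 0 at the base point, so it can be traded for
  -- the mixed phase.
  set φ : Plane × ℝ → ℝ := fun z => T z.1 - σ / 2 * (z.2 - H z.1) ^ 2 with hφdef
  have hφ : ContDiff ℝ ∞ φ := by
    have e1 : ContDiff ℝ ∞ fun z : Plane × ℝ => T z.1 := hT.comp contDiff_fst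
    have e2 : ContDiff ℝ ∞ fun z : Plane × ℝ => H z.1 := hH.comp contDiff_fst
    exact e1.sub (contDiff_const.mul ((contDiff_snd.sub e2).pow 2))
  have hfd : ∀ z : Plane × ℝ, HasFDerivAt φ
      ((fderiv ℝ T z.1).comp (ContinuousLinearMap.fst ℝ Plane ℝ) - (σ * (z.2 - H z.1)) •
        (ContinuousLinearMap.snd ℝ Plane ℝ -
          (fderiv ℝ H z.1).comp (ContinuousLinearMap.fst ℝ Plane ℝ))) z := by
    intro z
    have e1 : HasFDerivAt (fun z : Plane × ℝ => T z.1)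
        ((fderiv ℝ T z.1).comp (ContinuousLinearMap.fst ℝ Plane ℝ)) z :=
      ((hT.differentiable (by simp)) z.1).hasFDerivAt.comp z hasFDerivAt_fst
    have e2 : HasFDerivAt (fun z : Plane × ℝ => H z.1)
        ((fderiv ℝ H z.1).comp (ContinuousLinearMap.fst ℝ Plane ℝ)) z :=
      ((hH.differentiable (by simp)) z.1).hasFDerivAt.comp z hasFDerivAt_fst
    have e3 := e1.sub (((hasFDerivAt_snd.sub e2).pow 2).const_mul (σ / 2))
    refine e3.congr_fderiv ?_
    ext <;> simp <;> ring
  have hη : (fun z => fderiv ℝ φ z (0, 1)) = fun z => -σ * (z.2 - H z.1) := by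
    funext z
    rw [(hfd z).fderiv]
    simp
  have hηx : ∀ z : Plane × ℝ, fderiv ℝ (fun z => fderiv ℝ φ z (0, 1)) z ((0, 1), 0) =
      σ * fderiv ℝ H z.1 (0, 1) := by
    intro z
    rw [hη]
    have e2 : HasFDerivAt (fun z : Plane × ℝ => H z.1)
        ((fderiv ℝ H z.1).comp (ContinuousLinearMap.fst ℝ Plane ℝ)) z :=
      ((hH.differentiable (by simp)) z.1).hasFDerivAt.comp z hasFDerivAt_fst
    have e3 : HasFDerivAt (fun z : Plane × ℝ => -σ * (z.2 - H z.1)) _ z :=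
      (hasFDerivAt_snd.sub e2).const_mul (-σ)
    rw [e3.fderiv]
    simp
  have hcrit : ∀ᶠ q in 𝓝 q₀, φ (critPt S q) = mixedPhase S (critPt S q) ∧
      fderiv ℝ φ (critPt S q) ((0, 1), 0) = q.2 := by
    have h2' := (continuous_critPos hS).continuousAt.eventually h2
    filter_upwards [h1, h2'] with q hq hq2
    have e : (critPt S q).1 = critPos S q := rfl
    have e' : (critPt S q).2 = q.2 := rfl
    constructor
    · rw [hφdef]
      beta_reduce
      rw [e, e', hq.1, hq.2]
      simp only [mixedPhase, critPt]
      ring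
    · rw [(hfd _).fderiv]
      simp [e, e', hq.2, hq2]
  obtain ⟨U, hU, hz0, hUpos, hLL⟩ := exists_mixed_amplitude hS hφ hcrit (by rw [hηx]; exact h3)
  obtain ⟨O', hO'1, hO', hq0⟩ := eventually_nhds_iff.1 h1
  have hU' : IsOpen (U ∩ {z : Plane × ℝ | (z.1.1, z.2) ∈ O'}) :=
    hU.inter (hO'.preimage (by fun_prop))
  -- The amplitude b(p) does not depend on η; this cut-off makes it a test function without changing
  -- it near the critical point.
  obtain ⟨κ, hκ, N, hN, hz0N, hNU, hκ1⟩ := exists_bump hU' (x := critPt S q₀) ⟨hz0, hq0⟩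
  have hOopen : IsOpen (O' ∩ critPt S ⁻¹' N) := hO'.inter (hN.preimage (continuous_critPt hS))
  have hH0 : H (critPos S q₀) = q₀.2 := (hO'1 q₀ hq0).2
  refine ⟨O' ∩ critPt S ⁻¹' N,
    {p | (p.1, H p) ∈ O' ∩ critPt S ⁻¹' N} ∩ {p | (p, H p) ∈ N}, hOopen, ⟨hq0, hz0N⟩,
    (hOopen.preimage (continuous_fst.prodMk hH.continuous)).inter
      (hN.preimage (continuous_id.prodMk hH.continuous)), ⟨?_, ?_⟩, fun q hq => (hO'1 q hq.1).2, ?_⟩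
  · change (q₀.1, H (critPos S q₀)) ∈ O' ∩ critPt S ⁻¹' N
    rw [hH0]
    exact ⟨hq0, hz0N⟩
  · change (critPos S q₀, H (critPos S q₀)) ∈ N
    rw [hH0]
    exact hz0N
  intro a b ha hb hab
  have hA : TestFun U (fun z : Plane × ℝ => b z.1 * κ z) :=
    (hκ.mul_smooth (hb.smooth.comp contDiff_fst)).mono inter_subset_left
  obtain ⟨β, hβ, hβA, hAs⟩ := hLL _ hA
  -- On the critical set the reduction divides the amplitude by √|H_x|, which is the assumed
  -- relation between `a` and `b`. Where `a` vanishes for lack of support, the choice of the domain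
  -- of `b` makes the other side vanish too.
  have hβa : ∀ q, β (critPt S q) = a q := by
    intro q
    by_cases hqU : critPt S q ∈ U
    · have hm := hUpos q hqU
      have e1 := hβA q hqU
      rw [hηx] at hm e1
      change b (critPos S q) * κ (critPt S q) = _ at e1
      have hm' : (Real.sqrt (σ * fderiv ℝ H (critPos S q) (0, 1)) : ℂ) ≠ 0 :=
        Complex.ofReal_ne_zero.2 (Real.sqrt_pos.2 hm).ne'
      have habs : |fderiv ℝ H (critPos S q) (0, 1)| = σ * fderiv ℝ H (critPos S q) (0, 1) := by
        have hm'' : 0 < σ * fderiv ℝ H (critPos S q) (0, 1) := hm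
        rw [← abs_of_pos hm'', abs_mul]
        have : |σ| = 1 := by
          rw [← sq_eq_sq₀ (abs_nonneg _) zero_le_one, sq_abs, hσ, one_pow]
        rw [this, one_mul]
      by_cases hqO : q ∈ O' ∩ critPt S ⁻¹' N
      · rw [hκ1 _ hqO.2, mul_one, ← hab q hqO, habs, mul_comm] at e1
        exact (mul_left_cancel₀ hm' e1).symm
      · rw [ha.eq_zero hqO]
        have : b (critPos S q) * κ (critPt S q) = 0 := by
          by_cases hqU' : critPt S q ∈ U ∩ {z : Plane × ℝ | (z.1.1, z.2) ∈ O'}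
          · have hqO' : q ∈ O' := hqU'.2
            rw [hb.eq_zero (fun hv => hqO ?_), zero_mul]
            have := hv.1
            change (q.1, H (critPos S q)) ∈ O' ∩ critPt S ⁻¹' N at this
            rwa [(hO'1 q hqO').2] at this
          · rw [hκ.eq_zero hqU', mul_zero]
        rw [this] at e1
        exact (mul_eq_zero.1 e1.symm).resolve_left hm'
    · rw [hβ.eq_zero hqU, ha.eq_zero]
      exact fun hq => hqU (hNU hq.2).1
  have hMV := asymp_oscInt_mixedPhase hS (hβ.mono (subset_univ U))
    (ha.mono (subset_univ _)) hβa
  refine (hAs.trans hMV).symm.trans ?_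
  have hcont : ∀ h, 0 < h → Continuous
      fun p => Complex.exp (Complex.I * Real.pi * (1 - σ) / 4) * osc h (T p) * b p := by
    intro h _
    exact (continuous_const.mul ((contDiff_osc h).continuous.comp hT.continuous)).mul
      hb.smooth.continuous
  have hB : TestFun univ (fun z : Plane × ℝ => b z.1 * κ (z.1, H z.1 + z.2)) := by
    have := hA.comp (f := fun z : Plane × ℝ => (z.1, H z.1 + z.2))
      (g := fun z : Plane × ℝ => (z.1, z.2 - H z.1))
      (contDiff_fst.prodMk ((hH.comp contDiff_fst).add contDiff_snd))
      (continuous_fst.prodMk (continuous_snd.sub (hH.continuous.comp continuous_fst)))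
      (fun y => by simp)
    exact this.mono (subset_univ _)
  obtain ⟨C, hC0, hC⟩ := exists_gaussian_bound hB hσ
  have hB0 : ∀ p, b p * κ (p, H p + 0) = b p := by
    intro p
    by_cases hp : p ∈ {p : Plane | (p.1, H p) ∈ O' ∩ critPt S ⁻¹' N} ∩ {p | (p, H p) ∈ N}
    · rw [add_zero, hκ1 _ hp.2, mul_one]
    · rw [hb.eq_zero hp, zero_mul]
  -- Translating η by H(p) gives the pure Gaussian phase with p as a parameter.
  have hosc : ∀ h p, oscInt φ (fun z : Plane × ℝ => b z.1 * κ z) h p = osc h (T p) *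
      (amp h * ∫ v, osc h (-σ / 2 * v ^ 2) * (b p * κ (p, H p + v))) := by
    intro h p
    have e1 : ∫ v, osc h (φ (p, v)) * (b p * κ (p, v)) =
        ∫ v, osc h (φ (p, H p + v)) * (b p * κ (p, H p + v)) :=
      (integral_add_left_eq_self (fun v => osc h (φ (p, v)) * (b p * κ (p, v))) (H p)).symm
    have e2 : ∀ v, osc h (φ (p, H p + v)) * (b p * κ (p, H p + v)) =
        osc h (T p) * (osc h (-σ / 2 * v ^ 2) * (b p * κ (p, H p + v))) := by
      intro v
      have e3 : φ (p, H p + v) = T p + -σ / 2 * v ^ 2 := by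
        simp only [hφdef]
        ring
      rw [e3, osc_add, mul_assoc]
    rw [oscInt, e1]
    simp_rw [e2]
    rw [integral_const_mul]
    ring
  refine ⟨fun h _ => continuous_oscInt hU hφ.contDiffOn hA h, hcont, ?_⟩
  refine SmallL2.of_bound (hb.compact.isCompact) (C := C) (fun h hh h1 p => ?_) fun h hh p hp => ?_
  · rw [hosc]
    have e := hC h hh h1 p
    beta_reduce at e
    rw [hB0] at e
    have e3 : ∀ X Y Z : ℂ, osc h (T p) * X - Y * osc h (T p) * Z = osc h (T p) * (X - Y * Z) :=
      fun X Y Z => by ring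
    rw [e3, norm_mul, norm_osc, one_mul]
    exact e
  · have hbp : b p = 0 := image_eq_zero_of_notMem_tsupport hp
    rw [hosc]
    simp [hbp]

end

/-! ### Rotated frames and the algebra of the derivatives of X and P. -/

section

section Frames

/-- The linear form `v ↦ ⟨u, v⟩`. -/
def dotL (u : Plane) : Plane →L[ℝ] ℝ :=
  u.1 • ContinuousLinearMap.fst ℝ ℝ ℝ + u.2 • ContinuousLinearMap.snd ℝ ℝ ℝ

@[simp] theorem dotL_apply (u v : Plane) : dotL u v = dot u v := by simp [dotL, dot]

theorem dot_comm (u v : Plane) : dot u v = dot v u := by simp only [dot]; ring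

theorem HasFDerivAt.dot {E : Type*} [NormedAddCommGroup E] [NormedSpace ℝ E] {f g : E → Plane}
    {f' g' : E →L[ℝ] Plane} {x : E} (hf : HasFDerivAt f f' x) (hg : HasFDerivAt g g' x) :
    HasFDerivAt (fun x => dot (f x) (g x)) ((dotL (g x)).comp f' + (dotL (f x)).comp g') x := by
  refine ((hf.fst.mul hg.fst).add (hf.snd.mul hg.snd)).congr_fderiv ?_
  ext v
  simp [MaslovOperator.dot]
  ring

/-- The coordinates of a vector in the rotated frame. -/
def toFrame (θ : ℝ) : Plane →L[ℝ] Plane := (dotL (frame₁ θ)).prod (dotL (frame₂ θ))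

/-- The vector with given coordinates in the rotated frame. -/
def ofFrame (θ : ℝ) : Plane →L[ℝ] Plane := toFrame (-θ)

theorem toFrame_apply (θ : ℝ) (v : Plane) :
    toFrame θ v = (dot (frame₁ θ) v, dot (frame₂ θ) v) := by simp [toFrame]

theorem ofFrame_apply (θ : ℝ) (p : Plane) :
    ofFrame θ p = p.1 • frame₁ θ + p.2 • frame₂ θ := by
  ext <;> simp [ofFrame, toFrame, frame₁, frame₂, dot] <;> ring

theorem toFrame_ofFrame (θ : ℝ) (p : Plane) : toFrame θ (ofFrame θ p) = p := by
  have := Real.sin_sq_add_cos_sq θ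
  rw [ofFrame_apply, toFrame_apply]
  refine Prod.ext ?_ ?_
  · simp [frame₁, frame₂, dot]
    linear_combination p.1 * this
  · simp [frame₁, frame₂, dot]
    linear_combination p.2 * this

theorem ofFrame_toFrame (θ : ℝ) (p : Plane) : ofFrame θ (toFrame θ p) = p := by
  have := toFrame_ofFrame (-θ) p
  rwa [ofFrame, neg_neg] at this

theorem dot_frame₁_ofFrame (θ : ℝ) (p : Plane) : dot (frame₁ θ) (ofFrame θ p) = p.1 :=
  congrArg Prod.fst ((toFrame_apply θ _).symm.trans (toFrame_ofFrame θ p))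

theorem dot_frame₂_ofFrame (θ : ℝ) (p : Plane) : dot (frame₂ θ) (ofFrame θ p) = p.2 :=
  congrArg Prod.snd ((toFrame_apply θ _).symm.trans (toFrame_ofFrame θ p))

theorem dot_toFrame (θ : ℝ) (u v : Plane) : dot (toFrame θ u) (toFrame θ v) = dot u v := by
  have := Real.sin_sq_add_cos_sq θ
  simp only [toFrame_apply, dot, frame₁, frame₂]
  linear_combination (u.1 * v.1 + u.2 * v.2) * this

theorem det2_toFrame (θ : ℝ) (u v : Plane) : det2 (toFrame θ u) (toFrame θ v) = det2 u v := by
  have := Real.sin_sq_add_cos_sq θ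
  simp only [toFrame_apply, dot, frame₁, frame₂, det2]
  linear_combination (u.1 * v.2 - v.1 * u.2) * this

theorem fderiv_plane {F : Type*} [NormedAddCommGroup F] [NormedSpace ℝ F] (f : Plane → F)
    (y w : Plane) :
    fderiv ℝ f y w = w.1 • fderiv ℝ f y (1, 0) + w.2 • fderiv ℝ f y (0, 1) := by
  rw [← map_smul, ← map_smul, ← map_add]
  congr 1
  ext <;> simp

end Frames

section Algebra

/-! Relations between the derivatives `a = X_τ`, `b = X_ψ`, `e = P_τ`, `g = P_ψ`. -/

variable {p a b e g : Plane}

/-- X_ψ is orthogonal to P, hence a multiple of P turned by a right angle, and X_τ fixes the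
multiple. So X_ψ vanishes wherever det(X_τ, X_ψ) does. -/
theorem eq_smul_rotate (ha : dot p a = 1) (hb : dot p b = 0) :
    b = (-(det2 a b * p.2), det2 a b * p.1) := by
  simp only [dot, det2] at *
  ext
  · simp only
    linear_combination (-b.1) * ha + a.1 * hb
  · simp only
    linear_combination (-b.2) * ha + a.2 * hb

/-- At a focal point X_ψ = 0, and the Lagrangian condition makes P_ψ orthogonal to X_τ; with ⟨P,
X_τ⟩ = 1, P_ψ is d times X_τ turned by a right angle. Hence dQ is a square, which is why the indices
agree in mixed charts with focal points. -/
theorem mixed_det_of_focal (ha : dot p a = 1) (hb : dot p b = 0) (hl : dot e b = dot g a)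
    (hc : det2 a b = 0) (θ : ℝ) :
    det2 p g * dot (frame₁ θ) a = dot (frame₂ θ) g ∧
      det2 p g * (dot (frame₁ θ) a * dot (frame₂ θ) g - dot (frame₁ θ) b * dot (frame₂ θ) e) =
        dot (frame₂ θ) g ^ 2 := by
  have hb' := eq_smul_rotate ha hb
  rw [hc] at hb'
  have b1 : b.1 = 0 := by rw [hb']; simp
  have b2 : b.2 = 0 := by rw [hb']; simp
  have key : det2 p g * dot (frame₁ θ) a = dot (frame₂ θ) g := by
    simp only [dot, det2, b1, b2, frame₁, frame₂] at *
    have hl' : g.1 * a.1 + g.2 * a.2 = 0 := by linarith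
    linear_combination (-Real.sin θ * g.1 + Real.cos θ * g.2) * ha -
      (Real.cos θ * p.2 - Real.sin θ * p.1) * hl'
  refine ⟨key, ?_⟩
  have : dot (frame₁ θ) b = 0 := by simp [dot, b1, b2]
  rw [this]
  linear_combination dot (frame₂ θ) g * key

/-- The first axis is taken along P. Then ⟨f₁, X_ψ⟩ = 0, ⟨f₁, X_τ⟩ = 1/|P| and d = |P|⟨f₂, P_ψ⟩, so
r = 1/|P|². -/
theorem exists_adapted_frame (ha : dot p a = 1) (hb : dot p b = 0) :
    ∃ θ : ℝ, 0 < dot (frame₁ θ) a ∧ ∃ r : ℝ, 0 < r ∧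
      dot (frame₁ θ) a * dot (frame₂ θ) g - dot (frame₁ θ) b * dot (frame₂ θ) e =
        r * det2 p g := by
  have hp : (⟨p.1, p.2⟩ : ℂ) ≠ 0 := by
    intro h
    have h1 : p.1 = 0 := congrArg Complex.re h
    have h2 : p.2 = 0 := congrArg Complex.im h
    simp [dot, h1, h2] at ha
  set z : ℂ := ⟨p.1, p.2⟩ with hz
  have hn : 0 < ‖z‖ := norm_pos_iff.2 hp
  have h1 : p.1 = ‖z‖ * Real.cos z.arg := (Complex.norm_mul_cos_arg z).symm
  have h2 : p.2 = ‖z‖ * Real.sin z.arg := (Complex.norm_mul_sin_arg z).symm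
  set θ := z.arg
  have e1 : ‖z‖ * dot (frame₁ θ) a = 1 := by
    rw [← ha]
    simp only [dot, frame₁, h1, h2]
    ring
  have e2 : dot (frame₁ θ) b = 0 := by
    have : ‖z‖ * dot (frame₁ θ) b = 0 := by
      rw [← hb]
      simp only [dot, frame₁, h1, h2]
      ring
    exact (mul_eq_zero.1 this).resolve_left hn.ne'
  have e3 : det2 p g = ‖z‖ * dot (frame₂ θ) g := by
    simp only [det2, dot, frame₂, h1, h2]
    ring
  have e4 : dot (frame₁ θ) a = ‖z‖⁻¹ := eq_inv_of_mul_eq_one_right e1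
  refine ⟨θ, e4 ▸ inv_pos.2 hn, (‖z‖ ^ 2)⁻¹, by positivity, ?_⟩
  rw [e2, e4, e3]
  field_simp
  ring

/-- The Binet–Cauchy identity for the pairs (P, P_ψ) and (X_τ, f₂), with ⟨P, X_τ⟩ = 1 and det(X_τ,
f₂) = ⟨f₁, X_τ⟩. At critical points the left side is the derivative of τ_ψ in the direction f₂. -/
theorem mixed_hessian (ha : dot p a = 1) (θ : ℝ) :
    dot g (frame₂ θ) - dot p (frame₂ θ) * dot g a = det2 p g * dot (frame₁ θ) a := by
  have := Real.sin_sq_add_cos_sq θ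
  simp only [dot, det2, frame₁, frame₂] at *
  linear_combination (-g.1 * -Real.sin θ - g.2 * Real.cos θ) * ha

/-- With X_ψ = 0 and P_ψ orthogonal to X_τ the expression reduces to |P_ψ|², and P_ψ ≠ 0. -/
theorem caustic_im_pos (ha : dot p a = 1) (hb : dot p b = 0) (hl : dot e b = dot g a)
    (hc : det2 a b = 0) (hd : det2 p g ≠ 0) : 0 < det2 p g * (det2 a g + det2 e b) := by
  have hb' := eq_smul_rotate ha hb
  rw [hc] at hb'
  have b1 : b.1 = 0 := by rw [hb']; simp
  have b2 : b.2 = 0 := by rw [hb']; simp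
  have key : det2 p g * (det2 a g + det2 e b) = g.1 ^ 2 + g.2 ^ 2 := by
    simp only [dot, det2, b1, b2] at *
    have hl' : g.1 * a.1 + g.2 * a.2 = 0 := by linarith
    linear_combination (g.1 ^ 2 + g.2 ^ 2) * ha - (p.1 * g.1 + p.2 * g.2) * hl'
  rw [key]
  by_contra h
  have h1 : g.1 = 0 := by nlinarith [sq_nonneg g.1, sq_nonneg g.2]
  have h2 : g.2 = 0 := by nlinarith [sq_nonneg g.1, sq_nonneg g.2]
  exact hd (by simp [det2, h1, h2])

end Algebra

/-! ### The phase τ(x, ψ) of a singular chart and its critical points. -/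

namespace SingularChart

variable {L : LagrangianSurface} (C : SingularChart L)

theorem D_open : IsOpen C.D := C.param.isOpen

theorem contDiffOn_X : ContDiffOn ℝ ∞ C.X C.D := contDiff_fst.comp_contDiffOn C.param.smooth

theorem contDiffOn_P : ContDiffOn ℝ ∞ C.P C.D := contDiff_snd.comp_contDiffOn C.param.smooth

variable {C} {y : Plane}

theorem differentiableAt_r (hy : y ∈ C.D) : DifferentiableAt ℝ C.r y :=
  (C.param.smooth.contDiffAt (C.D_open.mem_nhds hy)).differentiableAt (by simp)

theorem hasFDerivAt_X (hy : y ∈ C.D) : HasFDerivAt C.X (fderiv ℝ C.X y) y :=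
  ((C.contDiffOn_X.contDiffAt (C.D_open.mem_nhds hy)).differentiableAt (by simp)).hasFDerivAt

theorem hasFDerivAt_P (hy : y ∈ C.D) : HasFDerivAt C.P (fderiv ℝ C.P y) y :=
  ((C.contDiffOn_P.contDiffAt (C.D_open.mem_nhds hy)).differentiableAt (by simp)).hasFDerivAt

theorem fderiv_X (hy : y ∈ C.D) (w : Plane) : fderiv ℝ C.X y w = (fderiv ℝ C.r y w).1 := by
  have := (differentiableAt_r hy).hasFDerivAt.fst
  rw [show C.X = fun y => (C.r y).1 from rfl, this.fderiv]
  rfl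

theorem fderiv_P (hy : y ∈ C.D) (w : Plane) : fderiv ℝ C.P y w = (fderiv ℝ C.r y w).2 := by
  have := (differentiableAt_r hy).hasFDerivAt.snd
  rw [show C.P = fun y => (C.r y).2 from rfl, this.fderiv]
  rfl

theorem dot_P_fderiv_X (hy : y ∈ C.D) (w : Plane) : dot (C.P y) (fderiv ℝ C.X y w) = w.1 := by
  rw [fderiv_X hy]
  exact C.eikonal y hy w

theorem dot_fderiv_symm (hy : y ∈ C.D) (v w : Plane) :
    dot (fderiv ℝ C.P y v) (fderiv ℝ C.X y w) = dot (fderiv ℝ C.P y w) (fderiv ℝ C.X y v) := by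
  rw [fderiv_X hy, fderiv_X hy, fderiv_P hy, fderiv_P hy]
  exact L.lagrangian C.D C.r C.param y hy v w

variable {z : Plane × ℝ}

theorem hasFDerivAt_tau (hz : z ∈ C.W) : HasFDerivAt C.tau (fderiv ℝ C.tau z) z :=
  ((C.tau_smooth.contDiffAt (C.W_open.mem_nhds hz)).differentiableAt (by simp)).hasFDerivAt

/-- The eikonal coordinates of the point with phase-space parameters `(x, ψ)`. -/
def coords (C : SingularChart L) (z : Plane × ℝ) : Plane := (C.tau z, z.2)

theorem contDiffOn_coords : ContDiffOn ℝ ∞ C.coords C.W :=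
  C.tau_smooth.prodMk contDiff_snd.contDiffOn

theorem hasFDerivAt_coords (hz : z ∈ C.W) : HasFDerivAt C.coords
    ((fderiv ℝ C.tau z).prod (ContinuousLinearMap.snd ℝ Plane ℝ)) z :=
  (hasFDerivAt_tau hz).prodMk hasFDerivAt_snd

/-- Differentiate ⟨P, x − X⟩ = 0 at τ = τ(x, ψ) and use ⟨P, dX⟩ = dτ. -/
theorem fderiv_tau_apply (hz : z ∈ C.W) (v : Plane × ℝ) :
    fderiv ℝ C.tau z v =
      dot (fderiv ℝ C.P (C.coords z) (fderiv ℝ C.tau z v, v.2)) (z.1 - C.X (C.coords z)) +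
        dot (C.P (C.coords z)) v.1 := by
  have hy : C.coords z ∈ C.D := C.tau_mem z hz
  have h1 := (hasFDerivAt_P hy).comp z (hasFDerivAt_coords hz)
  have h2 := (hasFDerivAt_fst (𝕜 := ℝ) (p := z)).sub
    ((hasFDerivAt_X hy).comp z (hasFDerivAt_coords hz))
  have h3 := HasFDerivAt.dot h1 h2
  have h4 : (fun x => dot ((C.P ∘ C.coords) x) (((Prod.fst : Plane × ℝ → Plane) - C.X ∘ C.coords) x)) =ᶠ[𝓝 z]
      fun _ => (0 : ℝ) := by
    filter_upwards [C.W_open.mem_nhds hz] with x hx using C.tau_eq x hx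
  have h5 := h3.unique ((hasFDerivAt_const (0 : ℝ) z).congr_of_eventuallyEq h4)
  have h6 := congrArg (fun l => l v) h5
  simp only [_root_.add_apply, ContinuousLinearMap.comp_apply, dotL_apply,
    ContinuousLinearMap.prod_apply, _root_.sub_apply, _root_.zero_apply,
    ContinuousLinearMap.coe_fst', ContinuousLinearMap.coe_snd', Function.comp_apply, Pi.sub_apply] at h6
  have h7 : ∀ u v w : Plane, dot u (v - w) = dot u v - dot u w := fun u v w => by
    simp [dot]; ring
  rw [h7 (C.P _), dot_P_fderiv_X hy, dot_comm] at h6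
  linarith

/-- If τ_ψ = 0 then ⟨P_ψ, x − X⟩ = 0; also ⟨P, x − X⟩ = 0, while P and P_ψ are independent. -/
theorem eq_X_of_crit (hz : z ∈ critSet C.W C.tau) : z.1 = C.X (C.coords z) := by
  have h1 := fderiv_tau_apply hz.1 (0, 1)
  rw [hz.2] at h1
  have h2 := C.tau_eq z hz.1
  have h3 := C.det_ne_zero z hz.1
  have hy : C.coords z ∈ C.D := C.tau_mem z hz.1
  have h4 := fderiv_P hy (0, 1)
  change det2 (C.P (C.coords z)) (fderiv ℝ C.r (C.coords z) (0, 1)).2 ≠ 0 at h3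
  change dot (C.P (C.coords z)) (z.1 - C.X (C.coords z)) = 0 at h2
  rw [← h4] at h3
  set g := fderiv ℝ C.P (C.coords z) (0, 1)
  set p := C.P (C.coords z)
  set u := z.1 - C.X (C.coords z)
  have h1' : dot g u = 0 := by simpa [dot] using h1.symm
  have u1 : det2 p g * u.1 = 0 := by
    simp only [det2, dot] at *
    linear_combination g.2 * h2 - p.2 * h1'
  have u2 : det2 p g * u.2 = 0 := by
    simp only [det2, dot] at *
    linear_combination p.1 * h1' - g.1 * h2
  have : u = 0 := Prod.ext ((mul_eq_zero.1 u1).resolve_left h3) ((mul_eq_zero.1 u2).resolve_left h3)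
  exact sub_eq_zero.1 this

theorem fderiv_tau_of_crit (hz : z ∈ critSet C.W C.tau) (v : Plane × ℝ) :
    fderiv ℝ C.tau z v = dot (C.P (C.coords z)) v.1 := by
  have h := fderiv_tau_apply hz.1 v
  rw [sub_eq_zero.2 (eq_X_of_crit hz)] at h
  simpa [dot] using h

theorem gradMap_of_crit (hz : z ∈ critSet C.W C.tau) : gradMap C.tau z = C.r (C.coords z) := by
  refine Prod.ext (eq_X_of_crit hz) (Prod.ext ?_ ?_)
  · change fderiv ℝ C.tau z ((1, 0), 0) = (C.P (C.coords z)).1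
    rw [fderiv_tau_of_crit hz]
    simp [dot]
  · change fderiv ℝ C.tau z ((0, 1), 0) = (C.P (C.coords z)).2
    rw [fderiv_tau_of_crit hz]
    simp [dot]

/-- Some critical point is mapped to `C.r y`; by injectivity of the parametrization its coordinates
are `y`, and then it can only be (X(y), ψ). -/
theorem crit_of_mem (hy : y ∈ C.G) :
    (C.X y, y.2) ∈ critSet C.W C.tau ∧ C.coords (C.X y, y.2) = y := by
  obtain ⟨z, hz, hzy⟩ := C.bijOn.surjOn ⟨y, hy, rfl⟩
  rw [gradMap_of_crit hz] at hzy
  have h1 := C.param.injOn (C.tau_mem z hz.1) (C.G_subset hy) hzy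
  have h1' : C.coords z = y := h1
  have h2 : z = (C.X y, y.2) := by
    refine Prod.ext ?_ ?_
    · rw [← h1']
      exact eq_X_of_crit hz
    · rw [← h1']
      rfl
  rw [← h2]
  exact ⟨hz, h1'⟩

/-- The condition is imposed on `W`; every point of the chart comes from a critical point in `W`. -/
theorem detP_ne_zero (hy : y ∈ C.G) : C.detP y ≠ 0 := by
  obtain ⟨hz, hzy⟩ := crit_of_mem hy
  have h := C.det_ne_zero _ hz.1
  change det2 (C.P (C.coords _)) (fderiv ℝ C.r (C.coords _) (0, 1)).2 ≠ 0 at h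
  rw [hzy] at h
  rwa [detP, fderiv_P (C.G_subset hy)]

theorem contDiffOn_fderiv_apply {F : Type*} [NormedAddCommGroup F] [NormedSpace ℝ F]
    {E : Type*} [NormedAddCommGroup E] [NormedSpace ℝ E] {f : E → F}
    {U : Set E} (hU : IsOpen U) (hf : ContDiffOn ℝ ∞ f U) (w : E) :
    ContDiffOn ℝ ∞ (fun y => fderiv ℝ f y w) U :=
  (hf.fderiv_of_isOpen hU (by simp)).clm_apply contDiffOn_const

/-- τ_ψ is a scalar product with x − X, which vanishes at the critical point; only the derivative of
this factor contributes, and second derivatives of P do not enter. -/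
theorem fderiv_tau_psi (hy : y ∈ C.G) (v : Plane × ℝ) :
    fderiv ℝ (fun z => fderiv ℝ C.tau z (0, 1)) (C.X y, y.2) v =
      dot (fderiv ℝ C.P y (0, 1)) (v.1 - fderiv ℝ C.X y (dot (C.P y) v.1, v.2)) := by
  obtain ⟨hz, hzy⟩ := crit_of_mem hy
  set z : Plane × ℝ := (C.X y, y.2) with hzdef
  have hyD := C.G_subset hy
  have hτ : DifferentiableAt ℝ (fun z => fderiv ℝ C.tau z (0, 1)) z :=
    ((contDiffOn_fderiv_apply C.W_open C.tau_smooth (0, 1)).contDiffAt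
      (C.W_open.mem_nhds hz.1)).differentiableAt (by simp)
  have hP : DifferentiableAt ℝ (fderiv ℝ C.P) (C.coords z) := by
    rw [hzy]
    exact ((C.contDiffOn_P.fderiv_of_isOpen C.D_open (m := ∞) (by simp)).contDiffAt
      (C.D_open.mem_nhds hyD)).differentiableAt (by simp)
  have hF : DifferentiableAt ℝ
      (fun z => fderiv ℝ C.P (C.coords z) (fderiv ℝ C.tau z (0, 1), (1 : ℝ))) z :=
    (hP.comp z (hasFDerivAt_coords hz.1).differentiableAt).clm_apply
      (hτ.prodMk (differentiableAt_const _))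
  have hX : HasFDerivAt C.X (fderiv ℝ C.X y) (C.coords z) := by
    rw [hzy]
    exact hasFDerivAt_X hyD
  have hG := (hasFDerivAt_fst (𝕜 := ℝ) (p := z)).sub (hX.comp z (hasFDerivAt_coords hz.1))
  have h1 := HasFDerivAt.dot hF.hasFDerivAt hG
  have h2 : (fun z => fderiv ℝ C.tau z (0, 1)) =ᶠ[𝓝 z] fun z =>
      dot (fderiv ℝ C.P (C.coords z) (fderiv ℝ C.tau z (0, 1), (1 : ℝ)))
        (((Prod.fst : Plane × ℝ → Plane) - C.X ∘ C.coords) z) := by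
    filter_upwards [C.W_open.mem_nhds hz.1] with x hx
    have := fderiv_tau_apply hx (0, 1)
    simpa [dot] using this
  rw [(h1.congr_of_eventuallyEq h2).fderiv]
  have h3 : ((Prod.fst : Plane × ℝ → Plane) - C.X ∘ C.coords) z = 0 := sub_eq_zero.2 (eq_X_of_crit hz)
  simp only [_root_.add_apply, ContinuousLinearMap.comp_apply, dotL_apply,
    ContinuousLinearMap.prod_apply, _root_.sub_apply,
    ContinuousLinearMap.coe_fst', ContinuousLinearMap.coe_snd', h3, hzy, hz.2,
    fderiv_tau_of_crit hz]
  simp [dot]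

/-- The mixed second derivative of `τ(x, ψ)` at a critical point. -/
theorem fderiv_tau_psi_frame (hy : y ∈ C.G) (θ : ℝ) :
    fderiv ℝ (fun z => fderiv ℝ C.tau z (0, 1)) (C.X y, y.2) (frame₂ θ, 0) =
      C.detP y * dot (frame₁ θ) (fderiv ℝ C.X y (1, 0)) := by
  rw [fderiv_tau_psi hy, fderiv_plane C.X y (dot _ _, _), detP,
    ← mixed_hessian (dot_P_fderiv_X (C.G_subset hy) (1, 0)) θ]
  simp [dot]
  ring

/-- The Jacobian of the mixed coordinates. -/
theorem jacDet_mixed (hy : y ∈ C.D) (θ : ℝ) : jacDet (C.stdCoord (.mixed θ)) y =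
    dot (frame₁ θ) (fderiv ℝ C.X y (1, 0)) * dot (frame₂ θ) (fderiv ℝ C.P y (0, 1)) -
      dot (frame₁ θ) (fderiv ℝ C.X y (0, 1)) * dot (frame₂ θ) (fderiv ℝ C.P y (1, 0)) := by
  have h : HasFDerivAt (C.stdCoord (.mixed θ)) (((dotL (frame₁ θ)).comp (fderiv ℝ C.X y)).prod
      ((dotL (frame₂ θ)).comp (fderiv ℝ C.P y))) y := by
    have := ((dotL (frame₁ θ)).hasFDerivAt.comp y (hasFDerivAt_X hy)).prodMk
      ((dotL (frame₂ θ)).hasFDerivAt.comp y (hasFDerivAt_P hy))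
    refine this.congr_of_eventuallyEq (Eventually.of_forall fun y => ?_)
    simp [stdCoord, ChartType.coord, X, P]
  rw [jacDet, h.fderiv]
  simp [det2]

theorem contDiffOn_stdCoord (κ : ChartType) : ContDiffOn ℝ ∞ (C.stdCoord κ) C.D := by
  cases κ with
  | position => exact C.contDiffOn_X
  | momentum => exact C.contDiffOn_P
  | mixed θ =>
    have := ((dotL (frame₁ θ)).contDiff.comp_contDiffOn C.contDiffOn_X).prodMk
      ((dotL (frame₂ θ)).contDiff.comp_contDiffOn C.contDiffOn_P)
    refine this.congr fun y _ => ?_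
    simp [stdCoord, ChartType.coord, X, P]

theorem contDiffOn_jacDet {f : Plane → Plane} {U : Set Plane} (hU : IsOpen U)
    (hf : ContDiffOn ℝ ∞ f U) : ContDiffOn ℝ ∞ (jacDet f) U := by
  have h1 := contDiffOn_fderiv_apply hU hf (1, 0)
  have h2 := contDiffOn_fderiv_apply hU hf (0, 1)
  exact (h1.fst.mul h2.snd).sub (h2.fst.mul h1.snd)

theorem contDiffOn_detP : ContDiffOn ℝ ∞ C.detP C.D := by
  have h2 := contDiffOn_fderiv_apply C.D_open C.contDiffOn_P (0, 1)
  exact (C.contDiffOn_P.fst.mul h2.snd).sub (h2.fst.mul C.contDiffOn_P.snd)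

theorem contDiffOn_mu : ContDiffOn ℝ ∞ C.mu C.D := L.vol_smooth C.D C.r C.param

theorem mu_ne_zero (hy : y ∈ C.D) : C.mu y ≠ 0 := L.vol_ne_zero C.D C.r C.param y hy

theorem focal_jacDet (hy : y ∈ C.D) (hf : L.IsFocalPt (C.r y)) : jacDet C.X y = 0 := by
  have h := hf.2 _ ⟨C.D, C.r, C.param, y, hy, rfl, (1, 0), rfl⟩ _
    ⟨C.D, C.r, C.param, y, hy, rfl, (0, 1), rfl⟩
  rwa [← fderiv_X hy, ← fderiv_X hy] at h

/-- In a mixed chart the conditions for the reduction of the angle integral hold at focal points. -/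
theorem mixed_at_focal (hy : y ∈ C.G) (hc : jacDet C.X y = 0) {θ : ℝ}
    (hQ : jacDet (C.stdCoord (.mixed θ)) y ≠ 0) :
    dot (frame₁ θ) (fderiv ℝ C.X y (1, 0)) ≠ 0 ∧
      0 < C.detP y * jacDet (C.stdCoord (.mixed θ)) y := by
  have hD := C.G_subset hy
  obtain ⟨h1, h2⟩ := mixed_det_of_focal (dot_P_fderiv_X hD (1, 0)) (dot_P_fderiv_X hD (0, 1))
    (dot_fderiv_symm hD (1, 0) (0, 1)) hc θ
  rw [← jacDet_mixed hD] at h2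
  change C.detP y * _ = _ at h1 h2
  have hd := detP_ne_zero hy
  have h3 : dot (frame₂ θ) (fderiv ℝ C.P y (0, 1)) ≠ 0 := by
    intro h
    rw [h] at h2
    exact mul_ne_zero hd hQ (by simpa using h2)
  refine ⟨fun h => h3 (by rw [← h1, h, mul_zero]), ?_⟩
  rw [h2]
  positivity

/-- Complements `mixed_at_focal`: at an arbitrary point at least one frame is suitable for the
direct comparison with the angle integral. -/
theorem exists_adapted_mixed (hy : y ∈ C.G) : ∃ θ : ℝ,
    dot (frame₁ θ) (fderiv ℝ C.X y (1, 0)) ≠ 0 ∧ ∃ r : ℝ, 0 < r ∧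
      jacDet (C.stdCoord (.mixed θ)) y = r * C.detP y := by
  have hD := C.G_subset hy
  obtain ⟨θ, h1, r, hr, h2⟩ := exists_adapted_frame (e := fderiv ℝ C.P y (1, 0))
    (g := fderiv ℝ C.P y (0, 1)) (dot_P_fderiv_X hD (1, 0)) (dot_P_fderiv_X hD (0, 1))
  exact ⟨θ, h1.ne', r, hr, by rw [jacDet_mixed hD, h2]; rfl⟩

end SingularChart

end

/-! ### Tangent planes and the variation of the Maslov index inside a singular chart. -/

section

section Param

variable {S : Set Phase} {D : Set Plane} {r : Plane → Phase}

/-- The parametrization is open onto the surface, so its inverse is continuous along any family that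
stays on the surface. -/
theorem IsRegularParam.eventually_invFunOn (h : IsRegularParam S D r) {y : Plane} (hy : y ∈ D)
    {T : Type*} {l : Filter T} {f : T → Phase} (hf : Tendsto f l (𝓝 (r y)))
    (hS : ∀ᶠ t in l, f t ∈ S) :
    Tendsto (fun t => Function.invFunOn r D (f t)) l (𝓝 y) ∧
      ∀ᶠ t in l, r (Function.invFunOn r D (f t)) = f t := by
  have key : ∀ O ⊆ D, IsOpen O → y ∈ O → ∀ᶠ t in l, Function.invFunOn r D (f t) ∈ O ∧
      r (Function.invFunOn r D (f t)) = f t := by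
    intro O hOD hO hyO
    obtain ⟨O', hO', hOO'⟩ := h.image_open O hOD hO
    have h1 : r y ∈ S ∩ O' := hOO' ▸ mem_image_of_mem r hyO
    filter_upwards [hS, hf.eventually (hO'.mem_nhds h1.2)] with t ht1 ht2
    have h2 : f t ∈ r '' O := hOO' ▸ ⟨ht1, ht2⟩
    obtain ⟨x, hx, hxt⟩ := h2
    have h3 : ∃ a ∈ D, r a = f t := ⟨x, hOD hx, hxt⟩
    have h4 := Function.invFunOn_eq h3
    have h5 := h.injOn (Function.invFunOn_mem h3) (hOD hx) (h4.trans hxt.symm)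
    exact ⟨h5 ▸ hx, h4⟩
  refine ⟨?_, (key D le_rfl h.isOpen hy).mono fun t ht => ht.2⟩
  intro s hs
  obtain ⟨O, hOs, hO, hyO⟩ := mem_nhds_iff.1 (inter_mem hs (h.isOpen.mem_nhds hy))
  exact (key O (fun x hx => (hOs hx).2) hO hyO).mono fun t ht => (hOs ht.1).1

theorem IsRegularParam.mem_carrier (h : IsRegularParam S D r) {y : Plane} (hy : y ∈ D) :
    r y ∈ S := by
  obtain ⟨O', -, hO'⟩ := h.image_open D le_rfl h.isOpen
  have : r y ∈ S ∩ O' := hO' ▸ mem_image_of_mem r hy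
  exact this.1

theorem IsRegularParam.contDiffAt (h : IsRegularParam S D r) {y : Plane} (hy : y ∈ D) :
    ContDiffAt ℝ ∞ r y := h.smooth.contDiffAt (h.isOpen.mem_nhds hy)

/-- Tangent vectors do not depend on the parametrization. -/
theorem IsRegularParam.exists_fderiv_eq (h : IsRegularParam S D r) {y : Plane} (hy : y ∈ D)
    {D' : Set Plane} {r' : Plane → Phase} (h' : IsRegularParam S D' r') {y' : Plane}
    (hy' : y' ∈ D') (he : r' y' = r y) (w' : Plane) :
    ∃ w, fderiv ℝ r y w = fderiv ℝ r' y' w' := by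
  -- A left inverse of the derivative makes B ∘ r a local diffeomorphism of the plane. The curve
  -- r⁻¹(r'(y' + tw')), so far known only to tend to `y`, thereby becomes differentiable.
  obtain ⟨B₀, hB₀⟩ := LinearMap.exists_leftInverse_of_injective
    (fderiv ℝ r y : Plane →ₗ[ℝ] Phase) (LinearMap.ker_eq_bot.2 (h.immersion y hy))
  set B : Phase →L[ℝ] Plane := LinearMap.toContinuousLinearMap B₀
  have hB : ∀ w, B (fderiv ℝ r y w) = w := fun w => LinearMap.congr_fun hB₀ w
  have hr : HasStrictFDerivAt (fun x => B (r x))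
      ((ContinuousLinearEquiv.refl ℝ Plane : Plane ≃L[ℝ] Plane) : Plane →L[ℝ] Plane) y := by
    have h1 : HasStrictFDerivAt r (fderiv ℝ r y) y :=
      (h.contDiffAt hy).hasStrictFDerivAt (by simp)
    have h2 := B.hasStrictFDerivAt.comp y h1
    refine h2.congr_fderiv ?_
    exact ContinuousLinearMap.ext hB
  have hσ : HasDerivAt (fun t : ℝ => r' (y' + t • w')) (fderiv ℝ r' y' w') 0 := by
    have h1 : HasFDerivAt r' (fderiv ℝ r' y') (y' + (0 : ℝ) • w') := by
      rw [zero_smul, add_zero]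
      exact ((h'.contDiffAt hy').differentiableAt (by simp)).hasFDerivAt
    have h2 : HasDerivAt (fun t : ℝ => y' + t • w') w' 0 := by
      simpa using ((hasDerivAt_id (0 : ℝ)).smul_const w').const_add y'
    exact h1.comp_hasDerivAt 0 h2
  have hσc : Tendsto (fun t : ℝ => r' (y' + t • w')) (𝓝 0) (𝓝 (r y)) := by
    have := hσ.continuousAt.tendsto
    simpa [he] using this
  have hD' : ∀ᶠ t : ℝ in 𝓝 0, y' + t • w' ∈ D' := by
    have h2 : ContinuousAt (fun t : ℝ => y' + t • w') 0 := by fun_prop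
    refine h2.eventually (h'.isOpen.mem_nhds ?_)
    simpa using hy'
  obtain ⟨hu, hru⟩ := h.eventually_invFunOn hy hσc (hD'.mono fun t ht => h'.mem_carrier ht)
  set u : ℝ → Plane := fun t => Function.invFunOn r D (r' (y' + t • w'))
  have hloc : ∀ᶠ t in 𝓝 (0 : ℝ), u t = hr.localInverse (fun x => B (r x)) _ y
      (B (r' (y' + t • w'))) := by
    filter_upwards [hu.eventually hr.eventually_left_inverse, hru] with t h1 h2
    rw [← h1]
    rw [h2]
  have hu' : HasDerivAt u (B (fderiv ℝ r' y' w')) 0 := by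
    have h1 := hr.to_localInverse.hasFDerivAt
    have h2 : HasDerivAt (fun t : ℝ => B (r' (y' + t • w'))) (B (fderiv ℝ r' y' w')) 0 :=
      B.hasFDerivAt.comp_hasDerivAt 0 hσ
    have h3 : B (r y) = B (r' (y' + (0 : ℝ) • w')) := by rw [zero_smul, add_zero, he]
    rw [h3] at h1
    exact (h1.comp_hasDerivAt 0 h2).congr_of_eventuallyEq hloc
  have hu0 : u 0 = y := by
    have h3 := hu'.continuousAt.tendsto
    exact tendsto_nhds_unique h3 hu
  have h4 : HasDerivAt (fun t => r (u t)) (fderiv ℝ r y (B (fderiv ℝ r' y' w'))) 0 := by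
    have h1 : HasFDerivAt r (fderiv ℝ r y) (u 0) := by
      rw [hu0]
      exact ((h.contDiffAt hy).differentiableAt (by simp)).hasFDerivAt
    exact h1.comp_hasDerivAt 0 hu'
  exact ⟨_, h4.unique (hσ.congr_of_eventuallyEq hru)⟩

end Param

/-- A continuous function whose exponential is constant up to a factor is constant. -/
theorem eq_of_exp_const {f : unitInterval → ℝ} (hf : Continuous f)
    (h : ∀ s t, Complex.exp (2 * Complex.I * f s) = Complex.exp (2 * Complex.I * f t))
    (s t : unitInterval) : f s = f t := by
  have hm : MapsTo (fun x => f x - f t) univ (AddSubgroup.zmultiples Real.pi : Set ℝ) := by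
    intro x _
    obtain ⟨n, hn⟩ := Complex.exp_eq_exp_iff_exists_int.1 (h x t)
    refine ⟨n, ?_⟩
    have h1 : (f x : ℂ) - f t = n * Real.pi := by
      have h2 : 2 * Complex.I * ((f x : ℂ) - f t - n * Real.pi) = 0 := by
        linear_combination hn
      have := (mul_eq_zero.1 h2).resolve_left (by simp)
      linear_combination this
    have h3 : f x - f t = n * Real.pi := by exact_mod_cast h1
    simp [h3]
  have hd : IsDiscrete (AddSubgroup.zmultiples Real.pi : Set ℝ) :=
    ⟨inferInstanceAs (DiscreteTopology (AddSubgroup.zmultiples Real.pi))⟩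
  have := isPreconnected_univ.constant_of_mapsTo hd
    ((hf.sub continuous_const).continuousOn) hm (mem_univ s) (mem_univ t)
  exact sub_eq_zero.1 (by simpa using this)

namespace LagrangianSurface

variable {L : LagrangianSurface}

theorem isJacobian_unique {ε : ℝ} {a : Phase} (ha : a ∈ L.carrier) {z z' : ℂ}
    (h : L.IsJacobian ε a z) (h' : L.IsJacobian ε a z') : z = z' := by
  obtain ⟨D, r, hr, y, hy, rfl⟩ := L.exists_param a ha
  have t1 : fderiv ℝ r y (1, 0) ∈ L.tangent (r y) := ⟨D, r, hr, y, hy, rfl, _, rfl⟩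
  have t2 : fderiv ℝ r y (0, 1) ∈ L.tangent (r y) := ⟨D, r, hr, y, hy, rfl, _, rfl⟩
  have h1 := (h _ t1 _ t2).symm.trans (h' _ t1 _ t2)
  exact mul_right_cancel₀ (Complex.ofReal_ne_zero.2 (L.vol_ne_zero D r hr y hy)) h1

end LagrangianSurface

/-- Doubling the angle removes the sign of ρ', so the signs of the density and of det(P, P_ψ) need
not be tracked. -/
theorem exp_two_mul_eq {ρ ρ' a b : ℝ} (hρ : 0 < ρ)
    (h : (ρ : ℂ) * Complex.exp (Complex.I * a) = ρ' * Complex.exp (Complex.I * b)) :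
    Complex.exp (2 * Complex.I * (a - b)) = 1 := by
  have h1 : Complex.exp (Complex.I * (a - b)) = ((ρ' / ρ : ℝ) : ℂ) := by
    rw [mul_sub, Complex.exp_sub, div_eq_iff (Complex.exp_ne_zero _)]
    push_cast
    rw [div_mul_eq_mul_div, eq_div_iff (Complex.ofReal_ne_zero.2 hρ.ne'), ← h]
    ring
  have h2 : ‖Complex.exp (Complex.I * (a - b))‖ = 1 := by
    have : Complex.I * ((a : ℂ) - b) = ((a - b : ℝ) : ℂ) * Complex.I := by push_cast; ring
    rw [this, Complex.norm_exp_ofReal_mul_I]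
  rw [h1, Complex.norm_real, Real.norm_eq_abs] at h2
  have h3 : (ρ' / ρ) ^ 2 = 1 := by rw [← sq_abs, h2, one_pow]
  have h4 : Complex.exp (2 * Complex.I * (a - b)) = Complex.exp (Complex.I * (a - b)) ^ 2 := by
    rw [← Complex.exp_nat_mul]
    congr 1
    push_cast
    ring
  rw [h4, h1]
  exact_mod_cast h3

namespace SingularChart

variable {L : LagrangianSurface} {C : SingularChart L} {y : Plane}

/-- Regularity may be witnessed in other parametrizations; their tangent vectors are combinations of
those of the chart. -/
theorem regular_jacDet (hy : y ∈ C.D) (hr : L.IsRegularPt (C.r y)) : jacDet C.X y ≠ 0 := by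
  obtain ⟨-, u, ⟨D₁, r₁, h₁, y₁, hy₁, e₁, w₁, rfl⟩, v, ⟨D₂, r₂, h₂, y₂, hy₂, e₂, w₂, rfl⟩, hne⟩ := hr
  obtain ⟨w, hw⟩ := C.param.exists_fderiv_eq hy h₁ hy₁ e₁ w₁
  obtain ⟨w', hw'⟩ := C.param.exists_fderiv_eq hy h₂ hy₂ e₂ w₂
  rw [← hw, ← hw', ← fderiv_X hy, ← fderiv_X hy, fderiv_plane C.X y w, fderiv_plane C.X y w'] at hne
  intro h0
  apply hne
  have : det2 (w.1 • fderiv ℝ C.X y (1, 0) + w.2 • fderiv ℝ C.X y (0, 1))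
      (w'.1 • fderiv ℝ C.X y (1, 0) + w'.2 • fderiv ℝ C.X y (0, 1)) =
      (w.1 * w'.2 - w.2 * w'.1) * jacDet C.X y := by
    simp [det2, jacDet]
    ring
  rw [this, h0, mul_zero]

/-- The complexified Jacobian `D(X - iεP)/D(τ, ψ)` multiplied by `i det(P, P_ψ)`. -/
def zeta (C : SingularChart L) (ε : ℝ) (y : Plane) : ℂ :=
  Complex.I * C.detP y * complexArea ε (fderiv ℝ C.r y (1, 0)) (fderiv ℝ C.r y (0, 1))

/-- The coefficient of `-iε` in the complexified Jacobian. -/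
def mixedArea (C : SingularChart L) (y : Plane) : ℝ :=
  det2 (fderiv ℝ C.X y (1, 0)) (fderiv ℝ C.P y (0, 1)) +
    det2 (fderiv ℝ C.P y (1, 0)) (fderiv ℝ C.X y (0, 1))

/-- The factor i det(P, P_ψ) moves the term linear in ε into the real part, where it is positive at
focal points; the imaginary part tends to Jd. -/
theorem zeta_eq (hy : y ∈ C.D) (ε : ℝ) : C.zeta ε y =
    ((ε * (C.detP y * C.mixedArea y) : ℝ) : ℂ) +
      ((C.detP y * (jacDet C.X y - ε ^ 2 * jacDet C.P y) : ℝ) : ℂ) * Complex.I := by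
  simp only [zeta, mixedArea, jacDet, det2, complexArea, fderiv_X hy, fderiv_P hy]
  generalize fderiv ℝ C.r y (1, 0) = u
  generalize fderiv ℝ C.r y (0, 1) = v
  push_cast
  linear_combination (C.detP y : ℂ) * (-ε * (u.1.1 * v.2.2 - v.2.1 * u.1.2 + u.2.1 * v.1.2 -
    v.1.1 * u.2.2) + Complex.I * ε ^ 2 * (u.2.1 * v.2.2 - v.2.1 * u.2.2)) * Complex.I_sq

theorem continuousOn_mixedArea : ContinuousOn C.mixedArea C.D := by
  have hX := fun w => (contDiffOn_fderiv_apply C.D_open C.contDiffOn_X w).continuousOn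
  have hP := fun w => (contDiffOn_fderiv_apply C.D_open C.contDiffOn_P w).continuousOn
  have h1 := hX (1, 0)
  have h2 := hX (0, 1)
  have h3 := hP (1, 0)
  have h4 := hP (0, 1)
  unfold mixedArea det2
  exact ((h1.fst.mul h4.snd).sub (h4.fst.mul h1.snd)).add
    ((h3.fst.mul h2.snd).sub (h2.fst.mul h3.snd))

theorem mixedArea_pos (hy : y ∈ C.G) (hc : jacDet C.X y = 0) : 0 < C.detP y * C.mixedArea y :=
  caustic_im_pos (dot_P_fderiv_X (C.G_subset hy) (1, 0)) (dot_P_fderiv_X (C.G_subset hy) (0, 1))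
    (dot_fderiv_symm (C.G_subset hy) (1, 0) (0, 1)) hc (detP_ne_zero hy)

/-- Where d·`mixedArea` > 0 the real part is positive. The rest of `K` is compact without focal
points, so |J| has a positive lower bound there and the imaginary part cannot vanish for small ε. -/
theorem eventually_zeta_mem_slitPlane {K : Set Plane} (hK : IsCompact K) (hKG : K ⊆ C.G) :
    ∀ᶠ ε in 𝓝[>] (0 : ℝ), ∀ y ∈ K, C.zeta ε y ∈ Complex.slitPlane := by
  have hKD : K ⊆ C.D := hKG.trans C.G_subset
  have hd : ContinuousOn C.detP K := contDiffOn_detP.continuousOn.mono hKD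
  have hE : ContinuousOn C.mixedArea K := continuousOn_mixedArea.mono hKD
  have hc : ContinuousOn (jacDet C.X) K :=
    (contDiffOn_jacDet C.D_open C.contDiffOn_X).continuousOn.mono hKD
  have hR : ContinuousOn (jacDet C.P) K :=
    (contDiffOn_jacDet C.D_open C.contDiffOn_P).continuousOn.mono hKD
  obtain ⟨M, hM⟩ := hK.exists_bound_of_continuousOn hR
  have hK' : IsCompact {y ∈ K | C.detP y * C.mixedArea y ≤ 0} := by
    have := (hd.mul hE).preimage_isClosed_of_isClosed hK.isClosed (isClosed_Iic (a := (0 : ℝ)))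
    exact hK.of_isClosed_subset this inter_subset_left
  obtain ⟨c₀, hc₀, hc₀'⟩ := hK'.exists_forall_le' (hc.abs.mono (fun y hy => hy.1)) (a := 0)
    (fun y hy => abs_pos.2 fun h0 => absurd (mixedArea_pos (hKG hy.1) h0) (not_lt.2 hy.2))
  have hlim : Tendsto (fun ε : ℝ => ε ^ 2 * M) (𝓝[>] 0) (𝓝 0) := by
    have : Tendsto (fun ε : ℝ => ε ^ 2 * M) (𝓝 0) (𝓝 ((0 : ℝ) ^ 2 * M)) :=
      Continuous.tendsto (by fun_prop) 0
    simp only [ne_eq, OfNat.ofNat_ne_zero, not_false_eq_true, zero_pow, zero_mul] at this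
    exact this.mono_left nhdsWithin_le_nhds
  filter_upwards [hlim.eventually (gt_mem_nhds hc₀), self_mem_nhdsWithin] with ε hε hε0 y hy
  rw [Complex.mem_slitPlane_iff, zeta_eq (hKD hy), Complex.add_re, Complex.add_im,
    Complex.ofReal_re, Complex.ofReal_im, Complex.re_ofReal_mul, Complex.im_ofReal_mul,
    Complex.I_re, Complex.I_im, mul_zero, mul_one, zero_add, add_zero]
  by_cases h : C.detP y * C.mixedArea y ≤ 0
  · right
    have h1 := hc₀' y ⟨hy, h⟩
    have h2 : |ε ^ 2 * jacDet C.P y| ≤ ε ^ 2 * M := by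
      rw [abs_mul, abs_of_nonneg (sq_nonneg ε)]
      exact mul_le_mul_of_nonneg_left (hM y hy) (sq_nonneg ε)
    have h3 : jacDet C.X y - ε ^ 2 * jacDet C.P y ≠ 0 := by
      intro h0
      rw [sub_eq_zero] at h0
      rw [h0] at h1
      linarith
    exact mul_ne_zero (detP_ne_zero (hKG hy)) h3
  · left
    exact mul_pos (show (0 : ℝ) < ε from hε0) (not_le.1 h)

theorem continuousOn_zeta (ε : ℝ) : ContinuousOn (C.zeta ε) C.D := by
  have hd : ContinuousOn C.detP C.D := contDiffOn_detP.continuousOn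
  have hE : ContinuousOn C.mixedArea C.D := continuousOn_mixedArea
  have hc : ContinuousOn (jacDet C.X) C.D :=
    (contDiffOn_jacDet C.D_open C.contDiffOn_X).continuousOn
  have hR : ContinuousOn (jacDet C.P) C.D :=
    (contDiffOn_jacDet C.D_open C.contDiffOn_P).continuousOn
  have h1 : ContinuousOn (fun y => ε * (C.detP y * C.mixedArea y)) C.D :=
    continuousOn_const.mul (hd.mul hE)
  have h2 : ContinuousOn (fun y => C.detP y * (jacDet C.X y - ε ^ 2 * jacDet C.P y)) C.D :=
    hd.mul (hc.sub (continuousOn_const.mul hR))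
  refine ContinuousOn.congr ((Complex.continuous_ofReal.comp_continuousOn h1).add
    ((Complex.continuous_ofReal.comp_continuousOn h2).mul (continuousOn_const (c := Complex.I)))) fun y hy => ?_
  exact zeta_eq hy ε

/-- The limit iJd lies on the imaginary axis, where the argument is continuous. -/
theorem tendsto_arg_zeta (hy : y ∈ C.G) (hc : jacDet C.X y ≠ 0) :
    Tendsto (fun ε => (C.zeta ε y).arg) (𝓝[>] 0)
      (𝓝 (if jacDet C.X y * C.detP y < 0 then -(Real.pi / 2) else Real.pi / 2)) := by
  have hne := mul_ne_zero hc (detP_ne_zero hy)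
  have h1 : Tendsto (fun ε => C.zeta ε y) (𝓝[>] 0)
      (𝓝 (((jacDet C.X y * C.detP y : ℝ) : ℂ) * Complex.I)) := by
    have h2 : Tendsto (fun ε : ℝ => C.zeta ε y) (𝓝 0)
        (𝓝 (((0 * (C.detP y * C.mixedArea y) : ℝ) : ℂ) +
      ((C.detP y * (jacDet C.X y - 0 ^ 2 * jacDet C.P y) : ℝ) : ℂ) * Complex.I)) := by
      simp_rw [zeta_eq (C.G_subset hy)]
      refine Continuous.tendsto ?_ (0 : ℝ)
      fun_prop
    have h3 : ((0 * (C.detP y * C.mixedArea y) : ℝ) : ℂ) +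
        ((C.detP y * (jacDet C.X y - 0 ^ 2 * jacDet C.P y) : ℝ) : ℂ) * Complex.I =
        ((jacDet C.X y * C.detP y : ℝ) : ℂ) * Complex.I := by
      push_cast
      ring
    rw [h3] at h2
    exact h2.mono_left nhdsWithin_le_nhds
  have h4 : ((jacDet C.X y * C.detP y : ℝ) : ℂ) * Complex.I ∈ Complex.slitPlane := by
    rw [Complex.mem_slitPlane_iff]
    right
    rwa [Complex.im_ofReal_mul, Complex.I_im, mul_one]
  have h5 := (Complex.continuousAt_arg h4).tendsto.comp h1
  have h6 : (((jacDet C.X y * C.detP y : ℝ) : ℂ) * Complex.I).arg =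
      if jacDet C.X y * C.detP y < 0 then -(Real.pi / 2) else Real.pi / 2 := by
    split_ifs with h
    · rw [show ((jacDet C.X y * C.detP y : ℝ) : ℂ) * Complex.I =
        ((-(jacDet C.X y * C.detP y) : ℝ) : ℂ) * (-Complex.I) by push_cast; ring,
        Complex.arg_real_mul _ (neg_pos.2 h), Complex.arg_neg_I]
    · rw [Complex.arg_real_mul _ (lt_of_le_of_ne (not_lt.1 h) hne.symm), Complex.arg_I]
  rw [h6] at h5
  exact h5

/-- The increment of the argument of the complexified Jacobian along a path in the chart. -/
theorem eventually_increment {u₀ b : L.carrier} (δ : Path u₀ b)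
    (hδ : ∀ t, (δ t : Phase) ∈ C.r '' C.G) {y u : Plane} (hy : y ∈ C.G) (hyb : C.r y = b)
    (hu : u ∈ C.G) (huu : C.r u = u₀) :
    ∀ᶠ ε in 𝓝[>] (0 : ℝ), ∀ θ : unitInterval → ℝ, Continuous θ →
      (∀ t, ∃ ρ : ℝ, 0 < ρ ∧ L.IsJacobian ε (δ t : Phase) (ρ * Complex.exp (Complex.I * θ t))) →
      θ 1 - θ 0 = (C.zeta ε y).arg - (C.zeta ε u).arg := by
  set η : unitInterval → Plane := fun t => Function.invFunOn C.r C.D (δ t : Phase) with hη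
  have hηr : ∀ t, ∀ x ∈ C.G, C.r x = δ t → η t = x := by
    intro t x hx hxt
    have h3 : ∃ a ∈ C.D, C.r a = (δ t : Phase) := ⟨x, C.G_subset hx, hxt⟩
    exact C.param.injOn (Function.invFunOn_mem h3) (C.G_subset hx)
      ((Function.invFunOn_eq h3).trans hxt.symm)
  have hη' : ∀ t, η t ∈ C.G ∧ C.r (η t) = δ t := by
    intro t
    obtain ⟨x, hx, hxt⟩ := hδ t
    rw [hηr t x hx hxt]
    exact ⟨hx, hxt⟩
  have hηc : Continuous η := by
    refine continuous_iff_continuousAt.2 fun t => ?_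
    refine (C.param.eventually_invFunOn (C.G_subset (hη' t).1) ?_ ?_).1
    · rw [(hη' t).2]
      exact (continuous_subtype_val.comp δ.continuous).tendsto t
    · exact Eventually.of_forall fun s => (δ s).2
  have hη1 : η 1 = y := hηr 1 y hy (by simp [hyb])
  have hη0 : η 0 = u := hηr 0 u hu (by simp [huu])
  filter_upwards [eventually_zeta_mem_slitPlane (isCompact_range hηc)
    (range_subset_iff.2 fun t => (hη' t).1)] with ε hε θ hθ hJ
  have hζc : Continuous fun t => C.zeta ε (η t) :=
    (continuousOn_zeta ε).comp_continuous hηc fun t => C.G_subset (hη' t).1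
  have hargc : Continuous fun t => (C.zeta ε (η t)).arg :=
    continuous_iff_continuousAt.2 fun t => ContinuousAt.comp (f := fun t => C.zeta ε (η t))
      (g := Complex.arg) (Complex.continuousAt_arg (hε _ (mem_range_self t))) hζc.continuousAt
  -- ζ is a real multiple of i𝒥^ε, so twice the difference of the arguments is π modulo 2π; by
  -- continuity the difference is constant along the path.
  have hexp : ∀ t, Complex.exp (2 * Complex.I * ((C.zeta ε (η t)).arg - θ t : ℝ)) = -1 := by
    intro t
    obtain ⟨ρ, hρ, hρJ⟩ := hJ t
    have hD := C.G_subset (hη' t).1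
    have h1 := hρJ _ ⟨C.D, C.r, C.param, η t, hD, (hη' t).2, (1, 0), rfl⟩ _
      ⟨C.D, C.r, C.param, η t, hD, (hη' t).2, (0, 1), rfl⟩
    have h2 : C.zeta ε (η t) = ((C.detP (η t) * ρ * C.mu (η t) : ℝ) : ℂ) *
        Complex.exp (Complex.I * ((θ t + Real.pi / 2 : ℝ) : ℂ)) := by
      rw [zeta, h1, ← (hη' t).2]
      push_cast
      rw [mul_add, Complex.exp_add, show Complex.I * (Real.pi / 2 : ℂ) = Real.pi / 2 * Complex.I by ring,
        Complex.exp_pi_div_two_mul_I]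
      change _ * (_ * (C.mu (η t) : ℂ)) = _
      ring
    have h0 : C.zeta ε (η t) ≠ 0 := Complex.slitPlane_ne_zero (hε _ (mem_range_self t))
    have h3 : ((‖C.zeta ε (η t)‖ : ℝ) : ℂ) * Complex.exp (Complex.I * (C.zeta ε (η t)).arg) =
        ((C.detP (η t) * ρ * C.mu (η t) : ℝ) : ℂ) *
        Complex.exp (Complex.I * ((θ t + Real.pi / 2 : ℝ) : ℂ)) := by
      rw [mul_comm Complex.I, Complex.norm_mul_exp_arg_mul_I, h2]
    have h4 := exp_two_mul_eq (norm_pos_iff.2 h0) h3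
    have h5 : 2 * Complex.I * (((C.zeta ε (η t)).arg - θ t : ℝ) : ℂ) =
        2 * Complex.I * ((C.zeta ε (η t)).arg - ((θ t + Real.pi / 2 : ℝ) : ℂ)) +
          Real.pi * Complex.I := by
      push_cast
      ring
    rw [h5, Complex.exp_add, h4, Complex.exp_pi_mul_I, one_mul]
  have := eq_of_exp_const (hargc.sub hθ) (fun s t => (hexp s).trans (hexp t).symm) 1 0
  rw [Pi.sub_apply, Pi.sub_apply, hη1, hη0] at this
  linarith

/-- The Maslov indices of two points of the chart. -/
theorem pointIndex_sub {a₀ u₀ : L.carrier} (hu₀ : (u₀ : Phase) ∈ C.r '' C.G) {γ : Path a₀ u₀}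
    {y y' : Plane} (hy : y ∈ C.G) (hy' : y' ∈ C.G) (hc : jacDet C.X y ≠ 0)
    (hc' : jacDet C.X y' ≠ 0) {k k' : ℤ} (hk : L.HasPointIndex (C.r '' C.G) γ (C.r y) k)
    (hk' : L.HasPointIndex (C.r '' C.G) γ (C.r y') k') :
    k + (if jacDet C.X y * C.detP y < 0 then 1 else 0) =
      k' + (if jacDet C.X y' * C.detP y' < 0 then 1 else 0) := by
  obtain ⟨u, hu, huu⟩ := hu₀
  obtain ⟨b, δ, hb, hδ, Θ, hΘ, hlim⟩ := hk
  obtain ⟨b', δ', hb', hδ', Θ', hΘ', hlim'⟩ := hk'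
  -- `h1` and `h2` run through the two halves of the concatenated path: along γ, and inside the
  -- chart.
  let h1 : unitInterval → unitInterval := fun s =>
    ⟨(s : ℝ) / 2, by constructor <;> linarith [s.2.1, s.2.2]⟩
  let h2 : unitInterval → unitInterval := fun s =>
    ⟨((s : ℝ) + 1) / 2, by constructor <;> linarith [s.2.1, s.2.2]⟩
  have h1c : Continuous h1 := by
    refine Continuous.subtype_mk ?_ _
    fun_prop
  have h2c : Continuous h2 := by
    refine Continuous.subtype_mk ?_ _
    fun_prop
  have e1 : ∀ {b : L.carrier} (δ : Path u₀ b) (s : unitInterval), (γ.trans δ) (h1 s) = γ s := by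
    intro b δ s
    rw [Path.trans_apply, dif_pos (by change (s : ℝ) / 2 ≤ 1 / 2; linarith [s.2.2])]
    congr 1
    exact Subtype.ext (by change 2 * ((s : ℝ) / 2) = s; ring)
  have e2 : ∀ {b : L.carrier} (δ : Path u₀ b) (s : unitInterval), (γ.trans δ) (h2 s) = δ s := by
    intro b δ s
    rw [Path.trans_apply]
    split_ifs with h
    · have hs : (s : ℝ) = 0 := by
        have h' : ((s : ℝ) + 1) / 2 ≤ 1 / 2 := h
        linarith [s.2.1]
      have hs' : s = 0 := Subtype.ext hs
      subst hs'
      rw [δ.source]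
      refine (congrArg γ ?_).trans γ.target
      exact Subtype.ext (by change 2 * ((((0 : unitInterval) : ℝ) + 1) / 2) = 1; simp)
    · congr 1
      exact Subtype.ext (by change 2 * (((s : ℝ) + 1) / 2) - 1 = s; ring)
  have z1 : h1 0 = 0 := Subtype.ext (by change ((0 : unitInterval) : ℝ) / 2 = _; simp)
  have z2 : h2 1 = 1 := Subtype.ext (by change (((1 : unitInterval) : ℝ) + 1) / 2 = _; simp)
  have z3 : h1 1 = h2 0 :=
    Subtype.ext (by change ((1 : unitInterval) : ℝ) / 2 = (((0 : unitInterval) : ℝ) + 1) / 2; simp)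
  have hev : ∀ᶠ ε in 𝓝[>] (0 : ℝ), (Θ ε 1 - Θ ε 0) / Real.pi - (Θ' ε 1 - Θ' ε 0) / Real.pi =
      ((C.zeta ε y).arg - (C.zeta ε y').arg) / Real.pi := by
    filter_upwards [eventually_increment δ hδ hy hb.symm hu huu,
      eventually_increment δ' hδ' hy' hb'.symm hu huu, self_mem_nhdsWithin] with ε i1 i2 hε
    have j1 := i1 (fun t => Θ ε (h2 t)) ((Θ ε).continuous.comp h2c) fun t => by
      have := hΘ ε hε (h2 t)
      rwa [e2] at this
    have j2 := i2 (fun t => Θ' ε (h2 t)) ((Θ' ε).continuous.comp h2c) fun t => by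
      have := hΘ' ε hε (h2 t)
      rwa [e2] at this
    -- Along γ both are continuous arguments of the same number, so they differ by a constant and
    -- have equal increments.
    have hexp : ∀ t, Complex.exp (2 * Complex.I * (Θ ε (h1 t) - Θ' ε (h1 t) : ℝ)) = 1 := by
      intro t
      obtain ⟨ρ, hρ, hρJ⟩ := hΘ ε hε (h1 t)
      obtain ⟨ρ', -, hρJ'⟩ := hΘ' ε hε (h1 t)
      rw [e1] at hρJ hρJ'
      push_cast
      exact exp_two_mul_eq hρ (LagrangianSurface.isJacobian_unique (γ t).2 hρJ hρJ')
    have j3 := eq_of_exp_const (((Θ ε).continuous.comp h1c).sub ((Θ' ε).continuous.comp h1c))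
      (fun s t => (hexp s).trans (hexp t).symm) 1 0
    rw [Pi.sub_apply, Pi.sub_apply] at j3
    simp only [Function.comp_apply, z1, z2, z3] at j1 j2 j3
    rw [← sub_div]
    congr 1
    linarith
  have hl := (hlim.sub hlim').congr' hev
  have hl' := ((tendsto_arg_zeta hy hc).sub (tendsto_arg_zeta hy' hc')).div_const Real.pi
  have huniq := tendsto_nhds_unique hl hl'
  have hpi := Real.pi_ne_zero
  split_ifs at huniq ⊢ with s1 s2 s2
  · rw [sub_self, zero_div] at huniq
    have : (k : ℝ) = k' := by linarith
    exact_mod_cast congrArg (· + (1 : ℝ)) this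
  · have h3 : (-(Real.pi / 2) - Real.pi / 2) / Real.pi = -1 := by field_simp; ring
    rw [h3] at huniq
    have : (k : ℝ) + 1 = k' + 0 := by linarith
    exact_mod_cast this
  · have h3 : (Real.pi / 2 - -(Real.pi / 2)) / Real.pi = 1 := by field_simp; ring
    rw [h3] at huniq
    have : (k : ℝ) + 0 = k' + 1 := by linarith
    exact_mod_cast this
  · rw [sub_self, zero_div] at huniq
    have : (k : ℝ) = k' := by linarith
    exact_mod_cast congrArg (· + (0 : ℝ)) this

end SingularChart

end

/-! ### Negative indices of inertia in the standard charts. -/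

section

/-- The negative index of a quadratic form on a line. -/
theorem sigNeg_of_span {M : Type*} [AddCommGroup M] [Module ℝ M] (Q : QuadraticForm ℝ M) {v : M}
    (hv : v ≠ 0) (hs : ∀ x, ∃ t : ℝ, x = t • v) : sigNeg Q = if Q v < 0 then 1 else 0 := by
  have hfr : Module.finrank ℝ M = 1 :=
    finrank_eq_one v hv fun x => (hs x).imp fun t ht => ht.symm
  have hfin : Module.Finite ℝ M := Module.finite_of_finrank_pos (by omega)
  have hle : sigNeg Q ≤ 1 := hfr ▸ sigPos_le_finrank (-Q)
  split_ifs with h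
  · refine le_antisymm hle ?_
    have hp : ((-Q).restrict (⊤ : Submodule ℝ M)).PosDef := by
      intro x hx
      obtain ⟨t, ht⟩ := hs x
      have ht0 : t ≠ 0 := by
        rintro rfl
        exact hx (Subtype.ext (by simpa using ht))
      change 0 < -Q x
      rw [ht, QuadraticMap.map_smul, smul_eq_mul]
      have := mul_self_pos.2 ht0
      nlinarith
    have := le_sigNeg_of_negDef Q hp
    rwa [finrank_top, hfr] at this
  · obtain ⟨V, hV, hp⟩ := exists_finrank_eq_sigNeg_and_negDef Q
    by_contra hne
    have hpos : 0 < Module.finrank ℝ V := by omega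
    have : Nontrivial V := Module.finrank_pos_iff.1 hpos
    obtain ⟨x, hx⟩ := exists_ne (0 : V)
    have h1 := hp x hx
    obtain ⟨t, ht⟩ := hs x
    change 0 < -Q x at h1
    rw [ht, QuadraticMap.map_smul, smul_eq_mul] at h1
    nlinarith [mul_self_nonneg t]

/-- The negative index of a quadratic form with an orthogonal basis of two vectors. -/
theorem sigNeg_of_orthogonal {M : Type*} [AddCommGroup M] [Module ℝ M] (Q : QuadraticForm ℝ M)
    (e : (Fin 2 → ℝ) ≃ₗ[ℝ] M) {α β : ℝ} (he : ∀ x, Q (e x) = α * (x 0 * x 0) + β * (x 1 * x 1)) :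
    sigNeg Q = (if α < 0 then 1 else 0) + (if β < 0 then 1 else 0) := by
  have hQ : QuadraticMap.Equivalent Q (QuadraticMap.weightedSumSquares ℝ ![α, β]) := by
    refine ⟨⟨e.symm, fun m => ?_⟩⟩
    have := he (e.symm m)
    rw [LinearEquiv.apply_symm_apply] at this
    rw [this]
    simp [QuadraticMap.weightedSumSquares_apply]
  rw [QuadraticForm.sigNeg_of_equiv_weightedSumSquares hQ]
  have : {i : Fin 2 | ![α, β] i < 0} =
      ((Finset.univ.filter fun i : Fin 2 => ![α, β] i < 0 : Finset (Fin 2)) : Set (Fin 2)) := by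
    ext
    simp
  rw [this, Set.ncard_coe_finset, Finset.card_filter, Fin.sum_univ_two]
  by_cases h1 : α < 0 <;> by_cases h2 : β < 0 <;> simp [h1, h2]

namespace SingularChart

variable {L : LagrangianSurface} {C : SingularChart L} {y : Plane}

/-- At a regular point only the zero tangent vector keeps all positions fixed. -/
theorem negIndex_position (hc : jacDet C.X y ≠ 0) : C.negIndex .position y = 0 := by
  refine Nat.le_zero.1 ((sigPos_le_finrank _).trans ?_)
  have : (ChartType.position.fixedPos.comap (fderiv ℝ C.X y : Plane →ₗ[ℝ] Plane)) = ⊥ := by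
    rw [eq_bot_iff]
    intro w hw
    have h0 : fderiv ℝ C.X y w = 0 := hw
    rw [fderiv_plane] at h0
    have h1 := congrArg Prod.fst h0
    have h2 := congrArg Prod.snd h0
    simp only [Prod.fst_add, Prod.snd_add, Prod.smul_fst, Prod.smul_snd, smul_eq_mul,
      Prod.fst_zero, Prod.snd_zero] at h1 h2
    have e1 : jacDet C.X y * w.1 = 0 := by
      simp only [jacDet, det2]
      linear_combination (fderiv ℝ C.X y (0, 1)).2 * h1 - (fderiv ℝ C.X y (0, 1)).1 * h2
    have e2 : jacDet C.X y * w.2 = 0 := by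
      simp only [jacDet, det2]
      linear_combination (fderiv ℝ C.X y (1, 0)).1 * h2 - (fderiv ℝ C.X y (1, 0)).2 * h1
    exact Prod.ext ((mul_eq_zero.1 e1).resolve_left hc) ((mul_eq_zero.1 e2).resolve_left hc)
  rw [this, finrank_bot]

/-- The vectors with ⟨f₁, dX⟩ = 0 form a line, spanned by `w` below. The components ⟨f₂, dX w⟩ and
⟨f₂, dP w⟩ are the two Jacobians, so the form has the value JQ at `w`. -/
theorem negIndex_mixed (hy : y ∈ C.D) {θ : ℝ} (hQ : jacDet (C.stdCoord (.mixed θ)) y ≠ 0) :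
    C.negIndex (.mixed θ) y =
      if jacDet C.X y * jacDet (C.stdCoord (.mixed θ)) y < 0 then 1 else 0 := by
  have hJ := jacDet_mixed hy θ
  set Q := jacDet (C.stdCoord (.mixed θ)) y
  set a := fderiv ℝ C.X y (1, 0) with ha
  set b := fderiv ℝ C.X y (0, 1) with hb
  set e := fderiv ℝ C.P y (1, 0) with he
  set g := fderiv ℝ C.P y (0, 1) with hg
  set w : Plane := (-dot (frame₁ θ) b, dot (frame₁ θ) a) with hw
  have hXw : fderiv ℝ C.X y w = w.1 • a + w.2 • b := fderiv_plane _ _ _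
  have hPw : fderiv ℝ C.P y w = w.1 • e + w.2 • g := fderiv_plane _ _ _
  have hmem : ∀ v : Plane, v ∈ (ChartType.mixed θ).fixedPos.comap
      (fderiv ℝ C.X y : Plane →ₗ[ℝ] Plane) ↔
      v.1 * dot (frame₁ θ) a + v.2 * dot (frame₁ θ) b = 0 := by
    intro v
    have h1 : v ∈ (ChartType.mixed θ).fixedPos.comap (fderiv ℝ C.X y : Plane →ₗ[ℝ] Plane) ↔
      dot (frame₁ θ) (fderiv ℝ C.X y v) = 0 := Iff.rfl
    rw [h1, fderiv_plane C.X y v]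
    have : dot (frame₁ θ) (v.1 • a + v.2 • b) =
        v.1 * dot (frame₁ θ) a + v.2 * dot (frame₁ θ) b := by
      simp [dot]
      ring
    rw [this]
  have hne : w ≠ 0 := by
    intro h0
    have h1 := congrArg Prod.fst h0
    have h2 := congrArg Prod.snd h0
    simp only [hw, Prod.fst_zero, Prod.snd_zero, neg_eq_zero] at h1 h2
    rw [h1, h2] at hJ
    exact hQ (by simpa using hJ)
  have hwmem := (hmem w).2 (by simp only [hw]; ring)
  have key := sigNeg_of_span ((C.tangentForm y).restrict ((ChartType.mixed θ).fixedPos.comap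
      (fderiv ℝ C.X y : Plane →ₗ[ℝ] Plane))) (v := ⟨w, hwmem⟩)
      (fun h => hne (congrArg Subtype.val h)) (by
    rintro ⟨v, hv⟩
    rw [hmem] at hv
    refine ⟨(v.2 * dot (frame₂ θ) g + v.1 * dot (frame₂ θ) e) / Q, Subtype.ext ?_⟩
    change v = ((v.2 * dot (frame₂ θ) g + v.1 * dot (frame₂ θ) e) / Q) • w
    refine Prod.ext ?_ ?_
    · simp only [hw, Prod.smul_fst, smul_eq_mul]
      rw [div_mul_eq_mul_div, eq_div_iff hQ, hJ]
      linear_combination dot (frame₂ θ) g * hv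
    · simp only [hw, Prod.smul_snd, smul_eq_mul]
      rw [div_mul_eq_mul_div, eq_div_iff hQ, hJ]
      linear_combination -dot (frame₂ θ) e * hv)
  have hval : (C.tangentForm y).restrict ((ChartType.mixed θ).fixedPos.comap
      (fderiv ℝ C.X y : Plane →ₗ[ℝ] Plane)) ⟨w, hwmem⟩ = jacDet C.X y * Q := by
    change dot (fderiv ℝ C.X y w) (fderiv ℝ C.P y w) = _
    rw [hXw, hPw, ← dot_toFrame θ]
    have h3 := det2_toFrame θ a b
    have h4 : jacDet C.X y = det2 a b := rfl
    rw [h4, ← h3, hJ]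
    simp only [toFrame_apply, det2, hw]
    simp only [dot, Prod.fst_add, Prod.snd_add, Prod.smul_fst, Prod.smul_snd, smul_eq_mul]
    ring
  rw [hval] at key
  exact key

/-- Completing the square: ⟨X_ψ, P_ψ⟩ = Jd ≠ 0, so with β = ⟨P_τ, X_ψ⟩ the vectors ∂_ψ and Jd ∂_τ −
β ∂_ψ form an orthogonal basis, with values Jd and J² d det(P_τ, P_ψ). -/
theorem negIndex_momentum (hy : y ∈ C.G) (hc : jacDet C.X y ≠ 0) :
    C.negIndex .momentum y = (if jacDet C.X y * C.detP y < 0 then 1 else 0) +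
      (if C.detP y * jacDet C.P y < 0 then 1 else 0) := by
  have hD := C.G_subset hy
  have hd := detP_ne_zero hy
  have hl := dot_fderiv_symm hD (1, 0) (0, 1)
  have hb' := eq_smul_rotate (dot_P_fderiv_X hD (1, 0)) (dot_P_fderiv_X hD (0, 1))
  have hcdef : jacDet C.X y = det2 (fderiv ℝ C.X y (1, 0)) (fderiv ℝ C.X y (0, 1)) := rfl
  have hddef : C.detP y = det2 (C.P y) (fderiv ℝ C.P y (0, 1)) := rfl
  have hRdef : jacDet C.P y = det2 (fderiv ℝ C.P y (1, 0)) (fderiv ℝ C.P y (0, 1)) := rfl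
  set a := fderiv ℝ C.X y (1, 0) with ha
  set b := fderiv ℝ C.X y (0, 1) with hb
  set e := fderiv ℝ C.P y (1, 0) with he
  set g := fderiv ℝ C.P y (0, 1) with hg
  have hδ : dot b g = jacDet C.X y * C.detP y := by
    rw [hddef, hcdef]
    conv_lhs => rw [hb']
    simp only [dot, det2]
    ring
  set c := jacDet C.X y
  set d := C.detP y
  set β := dot e b with hβ
  have hcd : c * d ≠ 0 := mul_ne_zero hc hd
  have htop : ∀ v : Plane, v ∈ ChartType.momentum.fixedPos.comap
      (fderiv ℝ C.X y : Plane →ₗ[ℝ] Plane) := fun v => trivial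
  let E : (Fin 2 → ℝ) ≃ₗ[ℝ] (ChartType.momentum.fixedPos.comap
      (fderiv ℝ C.X y : Plane →ₗ[ℝ] Plane)) :=
    { toFun := fun x => ⟨(c * d * x 1, x 0 - β * x 1), htop _⟩
      invFun := fun v => ![(v : Plane).2 + β * ((v : Plane).1 / (c * d)), (v : Plane).1 / (c * d)]
      map_add' := fun x x' => Subtype.ext (by
        refine Prod.ext ?_ ?_ <;> simp <;> ring)
      map_smul' := fun t x => Subtype.ext (by
        refine Prod.ext ?_ ?_ <;> simp <;> ring)
      left_inv := fun x => by
        ext i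
        fin_cases i
        · simp only [Fin.zero_eta, Matrix.cons_val_zero]
          rw [mul_div_cancel_left₀ _ hcd]
          ring
        · simp only [Fin.mk_one, Matrix.cons_val_one, Matrix.cons_val_fin_one]
          rw [mul_div_cancel_left₀ _ hcd]
      right_inv := fun v => Subtype.ext (by
        refine Prod.ext ?_ ?_
        · simp only [Matrix.cons_val_one, Matrix.cons_val_fin_one]
          rw [mul_div_cancel₀ _ hcd]
        · simp) }
  have key := sigNeg_of_orthogonal ((C.tangentForm y).restrict
    (ChartType.momentum.fixedPos.comap (fderiv ℝ C.X y : Plane →ₗ[ℝ] Plane))) E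
    (α := c * d) (β := c ^ 2 * (d * jacDet C.P y)) (fun x => by
      change dot (fderiv ℝ C.X y (c * d * x 1, x 0 - β * x 1))
        (fderiv ℝ C.P y (c * d * x 1, x 0 - β * x 1)) = _
      rw [fderiv_plane C.X, fderiv_plane C.P]
      change dot ((c * d * x 1) • a + (x 0 - β * x 1) • b)
        ((c * d * x 1) • e + (x 0 - β * x 1) • g) = _
      have h1 : dot ((c * d * x 1) • a + (x 0 - β * x 1) • b)
        ((c * d * x 1) • e + (x 0 - β * x 1) • g) = (c * d * x 1) ^ 2 * dot a e +
          (c * d * x 1) * (x 0 - β * x 1) * (dot g a + β) + (x 0 - β * x 1) ^ 2 * dot b g := by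
        simp only [hβ, dot, Prod.fst_add, Prod.snd_add, Prod.smul_fst, Prod.smul_snd, smul_eq_mul]
        ring
      have h2 : dot a e * dot b g - dot g a * β = c * jacDet C.P y := by
        rw [hcdef, hRdef, hβ]
        simp only [dot, det2]
        ring
      rw [h1, ← hl]
      rw [← hl, hδ] at h2
      rw [hδ]
      linear_combination (c * d * x 1 ^ 2) * h2)
  have hs : (c ^ 2 * (d * jacDet C.P y) < 0) ↔ d * jacDet C.P y < 0 := by
    have h2 : 0 < c ^ 2 := by positivity
    constructor
    · intro h
      by_contra h'
      exact absurd (mul_nonneg h2.le (not_lt.1 h')) (not_le.2 h)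
    · exact mul_neg_of_pos_of_neg h2
  simp only [hs] at key
  exact key

end SingularChart

end

/-! ### Local inverses and the standard integrand in local coordinates. -/

section

/-- `Y` is a smooth map whose restriction to the open set `O` is inverse to the restriction of the
continuous map `f` to the open set `V`. -/
structure LocalInverse {E F : Type*} [NormedAddCommGroup E] [NormedSpace ℝ E]
    [NormedAddCommGroup F] [NormedSpace ℝ F] (f : E → F) (Y : F → E) (V : Set E) (O : Set F) :
    Prop where
  isOpen_source : IsOpen V
  isOpen_target : IsOpen O
  continuousOn : ContinuousOn f V
  smooth : ContDiff ℝ ∞ Y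
  mapsTo : MapsTo f V O
  mapsTo_inv : MapsTo Y O V
  left_inv : ∀ y ∈ V, Y (f y) = y
  right_inv : ∀ q ∈ O, f (Y q) = q

namespace LocalInverse

section General

variable {E F : Type*} [NormedAddCommGroup E] [NormedSpace ℝ E]
  [NormedAddCommGroup F] [NormedSpace ℝ F] {f : E → F} {Y : F → E} {V : Set E} {O : Set F}

theorem restrict_source (h : LocalInverse f Y V O) {V' : Set E} (hV' : IsOpen V') :
    LocalInverse f Y (V ∩ V') (O ∩ Y ⁻¹' V') where
  isOpen_source := h.isOpen_source.inter hV'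
  isOpen_target := h.isOpen_target.inter (hV'.preimage h.smooth.continuous)
  continuousOn := h.continuousOn.mono inter_subset_left
  smooth := h.smooth
  mapsTo := fun y hy => ⟨h.mapsTo hy.1, by rw [mem_preimage, h.left_inv y hy.1]; exact hy.2⟩
  mapsTo_inv := fun _ hq => ⟨h.mapsTo_inv hq.1, hq.2⟩
  left_inv := fun y hy => h.left_inv y hy.1
  right_inv := fun q hq => h.right_inv q hq.1

theorem restrict_target (h : LocalInverse f Y V O) {O' : Set F} (hO' : IsOpen O') :
    LocalInverse f Y (V ∩ f ⁻¹' O') (O ∩ O') where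
  isOpen_source := h.continuousOn.isOpen_inter_preimage h.isOpen_source hO'
  isOpen_target := h.isOpen_target.inter hO'
  continuousOn := h.continuousOn.mono inter_subset_left
  smooth := h.smooth
  mapsTo := fun _ hy => ⟨h.mapsTo hy.1, hy.2⟩
  mapsTo_inv := fun q hq => ⟨h.mapsTo_inv hq.1, by rw [mem_preimage, h.right_inv q hq.1]; exact hq.2⟩
  left_inv := fun y hy => h.left_inv y hy.1
  right_inv := fun q hq => h.right_inv q hq.1

/-- The transport of a test function by a local diffeomorphism, extended by zero. -/
theorem push (h : LocalInverse f Y V O) {B : E → ℂ} (hB : TestFun V B) :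
    TestFun O (O.indicator fun q => B (Y q)) := by
  have hK : IsCompact (f '' tsupport B) :=
    hB.compact.isCompact.image_of_continuousOn (h.continuousOn.mono hB.subset)
  have hs : tsupport (O.indicator fun q => B (Y q)) ⊆ f '' tsupport B := by
    refine closure_minimal (fun q hq => ?_) hK.isClosed
    have hqO : q ∈ O := by
      by_contra hn
      exact hq (indicator_of_notMem hn _)
    refine ⟨Y q, subset_tsupport B fun h0 => hq ?_, h.right_inv q hqO⟩
    rw [indicator_of_mem hqO, h0]
  have hKO : f '' tsupport B ⊆ O := by
    rintro _ ⟨y, hy, rfl⟩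
    exact h.mapsTo (hB.subset hy)
  refine ⟨contDiff_iff_contDiffAt.2 fun q => ?_, hK.of_isClosed_subset (isClosed_tsupport _) hs,
    hs.trans hKO⟩
  by_cases hq : q ∈ O
  · have h1 : (O.indicator fun q => B (Y q)) =ᶠ[𝓝 q] fun q => B (Y q) := by
      filter_upwards [h.isOpen_target.mem_nhds hq] with x hx using indicator_of_mem hx _
    exact (hB.smooth.comp h.smooth).contDiffAt.congr_of_eventuallyEq h1
  · have h1 : (O.indicator fun q => B (Y q)) =ᶠ[𝓝 q] fun _ => 0 := by
      filter_upwards [hK.isClosed.isOpen_compl.mem_nhds fun hn => hq (hKO hn)] with x hx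
      exact image_eq_zero_of_notMem_tsupport fun hn => hx (hs hn)
    exact contDiffAt_const.congr_of_eventuallyEq h1

theorem fderiv_comp (h : LocalInverse f Y V O) {q : F} (hq : q ∈ O)
    (hf : DifferentiableAt ℝ f (Y q)) (w : F) : fderiv ℝ f (Y q) (fderiv ℝ Y q w) = w := by
  have h1 := hf.hasFDerivAt.comp q ((h.smooth.differentiable (by simp)) q).hasFDerivAt
  have h2 : (f ∘ Y) =ᶠ[𝓝 q] id := by
    filter_upwards [h.isOpen_target.mem_nhds hq] with x hx using h.right_inv x hx
  have h3 := h1.unique ((hasFDerivAt_id q).congr_of_eventuallyEq h2)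
  exact congrArg (fun l => l w) h3

end General

end LocalInverse

theorem exists_equiv_of_jacDet {f : Plane → Plane} {y : Plane} (hJ : jacDet f y ≠ 0) :
    ∃ e : Plane ≃L[ℝ] Plane, (e : Plane →L[ℝ] Plane) = fderiv ℝ f y := by
  have hinj : Function.Injective (fderiv ℝ f y : Plane →ₗ[ℝ] Plane) := by
    rw [← LinearMap.ker_eq_bot, eq_bot_iff]
    intro w hw
    have h0 : fderiv ℝ f y w = 0 := hw
    rw [fderiv_plane] at h0
    have h1 := congrArg Prod.fst h0
    have h2 := congrArg Prod.snd h0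
    simp only [Prod.fst_add, Prod.snd_add, Prod.smul_fst, Prod.smul_snd, smul_eq_mul,
      Prod.fst_zero, Prod.snd_zero] at h1 h2
    have e1 : jacDet f y * w.1 = 0 := by
      simp only [jacDet, det2]
      linear_combination (fderiv ℝ f y (0, 1)).2 * h1 - (fderiv ℝ f y (0, 1)).1 * h2
    have e2 : jacDet f y * w.2 = 0 := by
      simp only [jacDet, det2]
      linear_combination (fderiv ℝ f y (1, 0)).1 * h2 - (fderiv ℝ f y (1, 0)).2 * h1
    exact Prod.ext ((mul_eq_zero.1 e1).resolve_left hJ) ((mul_eq_zero.1 e2).resolve_left hJ)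
  exact ⟨(LinearEquiv.ofInjectiveEndo _ hinj).toContinuousLinearEquiv,
    ContinuousLinearMap.ext fun w => rfl⟩

/-- The inverse is smooth only on the target of the inverse function theorem; it is replaced by a
smooth map of the whole plane equal to it near the image of the point, and the domains are shrunk
accordingly. -/
theorem exists_localInverse {f : Plane → Plane} {U : Set Plane} (hU : IsOpen U)
    (hf : ContDiffOn ℝ ∞ f U) {y₀ : Plane} (hy₀ : y₀ ∈ U) (hJ : jacDet f y₀ ≠ 0) :
    ∃ (Y : Plane → Plane) (V O : Set Plane), LocalInverse f Y V O ∧ V ⊆ U ∧ y₀ ∈ V := by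
  have hfat : ∀ y ∈ U, ContDiffAt ℝ ∞ f y := fun y hy => hf.contDiffAt (hU.mem_nhds hy)
  obtain ⟨e, he⟩ := exists_equiv_of_jacDet hJ
  have hd : HasFDerivAt f (e : Plane →L[ℝ] Plane) y₀ := by
    rw [he]
    exact ((hfat y₀ hy₀).differentiableAt (by simp)).hasFDerivAt
  have hU' : IsOpen (U ∩ {y | jacDet f y ≠ 0}) :=
    (SingularChart.contDiffOn_jacDet hU hf).continuousOn.isOpen_inter_preimage hU isOpen_ne
  set φ := ((hfat y₀ hy₀).toOpenPartialHomeomorph f hd (by simp)).restrOpen _ hU' with hφ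
  have hφf : ∀ y, φ y = f y := fun y => rfl
  have hsrc : φ.source ⊆ U ∩ {y | jacDet f y ≠ 0} := fun y hy => hy.2
  have hy₀s : y₀ ∈ φ.source :=
    ⟨ContDiffAt.mem_toOpenPartialHomeomorph_source (hfat y₀ hy₀) hd (by simp), hy₀, hJ⟩
  have hsymm : ContDiffOn ℝ ∞ φ.symm φ.target := by
    intro q hq
    have hq' := hsrc (φ.map_target hq)
    obtain ⟨e', he'⟩ := exists_equiv_of_jacDet hq'.2
    refine (φ.contDiffAt_symm hq (f₀' := e') ?_ (hfat _ hq'.1)).contDiffWithinAt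
    rw [he']
    exact ((hfat _ hq'.1).differentiableAt (by simp)).hasFDerivAt
  obtain ⟨Y, hY, hYe⟩ := exists_smooth_extension φ.open_target hsymm (φ.map_source hy₀s)
  obtain ⟨N, hNe, hN, hNy⟩ := eventually_nhds_iff.1 hYe
  refine ⟨Y, φ.source ∩ φ ⁻¹' N, φ.target ∩ N, ⟨φ.isOpen_inter_preimage hN, φ.open_target.inter hN,
    φ.continuousOn.mono inter_subset_left, hY, fun y hy => ⟨φ.map_source hy.1, hy.2⟩,
    fun q hq => ?_, fun y hy => ?_, fun q hq => ?_⟩, fun y hy => (hsrc hy.1).1, hy₀s, hNy⟩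
  · rw [hNe q hq.2]
    exact ⟨φ.map_target hq.1, by rw [mem_preimage, φ.right_inv hq.1]; exact hq.2⟩
  · rw [← hφf, hNe _ hy.2, φ.left_inv hy.1]
  · rw [hNe q hq.2, ← hφf, φ.right_inv hq.1]

theorem contDiffOn_sqrt_abs {E : Type*} [NormedAddCommGroup E] [NormedSpace ℝ E] {f : E → ℝ}
    {U : Set E} (hf : ContDiffOn ℝ ∞ f U) (h0 : ∀ x ∈ U, f x ≠ 0) :
    ContDiffOn ℝ ∞ (fun x => Real.sqrt |f x|) U := by
  intro x hx
  exact ((contDiffAt_abs (h0 x hx)).comp_contDiffWithinAt x (hf x hx)).sqrt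
    (abs_pos.2 (h0 x hx)).ne'

namespace SingularChart

variable {L : LagrangianSurface} {C : SingularChart L}

/-- The amplitude of the standard operator as a function on the coordinate plane `(τ, ψ)`. -/
def stdAmp (C : SingularChart L) (κ : ChartType) (A : Plane → ℂ) (y : Plane) : ℂ :=
  (Real.sqrt |C.mu y / jacDet (C.stdCoord κ) y| : ℂ) * A y

theorem testFun_stdAmp {κ : ChartType} {V : Set Plane} (hV : IsOpen V) (hVD : V ⊆ C.D)
    (hJ : ∀ y ∈ V, jacDet (C.stdCoord κ) y ≠ 0) {A : Plane → ℂ} (hA : TestFun V A) :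
    TestFun V (C.stdAmp κ A) := by
  refine hA.mul_realOn hV (contDiffOn_sqrt_abs (ContDiffOn.div (contDiffOn_mu.mono hVD)
    ((contDiffOn_jacDet C.D_open (contDiffOn_stdCoord κ)).mono hVD) hJ) fun y hy => ?_)
  exact div_ne_zero (mu_ne_zero (hVD hy)) (hJ y hy)

/-- The set-theoretic inverse in the definition is traded for a smooth local one on the support of
the amplitude. The injection ℓ admits coordinates that differ from the prescribed ones by a rotation
or a change of order. -/
theorem stdIntegrand_eq {κ : ChartType} {V' : Set Plane} (hV' : InjOn (C.stdCoord κ) V')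
    {f Y ℓ : Plane → Plane} {V O : Set Plane} (hf : LocalInverse f Y V O)
    (hℓ : Function.Injective ℓ) (hc : ∀ y ∈ V', C.stdCoord κ y = ℓ (f y)) {A : Plane → ℂ}
    (hA : TestFun V A) (hAV' : Function.support A ⊆ V') (h : ℝ) (phase : Plane → ℝ) (q : Plane) :
    C.stdIntegrand κ V' A h phase (ℓ q) =
      osc h ((Y q).1 + phase (Y q)) * O.indicator (fun q => C.stdAmp κ A (Y q)) q := by
  have hinv : ∀ y ∈ V', C.stdInv κ V' (C.stdCoord κ y) = y := fun y hy =>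
    hV' (Function.invFunOn_mem ⟨y, hy, rfl⟩) hy (Function.invFunOn_eq ⟨y, hy, rfl⟩)
  by_cases hq : q ∈ O ∧ A (Y q) ≠ 0
  · have hy := hAV' hq.2
    have e1 : ℓ q = C.stdCoord κ (Y q) := by rw [hc _ hy, hf.right_inv q hq.1]
    rw [indicator_of_mem hq.1, stdIntegrand, indicator_of_mem (e1 ▸ mem_image_of_mem _ hy), e1]
    simp only [hinv _ hy, stdAmp, osc]
    ring
  · have h0 : O.indicator (fun q => C.stdAmp κ A (Y q)) q = 0 := by
      by_cases hqO : q ∈ O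
      · have hA0 : A (Y q) = 0 := by_contra fun h0 => hq ⟨hqO, h0⟩
        rw [indicator_of_mem hqO, stdAmp, hA0, mul_zero]
      · exact indicator_of_notMem hqO _
    rw [h0, mul_zero, stdIntegrand]
    by_cases hm : ℓ q ∈ C.stdCoord κ '' V'
    · obtain ⟨y, hy, hyq⟩ := hm
      rw [← hyq, indicator_of_mem (mem_image_of_mem _ hy)]
      have : A y = 0 := by
        rw [hc y hy] at hyq
        have hyq' := hℓ hyq
        by_contra hA0
        have hyV : y ∈ V := by_contra fun hyV => hA0 (hA.eq_zero hyV)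
        refine hq ⟨hyq' ▸ hf.mapsTo hyV, ?_⟩
        rwa [← hyq', hf.left_inv y hyV]
      simp only [hinv _ hy, this]
      simp
    · exact indicator_of_notMem hm _

end SingularChart

end

/-! ### Rotations, fibrewise substitutions, and mixed charts with their generating function. -/

section

section Rotation

theorem det_ofFrame (θ : ℝ) : LinearMap.det (ofFrame θ : Plane →ₗ[ℝ] Plane) = 1 := by
  rw [← LinearMap.det_toMatrix (Module.Basis.finTwoProd ℝ), Matrix.det_fin_two]
  simp only [LinearMap.toMatrix_apply, Module.Basis.finTwoProd_zero, Module.Basis.finTwoProd_one,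
    ContinuousLinearMap.coe_coe, ofFrame_apply]
  simp [frame₁, frame₂]
  nlinarith [Real.sin_sq_add_cos_sq θ]

theorem measurePreserving_ofFrame (θ : ℝ) :
    MeasurePreserving (ofFrame θ) (volume : Measure Plane) volume := by
  refine ⟨(ofFrame θ).continuous.measurable, ?_⟩
  have h := Measure.map_linearMap_addHaar_eq_smul_addHaar (volume : Measure Plane)
    (f := (ofFrame θ : Plane →ₗ[ℝ] Plane)) (by rw [det_ofFrame]; exact one_ne_zero)
  rw [det_ofFrame] at h
  simpa using h

theorem eLpNorm_comp_ofFrame (θ : ℝ) {u : Plane → ℂ} (hu : Continuous u) :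
    eLpNorm (fun p => u (ofFrame θ p)) 2 volume = eLpNorm u 2 volume :=
  eLpNorm_comp_measurePreserving hu.aestronglyMeasurable (measurePreserving_ofFrame θ)

theorem SmallL2.comp_ofFrame {u : ℝ → Plane → ℂ} (hu : SmallL2 u)
    (hc : ∀ h, 0 < h → Continuous (u h)) (θ : ℝ) : SmallL2 fun h p => u h (ofFrame θ p) := by
  obtain ⟨C, hC, H⟩ := hu
  exact ⟨C, hC, fun h h0 h1 => (eLpNorm_comp_ofFrame θ (hc h h0)).trans_le (H h h0 h1)⟩

theorem Asymp.comp_ofFrame {u v : ℝ → Plane → ℂ} (h : Asymp u v) (θ : ℝ) :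
    Asymp (fun h p => u h (ofFrame θ p)) (fun h p => v h (ofFrame θ p)) :=
  ⟨fun t ht => (h.left t ht).comp (ofFrame θ).continuous,
    fun t ht => (h.right t ht).comp (ofFrame θ).continuous,
    h.small.comp_ofFrame (fun t ht => (h.left t ht).sub (h.right t ht)) θ⟩

end Rotation

/-- Change of the integration variable in an oscillatory integral. -/
theorem oscInt_comp {F Φ : Plane × ℝ → Plane × ℝ} {V O : Set (Plane × ℝ)}
    (h : LocalInverse F Φ V O) {ℓ : Plane → Plane} (hΦ : ∀ z, (Φ z).1 = ℓ z.1)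
    (hF : ∀ z p, z.1 = ℓ p → (F z).1 = p) {B : Plane × ℝ → ℂ} (hB : ∀ z ∉ V, B z = 0)
    (τ : Plane × ℝ → ℝ) (t : ℝ) (p : Plane) :
    oscInt τ B t (ℓ p) = oscInt (fun z => τ (Φ z)) (fun z =>
      ((|fderiv ℝ (fun z => (Φ z).2) z (0, 1)| : ℝ) : ℂ) * O.indicator (fun z => B (Φ z)) z) t p := by
  have hΦ2 : ContDiff ℝ ∞ fun z => (Φ z).2 := h.smooth.snd
  -- Both maps preserve the fibres over the position, so on each fibre the substitution is
  -- one-dimensional.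
  set g : ℝ → ℝ := fun η => (Φ (p, η)).2 with hg
  have hgΦ : ∀ η, Φ (p, η) = (ℓ p, g η) := fun η => Prod.ext (hΦ _) rfl
  set s : Set ℝ := {η | (p, η) ∈ O} with hs
  have hsO : IsOpen s := h.isOpen_target.preimage (by fun_prop)
  have hd : ∀ η ∈ s, HasDerivWithinAt g (fderiv ℝ (fun z => (Φ z).2) (p, η) (0, 1)) s η :=
    fun η _ => (hasDerivAt_slice ((hΦ2.differentiable (by simp)) (p, η))).hasDerivWithinAt
  have hinj : InjOn g s := by
    intro η hη η' hη' he
    have h1 := h.right_inv _ hη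
    have h2 := h.right_inv _ hη'
    rw [hgΦ, he, ← hgΦ, h2] at h1
    exact (congrArg Prod.snd h1).symm
  have himg : g '' s = {ψ | (ℓ p, ψ) ∈ V} := by
    ext ψ
    constructor
    · rintro ⟨η, hη, rfl⟩
      have := h.mapsTo_inv hη
      rwa [hgΦ] at this
    · intro hψ
      have h1 : F (ℓ p, ψ) = (p, (F (ℓ p, ψ)).2) := Prod.ext (hF _ p rfl) rfl
      have h2 := h.mapsTo hψ
      have h3 := h.left_inv _ hψ
      rw [h1] at h2 h3
      exact ⟨_, h2, congrArg Prod.snd h3⟩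
  have hcv := integral_image_eq_integral_abs_deriv_smul hsO.measurableSet hd hinj
    (fun ψ => osc t (τ (ℓ p, ψ)) * B (ℓ p, ψ))
  have e1 : ∫ ψ in g '' s, osc t (τ (ℓ p, ψ)) * B (ℓ p, ψ) =
      ∫ ψ, osc t (τ (ℓ p, ψ)) * B (ℓ p, ψ) := by
    refine setIntegral_eq_integral_of_forall_compl_eq_zero fun ψ hψ => ?_
    rw [himg] at hψ
    rw [hB _ hψ, mul_zero]
  rw [oscInt, oscInt, ← e1, hcv, ← integral_indicator hsO.measurableSet]
  congr 2
  funext η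
  by_cases hη : η ∈ s
  · have hη' : (p, η) ∈ O := hη
    rw [indicator_of_mem hη, indicator_of_mem hη', hgΦ, Complex.real_smul]
    ring
  · have hη' : (p, η) ∉ O := hη
    rw [indicator_of_notMem hη, indicator_of_notMem hη', mul_zero, mul_zero]

namespace SingularChart

variable {L : LagrangianSurface}

/-- A mixed chart together with its inverse and the generating function of the mixed phase. -/
structure IsMixedModel (C : SingularChart L) (θ : ℝ) (Y : Plane → Plane) (S : Plane → ℝ)
    (V O : Set Plane) : Prop extends LocalInverse (C.stdCoord (.mixed θ)) Y V O where
  subset : V ⊆ C.G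
  jac_ne_zero : ∀ y ∈ V, jacDet (C.stdCoord (.mixed θ)) y ≠ 0
  smooth_S : ContDiff ℝ ∞ S
  S_eq : ∀ q ∈ O, S q = (Y q).1 - q.2 * dot (frame₂ θ) (C.X (Y q))

variable {C : SingularChart L} {θ : ℝ} {Y : Plane → Plane} {S : Plane → ℝ} {V O : Set Plane}

theorem IsMixedModel.restrict (M : C.IsMixedModel θ Y S V O) {V' : Set Plane} (hV' : IsOpen V') :
    C.IsMixedModel θ Y S (V ∩ V') (O ∩ Y ⁻¹' V') :=
  { M.toLocalInverse.restrict_source hV' with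
    subset := fun _ hy => M.subset hy.1
    jac_ne_zero := fun y hy => M.jac_ne_zero y hy.1
    smooth_S := M.smooth_S
    S_eq := fun q hq => M.S_eq q hq.1 }

theorem exists_mixedModel {y₀ : Plane} (hy₀ : y₀ ∈ C.G) {θ : ℝ}
    (hJ : jacDet (C.stdCoord (.mixed θ)) y₀ ≠ 0) :
    ∃ Y S V O, C.IsMixedModel θ Y S V O ∧ y₀ ∈ V := by
  have hopen : IsOpen (C.G ∩ {y | jacDet (C.stdCoord (.mixed θ)) y ≠ 0}) :=
    ((contDiffOn_jacDet C.D_open (contDiffOn_stdCoord _)).continuousOn.mono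
      C.G_subset).isOpen_inter_preimage C.G_open isOpen_ne
  obtain ⟨Y, V, O, h, hV, hyV⟩ := exists_localInverse hopen
    ((contDiffOn_stdCoord (.mixed θ)).mono fun y hy => C.G_subset hy.1)
    (y₀ := y₀) ⟨hy₀, hJ⟩ hJ
  have hS : ContDiffOn ℝ ∞ (fun q => (Y q).1 - q.2 * dot (frame₂ θ) (C.X (Y q))) O := by
    have h1 : ContDiffOn ℝ ∞ (fun q => C.X (Y q)) O :=
      C.contDiffOn_X.comp h.smooth.contDiffOn fun q hq => C.G_subset (hV (h.mapsTo_inv hq)).1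
    have h2 : ContDiffOn ℝ ∞ (fun q => dotL (frame₂ θ) (C.X (Y q))) O :=
      (dotL (frame₂ θ)).contDiff.comp_contDiffOn h1
    simp only [dotL_apply] at h2
    exact h.smooth.fst.contDiffOn.sub (contDiff_snd.contDiffOn.mul h2)
  obtain ⟨S, hSs, hSe⟩ := exists_smooth_extension h.isOpen_target hS (h.mapsTo hyV)
  obtain ⟨N, hNe, hN, hNy⟩ := eventually_nhds_iff.1 hSe
  have h' := h.restrict_target hN
  exact ⟨Y, S, _, _, { h' with
    subset := fun y hy => (hV hy.1).1
    jac_ne_zero := fun y hy => (hV hy.1).2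
    smooth_S := hSs
    S_eq := fun q hq => hNe q hq.2 }, hyV, hNy⟩

namespace IsMixedModel

variable {q : Plane}

theorem mem_G (M : C.IsMixedModel θ Y S V O) (hq : q ∈ O) : Y q ∈ C.G := M.subset (M.mapsTo_inv hq)

theorem coord_eq (M : C.IsMixedModel θ Y S V O) (hq : q ∈ O) :
    dot (frame₁ θ) (C.X (Y q)) = q.1 ∧ dot (frame₂ θ) (C.P (Y q)) = q.2 := by
  have h := M.right_inv q hq
  exact ⟨congrArg Prod.fst h, congrArg Prod.snd h⟩

theorem hasFDerivAt_X_comp (M : C.IsMixedModel θ Y S V O) (hq : q ∈ O) :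
    HasFDerivAt (fun q => C.X (Y q)) ((fderiv ℝ C.X (Y q)).comp (fderiv ℝ Y q)) q :=
  (hasFDerivAt_X (C.G_subset (M.mem_G hq))).comp q
    ((M.smooth.differentiable (by simp)) q).hasFDerivAt

theorem hasFDerivAt_P_comp (M : C.IsMixedModel θ Y S V O) (hq : q ∈ O) :
    HasFDerivAt (fun q => C.P (Y q)) ((fderiv ℝ C.P (Y q)).comp (fderiv ℝ Y q)) q :=
  (hasFDerivAt_P (C.G_subset (M.mem_G hq))).comp q
    ((M.smooth.differentiable (by simp)) q).hasFDerivAt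

theorem coord_fderiv (M : C.IsMixedModel θ Y S V O) (hq : q ∈ O) (w : Plane) :
    dot (frame₁ θ) (fderiv ℝ C.X (Y q) (fderiv ℝ Y q w)) = w.1 ∧
      dot (frame₂ θ) (fderiv ℝ C.P (Y q) (fderiv ℝ Y q w)) = w.2 := by
  have hO := M.isOpen_target.mem_nhds hq
  constructor
  · have h1 := (dotL (frame₁ θ)).hasFDerivAt.comp q (M.hasFDerivAt_X_comp hq)
    have h2 : (dotL (frame₁ θ) ∘ fun q => C.X (Y q)) =ᶠ[𝓝 q] fun q => q.1 := by
      filter_upwards [hO] with x hx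
      simpa using (M.coord_eq hx).1
    have h3 := h1.unique (hasFDerivAt_fst.congr_of_eventuallyEq h2)
    simpa using congrArg (fun l => l w) h3
  · have h1 := (dotL (frame₂ θ)).hasFDerivAt.comp q (M.hasFDerivAt_P_comp hq)
    have h2 : (dotL (frame₂ θ) ∘ fun q => C.P (Y q)) =ᶠ[𝓝 q] fun q => q.2 := by
      filter_upwards [hO] with x hx
      simpa using (M.coord_eq hx).2
    have h3 := h1.unique (hasFDerivAt_snd.congr_of_eventuallyEq h2)
    simpa using congrArg (fun l => l w) h3

/-- S is the partial Legendre transform of τ: expand dτ = ⟨P, dX⟩ in the frame and subtract d(η⟨f₂,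
X⟩). -/
theorem fderiv_S (M : C.IsMixedModel θ Y S V O) (hq : q ∈ O) (w : Plane) :
    fderiv ℝ S q w = dot (frame₁ θ) (C.P (Y q)) * w.1 - dot (frame₂ θ) (C.X (Y q)) * w.2 := by
  have h1 : HasFDerivAt (fun q => dotL (frame₂ θ) (C.X (Y q))) _ q :=
    (dotL (frame₂ θ)).hasFDerivAt.comp q (M.hasFDerivAt_X_comp hq)
  have hY := ((M.smooth.differentiable (by simp)) q).hasFDerivAt
  have h2 := hY.fst.sub ((hasFDerivAt_snd (𝕜 := ℝ) (p := q)).mul h1)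
  have h3 : S =ᶠ[𝓝 q] fun q => (Y q).1 - q.2 * dotL (frame₂ θ) (C.X (Y q)) := by
    filter_upwards [M.isOpen_target.mem_nhds hq] with x hx
    rw [M.S_eq x hx, dotL_apply]
  have h5 : HasFDerivAt S _ q := h2.congr_of_eventuallyEq h3
  rw [h5.fderiv]
  have h6 := dot_P_fderiv_X (C.G_subset (M.mem_G hq)) (fderiv ℝ Y q w)
  rw [← dot_toFrame θ] at h6
  simp only [toFrame_apply] at h6
  rw [show ∀ a b c d : ℝ, dot (a, b) (c, d) = a * c + b * d from fun _ _ _ _ => rfl,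
    (M.coord_fderiv hq w).1, (M.coord_eq hq).2] at h6
  simp
  linear_combination -h6

theorem dEta_eq (M : C.IsMixedModel θ Y S V O) (hq : q ∈ O) :
    dEta S q = -dot (frame₂ θ) (C.X (Y q)) := by
  rw [dEta, M.fderiv_S hq]
  simp

/-- So the critical points of the mixed phase lie over the positions of the points of the surface.
-/
theorem ofFrame_critPos (M : C.IsMixedModel θ Y S V O) (hq : q ∈ O) :
    ofFrame θ (critPos S q) = C.X (Y q) := by
  rw [critPos, M.dEta_eq hq, neg_neg, ← (M.coord_eq hq).1, ← toFrame_apply, ofFrame_toFrame]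

/-- Cramer's rule for ψ as a function of (s, η). -/
theorem fderiv_Y_snd (M : C.IsMixedModel θ Y S V O) (hq : q ∈ O) :
    jacDet (C.stdCoord (.mixed θ)) (Y q) * (fderiv ℝ Y q (0, 1)).2 =
      dot (frame₁ θ) (fderiv ℝ C.X (Y q) (1, 0)) := by
  have hD := C.G_subset (M.mem_G hq)
  have h1 := M.coord_fderiv hq (0, 1)
  set u := fderiv ℝ Y q (0, 1)
  rw [fderiv_plane C.X, fderiv_plane C.P] at h1
  rw [jacDet_mixed hD]
  simp only [dot, Prod.fst_add, Prod.snd_add, Prod.smul_fst, Prod.smul_snd, smul_eq_mul] at h1 ⊢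
  linear_combination ((frame₁ θ).1 * (fderiv ℝ C.X (Y q) (1, 0)).1 +
    (frame₁ θ).2 * (fderiv ℝ C.X (Y q) (1, 0)).2) * h1.2 -
    ((frame₂ θ).1 * (fderiv ℝ C.P (Y q) (1, 0)).1 +
    (frame₂ θ).2 * (fderiv ℝ C.P (Y q) (1, 0)).2) * h1.1

/-- The standard operator in a mixed chart as an oscillatory integral. -/
theorem stdOp_eq (M : C.IsMixedModel θ Y S V O) {V' : Set Plane}
    (hV' : InjOn (C.stdCoord (.mixed θ)) V') {A : Plane → ℂ} (hA : TestFun V A)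
    (hAV' : Function.support A ⊆ V') (m : ℤ) (h : ℝ) (p : Plane) :
    C.stdOp (.mixed θ) V' m A h (ofFrame θ p) = Complex.exp (-Complex.I * Real.pi * m / 2) *
      oscInt (mixedPhase S) (fun z => O.indicator (fun q => C.stdAmp (.mixed θ) A (Y q))
        (z.1.1, z.2)) h p := by
  rw [stdOp]
  change _ * ((Complex.I / (2 * Real.pi * h)) ^ ((1 : ℂ) / 2) * _) = _ * (amp h * _)
  rw [amp]
  congr 2
  congr 1
  funext η
  have e := C.stdIntegrand_eq hV' M.toLocalInverse (ℓ := id) Function.injective_id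
    (fun y _ => rfl) hA hAV' h
    (fun y => dot (frame₂ θ) (C.P y) * dot (frame₂ θ) (ofFrame θ p - C.X y)) (p.1, η)
  rw [id] at e
  rw [dot_frame₁_ofFrame, e]
  by_cases hq : (p.1, η) ∈ O
  · congr 2
    have h1 : dot (frame₂ θ) (ofFrame θ p - C.X (Y (p.1, η))) =
        p.2 - dot (frame₂ θ) (C.X (Y (p.1, η))) := by
      have := dot_frame₂_ofFrame θ p
      rw [← this]
      simp [dot]
      ring
    rw [h1, (M.coord_eq hq).2, mixedPhase, M.S_eq _ hq]
    ring
  · beta_reduce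
    rw [indicator_of_notMem hq, mul_zero, mul_zero]

end IsMixedModel

end SingularChart

end

/-! ### The substitution ψ = ψ(s, η) in the angle integral. -/

section

namespace SingularChart

variable {L : LagrangianSurface} {C : SingularChart L} {θ : ℝ} {Y : Plane → Plane} {S : Plane → ℝ}
  {V O : Set Plane}

/-- The change of variables `(s, x, η) ↦ (x, ψ)` adapted to a mixed chart. -/
def psiMap (θ : ℝ) (Y : Plane → Plane) (z : Plane × ℝ) : Plane × ℝ :=
  (ofFrame θ z.1, (Y (z.1.1, z.2)).2)

theorem contDiff_psiMap (hY : ContDiff ℝ ∞ Y) : ContDiff ℝ ∞ (psiMap θ Y) := by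
  have h1 : ContDiff ℝ ∞ fun z : Plane × ℝ => (z.1.1, z.2) :=
    contDiff_fst.fst.prodMk contDiff_snd
  exact ((ofFrame θ).contDiff.comp contDiff_fst).prodMk (hY.comp h1).snd

theorem fderiv_psiMap (hY : ContDiff ℝ ∞ Y) (z v : Plane × ℝ) : fderiv ℝ (psiMap θ Y) z v =
    (ofFrame θ v.1, (fderiv ℝ Y (z.1.1, z.2) (v.1.1, v.2)).2) := by
  have h1 : HasFDerivAt (fun z : Plane × ℝ => (z.1.1, z.2))
      (((ContinuousLinearMap.fst ℝ ℝ ℝ).comp (ContinuousLinearMap.fst ℝ Plane ℝ)).prod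
        (ContinuousLinearMap.snd ℝ Plane ℝ)) z :=
    (hasFDerivAt_fst.fst).prodMk hasFDerivAt_snd
  have h2 := (((hY.differentiable (by simp)) (z.1.1, z.2)).hasFDerivAt.comp z h1).snd
  have h3 : HasFDerivAt (psiMap θ Y) _ z :=
    ((ofFrame θ).hasFDerivAt.comp z hasFDerivAt_fst).prodMk h2
  rw [h3.fderiv]
  rfl

theorem IsMixedModel.psiMap_critPt (M : C.IsMixedModel θ Y S V O) {q : Plane} (hq : q ∈ O) :
    psiMap θ Y (critPt S q) = (C.X (Y q), (Y q).2) :=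
  Prod.ext (M.ofFrame_critPos hq) rfl

/-- Near a point where the position coordinate is transversal to `ψ`, the change of variables
`(s, x, η) ↦ (x, ψ)` is invertible. -/
theorem IsMixedModel.exists_psi_inverse (M : C.IsMixedModel θ Y S V O) {y₀ : Plane} (hy₀ : y₀ ∈ V)
    (hX : dot (frame₁ θ) (fderiv ℝ C.X y₀ (1, 0)) ≠ 0) :
    ∃ (V' : Set Plane) (F : Plane × ℝ → Plane × ℝ) (V₃ : Set (Plane × ℝ)), IsOpen V' ∧ y₀ ∈ V' ∧
      LocalInverse F (psiMap θ Y) V₃ {z | (z.1.1, z.2) ∈ O ∩ Y ⁻¹' V'} ∧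
      ∀ z p, z.1 = ofFrame θ p → (F z).1 = p := by
  have hVG := M.subset
  have hVD : V ⊆ C.D := hVG.trans C.G_subset
  -- If ⟨f₁, X_τ⟩ ≠ 0, then (s, ψ) is a coordinate system as well, and η = ⟨f₂, P⟩ becomes a
  -- function of s and ψ.
  set f : Plane → Plane := fun y => (dot (frame₁ θ) (C.X y), y.2) with hf
  have hfs : ContDiffOn ℝ ∞ f V := by
    have h1 : ContDiffOn ℝ ∞ (fun y => dotL (frame₁ θ) (C.X y)) V :=
      (dotL (frame₁ θ)).contDiff.comp_contDiffOn (C.contDiffOn_X.mono hVD)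
    simp only [dotL_apply] at h1
    exact h1.prodMk contDiff_snd.contDiffOn
  have hfd : HasFDerivAt f (((dotL (frame₁ θ)).comp (fderiv ℝ C.X y₀)).prod
      (ContinuousLinearMap.snd ℝ ℝ ℝ)) y₀ := by
    have h1 := ((dotL (frame₁ θ)).hasFDerivAt.comp y₀ (hasFDerivAt_X (hVD hy₀))).prodMk
      (hasFDerivAt_snd (𝕜 := ℝ) (p := y₀))
    refine h1.congr_of_eventuallyEq (Eventually.of_forall fun y => ?_)
    simp [hf]
  have hfJ : jacDet f y₀ ≠ 0 := by
    rw [jacDet, hfd.fderiv]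
    simpa [det2] using hX
  obtain ⟨Y', V', O', h', hV'V, hy₀'⟩ := exists_localInverse M.isOpen_source hfs hy₀ hfJ
  set F : Plane × ℝ → Plane × ℝ := fun z =>
    (toFrame θ z.1, dot (frame₂ θ) (C.P (Y' (dot (frame₁ θ) z.1, z.2)))) with hF
  have hco : Continuous fun z : Plane × ℝ => (dot (frame₁ θ) z.1, z.2) := by
    have h1 : Continuous fun z : Plane × ℝ => dotL (frame₁ θ) z.1 :=
      (dotL (frame₁ θ)).continuous.comp continuous_fst
    simp only [dotL_apply] at h1
    exact h1.prodMk continuous_snd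
  refine ⟨V', F, {z | (dot (frame₁ θ) z.1, z.2) ∈ O'}, h'.isOpen_source, hy₀', ?_, ?_⟩
  · have hcoord : ∀ z : Plane × ℝ, (dot (frame₁ θ) z.1, z.2) ∈ O' →
        ((F z).1.1, (F z).2) = C.stdCoord (.mixed θ) (Y' (dot (frame₁ θ) z.1, z.2)) ∧
        (Y' (dot (frame₁ θ) z.1, z.2)).2 = z.2 := by
      intro z hz
      have h1 := h'.right_inv _ hz
      have h2 : dot (frame₁ θ) (C.X (Y' (dot (frame₁ θ) z.1, z.2))) = dot (frame₁ θ) z.1 :=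
        congrArg Prod.fst h1
      refine ⟨Prod.ext ?_ rfl, congrArg Prod.snd h1⟩
      rw [hF]
      change (toFrame θ z.1).1 = dot (frame₁ θ) (C.X (Y' (dot (frame₁ θ) z.1, z.2)))
      rw [h2, toFrame_apply]
    have hpsi : ∀ z : Plane × ℝ, (z.1.1, z.2) ∈ O ∩ Y ⁻¹' V' →
        (dot (frame₁ θ) (psiMap θ Y z).1, (psiMap θ Y z).2) = f (Y (z.1.1, z.2)) := by
      intro z hz
      refine Prod.ext ?_ rfl
      change dot (frame₁ θ) (ofFrame θ z.1) = dot (frame₁ θ) (C.X (Y (z.1.1, z.2)))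
      rw [dot_frame₁_ofFrame, (M.coord_eq hz.1).1]
    refine ⟨h'.isOpen_target.preimage hco,
      (M.isOpen_target.inter (h'.isOpen_source.preimage M.smooth.continuous)).preimage
        (by fun_prop), ?_, contDiff_psiMap M.smooth, fun z hz => ?_, fun z hz => ?_,
      fun z hz => ?_, fun z hz => ?_⟩
    · refine ((toFrame θ).continuous.comp continuous_fst).continuousOn.prodMk ?_
      have h1 : ContinuousOn (fun z : Plane × ℝ => C.P (Y' (dot (frame₁ θ) z.1, z.2)))
          {z | (dot (frame₁ θ) z.1, z.2) ∈ O'} :=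
        C.contDiffOn_P.continuousOn.comp (h'.smooth.continuous.comp hco).continuousOn
          fun z hz => hVD (hV'V (h'.mapsTo_inv hz))
      have h2 := (dotL (frame₂ θ)).continuous.comp_continuousOn h1
      simpa only [Function.comp_def, dotL_apply] using h2
    · have h1 := h'.mapsTo_inv hz
      change ((F z).1.1, (F z).2) ∈ O ∩ Y ⁻¹' V'
      rw [(hcoord z hz).1]
      refine ⟨M.mapsTo (hV'V h1), ?_⟩
      rw [mem_preimage, M.left_inv _ (hV'V h1)]
      exact h1
    · change (dot (frame₁ θ) (psiMap θ Y z).1, (psiMap θ Y z).2) ∈ O'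
      rw [hpsi z hz]
      exact h'.mapsTo hz.2
    · have h1 := h'.mapsTo_inv hz
      refine Prod.ext (ofFrame_toFrame θ z.1) ?_
      change (Y ((F z).1.1, (F z).2)).2 = z.2
      rw [(hcoord z hz).1, M.left_inv _ (hV'V h1), (hcoord z hz).2]
    · refine Prod.ext (toFrame_ofFrame θ z.1) ?_
      change dot (frame₂ θ) (C.P (Y' (dot (frame₁ θ) (psiMap θ Y z).1, (psiMap θ Y z).2))) = z.2
      rw [hpsi z hz, h'.left_inv _ hz.2, (M.coord_eq hz.1).2]
  · intro z p hzp
    change toFrame θ z.1 = p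
    rw [hzp, toFrame_ofFrame]

/-- The phase of the angle integral in the variables adapted to a mixed chart: values and
derivatives at the critical points. -/
theorem IsMixedModel.phase_derivs (M : C.IsMixedModel θ Y S V O) {q : Plane} (hq : q ∈ O)
    {φ : Plane × ℝ → ℝ} (hφ : φ =ᶠ[𝓝 (critPt S q)] fun z => C.tau (psiMap θ Y z)) :
    φ (critPt S q) = mixedPhase S (critPt S q) ∧
      fderiv ℝ φ (critPt S q) ((0, 1), 0) = q.2 ∧
      fderiv ℝ (fun z => fderiv ℝ φ z (0, 1)) (critPt S q) ((0, 1), 0) =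
        (fderiv ℝ Y q (0, 1)).2 *
          (C.detP (Y q) * dot (frame₁ θ) (fderiv ℝ C.X (Y q) (1, 0))) := by
  have hG := M.mem_G hq
  obtain ⟨hc, hcy⟩ := crit_of_mem hG
  have hψ := M.psiMap_critPt hq
  have hcW := hc.1
  rw [← hψ] at hc hcW hcy
  have hΦ := contDiff_psiMap (θ := θ) M.smooth
  have hΦd : ∀ z, HasFDerivAt (psiMap θ Y) (fderiv ℝ (psiMap θ Y) z) z := fun z =>
    ((hΦ.differentiable (by simp)) z).hasFDerivAt
  have hdφ : ∀ z, psiMap θ Y z ∈ C.W → HasFDerivAt (fun z => C.tau (psiMap θ Y z))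
      ((fderiv ℝ C.tau (psiMap θ Y z)).comp (fderiv ℝ (psiMap θ Y) z)) z := fun z hz =>
    (hasFDerivAt_tau hz).comp z (hΦd z)
  have hev : ∀ᶠ z in 𝓝 (critPt S q), psiMap θ Y z ∈ C.W :=
    hΦ.continuous.continuousAt.eventually (C.W_open.mem_nhds hcW)
  refine ⟨?_, ?_, ?_⟩
  · rw [hφ.eq_of_nhds]
    have h1 : C.tau (psiMap θ Y (critPt S q)) = (Y q).1 := congrArg Prod.fst hcy
    rw [h1]
    simp only [mixedPhase, critPt]
    rw [M.S_eq q hq, M.dEta_eq hq]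
    ring
  · rw [hφ.fderiv_eq, (hdφ _ hcW).fderiv, ContinuousLinearMap.comp_apply,
      fderiv_psiMap M.smooth, fderiv_tau_of_crit hc, hcy, ← (M.coord_eq hq).2, ofFrame_apply]
    simp [dot_comm]
  · have h1 : (fun z => fderiv ℝ φ z (0, 1)) =ᶠ[𝓝 (critPt S q)] fun z =>
        (fderiv ℝ Y (z.1.1, z.2) (0, 1)).2 * fderiv ℝ C.tau (psiMap θ Y z) (0, 1) := by
      filter_upwards [hφ.fderiv (𝕜 := ℝ), hev] with z hz1 hz2
      rw [hz1, (hdφ z hz2).fderiv, ContinuousLinearMap.comp_apply, fderiv_psiMap M.smooth]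
      have h2 : (ofFrame θ ((0, 1) : Plane × ℝ).1, (fderiv ℝ Y (z.1.1, z.2)
          (((0, 1) : Plane × ℝ).1.1, ((0, 1) : Plane × ℝ).2)).2) =
          (fderiv ℝ Y (z.1.1, z.2) (0, 1)).2 • ((0, 1) : Plane × ℝ) := by
        refine Prod.ext ?_ ?_ <;> simp
      rw [h2, map_smul, smul_eq_mul]
    have hd1 : DifferentiableAt ℝ (fun z : Plane × ℝ => (fderiv ℝ Y (z.1.1, z.2) (0, 1)).2)
        (critPt S q) := by
      have h3 : ContDiff ℝ ∞ fun q => fderiv ℝ Y q (0, 1) :=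
        (M.smooth.fderiv_right (m := ∞) (by simp)).clm_apply contDiff_const
      have h4 : ContDiff ℝ ∞ fun z : Plane × ℝ => (z.1.1, z.2) :=
        contDiff_fst.fst.prodMk contDiff_snd
      have h5 : ContDiff ℝ ∞ fun z : Plane × ℝ => (fderiv ℝ Y (z.1.1, z.2) (0, 1)).2 :=
        (h3.comp h4).snd
      exact (h5.differentiable (by simp)) _
    have hd2 : HasFDerivAt (fun z => fderiv ℝ C.tau z (0, 1))
        (fderiv ℝ (fun z => fderiv ℝ C.tau z (0, 1)) (psiMap θ Y (critPt S q)))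
        (psiMap θ Y (critPt S q)) :=
      (((contDiffOn_fderiv_apply C.W_open C.tau_smooth (0, 1)).contDiffAt
        (C.W_open.mem_nhds hcW)).differentiableAt (by simp)).hasFDerivAt
    have h5 := hd1.hasFDerivAt.mul (hd2.comp (critPt S q) (hΦd _))
    have h6 := h5.congr_of_eventuallyEq h1
    have h7 : fderiv ℝ (psiMap θ Y) (critPt S q) ((0, 1), 0) = (frame₂ θ, 0) := by
      rw [fderiv_psiMap M.smooth, ofFrame_apply]
      refine Prod.ext ?_ ?_
      · simp
      · have : ((((0, 1), 0) : Plane × ℝ).1.1, (((0, 1), 0) : Plane × ℝ).2) = (0 : Plane) := rfl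
        simp only [this, map_zero, Prod.snd_zero]
    have h8 : fderiv ℝ C.tau (psiMap θ Y (critPt S q)) (0, 1) = 0 := hc.2
    have h9 := fderiv_tau_psi_frame hG θ
    rw [← hψ] at h9
    rw [h6.fderiv]
    simp only [_root_.add_apply, _root_.smul_apply, ContinuousLinearMap.comp_apply, smul_eq_mul,
      Function.comp_apply, h7, h8, h9]
    simp [critPt]

end SingularChart

end

/-! ### Local equality of the angle integral and the mixed integral. -/

section

namespace SingularChart

variable {L : LagrangianSurface} {C : SingularChart L} {θ : ℝ}

theorem fderiv_psiMap_snd {Y : Plane → Plane} (hY : ContDiff ℝ ∞ Y) (z : Plane × ℝ) :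
    fderiv ℝ (fun z => (psiMap θ Y z).2) z (0, 1) = (fderiv ℝ Y (z.1.1, z.2) (0, 1)).2 := by
  have h := ((contDiff_psiMap (θ := θ) hY).differentiable (by simp) z).hasFDerivAt.snd
  rw [h.fderiv, ContinuousLinearMap.comp_apply, fderiv_psiMap hY]
  rfl

/-- To be read with x = ⟨f₁, X_τ⟩ and J the mixed Jacobian: x/J is ψ_η, and x/J·(dx) is the mixed
derivative of the phase. Dividing by the root of the latter turns the substituted amplitude of the
angle integral into the standard one. -/
theorem sqrt_amplitude {μ d J x : ℝ} (hx : x ≠ 0) (hdJ : 0 < d * J) :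
    |x / J| * Real.sqrt |μ * d| =
      Real.sqrt (x / J * (d * x)) * Real.sqrt |μ / J| := by
  have hd : d ≠ 0 := fun h => by simp [h] at hdJ
  have hJ : J ≠ 0 := fun h => by simp [h] at hdJ
  have h1 : x / J * (d * x) = x ^ 2 * (d / J) := by
    field_simp
  have h2 : 0 < d / J := by
    have : d / J = d * J / J ^ 2 := by field_simp
    rw [this]
    positivity
  have h3 : 0 ≤ x / J * (d * x) := by
    rw [h1]
    positivity
  rw [← Real.sqrt_sq (abs_nonneg (x / J)), ← Real.sqrt_mul (sq_nonneg _), ← Real.sqrt_mul h3]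
  congr 1
  have h4 : |d| = d / J * |J| := by
    rw [← abs_of_pos h2, ← abs_mul, div_mul_cancel₀ _ hJ]
  rw [sq_abs, abs_mul, abs_div μ, h1, h4, div_pow, ← sq_abs J]
  have := abs_pos.2 hJ
  generalize d / J = r
  field_simp

/-- Near a point where the frame is suitable, the angle integral is equal to the mixed one. -/
theorem exists_asymp_angle_mixed {y₀ : Plane} (hy₀ : y₀ ∈ C.G)
    (hX : dot (frame₁ θ) (fderiv ℝ C.X y₀ (1, 0)) ≠ 0)
    (hd : 0 < C.detP y₀ * jacDet (C.stdCoord (.mixed θ)) y₀) :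
    ∃ Y S V O, C.IsMixedModel θ Y S V O ∧ y₀ ∈ V ∧ ∀ A, TestFun V A → ∀ a, TestFun C.W a →
      (∀ y ∈ C.G, a (C.X y, y.2) = (Real.sqrt |C.mu y * C.detP y| : ℂ) * A y) →
      (∀ z ∈ tsupport a, C.coords z ∈ tsupport A) →
      Asymp (fun h p => oscInt C.tau a h (ofFrame θ p)) (oscInt (mixedPhase S) (fun z =>
        O.indicator (fun q => C.stdAmp (.mixed θ) A (Y q)) (z.1.1, z.2))) := by
  have hJ0 : jacDet (C.stdCoord (.mixed θ)) y₀ ≠ 0 := fun h => by simp [h] at hd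
  obtain ⟨Y, S, V₀, O₀, M₀, hyV₀⟩ := exists_mixedModel hy₀ hJ0
  have hgood : ∃ V₁ : Set Plane, IsOpen V₁ ∧ y₀ ∈ V₁ ∧ ∀ y ∈ V₀ ∩ V₁,
      dot (frame₁ θ) (fderiv ℝ C.X y (1, 0)) ≠ 0 ∧
        0 < C.detP y * jacDet (C.stdCoord (.mixed θ)) y := by
    have hV₀D : V₀ ⊆ C.D := M₀.subset.trans C.G_subset
    have h1 : ContinuousOn (fun y => dotL (frame₁ θ) (fderiv ℝ C.X y (1, 0))) V₀ :=
      (dotL (frame₁ θ)).continuous.comp_continuousOn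
        ((contDiffOn_fderiv_apply C.D_open C.contDiffOn_X (1, 0)).continuousOn.mono hV₀D)
    have h2 : ContinuousOn (fun y => C.detP y * jacDet (C.stdCoord (.mixed θ)) y) V₀ :=
      (contDiffOn_detP.continuousOn.mul
        (contDiffOn_jacDet C.D_open (contDiffOn_stdCoord (.mixed θ))).continuousOn).mono hV₀D
    refine ⟨_, (h1.isOpen_inter_preimage M₀.isOpen_source isOpen_ne).inter
      (h2.isOpen_inter_preimage M₀.isOpen_source isOpen_Ioi),
      ⟨⟨hyV₀, by simpa using hX⟩, hyV₀, hd⟩, fun y hy => ⟨?_, hy.2.2.2⟩⟩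
    simpa using hy.2.1.2
  obtain ⟨V₁, hV₁, hyV₁, hgood⟩ := hgood
  have M₁ := M₀.restrict hV₁
  have hyV : y₀ ∈ V₀ ∩ V₁ := ⟨hyV₀, hyV₁⟩
  obtain ⟨V', F, V₃, hV', hyV', hF, hFfst⟩ := M₁.exists_psi_inverse hyV hX
  have M₂ := M₁.restrict hV'
  set V := V₀ ∩ V₁ ∩ V'
  set O := O₀ ∩ Y ⁻¹' V₁ ∩ Y ⁻¹' V'
  have hyV : y₀ ∈ V := ⟨hyV, hyV'⟩
  set q₀ := C.stdCoord (.mixed θ) y₀ with hq₀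
  have hq₀O : q₀ ∈ O := M₂.mapsTo hyV
  have hYq₀ : Y q₀ = y₀ := M₂.left_inv _ hyV
  have hΦ := contDiff_psiMap (θ := θ) M₂.smooth
  have hO₃open : IsOpen (psiMap θ Y ⁻¹' C.W) := C.W_open.preimage hΦ.continuous
  have hz₀W : critPt S q₀ ∈ psiMap θ Y ⁻¹' C.W := by
    rw [mem_preimage, M₂.psiMap_critPt hq₀O]
    exact (crit_of_mem (M₂.mem_G hq₀O)).1.1
  obtain ⟨φ, hφ, hφe⟩ := exists_smooth_extension hO₃open
    (C.tau_smooth.comp hΦ.contDiffOn fun z hz => hz) hz₀W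
  obtain ⟨N₀, hN₀e, hN₀, hz₀N₀⟩ := eventually_nhds_iff.1 hφe
  have hφN : ∀ q, critPt S q ∈ N₀ →
      φ =ᶠ[𝓝 (critPt S q)] fun z => C.tau (psiMap θ Y z) := fun q hq => by
    filter_upwards [hN₀.mem_nhds hq] with z hz using hN₀e z hz
  have hcrit : ∀ᶠ q in 𝓝 q₀, φ (critPt S q) = mixedPhase S (critPt S q) ∧
      fderiv ℝ φ (critPt S q) ((0, 1), 0) = q.2 := by
    filter_upwards [M₂.isOpen_target.mem_nhds hq₀O,
      (continuous_critPt M₂.smooth_S).continuousAt.eventually (hN₀.mem_nhds hz₀N₀)] with q hq hqN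
    have h1 := M₂.phase_derivs hq (hφN q hqN)
    exact ⟨h1.1, h1.2.1⟩
  have hJx : ∀ q ∈ O, (fderiv ℝ Y q (0, 1)).2 = dot (frame₁ θ) (fderiv ℝ C.X (Y q) (1, 0)) /
      jacDet (C.stdCoord (.mixed θ)) (Y q) := fun q hq => by
    rw [eq_div_iff (M₂.jac_ne_zero _ (M₂.mapsTo_inv hq)), mul_comm, M₂.fderiv_Y_snd hq]
  -- Since ψ_η = ⟨f₁, X_τ⟩/Q, the mixed derivative of the phase has the sign of dQ.
  have hposO : ∀ q ∈ O, 0 < (fderiv ℝ Y q (0, 1)).2 *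
      (C.detP (Y q) * dot (frame₁ θ) (fderiv ℝ C.X (Y q) (1, 0))) := by
    intro q hq
    obtain ⟨h1, h2⟩ := hgood _ (M₂.mapsTo_inv hq).1
    have h3 := M₂.jac_ne_zero _ (M₂.mapsTo_inv hq)
    rw [hJx q hq]
    have h4 : ∀ x J d : ℝ, J ≠ 0 → x / J * (d * x) = x ^ 2 * (d * J) / J ^ 2 := by
      intro x J d hJ
      field_simp
    rw [h4 _ _ _ h3]
    positivity
  obtain ⟨U, hU, hz₀U, hUpos, hLL⟩ := exists_mixed_amplitude M₂.smooth_S hφ hcrit (by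
    rw [(M₂.phase_derivs hq₀O (hφN q₀ hz₀N₀)).2.2]
    exact hposO q₀ hq₀O)
  have hF' := (hF.restrict_target (hU.inter hN₀)).restrict_source C.W_open
  set V₃' := V₃ ∩ F ⁻¹' (U ∩ N₀) ∩ C.W with hV₃'
  set O₃' := {z : Plane × ℝ | (z.1.1, z.2) ∈ O₀ ∩ Y ⁻¹' V₁ ∩ Y ⁻¹' V'} ∩ (U ∩ N₀) ∩
    psiMap θ Y ⁻¹' C.W with hO₃'
  have hz₀O₃ : critPt S q₀ ∈ O₃' := ⟨⟨hq₀O, hz₀U, hz₀N₀⟩, hz₀W⟩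
  have hz₀V₃ : (C.X y₀, y₀.2) ∈ V₃' := by
    have h1 := hF'.mapsTo_inv hz₀O₃
    rwa [M₂.psiMap_critPt hq₀O, hYq₀] at h1
  obtain ⟨κ, hκ, N, hN, hz₀N, hNV, hκ1⟩ := exists_bump hF'.isOpen_source hz₀V₃
  have hVD : V ⊆ C.D := M₂.subset.trans C.G_subset
  have hVN : IsOpen (V ∩ (fun y => (C.X y, y.2)) ⁻¹' N) :=
    ((C.contDiffOn_X.continuousOn.mono hVD).prodMk continuous_snd.continuousOn).isOpen_inter_preimage
      M₂.isOpen_source hN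
  have M := M₂.restrict hVN
  refine ⟨Y, S, _, _, M, ⟨hyV, hyV, hz₀N⟩, fun A hA a ha haA has => ?_⟩
  have hAN : ∀ y ∈ tsupport A, y ∈ V ∧ (C.X y, y.2) ∈ N := fun y hy => (hA.subset hy).2
  have hB : TestFun V₃' (fun z => a z * κ z) := hκ.mul_smooth ha.smooth
  have hBW : TestFun C.W (fun z => a z * κ z) := hB.mono inter_subset_right
  have hr : TestFun C.W (fun z => a z - a z * κ z) := ha.sub hBW
  -- Critical points in the support of `a` lie over the support of `A`, near which κ = 1; the rest
  -- of the amplitude sees none of them.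
  have hrne : ∀ z ∈ tsupport (fun z => a z - a z * κ z), fderiv ℝ C.tau z (0, 1) ≠ 0 := by
    intro z hz h0
    have hza : z ∈ tsupport a := by
      refine closure_mono (fun x hx => ?_) hz
      intro hx0
      exact hx (by simp [hx0])
    have hzc : z ∈ critSet C.W C.tau := ⟨hr.subset hz, h0⟩
    have h1 := (hAN _ (has z hza)).2
    have h2 : (C.X (C.coords z), (C.coords z).2) = z := Prod.ext (eq_X_of_crit hzc).symm rfl
    rw [h2] at h1
    obtain ⟨x, hxN, hx⟩ := mem_closure_iff.1 hz N hN h1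
    exact hx (by simp [hκ1 x hxN])
  have hrs := smallL2_oscInt_of_deriv_ne_zero C.W_open C.tau_smooth hr hrne
  have hac : ∀ {b : Plane × ℝ → ℂ}, TestFun C.W b → ∀ h, 0 < h → Continuous (oscInt C.tau b h) :=
    fun hb h _ => continuous_oscInt C.W_open C.tau_smooth hb h
  have hstep1 : Asymp (oscInt C.tau a) (oscInt C.tau fun z => a z * κ z) := by
    refine ⟨hac ha, hac hBW, hrs.congr fun h _ p => ?_⟩
    have h1 := oscInt_add C.W_open C.tau_smooth hr hBW h p
    have h2 : (fun z => a z - a z * κ z + a z * κ z) = a := by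
      funext z
      ring
    rw [h2] at h1
    rw [h1, add_sub_cancel_right]
  refine (hstep1.comp_ofFrame θ).trans ?_
  -- After the substitution the phase may be replaced by its globally smooth extension, because the
  -- new amplitude lives where the two agree.
  have hcomp : (fun h p => oscInt C.tau (fun z => a z * κ z) h (ofFrame θ p)) =
      oscInt φ (fun z => ((|(fderiv ℝ Y (z.1.1, z.2) (0, 1)).2| : ℝ) : ℂ) *
        O₃'.indicator (fun z => a (psiMap θ Y z) * κ (psiMap θ Y z)) z) := by
    funext h p
    rw [oscInt_comp hF' (ℓ := ofFrame θ) (fun z => rfl) hFfst (fun z hz => hB.eq_zero hz) C.tau h p]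
    simp_rw [fderiv_psiMap_snd M.smooth]
    refine congrFun (congrFun (oscInt_congr fun z hz => ?_) h) p
    have hz' : z ∈ O₃' := by
      by_contra hn
      exact hz (by rw [indicator_of_notMem hn, mul_zero])
    exact (hN₀e z hz'.1.2.2).symm
  rw [hcomp]
  have hpush := hF'.push hB
  have hψ0 : ∀ z ∈ O₃', (fderiv ℝ Y (z.1.1, z.2) (0, 1)).2 ≠ 0 := by
    intro z hz h0
    have h1 := hposO _ hz.1.1
    rw [h0, zero_mul] at h1
    exact lt_irrefl _ h1
  have hã : TestFun U (fun z => ((|(fderiv ℝ Y (z.1.1, z.2) (0, 1)).2| : ℝ) : ℂ) *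
        O₃'.indicator (fun z => a (psiMap θ Y z) * κ (psiMap θ Y z)) z) := by
    have h3 : ContDiff ℝ ∞ fun q => fderiv ℝ Y q (0, 1) :=
      (M.smooth.fderiv_right (m := ∞) (by simp)).clm_apply contDiff_const
    have h4 : ContDiff ℝ ∞ fun z : Plane × ℝ => (z.1.1, z.2) :=
      contDiff_fst.fst.prodMk contDiff_snd
    have h5 : ContDiff ℝ ∞ fun z : Plane × ℝ => (fderiv ℝ Y (z.1.1, z.2) (0, 1)).2 :=
      (h3.comp h4).snd
    have h6 : ContDiffOn ℝ ∞ (fun z : Plane × ℝ => |(fderiv ℝ Y (z.1.1, z.2) (0, 1)).2|) O₃' :=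
      fun z hz => ContDiffAt.comp_contDiffWithinAt (g := fun t : ℝ => |t|)
        (f := fun z : Plane × ℝ => (fderiv ℝ Y (z.1.1, z.2) (0, 1)).2) z
        (contDiffAt_abs (hψ0 z hz)) h5.contDiffAt.contDiffWithinAt
    exact (hpush.mul_realOn hF'.isOpen_target h6).mono fun z hz => hz.1.2.1
  obtain ⟨b, hb, hbã, hAs⟩ := hLL _ hã
  refine hAs.trans ?_
  have hstd : TestFun (V ∩ (V ∩ (fun y => (C.X y, y.2)) ⁻¹' N)) (C.stdAmp (.mixed θ) A) :=
    testFun_stdAmp M.isOpen_source (M.subset.trans C.G_subset) M.jac_ne_zero hA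
  have ha₀ := M.toLocalInverse.push hstd
  -- It remains to compare the two amplitudes at the critical points of the mixed phase.
  refine asymp_oscInt_mixedPhase M.smooth_S (hb.mono (subset_univ _)) (ha₀.mono (subset_univ _))
    fun q => ?_
  by_cases hq : q ∈ O ∩ Y ⁻¹' (V ∩ (fun y => (C.X y, y.2)) ⁻¹' N)
  · have hψ := M.psiMap_critPt hq
    have hm : critPt S q ∈ O₃' := by
      have h1 : psiMap θ Y (critPt S q) ∈ V₃' := by
        rw [hψ]
        exact hNV hq.2.2
      have h2 : F (psiMap θ Y (critPt S q)) = critPt S q := hF.right_inv _ hq.1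
      have h3 := hF'.mapsTo h1
      rwa [h2] at h3
    have h1 := hbã q hm.1.2.1
    beta_reduce at h1
    rw [(M.phase_derivs hq (hφN q hm.1.2.2)).2.2, indicator_of_mem hm, hψ, hκ1 _ hq.2.2, mul_one,
      haA _ (M.mem_G hq)] at h1
    rw [indicator_of_mem hq, stdAmp]
    have hpos := hposO q hq.1
    obtain ⟨h2, h3⟩ := hgood _ (M₂.mapsTo_inv hq.1).1
    have hc : ((critPt S q).1.1, (critPt S q).2) = q := rfl
    rw [hc] at h1
    have hne : (Real.sqrt ((fderiv ℝ Y q (0, 1)).2 * (C.detP (Y q) *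
        dot (frame₁ θ) (fderiv ℝ C.X (Y q) (1, 0)))) : ℂ) ≠ 0 :=
      Complex.ofReal_ne_zero.2 (Real.sqrt_pos.2 hpos).ne'
    have h4 := sqrt_amplitude (μ := C.mu (Y q)) h2 h3
    rw [← hJx q hq.1] at h4
    refine mul_left_cancel₀ hne ?_
    rw [← h1, ← mul_assoc, ← mul_assoc, ← Complex.ofReal_mul, ← Complex.ofReal_mul, h4]
  · rw [indicator_of_notMem hq]
    by_cases hqU : critPt S q ∈ U
    · have h1 := hbã q hqU
      have hne := Complex.ofReal_ne_zero.2 (Real.sqrt_pos.2 (hUpos q hqU)).ne'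
      refine (mul_eq_zero.1 (h1.symm.trans ?_)).resolve_left hne
      by_cases hm : critPt S q ∈ O₃'
      · have hqO : q ∈ O := hm.1.1
        have hA0 : A (Y q) = 0 := hA.eq_zero fun h => hq ⟨hqO, h.2⟩
        rw [indicator_of_mem hm, M₂.psiMap_critPt hqO, haA _ (M₂.mem_G hqO), hA0]
        simp
      · rw [indicator_of_notMem hm, mul_zero]
    · exact hb.eq_zero hqU

end SingularChart

end

/-! ### The partial Fourier transform. -/

section

/-- Rescaling the integration to [0, 1] makes the smoothness of `contDiff_unitIntegral` applicable.
-/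
theorem TestFun.integral {P : Type} [NormedAddCommGroup P] [NormedSpace ℝ P] [ProperSpace P]
    {c : P × ℝ → ℂ} (hc : TestFun univ c) : TestFun univ (fun p => ∫ t, c (p, t)) := by
  obtain ⟨R, hR, hcR⟩ := hc.exists_radius
  have hz : ∀ p t, R < |t| → c (p, t) = 0 := by
    intro p t ht
    by_contra h
    have h1 := hcR _ (subset_tsupport c h)
    have h2 : ‖t‖ ≤ ‖(p, t)‖ := norm_snd_le (p, t)
    rw [Real.norm_eq_abs] at h2
    linarith
  have h1 : (fun p => ∫ t, c (p, t)) =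
      fun p => ((4 * R : ℝ) : ℂ) * ∫ s in (0 : ℝ)..1, c (p, 4 * R * s - 2 * R) := by
    funext p
    have h2 : ∫ t, c (p, t) = ∫ t in (-(2 * R))..(2 * R), c (p, t) := by
      rw [intervalIntegral.integral_of_le (by linarith)]
      refine (setIntegral_eq_integral_of_forall_compl_eq_zero fun t ht => hz p t ?_).symm
      by_contra hn
      have := abs_le.1 (not_lt.1 hn)
      exact ht ⟨by linarith, by linarith⟩
    have h3 := intervalIntegral.smul_integral_comp_mul_sub (a := 0) (b := 1)
      (fun t => c (p, t)) (4 * R) (2 * R)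
    rw [Complex.real_smul] at h3
    rw [h2, h3]
    congr 1 <;> ring
  have h2 : ContDiff ℝ ∞ (fun z : P × ℝ => c (z.1, 4 * R * z.2 - 2 * R)) :=
    hc.smooth.comp (contDiff_fst.prodMk ((contDiff_const.mul contDiff_snd).sub contDiff_const))
  refine ⟨?_, ?_, subset_univ _⟩
  · rw [h1]
    exact contDiff_const.mul (contDiff_unitIntegral h2)
  · have hK : IsCompact (Prod.fst '' tsupport c) := hc.compact.isCompact.image continuous_fst
    refine hK.of_isClosed_subset (isClosed_tsupport _) (closure_minimal (fun p hp => ?_) hK.isClosed)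
    by_contra hn
    refine hp ?_
    have : ∀ t, c (p, t) = 0 := fun t =>
      image_eq_zero_of_notMem_tsupport fun h => hn ⟨_, h, rfl⟩
    simp [this]

/-- The normalized Fourier transform in the first variable. -/
def partialFourier (u : ℝ → Plane → ℂ) (h : ℝ) (p : Plane) : ℂ :=
  amp h * ∫ η, osc h (η * p.2) * u h (η, p.1)

/-- The partial Fourier transform does not increase the norm. -/
theorem eLpNorm_partialFourier_le {w : Plane → ℂ} (hw : Continuous w)
    (ht : ∀ x, TestFun univ (fun η => w (η, x))) {h : ℝ} (hh : 0 < h)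
    (hc : Continuous fun p : Plane => amp h * ∫ η, osc h (η * p.2) * w (η, p.1)) {C : ℝ}
    (hC : 0 ≤ C) (hwC : eLpNorm w 2 volume ≤ ENNReal.ofReal C) :
    eLpNorm (fun p : Plane => amp h * ∫ η, osc h (η * p.2) * w (η, p.1)) 2 volume ≤
      ENNReal.ofReal C := by
  refine eLpNorm_two_le hC (le_trans (le_of_eq ?_) (lintegral_sq_le_of_eLpNorm hC hwC))
  have hm1 : Measurable fun p : Plane => ‖amp h * ∫ η, osc h (η * p.2) * w (η, p.1)‖ₑ ^ 2 :=
    hc.measurable.enorm.pow_const 2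
  have hm2 : Measurable fun p : Plane => ‖w p‖ₑ ^ 2 := hw.measurable.enorm.pow_const 2
  rw [Measure.volume_eq_prod, lintegral_prod _ hm1.aemeasurable,
    lintegral_prod_symm _ hm2.aemeasurable]
  refine lintegral_congr fun x => ?_
  have h1 := lintegral_fourier_sq (ht x) hh
  have h2 : ∀ y : ℝ, ‖amp h * ∫ η, osc h (η * y) * w (η, x)‖ₑ ^ 2 =
      ‖amp h‖ₑ ^ 2 * ‖∫ η, osc h (η * y) * w (η, x)‖ₑ ^ 2 := by
    intro y
    rw [enorm_mul, mul_pow]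
  simp_rw [h2]
  rw [lintegral_const_mul' _ _ (by simp), h1, ← mul_assoc]
  have h3 : ‖amp h‖ₑ ^ 2 * ENNReal.ofReal (2 * Real.pi * h) = 1 := by
    have hp : 0 < 2 * Real.pi * h := by positivity
    rw [← ofReal_norm, norm_amp hh, ← ENNReal.ofReal_pow (by positivity),
      ← ENNReal.ofReal_mul (by positivity), inv_pow, Real.sq_sqrt hp.le,
      inv_mul_cancel₀ hp.ne', ENNReal.ofReal_one]
  rw [h3, one_mul]

/-- The partial Fourier transform of functions which are smooth and compactly supported in the
first variable preserves equality modulo `O(h)`. -/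
theorem Asymp.partialFourier {u v : ℝ → Plane → ℂ} (huv : Asymp u v) {R : ℝ}
    (hu : ∀ h, 0 < h → ∀ x, TestFun univ (fun η => u h (η, x)))
    (hv : ∀ h, 0 < h → ∀ x, TestFun univ (fun η => v h (η, x)))
    (huR : ∀ h p, u h p ≠ 0 → |p.1| ≤ R) (hvR : ∀ h p, v h p ≠ 0 → |p.1| ≤ R) :
    Asymp (partialFourier u) (partialFourier v) := by
  have hcont : ∀ {u : ℝ → Plane → ℂ} {h : ℝ}, Continuous (u h) →
      (∀ p, u h p ≠ 0 → |p.1| ≤ R) → Continuous (MaslovOperator.partialFourier u h) := by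
    intro u h hc hR
    refine continuous_const.mul (continuous_integral_of_bounded_support
      (f := fun z : Plane × ℝ => osc h (z.2 * z.1.2) * u h (z.2, z.1.1)) (R := R) ?_ ?_)
    · exact ((contDiff_osc h).continuous.comp (by fun_prop)).mul (hc.comp (by fun_prop))
    · intro p t hp
      exact hR (t, p.1) (right_ne_zero_of_mul hp)
  obtain ⟨C, hC, H⟩ := huv.small
  have hlin : ∀ h, 0 < h → ∀ p : Plane, MaslovOperator.partialFourier u h p -
      MaslovOperator.partialFourier v h p =
      amp h * ∫ η, osc h (η * p.2) * (u h (η, p.1) - v h (η, p.1)) := by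
    intro h hh p
    have hi : ∀ {f : ℝ → ℂ}, TestFun univ f → Integrable fun η => osc h (η * p.2) * f η := by
      intro f hf
      refine Continuous.integrable_of_hasCompactSupport
        (((contDiff_osc h).continuous.comp (by fun_prop)).mul hf.smooth.continuous) ?_
      exact hf.compact.mul_left
    simp only [MaslovOperator.partialFourier, mul_sub]
    rw [integral_sub (hi (hu h hh p.1)) (hi (hv h hh p.1)), mul_sub]
  have c1 := fun h hh => hcont (huv.left h hh) (huR h)
  have c2 := fun h hh => hcont (huv.right h hh) (hvR h)
  refine ⟨c1, c2, C, hC, fun h hh h1 => ?_⟩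
  have hc := (c1 h hh).sub (c2 h hh)
  have he : (fun p => MaslovOperator.partialFourier u h p - MaslovOperator.partialFourier v h p) =
      fun p : Plane => amp h * ∫ η, osc h (η * p.2) * (u h (η, p.1) - v h (η, p.1)) :=
    funext (hlin h hh)
  have hc' : Continuous
      (fun p => MaslovOperator.partialFourier u h p - MaslovOperator.partialFourier v h p) := hc
  beta_reduce
  rw [he] at hc' ⊢
  exact eLpNorm_partialFourier_le (w := fun p => u h p - v h p)
    ((huv.left h hh).sub (huv.right h hh)) (fun x => (hu h hh x).sub (hv h hh x)) hh hc'
    (by positivity) (H h hh h1)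

theorem Asymp.of_comp_ofFrame {u v : ℝ → Plane → ℂ} {θ : ℝ}
    (h : Asymp (fun h p => u h (ofFrame θ p)) (fun h p => v h (ofFrame θ p))) : Asymp u v := by
  have h1 := h.comp_ofFrame (-θ)
  have h2 : ∀ p, ofFrame θ (ofFrame (-θ) p) = p := fun p => by
    have := toFrame_ofFrame (-θ) p
    rw [ofFrame]
    exact this
  simp only [h2] at h1
  exact h1

end

/-! ### Position charts and their comparison with mixed ones. -/

section

/-- A negative sign in the Gaussian integral contributes e^{iπ/2}, which cancels the factor
e^{−iπ/2} of an index larger by one. -/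
theorem exp_index_shift (k : ℤ) {t : ℝ} :
    Complex.exp (-Complex.I * Real.pi * ((k + if t < 0 then 1 else 0 : ℤ) : ℂ) / 2) *
      Complex.exp (Complex.I * Real.pi * (1 - ((if t < 0 then -1 else 1 : ℝ) : ℂ)) / 4) =
      Complex.exp (-Complex.I * Real.pi * k / 2) := by
  rw [← Complex.exp_add]
  congr 1
  split_ifs
  · push_cast
    ring
  · push_cast
    ring

namespace SingularChart

variable {L : LagrangianSurface} {C : SingularChart L} {θ : ℝ}

/-- A position chart in the rotated coordinates together with its inverse. -/
theorem exists_positionModel {y₀ : Plane} (hy₀ : y₀ ∈ C.G) (hc : jacDet C.X y₀ ≠ 0) (θ : ℝ) :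
    ∃ Y V O, LocalInverse (fun y => toFrame θ (C.X y)) Y V O ∧ V ⊆ C.G ∧
      (∀ y ∈ V, jacDet C.X y ≠ 0) ∧ y₀ ∈ V := by
  have hopen : IsOpen (C.G ∩ {y | jacDet C.X y ≠ 0}) :=
    ((contDiffOn_jacDet C.D_open C.contDiffOn_X).continuousOn.mono
      C.G_subset).isOpen_inter_preimage C.G_open isOpen_ne
  have hJ : jacDet (fun y => toFrame θ (C.X y)) y₀ ≠ 0 := by
    have h1 : HasFDerivAt (fun y => toFrame θ (C.X y)) _ y₀ :=
      (toFrame θ).hasFDerivAt.comp y₀ (hasFDerivAt_X (C.G_subset hy₀))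
    rw [jacDet, h1.fderiv, ContinuousLinearMap.comp_apply, ContinuousLinearMap.comp_apply,
      det2_toFrame]
    exact hc
  obtain ⟨Y, V, O, h, hV, hyV⟩ := exists_localInverse hopen
    ((toFrame θ).contDiff.comp_contDiffOn (C.contDiffOn_X.mono fun y hy => C.G_subset hy.1))
    (y₀ := y₀) ⟨hy₀, hc⟩ hJ
  exact ⟨Y, V, O, h, fun y hy => (hV hy).1, fun y hy => (hV hy).2, hyV⟩

section Position

variable {Y : Plane → Plane} {V O : Set Plane}

theorem position_fderiv (M : LocalInverse (fun y => toFrame θ (C.X y)) Y V O) (hV : V ⊆ C.G)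
    {q : Plane} (hq : q ∈ O) (w : Plane) :
    toFrame θ (fderiv ℝ C.X (Y q) (fderiv ℝ Y q w)) = w := by
  have h1 : HasFDerivAt (fun y => toFrame θ (C.X y)) _ (Y q) :=
    (toFrame θ).hasFDerivAt.comp (Y q) (hasFDerivAt_X (C.G_subset (hV (M.mapsTo_inv hq))))
  have h2 := M.fderiv_comp hq h1.differentiableAt w
  rw [h1.fderiv] at h2
  exact h2

theorem position_fderiv_tau (M : LocalInverse (fun y => toFrame θ (C.X y)) Y V O) (hV : V ⊆ C.G)
    {q : Plane} (hq : q ∈ O) :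
    fderiv ℝ (fun q => (Y q).1) q (0, 1) = dot (frame₂ θ) (C.P (Y q)) := by
  have h1 := ((M.smooth.differentiable (by simp)) q).hasFDerivAt.fst
  rw [h1.fderiv]
  have h2 := dot_P_fderiv_X (C.G_subset (hV (M.mapsTo_inv hq))) (fderiv ℝ Y q (0, 1))
  rw [← dot_toFrame θ, position_fderiv M hV hq, toFrame_apply] at h2
  change (fderiv ℝ Y q (0, 1)).1 = _
  rw [← h2]
  simp [dot]

/-- Chain rule for Jacobians: mixed coordinates arise from positions by replacing ⟨f₂, x⟩ with ⟨f₂,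
P⟩. -/
theorem position_fderiv_P (M : LocalInverse (fun y => toFrame θ (C.X y)) Y V O) (hV : V ⊆ C.G)
    {q : Plane} (hq : q ∈ O) :
    jacDet C.X (Y q) * fderiv ℝ (fun q => dot (frame₂ θ) (C.P (Y q))) q (0, 1) =
      jacDet (C.stdCoord (.mixed θ)) (Y q) := by
  have hD := C.G_subset (hV (M.mapsTo_inv hq))
  have h1 : HasFDerivAt (fun q => dotL (frame₂ θ) (C.P (Y q))) _ q :=
    (dotL (frame₂ θ)).hasFDerivAt.comp q
      ((hasFDerivAt_P hD).comp q ((M.smooth.differentiable (by simp)) q).hasFDerivAt)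
  simp only [dotL_apply] at h1
  rw [h1.fderiv]
  change _ * dotL (frame₂ θ) (fderiv ℝ C.P (Y q) (fderiv ℝ Y q (0, 1))) = _
  have h2 := position_fderiv M hV hq (0, 1)
  set u := fderiv ℝ Y q (0, 1)
  rw [fderiv_plane C.X, toFrame_apply] at h2
  rw [jacDet_mixed hD, dotL_apply, fderiv_plane C.P, jacDet, ← det2_toFrame θ, toFrame_apply,
    toFrame_apply, det2]
  have h3 := congrArg Prod.fst h2
  have h4 := congrArg Prod.snd h2
  simp only [dot, Prod.fst_add, Prod.snd_add, Prod.smul_fst, Prod.smul_snd, smul_eq_mul] at h3 h4 ⊢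
  set a1 := (frame₁ θ).1 * (fderiv ℝ C.X (Y q) (1, 0)).1 +
    (frame₁ θ).2 * (fderiv ℝ C.X (Y q) (1, 0)).2 with ha1
  set a2 := (frame₂ θ).1 * (fderiv ℝ C.X (Y q) (1, 0)).1 +
    (frame₂ θ).2 * (fderiv ℝ C.X (Y q) (1, 0)).2 with ha2
  set b1 := (frame₁ θ).1 * (fderiv ℝ C.X (Y q) (0, 1)).1 +
    (frame₁ θ).2 * (fderiv ℝ C.X (Y q) (0, 1)).2 with hb1
  set b2 := (frame₂ θ).1 * (fderiv ℝ C.X (Y q) (0, 1)).1 +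
    (frame₂ θ).2 * (fderiv ℝ C.X (Y q) (0, 1)).2 with hb2
  set e2 := (frame₂ θ).1 * (fderiv ℝ C.P (Y q) (1, 0)).1 +
    (frame₂ θ).2 * (fderiv ℝ C.P (Y q) (1, 0)).2 with he2
  set g2 := (frame₂ θ).1 * (fderiv ℝ C.P (Y q) (0, 1)).1 +
    (frame₂ θ).2 * (fderiv ℝ C.P (Y q) (0, 1)).2 with hg2
  have h3' : u.1 * a1 + u.2 * b1 = 0 := by rw [ha1, hb1]; linear_combination h3
  have h4' : u.1 * a2 + u.2 * b2 = 1 := by rw [ha2, hb2]; linear_combination h4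
  have h5 : (frame₂ θ).1 * (u.1 * (fderiv ℝ C.P (Y q) (1, 0)).1 +
      u.2 * (fderiv ℝ C.P (Y q) (0, 1)).1) + (frame₂ θ).2 * (u.1 * (fderiv ℝ C.P (Y q) (1, 0)).2 +
      u.2 * (fderiv ℝ C.P (Y q) (0, 1)).2) = u.1 * e2 + u.2 * g2 := by
    rw [he2, hg2]; ring
  rw [h5]
  linear_combination (e2 * b2 - g2 * a2) * h3' + (a1 * g2 - b1 * e2) * h4'

theorem stdOp_position_eq (M : LocalInverse (fun y => toFrame θ (C.X y)) Y V O) {V' : Set Plane}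
    (hV' : InjOn (C.stdCoord .position) V') {A : Plane → ℂ} (hA : TestFun V A)
    (hAV' : Function.support A ⊆ V') (m : ℤ) (h : ℝ) (p : Plane) :
    C.stdOp .position V' m A h (ofFrame θ p) = Complex.exp (-Complex.I * Real.pi * m / 2) *
      (osc h (Y p).1 * O.indicator (fun q => C.stdAmp .position A (Y q)) p) := by
  have hinj : Function.Injective (ofFrame θ) := fun p q hpq => by
    rw [← toFrame_ofFrame θ p, hpq, toFrame_ofFrame]
  have e := C.stdIntegrand_eq hV' M hinj (fun y _ => (ofFrame_toFrame θ (C.X y)).symm) hA hAV' h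
    (fun _ => 0) p
  rw [add_zero] at e
  rw [stdOp]
  change _ * C.stdIntegrand .position V' A h (fun _ => 0) (ofFrame θ p) = _
  rw [e]

end Position

/-- The chain rule for half-densities. -/
theorem sqrt_div_mul {μ J c : ℝ} (hJ : J ≠ 0) :
    Real.sqrt |μ / J| * Real.sqrt |J / c| = Real.sqrt |μ / c| := by
  rw [← Real.sqrt_mul (abs_nonneg _), ← abs_mul]
  congr 2
  field_simp

theorem sign_mul_div_pos {J c : ℝ} (hc : c ≠ 0) (hJ : J ≠ 0) :
    0 < (if c * J < 0 then -1 else 1 : ℝ) * (J / c) := by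
  have h1 : J / c = c * J / c ^ 2 := by field_simp
  have h2 : 0 < c ^ 2 := by positivity
  rw [h1]
  split_ifs with h
  · have := div_pos (neg_pos.2 h) h2
    rw [neg_div] at this
    linarith
  · have h3 : 0 < c * J := lt_of_le_of_ne (not_lt.1 h) (mul_ne_zero hc hJ).symm
    have := div_pos h3 h2
    linarith

/-- Near a regular point the mixed operator is equal to the position operator. -/
theorem exists_asymp_mixed_position {y₀ : Plane} (hy₀ : y₀ ∈ C.G) (hc : jacDet C.X y₀ ≠ 0)
    (hJ : jacDet (C.stdCoord (.mixed θ)) y₀ ≠ 0) :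
    ∃ V, IsOpen V ∧ y₀ ∈ V ∧ ∀ (V₁ V₂ : Set Plane),
      InjOn (C.stdCoord .position) V₁ → InjOn (C.stdCoord (.mixed θ)) V₂ → ∀ A, TestFun V A →
      Function.support A ⊆ V₁ → Function.support A ⊆ V₂ → ∀ k : ℤ, Asymp
        (C.stdOp (.mixed θ) V₂ (k +
          if jacDet C.X y₀ * jacDet (C.stdCoord (.mixed θ)) y₀ < 0 then 1 else 0) A)
        (C.stdOp .position V₁ k A) := by
  obtain ⟨Y, S, V₀, O₀, M, hyV⟩ := exists_mixedModel hy₀ hJ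
  obtain ⟨Y', V', O', M', hV'G, hV'c, hyV'⟩ := exists_positionModel hy₀ hc θ
  have hHs : ContDiffOn ℝ ∞ (fun q => dotL (frame₂ θ) (C.P (Y' q))) O' :=
    (dotL (frame₂ θ)).contDiff.comp_contDiffOn (C.contDiffOn_P.comp M'.smooth.contDiffOn
      fun q hq => C.G_subset (hV'G (M'.mapsTo_inv hq)))
  simp only [dotL_apply] at hHs
  -- `H` is ⟨f₂, P⟩ as a function of the position. With T = τ, whose gradient is P, it provides the
  -- data of `asymp_oscInt_legendre`.
  obtain ⟨H, hH, hHe⟩ := exists_smooth_extension M'.isOpen_target hHs (M'.mapsTo hyV')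
  obtain ⟨N, hNe, hN, hyN⟩ := eventually_nhds_iff.1 hHe
  set q₀ := C.stdCoord (.mixed θ) y₀ with hq₀def
  have hq₀ : q₀ ∈ O₀ := M.mapsTo hyV
  have hYq₀ : Y q₀ = y₀ := M.left_inv _ hyV
  have hpos : ∀ q ∈ O₀, critPos S q = toFrame θ (C.X (Y q)) := fun q hq => by
    rw [← M.ofFrame_critPos hq, toFrame_ofFrame]
  have hp₀ : critPos S q₀ = toFrame θ (C.X y₀) := by rw [hpos q₀ hq₀, hYq₀]
  have hp₀O : critPos S q₀ ∈ O' ∩ N := by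
    rw [hp₀]
    exact ⟨M'.mapsTo hyV', hyN⟩
  have hON : IsOpen (O' ∩ N) := M'.isOpen_target.inter hN
  have hHder : ∀ p ∈ O' ∩ N, fderiv ℝ H p (0, 1) =
      jacDet (C.stdCoord (.mixed θ)) (Y' p) / jacDet C.X (Y' p) := by
    intro p hp
    have h1 : H =ᶠ[𝓝 p] fun q => dot (frame₂ θ) (C.P (Y' q)) := by
      filter_upwards [hN.mem_nhds hp.2] with x hx using hNe x hx
    rw [h1.fderiv_eq, eq_div_iff (hV'c _ (M'.mapsTo_inv hp.1)), mul_comm,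
      position_fderiv_P M' hV'G hp.1]
  have hY'p₀ : Y' (critPos S q₀) = y₀ := by
    rw [hp₀]
    exact M'.left_inv _ hyV'
  set σ : ℝ := if jacDet C.X y₀ * jacDet (C.stdCoord (.mixed θ)) y₀ < 0 then -1 else 1 with hσ
  have hσ2 : σ ^ 2 = 1 := by
    rw [hσ]
    split_ifs <;> norm_num
  have h1 : ∀ᶠ q in 𝓝 q₀, (fun p => (Y' p).1) (critPos S q) = S q - q.2 * dEta S q ∧
      H (critPos S q) = q.2 := by
    filter_upwards [M.isOpen_target.mem_nhds hq₀,
      (continuous_critPos M.smooth_S).continuousAt.eventually (hON.mem_nhds hp₀O),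
      M.smooth.continuous.continuousAt.eventually
        (M'.isOpen_source.mem_nhds (by rw [hYq₀]; exact hyV'))] with q hq hqN hqV
    have e1 : Y' (critPos S q) = Y q := by
      rw [hpos q hq]
      exact M'.left_inv _ hqV
    constructor
    · rw [e1, M.S_eq q hq, M.dEta_eq hq]
      ring
    · rw [hNe _ hqN.2]
      beta_reduce
      rw [e1, (M.coord_eq hq).2]
  have h2 : ∀ᶠ p in 𝓝 (critPos S q₀), fderiv ℝ (fun p => (Y' p).1) p (0, 1) = H p := by
    filter_upwards [hON.mem_nhds hp₀O] with p hp
    rw [position_fderiv_tau M' hV'G hp.1, hNe p hp.2]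
  have h3 : 0 < σ * fderiv ℝ H (critPos S q₀) (0, 1) := by
    rw [hHder _ hp₀O, hY'p₀]
    exact sign_mul_div_pos hc hJ
  obtain ⟨OG, VG, hOG, hq₀G, hVG, hp₀G, hHG, key⟩ :=
    asymp_oscInt_legendre M.smooth_S M'.smooth.fst hH hσ2 h1 h2 h3
  have hW1 : IsOpen (V₀ ∩ C.stdCoord (.mixed θ) ⁻¹' OG) :=
    M.continuousOn.isOpen_inter_preimage M.isOpen_source hOG
  have hW2 : IsOpen (V' ∩ (fun y => toFrame θ (C.X y)) ⁻¹' (VG ∩ N)) :=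
    M'.continuousOn.isOpen_inter_preimage M'.isOpen_source (hVG.inter hN)
  set V := (V₀ ∩ C.stdCoord (.mixed θ) ⁻¹' OG) ∩
    (V' ∩ (fun y => toFrame θ (C.X y)) ⁻¹' (VG ∩ N)) with hVdef
  have hVo : IsOpen V := hW1.inter hW2
  have hyVV : y₀ ∈ V := by
    refine ⟨⟨hyV, hq₀G⟩, hyV', ?_, hyN⟩
    change toFrame θ (C.X y₀) ∈ VG
    rw [← hp₀]
    exact hp₀G
  have MV := M.restrict hVo
  have MV' := M'.restrict_source hVo
  have e1 : V₀ ∩ V = V := inter_eq_right.2 fun y hy => hy.1.1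
  have e2 : V' ∩ V = V := inter_eq_right.2 fun y hy => hy.2.1
  rw [e1] at MV
  rw [e2] at MV'
  refine ⟨V, hVo, hyVV, fun V₁ V₂ hi₁ hi₂ A hA hV₁ hV₂ k => ?_⟩
  have hVD : V ⊆ C.D := MV.subset.trans C.G_subset
  have ha := MV.toLocalInverse.push (testFun_stdAmp hVo hVD MV.jac_ne_zero hA)
  have hb := MV'.push (testFun_stdAmp (κ := .position) hVo hVD (fun y hy => hV'c y hy.2.1) hA)
  have haO : TestFun OG ((O₀ ∩ Y ⁻¹' V).indicator fun q => C.stdAmp (.mixed θ) A (Y q)) := by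
    refine ha.mono fun q hq => ?_
    have h4 := hq.2.1.2
    rwa [mem_preimage, M.right_inv q hq.1] at h4
  have hbV : TestFun VG ((O' ∩ Y' ⁻¹' V).indicator fun q => C.stdAmp .position A (Y' q)) := by
    refine hb.mono fun q hq => ?_
    have h4 : toFrame θ (C.X (Y' q)) ∈ VG := hq.2.2.2.1
    have h5 : toFrame θ (C.X (Y' q)) = q := M'.right_inv q hq.1
    rwa [h5] at h4
  have hmain := key _ _ haO hbV fun q hq => by
    by_cases hqV : q ∈ O₀ ∩ Y ⁻¹' V
    · have h4 : critPos S q = toFrame θ (C.X (Y q)) := hpos q hqV.1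
      have h5 : critPos S q ∈ O' ∩ Y' ⁻¹' V := by
        rw [h4]
        exact MV'.mapsTo hqV.2
      have h6 : Y' (critPos S q) = Y q := by
        rw [h4]
        exact MV'.left_inv _ hqV.2
      have h7 : critPos S q ∈ N := by
        rw [h4]
        exact hqV.2.2.2.2
      rw [indicator_of_mem hqV, indicator_of_mem h5, h6, hHder _ ⟨h5.1, h7⟩, h6, stdAmp, stdAmp]
      have h8 := sqrt_div_mul (μ := C.mu (Y q)) (c := jacDet C.X (Y q)) (MV.jac_ne_zero _ hqV.2)
      change _ = (Real.sqrt |C.mu (Y q) / jacDet C.X (Y q)| : ℂ) * A (Y q)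
      rw [← h8]
      push_cast
      ring
    · rw [indicator_of_notMem hqV, zero_mul]
      by_cases h5 : critPos S q ∈ O' ∩ Y' ⁻¹' V
      -- If the position over q belonged to a point of `V`, then by `hHG` q would be the mixed
      -- coordinates of that point, contrary to `hqV`.
      · exfalso
        set y := Y' (critPos S q) with hy
        have h6 : toFrame θ (C.X y) = critPos S q := M'.right_inv _ h5.1
        have h7 : critPos S q ∈ N := by
          rw [← h6]
          exact h5.2.2.2.2
        have h8 := hHG q hq
        rw [hNe _ h7] at h8
        beta_reduce at h8
        rw [← hy] at h8
        have h9 : C.stdCoord (.mixed θ) y = q := by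
          refine Prod.ext ?_ h8
          have := congrArg Prod.fst h6
          rw [toFrame_apply] at this
          exact this
        refine hqV ?_
        rw [← h9]
        exact MV.mapsTo h5.2
      · rw [indicator_of_notMem h5]
  refine Asymp.of_comp_ofFrame (θ := θ) ?_
  have hfin := hmain.const_mul (Complex.exp (-Complex.I * Real.pi * ((k + if jacDet C.X y₀ *
    jacDet (C.stdCoord (.mixed θ)) y₀ < 0 then 1 else 0 : ℤ) : ℂ) / 2))
  refine hfin.congr (fun h _ p => ?_) fun h _ p => ?_
  · exact MV.stdOp_eq hi₂ hA hV₂ _ h p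
  · rw [stdOp_position_eq MV' hi₁ hA hV₁, ← exp_index_shift k (t := jacDet C.X y₀ *
      jacDet (C.stdCoord (.mixed θ)) y₀), hσ]
    ring

end SingularChart

end

/-! ### Momentum charts and their operator as an iterated integral. -/

section

theorem amp_mul_self {h : ℝ} (hh : 0 < h) : amp h * amp h = Complex.I / (2 * Real.pi * h) := by
  have h0 : (Complex.I / (2 * Real.pi * h) : ℂ) ≠ 0 := by
    refine div_ne_zero Complex.I_ne_zero ?_
    have h1 : (Real.pi : ℂ) ≠ 0 := by exact_mod_cast Real.pi_ne_zero
    have h2 : (h : ℂ) ≠ 0 := by exact_mod_cast hh.ne'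
    exact mul_ne_zero (mul_ne_zero two_ne_zero h1) h2
  rw [amp, ← Complex.cpow_add _ _ h0]
  norm_num

/-- The integral over the plane in swapped rotated coordinates. -/
theorem integral_plane_swap (θ : ℝ) {f : Plane → ℂ}
    (hf : Integrable fun q : Plane => f (ofFrame θ (q.2, q.1))) :
    ∫ p, f p = ∫ η, ∫ ζ, f (ofFrame θ (ζ, η)) := by
  have hm : MeasurePreserving (fun q : Plane => ofFrame θ (q.2, q.1)) volume volume :=
    (measurePreserving_ofFrame θ).comp
      (Measure.measurePreserving_swap (μ := (volume : Measure ℝ)) (ν := (volume : Measure ℝ)))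
  have he : MeasurableEmbedding (fun q : Plane => ofFrame θ (q.2, q.1)) := by
    let φ : Plane ≃ₜ Plane :=
      { toFun := fun q => ofFrame θ (q.2, q.1)
        invFun := fun p => ((toFrame θ p).2, (toFrame θ p).1)
        left_inv := fun q => by simp [toFrame_ofFrame]
        right_inv := fun p => by simp [ofFrame_toFrame]
        continuous_toFun := by fun_prop
        continuous_invFun := by fun_prop }
    exact φ.measurableEmbedding
  rw [← hm.integral_comp he, Measure.volume_eq_prod]
  exact integral_prod _ hf

namespace SingularChart

variable {L : LagrangianSurface}

/-- A momentum chart together with its inverse and the generating function of its phase. The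
coordinates are the momenta in a rotated frame, in the reverse order. -/
structure IsMomentumModel (C : SingularChart L) (θ : ℝ) (Y : Plane → Plane) (S : Plane → ℝ)
    (V O : Set Plane) : Prop extends
    LocalInverse (fun y => (dotL (frame₂ θ) (C.P y), dotL (frame₁ θ) (C.P y))) Y V O where
  subset : V ⊆ C.G
  jac_ne_zero : ∀ y ∈ V, jacDet (C.stdCoord .momentum) y ≠ 0
  smooth_S : ContDiff ℝ ∞ S
  S_eq : ∀ q ∈ O, S q = (Y q).1 - dot (C.P (Y q)) (C.X (Y q))

variable {C : SingularChart L} {θ : ℝ} {Y : Plane → Plane} {S : Plane → ℝ} {V O : Set Plane}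

theorem IsMomentumModel.restrict (M : C.IsMomentumModel θ Y S V O) {V' : Set Plane}
    (hV' : IsOpen V') : C.IsMomentumModel θ Y S (V ∩ V') (O ∩ Y ⁻¹' V') :=
  { M.toLocalInverse.restrict_source hV' with
    subset := fun _ hy => M.subset hy.1
    jac_ne_zero := fun y hy => M.jac_ne_zero y hy.1
    smooth_S := M.smooth_S
    S_eq := fun q hq => M.S_eq q hq.1 }

theorem exists_momentumModel {y₀ : Plane} (hy₀ : y₀ ∈ C.G) (θ : ℝ) (hR : jacDet C.P y₀ ≠ 0) :
    ∃ Y S V O, C.IsMomentumModel θ Y S V O ∧ y₀ ∈ V := by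
  have hopen : IsOpen (C.G ∩ {y | jacDet C.P y ≠ 0}) :=
    ((contDiffOn_jacDet C.D_open C.contDiffOn_P).continuousOn.mono
      C.G_subset).isOpen_inter_preimage C.G_open isOpen_ne
  -- Rotating the momenta preserves the Jacobian, and reversing their order only changes its sign.
  have hJ : jacDet (fun y => (dotL (frame₂ θ) (C.P y), dotL (frame₁ θ) (C.P y))) y₀ ≠ 0 := by
    have h1 := hasFDerivAt_P (C.G_subset hy₀)
    have h2 : HasFDerivAt (fun y => (dotL (frame₂ θ) (C.P y), dotL (frame₁ θ) (C.P y))) _ y₀ :=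
      ((dotL (frame₂ θ)).hasFDerivAt.comp y₀ h1).prodMk ((dotL (frame₁ θ)).hasFDerivAt.comp y₀ h1)
    have h3 := det2_toFrame θ (fderiv ℝ C.P y₀ (1, 0)) (fderiv ℝ C.P y₀ (0, 1))
    rw [jacDet, h2.fderiv]
    intro h0
    refine hR ?_
    rw [jacDet, ← h3, toFrame_apply, toFrame_apply]
    simp only [det2, ContinuousLinearMap.prod_apply, ContinuousLinearMap.comp_apply,
      dotL_apply] at h0 ⊢
    linear_combination -h0
  have hP : ContDiffOn ℝ ∞ C.P (C.G ∩ {y | jacDet C.P y ≠ 0}) :=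
    C.contDiffOn_P.mono fun y hy => C.G_subset hy.1
  obtain ⟨Y, V, O, h, hV, hyV⟩ := exists_localInverse hopen
    (((dotL (frame₂ θ)).contDiff.comp_contDiffOn hP).prodMk
      ((dotL (frame₁ θ)).contDiff.comp_contDiffOn hP))
    (y₀ := y₀) ⟨hy₀, hR⟩ hJ
  have hYD : MapsTo Y O C.D := fun q hq => C.G_subset (hV (h.mapsTo_inv hq)).1
  have hS : ContDiffOn ℝ ∞ (fun q => (Y q).1 - dot (C.P (Y q)) (C.X (Y q))) O := by
    have h1 : ContDiffOn ℝ ∞ (fun q => C.X (Y q)) O :=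
      C.contDiffOn_X.comp h.smooth.contDiffOn hYD
    have h2 : ContDiffOn ℝ ∞ (fun q => C.P (Y q)) O :=
      C.contDiffOn_P.comp h.smooth.contDiffOn hYD
    exact h.smooth.fst.contDiffOn.sub ((h2.fst.mul h1.fst).add (h2.snd.mul h1.snd))
  obtain ⟨S, hSs, hSe⟩ := exists_smooth_extension h.isOpen_target hS (h.mapsTo hyV)
  obtain ⟨N, hNe, hN, hNy⟩ := eventually_nhds_iff.1 hSe
  have h' := h.restrict_target hN
  exact ⟨Y, S, _, _, { h' with
    subset := fun y hy => (hV hy.1).1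
    jac_ne_zero := fun y hy => (hV hy.1).2
    smooth_S := hSs
    S_eq := fun q hq => hNe q hq.2 }, hyV, hNy⟩

namespace IsMomentumModel

variable {q : Plane}

theorem mem_G (M : C.IsMomentumModel θ Y S V O) (hq : q ∈ O) : Y q ∈ C.G :=
  M.subset (M.mapsTo_inv hq)

theorem toFrame_P (M : C.IsMomentumModel θ Y S V O) (hq : q ∈ O) :
    toFrame θ (C.P (Y q)) = (q.2, q.1) := by
  have h := M.right_inv q hq
  rw [toFrame_apply]
  exact Prod.ext (congrArg Prod.snd h) (congrArg Prod.fst h)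

/-- d(τ − ⟨P, X⟩) = −⟨X, dP⟩, and varying the second coordinate moves P along f₁. -/
theorem dEta_eq (M : C.IsMomentumModel θ Y S V O) (hq : q ∈ O) :
    dEta S q = -dot (frame₁ θ) (C.X (Y q)) := by
  have hD := C.G_subset (M.mem_G hq)
  have hY := ((M.smooth.differentiable (by simp)) q).hasFDerivAt
  have hX := (hasFDerivAt_X hD).comp q hY
  have hP := (hasFDerivAt_P hD).comp q hY
  have h1 := hY.fst.sub (MaslovOperator.HasFDerivAt.dot hP hX)
  have h3 : S =ᶠ[𝓝 q] fun q => (Y q).1 - dot (C.P (Y q)) (C.X (Y q)) := by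
    filter_upwards [M.isOpen_target.mem_nhds hq] with x hx using M.S_eq x hx
  have h5 : HasFDerivAt S _ q := h1.congr_of_eventuallyEq h3
  have h7 : toFrame θ (fderiv ℝ C.P (Y q) (fderiv ℝ Y q (0, 1))) = (1, 0) := by
    have h8 := (toFrame θ).hasFDerivAt.comp q hP
    have h9 : (toFrame θ ∘ C.P ∘ Y) =ᶠ[𝓝 q] fun q => (q.2, q.1) := by
      filter_upwards [M.isOpen_target.mem_nhds hq] with x hx using M.toFrame_P hx
    have h10 := h8.unique ((hasFDerivAt_snd.prodMk hasFDerivAt_fst).congr_of_eventuallyEq h9)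
    simpa using congrArg (fun l => l (0, 1)) h10
  have h6 := dot_P_fderiv_X hD (fderiv ℝ Y q (0, 1))
  have h8 := dot_toFrame θ (C.X (Y q)) (fderiv ℝ C.P (Y q) (fderiv ℝ Y q (0, 1)))
  rw [h7, toFrame_apply] at h8
  rw [dEta, h5.fderiv]
  simp [dot] at h6 h8 ⊢
  linear_combination h8 - h6

/-- The standard operator in a momentum chart as an iterated oscillatory integral. -/
theorem stdOp_eq (M : C.IsMomentumModel θ Y S V O) {V' : Set Plane}
    (hV' : InjOn (C.stdCoord .momentum) V') {A : Plane → ℂ} (hA : TestFun V A)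
    (hAV' : Function.support A ⊆ V') (m : ℤ) {h : ℝ} (hh : 0 < h) (p : Plane) :
    C.stdOp .momentum V' m A h (ofFrame θ p) = Complex.exp (-Complex.I * Real.pi * m / 2) *
      partialFourier (oscInt (mixedPhase S) (fun z =>
        O.indicator (fun q => C.stdAmp .momentum A (Y q)) (z.1.1, z.2))) h p := by
  have hinj : Function.Injective (fun q : Plane => ofFrame θ (q.2, q.1)) := fun q q' hqq => by
    have h1 := congrArg (toFrame θ) hqq
    simp only [toFrame_ofFrame, Prod.mk.injEq] at h1
    exact Prod.ext h1.2 h1.1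
  have hb := M.toLocalInverse.push (testFun_stdAmp M.isOpen_source
    (M.subset.trans C.G_subset) M.jac_ne_zero hA)
  -- ⟨P, x⟩ splits along the frame: the f₁ part completes a mixed phase, and the f₂ part is the
  -- kernel of the outer Fourier transform.
  have e : ∀ q : Plane, C.stdIntegrand .momentum V' A h
      (fun y => dot (C.P y) (ofFrame θ p - C.X y)) (ofFrame θ (q.2, q.1)) =
      osc h (q.1 * p.2) * (osc h (mixedPhase S ((q.1, p.1), q.2)) *
        O.indicator (fun q => C.stdAmp .momentum A (Y q)) q) := by
    intro q
    rw [C.stdIntegrand_eq hV' M.toLocalInverse hinj (fun y _ => by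
      have := (ofFrame_toFrame θ (C.P y)).symm
      rwa [toFrame_apply] at this) hA hAV' h _ q]
    by_cases hq : q ∈ O
    · rw [← mul_assoc, ← osc_add]
      congr 2
      have h1 : dot (C.P (Y q)) (ofFrame θ p) = q.2 * p.1 + q.1 * p.2 := by
        rw [← dot_toFrame θ, M.toFrame_P hq, toFrame_ofFrame]
        rfl
      have h2 : dot (C.P (Y q)) (ofFrame θ p - C.X (Y q)) =
          dot (C.P (Y q)) (ofFrame θ p) - dot (C.P (Y q)) (C.X (Y q)) := by
        simp only [dot, Prod.fst_sub, Prod.snd_sub]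
        ring
      rw [h2, h1, mixedPhase, M.S_eq q hq]
      ring
    · rw [indicator_of_notMem hq, mul_zero, mul_zero, mul_zero]
  have hint : Integrable fun q : Plane => C.stdIntegrand .momentum V' A h
      (fun y => dot (C.P y) (ofFrame θ p - C.X y)) (ofFrame θ (q.2, q.1)) := by
    simp_rw [e]
    have hSc := M.smooth_S.continuous
    refine Continuous.integrable_of_hasCompactSupport ?_ ?_
    · refine ((contDiff_osc h).continuous.comp (by fun_prop)).mul
        (((contDiff_osc h).continuous.comp ?_).mul hb.smooth.continuous)
      unfold mixedPhase
      fun_prop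
    · exact hb.compact.mul_left.mul_left
  rw [stdOp]
  change _ * ((Complex.I / (2 * Real.pi * h)) * ∫ p', C.stdIntegrand .momentum V' A h
    (fun y => dot (C.P y) (ofFrame θ p - C.X y)) p') = _
  rw [integral_plane_swap θ hint, ← amp_mul_self hh, partialFourier]
  congr 1
  rw [mul_assoc]
  congr 1
  rw [← integral_const_mul]
  congr 1
  funext η
  have e' := fun ζ => e (η, ζ)
  simp only at e'
  simp_rw [e']
  rw [integral_const_mul, oscInt]
  ring

end IsMomentumModel

end SingularChart

end

/-! ### Comparison of momentum and mixed operators. -/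

section

/-- A partial Fourier transform of functions with phase `S` is a mixed integral. -/
theorem Asymp.partialFourier_mixed {S S' : Plane → ℝ} (hS : ContDiff ℝ ∞ S)
    (hS' : ContDiff ℝ ∞ S') {a b : Plane → ℂ} (ha : TestFun univ a) (hb : TestFun univ b) {c : ℂ}
    (hab : Asymp (oscInt (mixedPhase S') fun z => a (z.1.1, z.2))
      fun h p => c * osc h (S (p.2, p.1)) * b (p.2, p.1)) :
    Asymp (MaslovOperator.partialFourier (oscInt (mixedPhase S') fun z => a (z.1.1, z.2)))
      fun h p => c * oscInt (mixedPhase S) (fun z => b (z.1.1, z.2)) h p := by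
  obtain ⟨R₁, -, hR₁⟩ := ha.exists_radius
  obtain ⟨R₂, -, hR₂⟩ := hb.exists_radius
  refine (Asymp.partialFourier (R := max R₁ R₂) hab (fun h _ x => ?_) (fun h _ x => ?_)
    (fun h p hp => ?_) fun h p hp => ?_).congr (fun h _ p => rfl) fun h _ p => ?_
  · have h1 : TestFun univ fun z : ℝ × ℝ => osc h (S' z + z.2 * x) * a z :=
      ha.mul_smooth ((contDiff_osc h).comp (hS'.add (contDiff_snd.mul contDiff_const)))
    exact h1.integral.mul_smooth (contDiff_const (c := amp h))
  · have h1 : TestFun univ fun t => b (x, t) :=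
      ⟨hb.smooth.comp (contDiff_const.prodMk contDiff_id), hb.slice_compact x, subset_univ _⟩
    exact h1.mul_smooth (contDiff_const.mul
      ((contDiff_osc h).comp (hS.comp (contDiff_const.prodMk contDiff_id))))
  · by_contra hn
    refine hp ?_
    have h1 : ∀ ξ, a (p.1, ξ) = 0 := fun ξ => by
      by_contra h0
      have h2 := hR₁ _ (subset_tsupport a h0)
      have h3 := (norm_fst_le (p.1, ξ)).trans h2
      rw [Real.norm_eq_abs] at h3
      exact hn (h3.trans (le_max_left _ _))
    simp [oscInt, h1]
  · have h0 : b (p.2, p.1) ≠ 0 := right_ne_zero_of_mul hp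
    have h3 := (norm_snd_le (p.2, p.1)).trans (hR₂ _ (subset_tsupport b h0))
    rw [Real.norm_eq_abs] at h3
    exact h3.trans (le_max_right _ _)
  · rw [oscInt, MaslovOperator.partialFourier, mul_left_comm, ← integral_const_mul]
    congr 2
    funext η
    rw [mixedPhase, osc_add]
    ring

namespace SingularChart

variable {L : LagrangianSurface} {C : SingularChart L} {θ : ℝ}

/-- Chain rule for Jacobians: replacing s with ⟨f₁, P⟩ leads from mixed coordinates to momenta. -/
theorem IsMixedModel.jacDet_mul_fderiv_P {Y : Plane → Plane} {S : Plane → ℝ} {V O : Set Plane}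
    (M : C.IsMixedModel θ Y S V O) {q : Plane} (hq : q ∈ O) :
    jacDet (C.stdCoord (.mixed θ)) (Y q) *
      dot (frame₁ θ) (fderiv ℝ C.P (Y q) (fderiv ℝ Y q (1, 0))) =
      jacDet (C.stdCoord .momentum) (Y q) := by
  have hD := C.G_subset (M.mem_G hq)
  have h1 := M.coord_fderiv hq (1, 0)
  set u := fderiv ℝ Y q (1, 0)
  have h2 : jacDet (C.stdCoord .momentum) (Y q) = _ := (det2_toFrame θ _ _).symm
  have e : fderiv ℝ (C.stdCoord .momentum) = fderiv ℝ C.P := rfl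
  rw [h2, jacDet_mixed hD, toFrame_apply, toFrame_apply, det2, e]
  rw [fderiv_plane C.X, fderiv_plane C.P] at h1
  rw [fderiv_plane C.P (Y q) u]
  set a := fderiv ℝ C.P (Y q) (1, 0)
  set b := fderiv ℝ C.P (Y q) (0, 1)
  set c := fderiv ℝ C.X (Y q) (1, 0)
  set d := fderiv ℝ C.X (Y q) (0, 1)
  have hlin : ∀ k s t : Plane, dot k (u.1 • s + u.2 • t) = u.1 * dot k s + u.2 * dot k t := by
    intro k s t
    simp [dot]
    ring
  rw [hlin] at h1 ⊢
  rw [hlin] at h1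
  obtain ⟨h3, h4⟩ := h1
  linear_combination (dot (frame₁ θ) a * dot (frame₂ θ) b - dot (frame₁ θ) b * dot (frame₂ θ) a) *
    h3 + (dot (frame₁ θ) b * dot (frame₁ θ) c - dot (frame₁ θ) a * dot (frame₁ θ) d) * h4

/-- The momentum operator is equal to the mixed operator where both are defined. -/
theorem exists_asymp_momentum_mixed {y₀ : Plane} (hy₀ : y₀ ∈ C.G) (hR : jacDet C.P y₀ ≠ 0)
    (hJ : jacDet (C.stdCoord (.mixed θ)) y₀ ≠ 0) :
    ∃ V, IsOpen V ∧ y₀ ∈ V ∧ ∀ (V₁ V₂ : Set Plane),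
      InjOn (C.stdCoord (.mixed θ)) V₁ → InjOn (C.stdCoord .momentum) V₂ → ∀ A, TestFun V A →
      Function.support A ⊆ V₁ → Function.support A ⊆ V₂ → ∀ k : ℤ, Asymp
        (C.stdOp .momentum V₂ (k +
          if jacDet (C.stdCoord (.mixed θ)) y₀ * jacDet C.P y₀ < 0 then 1 else 0) A)
        (C.stdOp (.mixed θ) V₁ k A) := by
  obtain ⟨Y', S', V', O', M', hyV'⟩ := exists_mixedModel hy₀ hJ
  obtain ⟨Y, S, V₀, O₀, M, hyV⟩ := exists_momentumModel hy₀ θ hR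
  have hsw : ContDiff ℝ ∞ fun p : Plane => ((p.2, p.1) : Plane) :=
    contDiff_snd.prodMk contDiff_fst
  have hHs : ContDiffOn ℝ ∞ (fun q => dotL (frame₁ θ) (C.P (Y' q))) O' :=
    (dotL (frame₁ θ)).contDiff.comp_contDiffOn (C.contDiffOn_P.comp M'.smooth.contDiffOn
      fun q hq => C.G_subset (M'.mem_G hq))
  simp only [dotL_apply] at hHs
  -- `H` is ⟨f₁, P⟩ in the mixed coordinates. Arguments are swapped below, because the inner
  -- integral runs over ⟨f₁, P⟩ with ⟨f₂, P⟩ as parameter and s as position.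
  obtain ⟨H, hH, hHe⟩ := exists_smooth_extension M'.isOpen_target hHs (M'.mapsTo hyV')
  obtain ⟨N, hNe, hN, hyN⟩ := eventually_nhds_iff.1 hHe
  have hHd : ∀ q ∈ O' ∩ N, fderiv ℝ (fun p : Plane => H (p.2, p.1)) (q.2, q.1) (0, 1) =
      jacDet (C.stdCoord .momentum) (Y' q) / jacDet (C.stdCoord (.mixed θ)) (Y' q) := by
    intro q hq
    have h1 : HasFDerivAt (fun q => dotL (frame₁ θ) (C.P (Y' q))) _ q :=
      (dotL (frame₁ θ)).hasFDerivAt.comp q (M'.hasFDerivAt_P_comp hq.1)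
    have h2 : H =ᶠ[𝓝 q] fun q => dotL (frame₁ θ) (C.P (Y' q)) := by
      filter_upwards [hN.mem_nhds hq.2] with x hx
      rw [hNe x hx, dotL_apply]
    have h3 : HasFDerivAt H _ ((q.2, q.1) : Plane).swap := h1.congr_of_eventuallyEq h2
    have h4 : HasFDerivAt (fun p : Plane => H (p.2, p.1)) _ ((q.2, q.1) : Plane) :=
      h3.comp (q.2, q.1) (hasFDerivAt_snd.prodMk hasFDerivAt_fst)
    rw [h4.fderiv, eq_div_iff (M'.jac_ne_zero _ (M'.mapsTo_inv hq.1)), mul_comm,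
      ← M'.jacDet_mul_fderiv_P hq.1]
    simp
  set f : Plane → Plane := fun y => (dotL (frame₂ θ) (C.P y), dotL (frame₁ θ) (C.P y)) with hf
  set q₀ := f y₀ with hq₀def
  have hq₀ : q₀ ∈ O₀ := M.mapsTo hyV
  have hYq₀ : Y q₀ = y₀ := M.left_inv _ hyV
  have hpos : ∀ q ∈ O₀, ((critPos S q).2, (critPos S q).1) = C.stdCoord (.mixed θ) (Y q) := by
    intro q hq
    rw [critPos, M.dEta_eq hq, neg_neg]
    have h1 := congrArg Prod.snd (M.toFrame_P hq)
    rw [toFrame_apply] at h1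
    exact Prod.ext rfl h1.symm
  have hpos' : ∀ q ∈ O₀, critPos S q =
      ((C.stdCoord (.mixed θ) (Y q)).2, (C.stdCoord (.mixed θ) (Y q)).1) := by
    intro q hq
    rw [← hpos q hq]
  have hON : IsOpen (O' ∩ N) := M'.isOpen_target.inter hN
  have hp₀O : C.stdCoord (.mixed θ) y₀ ∈ O' ∩ N := ⟨M'.mapsTo hyV', hyN⟩
  set σ : ℝ := if jacDet (C.stdCoord (.mixed θ)) y₀ * jacDet C.P y₀ < 0 then -1 else 1 with hσ
  have hσ2 : σ ^ 2 = 1 := by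
    rw [hσ]
    split_ifs <;> norm_num
  have h1 : ∀ᶠ q in 𝓝 q₀, (fun p : Plane => S' (p.2, p.1)) (critPos S q) =
      S q - q.2 * dEta S q ∧ (fun p : Plane => H (p.2, p.1)) (critPos S q) = q.2 := by
    filter_upwards [M.isOpen_target.mem_nhds hq₀, M.smooth.continuous.continuousAt.eventually
      ((M'.continuousOn.isOpen_inter_preimage M'.isOpen_source hN).mem_nhds
        (by rw [hYq₀]; exact ⟨hyV', hyN⟩))] with q hq hqV
    have e1 : Y' (C.stdCoord (.mixed θ) (Y q)) = Y q := M'.left_inv _ hqV.1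
    have e2 := M.toFrame_P hq
    rw [toFrame_apply] at e2
    constructor
    · rw [hpos q hq, M'.S_eq _ (M'.mapsTo hqV.1), e1, M.S_eq q hq, M.dEta_eq hq,
        ← dot_toFrame θ (C.P (Y q)), M.toFrame_P hq, toFrame_apply]
      have e3 : (C.stdCoord (.mixed θ) (Y q)).2 = q.1 := congrArg Prod.snd e2
      rw [e3]
      simp only [dot]
      ring
    · rw [hpos q hq, hNe _ hqV.2]
      beta_reduce
      rw [e1]
      exact congrArg Prod.fst e2
  have h2 : ∀ᶠ p in 𝓝 (critPos S q₀), fderiv ℝ (fun p : Plane => S' (p.2, p.1)) p (0, 1) =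
      (fun p : Plane => H (p.2, p.1)) p := by
    have hev : ∀ᶠ p : Plane in 𝓝 (critPos S q₀), ((p.2, p.1) : Plane) ∈ O' ∩ N :=
      hsw.continuous.continuousAt.eventually (hON.mem_nhds (by
        beta_reduce
        rw [hpos q₀ hq₀, hYq₀]
        exact hp₀O))
    filter_upwards [hev] with p hp
    have h4 : HasFDerivAt (fun p : Plane => S' (p.2, p.1)) _ p :=
      ((M'.smooth_S.differentiable (by simp)) (p.2, p.1)).hasFDerivAt.comp p
        (hasFDerivAt_snd.prodMk hasFDerivAt_fst)
    rw [h4.fderiv, hNe _ hp.2]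
    have h5 := M'.fderiv_S hp.1 (1, 0)
    simp at h5 ⊢
    exact h5
  have h3 : 0 < σ * fderiv ℝ (fun p : Plane => H (p.2, p.1)) (critPos S q₀) (0, 1) := by
    rw [hpos' q₀ hq₀, hYq₀, hHd _ hp₀O, M'.left_inv _ hyV']
    exact sign_mul_div_pos hJ hR
  -- The inner integral becomes an exponential with the generating function S' of the mixed chart;
  -- the outer Fourier transform then restores the mixed integral.
  obtain ⟨OG, VG, hOG, hq₀G, hVG, hp₀G, hHG, key⟩ :=
    asymp_oscInt_legendre M.smooth_S (M'.smooth_S.comp hsw) (hH.comp hsw) hσ2 h1 h2 h3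
  have hW1 : IsOpen (V₀ ∩ f ⁻¹' OG) := M.continuousOn.isOpen_inter_preimage M.isOpen_source hOG
  have hVG' : IsOpen ((fun p : Plane => ((p.2, p.1) : Plane)) ⁻¹' VG) :=
    hVG.preimage hsw.continuous
  have hW2 : IsOpen (V' ∩ C.stdCoord (.mixed θ) ⁻¹'
      ((fun p : Plane => ((p.2, p.1) : Plane)) ⁻¹' VG ∩ N)) :=
    M'.continuousOn.isOpen_inter_preimage M'.isOpen_source (hVG'.inter hN)
  set V := (V₀ ∩ f ⁻¹' OG) ∩ (V' ∩ C.stdCoord (.mixed θ) ⁻¹'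
      ((fun p : Plane => ((p.2, p.1) : Plane)) ⁻¹' VG ∩ N)) with hVdef
  have hVo : IsOpen V := hW1.inter hW2
  have hyVV : y₀ ∈ V := by
    refine ⟨⟨hyV, hq₀G⟩, hyV', ?_, hyN⟩
    change _ ∈ VG
    rw [hpos' q₀ hq₀, hYq₀] at hp₀G
    exact hp₀G
  have MV := M.restrict hVo
  have MV' := M'.restrict hVo
  have e1 : V₀ ∩ V = V := inter_eq_right.2 fun y hy => hy.1.1
  have e2 : V' ∩ V = V := inter_eq_right.2 fun y hy => hy.2.1
  rw [e1] at MV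
  rw [e2] at MV'
  refine ⟨V, hVo, hyVV, fun V₁ V₂ hi₁ hi₂ A hA hV₁ hV₂ k => ?_⟩
  have hVD : V ⊆ C.D := MV.subset.trans C.G_subset
  have ha := MV.toLocalInverse.push (testFun_stdAmp hVo hVD MV.jac_ne_zero hA)
  have hb := MV'.toLocalInverse.push (testFun_stdAmp hVo hVD MV'.jac_ne_zero hA)
  have haO : TestFun OG ((O₀ ∩ Y ⁻¹' V).indicator fun q => C.stdAmp .momentum A (Y q)) := by
    refine ha.mono fun q hq => ?_
    have h4 : f (Y q) ∈ OG := hq.2.1.2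
    have h5 : f (Y q) = q := M.right_inv q hq.1
    rwa [h5] at h4
  have hbV : TestFun VG (fun p : Plane =>
      (O' ∩ Y' ⁻¹' V).indicator (fun q => C.stdAmp (.mixed θ) A (Y' q)) (p.2, p.1)) := by
    refine (hb.comp hsw hsw.continuous fun y => rfl).mono fun p hp => ?_
    have h4 := hp.2.2.2.1
    have h5 : C.stdCoord (.mixed θ) (Y' (p.2, p.1)) = (p.2, p.1) := M'.right_inv _ hp.1
    rw [mem_preimage, h5] at h4
    exact h4
  have hmain := key _ _ haO hbV fun q hq => by
    by_cases hqV : q ∈ O₀ ∩ Y ⁻¹' V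
    · have h4 := hpos q hqV.1
      have h5 : C.stdCoord (.mixed θ) (Y q) ∈ O' ∩ Y' ⁻¹' V := MV'.mapsTo hqV.2
      have h6 : Y' (C.stdCoord (.mixed θ) (Y q)) = Y q := MV'.left_inv _ hqV.2
      have h7 := hHd _ ⟨h5.1, hqV.2.2.2.2⟩
      rw [h6] at h7
      rw [indicator_of_mem hqV, h4, indicator_of_mem h5, h6, hpos' q hqV.1]
      change _ * ((Real.sqrt |fderiv ℝ (fun p : Plane => H (p.2, p.1)) _ (0, 1)| : ℝ) : ℂ) = _
      rw [h7, stdAmp, stdAmp]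
      have h8 := sqrt_div_mul (μ := C.mu (Y q)) (c := jacDet (C.stdCoord (.mixed θ)) (Y q))
        (MV.jac_ne_zero _ hqV.2)
      rw [← h8]
      push_cast
      ring
    · rw [indicator_of_notMem hqV, zero_mul]
      by_cases h5 : ((critPos S q).2, (critPos S q).1) ∈ O' ∩ Y' ⁻¹' V
      · exfalso
        set y := Y' ((critPos S q).2, (critPos S q).1) with hy
        have h6 : C.stdCoord (.mixed θ) y = ((critPos S q).2, (critPos S q).1) :=
          M'.right_inv _ h5.1
        have h7 : ((critPos S q).2, (critPos S q).1) ∈ N := by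
          rw [← h6]
          exact h5.2.2.2.2
        have h8 : H ((critPos S q).2, (critPos S q).1) = q.2 := hHG q hq
        rw [hNe _ h7] at h8
        beta_reduce at h8
        rw [← hy] at h8
        have h9 : f y = q := by
          refine Prod.ext ?_ ?_
          · exact congrArg Prod.snd h6
          · exact h8
        refine hqV ?_
        rw [← h9]
        exact MV.mapsTo h5.2
      · rw [indicator_of_notMem h5]
  have hfour := Asymp.partialFourier_mixed M'.smooth_S M.smooth_S (haO.mono (subset_univ _))
    (hb.mono (subset_univ _)) hmain
  refine Asymp.of_comp_ofFrame (θ := θ) ?_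
  have hfin := hfour.const_mul (Complex.exp (-Complex.I * Real.pi * ((k +
    if jacDet (C.stdCoord (.mixed θ)) y₀ * jacDet C.P y₀ < 0 then 1 else 0 : ℤ) : ℂ) / 2))
  refine hfin.congr (fun h hh p => ?_) fun h _ p => ?_
  · exact MV.stdOp_eq hi₂ hA hV₂ _ hh p
  · rw [MV'.stdOp_eq hi₁ hA hV₁, ← exp_index_shift k (t :=
      jacDet (C.stdCoord (.mixed θ)) y₀ * jacDet C.P y₀), hσ]
    ring

end SingularChart

end

/-! ### Local agreement of the operators and the bookkeeping of indices. -/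

section

theorem LocalInverse.injOn {f Y : Plane → Plane} {V O : Set Plane} (h : LocalInverse f Y V O) :
    InjOn f V := fun y hy y' hy' e => by
  rw [← h.left_inv y hy, e, h.left_inv y' hy']

theorem sign_iff_of_isPreconnected {V : Set Plane} (hV : IsPreconnected V) {f : Plane → ℝ}
    (hf : ContinuousOn f V) (h0 : ∀ y ∈ V, f y ≠ 0) {y y' : Plane} (hy : y ∈ V) (hy' : y' ∈ V) :
    f y < 0 ↔ f y' < 0 := by
  have key : ∀ {y y' : Plane}, y ∈ V → y' ∈ V → f y < 0 → f y' < 0 := by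
    intro y y' hy hy' h
    by_contra hn
    obtain ⟨z, hz, hz0⟩ := hV.intermediate_value hy hy' hf ⟨h.le, not_lt.1 hn⟩
    exact h0 z hz hz0
  exact ⟨key hy hy', key hy' hy⟩

theorem ite_neg_congr {s t : ℝ} (h : s < 0 ↔ t < 0) :
    (if s < 0 then 1 else 0 : ℤ) = if t < 0 then 1 else 0 := by
  simp only [h]

theorem mul_neg_iff_of_pos {a b c : ℝ} (h : 0 < b * c) : a * b < 0 ↔ a * c < 0 := by
  rcases mul_pos_iff.1 h with ⟨hb, hc⟩ | ⟨hb, hc⟩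
  · rw [mul_neg_iff, mul_neg_iff]
    simp [hb, hc, hb.not_gt, hc.not_gt]
  · rw [mul_neg_iff, mul_neg_iff]
    simp [hb, hc, hb.not_gt, hc.not_gt]

namespace SingularChart

variable {L : LagrangianSurface} {C : SingularChart L} {θ : ℝ}

/-- `a` is an amplitude of the angle integral which corresponds to the amplitude `A` on the
surface. -/
structure IsAngleAmp (C : SingularChart L) (A : Plane → ℂ) (a : Plane × ℝ → ℂ) : Prop where
  testFun : TestFun C.W a
  eq : ∀ y ∈ C.G, a (C.X y, y.2) = (Real.sqrt |C.mu y * C.detP y| : ℂ) * A y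
  supp : ∀ z ∈ tsupport a, C.coords z ∈ tsupport A

/-- The angle integral with the phase factor determined by the index `m`. -/
def angleInt (C : SingularChart L) (m : ℤ) (a : Plane × ℝ → ℂ) (h : ℝ) (p : Plane) : ℂ :=
  Complex.exp (-Complex.I * Real.pi * m / 2) * oscInt C.tau a h p

theorem exists_asymp_angleInt_mixed {y₀ : Plane} (hy₀ : y₀ ∈ C.G)
    (hX : dot (frame₁ θ) (fderiv ℝ C.X y₀ (1, 0)) ≠ 0)
    (hd : 0 < C.detP y₀ * jacDet (C.stdCoord (.mixed θ)) y₀) :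
    ∃ V, IsOpen V ∧ y₀ ∈ V ∧ InjOn (C.stdCoord (.mixed θ)) V ∧ ∀ V₁ : Set Plane,
      InjOn (C.stdCoord (.mixed θ)) V₁ → ∀ A, TestFun V A → Function.support A ⊆ V₁ →
      ∀ a, C.IsAngleAmp A a → ∀ m : ℤ,
        Asymp (C.angleInt m a) (C.stdOp (.mixed θ) V₁ m A) := by
  obtain ⟨Y, S, V, O, M, hyV, H⟩ := exists_asymp_angle_mixed hy₀ hX hd
  refine ⟨V, M.isOpen_source, hyV, M.injOn, fun V₁ hi A hA hAV₁ a ha m => ?_⟩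
  refine Asymp.of_comp_ofFrame (θ := θ) ?_
  exact ((H A hA a ha.testFun ha.eq ha.supp).const_mul
    (Complex.exp (-Complex.I * Real.pi * m / 2))).congr (fun h _ p => rfl)
    fun h _ p => M.stdOp_eq hi hA hAV₁ m h p

/-- The mixed chart of the adapted frame is the intermediary. There Q has the sign of d, so the
shift [JQ < 0] becomes the [Jd < 0] of the singular chart. -/
theorem exists_asymp_angleInt_position {y₀ : Plane} (hy₀ : y₀ ∈ C.G) (hc : jacDet C.X y₀ ≠ 0) :
    ∃ V, IsOpen V ∧ y₀ ∈ V ∧ InjOn (C.stdCoord .position) V ∧ ∀ V₁ : Set Plane,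
      InjOn (C.stdCoord .position) V₁ → ∀ A, TestFun V A → Function.support A ⊆ V₁ →
      ∀ a, C.IsAngleAmp A a → ∀ k : ℤ,
        Asymp (C.angleInt (k + if jacDet C.X y₀ * C.detP y₀ < 0 then 1 else 0) a)
          (C.stdOp .position V₁ k A) := by
  obtain ⟨θ, hX, r, hr, hJ⟩ := exists_adapted_mixed hy₀
  have hd := detP_ne_zero hy₀
  have hpos : 0 < C.detP y₀ * jacDet (C.stdCoord (.mixed θ)) y₀ := by
    rw [hJ]
    have : 0 < C.detP y₀ ^ 2 := by positivity
    nlinarith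
  obtain ⟨V₂, hV₂, hyV₂, hi₂, H₂⟩ := exists_asymp_angleInt_mixed hy₀ hX hpos
  obtain ⟨V₃, hV₃, hyV₃, H₃⟩ := exists_asymp_mixed_position hy₀ hc
    (θ := θ) (fun h0 => by simp [h0] at hpos)
  obtain ⟨Y, V₄, O, M, -, -, hyV₄⟩ := exists_positionModel hy₀ hc 0
  have hi₄ : InjOn (C.stdCoord .position) V₄ := by
    intro y hy y' hy' he
    refine M.injOn hy hy' ?_
    exact congrArg (toFrame 0) he
  refine ⟨V₂ ∩ V₃ ∩ V₄, (hV₂.inter hV₃).inter M.isOpen_source, ⟨⟨hyV₂, hyV₃⟩, hyV₄⟩,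
    hi₄.mono inter_subset_right, fun V₁ hi₁ A hA hAV₁ a ha k => ?_⟩
  have hA₂ : TestFun V₂ A := hA.mono fun y hy => hy.1.1
  have hs := (subset_tsupport A).trans hA₂.subset
  have h1 := H₃ V₁ V₂ hi₁ hi₂ A (hA.mono fun y hy => hy.1.2) hAV₁ hs k
  rw [ite_neg_congr (mul_neg_iff_of_pos (a := jacDet C.X y₀) (mul_comm (C.detP y₀) _ ▸ hpos))] at h1
  exact (H₂ V₂ hi₂ A hA₂ hs a ha _).trans h1

theorem continuousOn_jacDet_stdCoord (κ : ChartType) : ContinuousOn (jacDet (C.stdCoord κ)) C.D :=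
  (contDiffOn_jacDet C.D_open (contDiffOn_stdCoord κ)).continuousOn

variable {κ : ChartType} {V : Set Plane} {a₀ u₀ : L.carrier} {γ : Path a₀ u₀} {m m' : ℤ}

/-- The two indices may be read off at different regular points; `pointIndex_sub` expresses both
through the index k of one regular point of `V`. -/
theorem HasStdIndex.exists_regular (hV : C.IsStdChart κ V) (hu₀ : (u₀ : Phase) ∈ C.r '' C.G)
    (hm : C.HasIndex γ m) (hm' : C.HasStdIndex κ V γ m') :
    ∃ y ∈ V, jacDet C.X y ≠ 0 ∧ ∃ k : ℤ, m' = k + C.negIndex κ y ∧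
      m = k + if jacDet C.X y * C.detP y < 0 then 1 else 0 := by
  obtain ⟨y, hy, hr, k, hk, hm'⟩ := hm'
  obtain ⟨y', hy', hr', k', hk', hm⟩ := hm
  have hG := hV.subset hy
  have hc := regular_jacDet (C.G_subset hG) hr
  refine ⟨y, hy, hc, k, hm', ?_⟩
  rw [hm]
  exact pointIndex_sub hu₀ hy' hG (regular_jacDet (C.G_subset hy') hr') hc hk' hk

theorem sign_mixed_iff (hV : C.IsStdChart κ V) {y y' : Plane} (hy : y ∈ V) (hy' : y' ∈ V) :
    C.detP y * jacDet (C.stdCoord κ) y < 0 ↔ C.detP y' * jacDet (C.stdCoord κ) y' < 0 := by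
  have hVD := hV.subset.trans C.G_subset
  exact sign_iff_of_isPreconnected hV.connected.isPreconnected
    ((contDiffOn_detP.continuousOn.mono hVD).mul ((continuousOn_jacDet_stdCoord κ).mono hVD))
    (fun y hy => mul_ne_zero (detP_ne_zero (hV.subset hy)) (hV.jac_ne_zero y hy)) hy hy'

/-- The inequality, which holds at any focal point, persists on the connected set `V`. At a regular
point [JQ < 0] and [Jd < 0] then coincide, so the indices are equal as integers. -/
theorem index_eq_of_focal (hV : C.IsStdChart (.mixed θ) V) (hu₀ : (u₀ : Phase) ∈ C.r '' C.G)
    (hm : C.HasIndex γ m) (hm' : C.HasStdIndex (.mixed θ) V γ m') {y₀ : Plane} (hy₀ : y₀ ∈ V)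
    (hpos : 0 < C.detP y₀ * jacDet (C.stdCoord (.mixed θ)) y₀) : m = m' := by
  obtain ⟨y, hy, hc, k, hk', hk⟩ := HasStdIndex.exists_regular hV hu₀ hm hm'
  have h1 : 0 < C.detP y * jacDet (C.stdCoord (.mixed θ)) y := by
    have h2 := (sign_mixed_iff hV hy hy₀).not.2 hpos.not_gt
    exact lt_of_le_of_ne (not_lt.1 h2)
      (mul_ne_zero (detP_ne_zero (hV.subset hy)) (hV.jac_ne_zero y hy)).symm
  rw [hk, hk', negIndex_mixed (C.G_subset (hV.subset hy)) (hV.jac_ne_zero y hy),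
    ite_neg_congr (mul_neg_iff_of_pos h1)]
  push_cast
  rfl

/-- The local form of the agreement of the angle integral with a standard operator. -/
theorem exists_asymp_angleInt_stdOp (hV : C.IsStdChart κ V) (hu₀ : (u₀ : Phase) ∈ C.r '' C.G)
    (hm : C.HasIndex γ m) (hm' : C.HasStdIndex κ V γ m') {y₀ : Plane} (hy₀ : y₀ ∈ V) :
    ∃ V₀, IsOpen V₀ ∧ y₀ ∈ V₀ ∧ ∀ A, TestFun V₀ A → Function.support A ⊆ V →
      ∀ a, C.IsAngleAmp A a → Asymp (C.angleInt m a) (C.stdOp κ V m' A) := by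
  have hVD := hV.subset.trans C.G_subset
  have hd := detP_ne_zero (hV.subset hy₀)
  obtain ⟨y, hy, hc, k, hk', hk⟩ := HasStdIndex.exists_regular hV hu₀ hm hm'
  cases κ with
  | position =>
    have hc₀ : jacDet C.X y₀ ≠ 0 := hV.jac_ne_zero y₀ hy₀
    obtain ⟨V₀, hV₀, hyV₀, -, H⟩ := exists_asymp_angleInt_position (hV.subset hy₀) hc₀
    refine ⟨V₀, hV₀, hyV₀, fun A hA hAV a ha => ?_⟩
    have h1 := H V hV.injOn A hA hAV a ha m'
    have h2 : m = m' + if jacDet C.X y₀ * C.detP y₀ < 0 then 1 else 0 := by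
      have h3 : jacDet C.X y * C.detP y < 0 ↔ jacDet C.X y₀ * C.detP y₀ < 0 := by
        rw [mul_comm, mul_comm (jacDet C.X y₀)]
        exact sign_mixed_iff hV hy hy₀
      rw [hk, hk', negIndex_position hc, ite_neg_congr h3]
      simp
    rwa [← h2] at h1
  | mixed θ =>
    have hJ := hV.jac_ne_zero
    -- At a focal point the comparison is direct. At a regular one the frame θ may violate its
    -- conditions, and the position operator serves as intermediary.
    by_cases hc₀ : jacDet C.X y₀ = 0
    · obtain ⟨hX, hpos⟩ := mixed_at_focal (hV.subset hy₀) hc₀ (hJ y₀ hy₀)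
      obtain ⟨V₀, hV₀, hyV₀, -, H⟩ := exists_asymp_angleInt_mixed (hV.subset hy₀) hX hpos
      refine ⟨V₀, hV₀, hyV₀, fun A hA hAV a ha => ?_⟩
      rw [← index_eq_of_focal hV hu₀ hm hm' hy₀ hpos]
      exact H V hV.injOn A hA hAV a ha m
    · obtain ⟨V₁, hV₁, hyV₁, hi₁, H₁⟩ := exists_asymp_angleInt_position (hV.subset hy₀) hc₀
      obtain ⟨V₂, hV₂, hyV₂, H₂⟩ := exists_asymp_mixed_position (hV.subset hy₀) hc₀ (hJ y₀ hy₀)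
      refine ⟨V₁ ∩ V₂, hV₁.inter hV₂, ⟨hyV₁, hyV₂⟩, fun A hA hAV a ha => ?_⟩
      have hA₁ : TestFun V₁ A := hA.mono inter_subset_left
      have hs := (subset_tsupport A).trans hA₁.subset
      set k₀ : ℤ := m - if jacDet C.X y₀ * C.detP y₀ < 0 then 1 else 0 with hk₀
      have h1 := H₁ V₁ hi₁ A hA₁ hs a ha k₀
      have h2 := H₂ V₁ V hi₁ hV.injOn A (hA.mono inter_subset_right) hs hAV k₀
      have e1 : k₀ + (if jacDet C.X y₀ * C.detP y₀ < 0 then 1 else 0) = m := by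
        rw [hk₀]
        ring
      have e2 : k₀ + (if jacDet C.X y₀ * jacDet (C.stdCoord (.mixed θ)) y₀ < 0 then 1 else 0) =
          m' := by
        -- If dQ < 0, the chart has no focal points and J keeps its sign on it, so the signs at `y`
        -- are those at `y₀`. If dQ > 0, the two indices coincide.
        rcases lt_or_gt_of_ne (mul_ne_zero hd (hJ y₀ hy₀)) with hn | hp
        · have h3 : ∀ z ∈ V, jacDet C.X z ≠ 0 := by
            intro z hz h0
            have h4 := (mixed_at_focal (hV.subset hz) h0 (hJ z hz)).2
            exact h4.not_gt ((sign_mixed_iff hV hy₀ hz).1 hn)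
          have hpc := hV.connected.isPreconnected
          have hcc : ContinuousOn (jacDet C.X) V :=
            (contDiffOn_jacDet C.D_open C.contDiffOn_X).continuousOn.mono hVD
          have h5 := sign_iff_of_isPreconnected hpc
            (hcc.mul (contDiffOn_detP.continuousOn.mono hVD))
            (fun z hz => mul_ne_zero (h3 z hz) (detP_ne_zero (hV.subset hz))) hy hy₀
          have h6 := sign_iff_of_isPreconnected hpc
            (hcc.mul ((continuousOn_jacDet_stdCoord (.mixed θ)).mono hVD))
            (fun z hz => mul_ne_zero (h3 z hz) (hJ z hz)) hy hy₀
          simp only [Pi.mul_apply] at h5 h6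
          rw [hk₀, hk', hk, negIndex_mixed (C.G_subset (hV.subset hy)) (hJ y hy),
            ite_neg_congr h5, ← ite_neg_congr h6]
          push_cast
          ring
        · rw [← index_eq_of_focal hV hu₀ hm hm' hy₀ hp, ← ite_neg_congr (mul_neg_iff_of_pos hp),
            e1]
      rw [e1] at h1
      rw [e2] at h2
      exact h1.trans h2.symm
  | momentum =>
    have hR : jacDet C.P y₀ ≠ 0 := hV.jac_ne_zero y₀ hy₀
    obtain ⟨θ, hX, r, hr, hJ⟩ := exists_adapted_mixed (hV.subset hy₀)
    have hpos : 0 < C.detP y₀ * jacDet (C.stdCoord (.mixed θ)) y₀ := by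
      rw [hJ]
      have : 0 < C.detP y₀ ^ 2 := by positivity
      nlinarith
    obtain ⟨V₁, hV₁, hyV₁, hi₁, H₁⟩ := exists_asymp_angleInt_mixed (hV.subset hy₀) hX hpos
    obtain ⟨V₂, hV₂, hyV₂, H₂⟩ := exists_asymp_momentum_mixed (hV.subset hy₀) hR
      (θ := θ) (fun h0 => by simp [h0] at hpos)
    refine ⟨V₁ ∩ V₂, hV₁.inter hV₂, ⟨hyV₁, hyV₂⟩, fun A hA hAV a ha => ?_⟩
    have hA₁ : TestFun V₁ A := hA.mono inter_subset_left
    have hs := (subset_tsupport A).trans hA₁.subset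
    have h1 := H₁ V₁ hi₁ A hA₁ hs a ha m
    have h2 := H₂ V₁ V hi₁ hV.injOn A (hA.mono inter_subset_right) hs hAV m
    -- In the adapted frame Q has the sign of d. The shift is therefore what remains of the negative
    -- index in momenta once [Jd < 0] has been absorbed in m.
    have e2 : m + (if jacDet (C.stdCoord (.mixed θ)) y₀ * jacDet C.P y₀ < 0 then 1 else 0) =
        m' := by
      have h3 : C.detP y * jacDet C.P y < 0 ↔ C.detP y₀ * jacDet C.P y₀ < 0 :=
        sign_mixed_iff hV hy hy₀
      have h4 : jacDet (C.stdCoord (.mixed θ)) y₀ * jacDet C.P y₀ < 0 ↔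
          C.detP y₀ * jacDet C.P y₀ < 0 := by
        rw [mul_comm, mul_comm (C.detP y₀)]
        exact (mul_neg_iff_of_pos hpos).symm
      rw [ite_neg_congr h4, ← ite_neg_congr h3, hk', hk, negIndex_momentum (hV.subset hy) hc]
      push_cast
      ring
    rw [e2] at h2
    exact h1.trans h2.symm

end SingularChart

end

/-! ### From local to global: cut-offs, partitions of unity, and the set N. -/

section

/-- A smooth cut-off function which is equal to `1` on a compact set. -/
theorem exists_testFun_one {E : Type*} [NormedAddCommGroup E] [NormedSpace ℝ E]
    [FiniteDimensional ℝ E] {K W : Set E} (hK : IsCompact K) (hW : IsOpen W) (hKW : K ⊆ W) :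
    ∃ ζ : E → ℂ, TestFun W ζ ∧ ∀ z ∈ K, ζ z = 1 := by
  have := FiniteDimensional.proper ℝ E
  obtain ⟨M, hM, hKM, hMW⟩ := exists_compact_between hK hW hKW
  obtain ⟨f, hf0, hf1, -⟩ := exists_contMDiffMap_zero_one_of_isClosed (n := (⊤ : ℕ∞))
    (modelWithCornersSelf ℝ E) (s := (interior M)ᶜ) (t := K)
    isOpen_interior.isClosed_compl hK.isClosed (disjoint_compl_left_iff_subset.2 hKM)
  have hs : tsupport (fun z => (f z : ℂ)) ⊆ M := by
    refine closure_minimal (fun z hz => ?_) hM.isClosed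
    by_contra hn
    refine hz ?_
    have h0 : f z = 0 := hf0 fun h => hn (interior_subset h)
    simp [h0]
  refine ⟨fun z => (f z : ℂ), ⟨Complex.ofRealCLM.contDiff.comp f.contMDiff.contDiff,
    hM.of_isClosed_subset (isClosed_tsupport _) hs, hs.trans hMW⟩, fun z hz => ?_⟩
  have h1 : f z = 1 := hf1 hz
  simp [h1]

/-- Properties of test functions which are local and compatible with smooth cut-offs. -/
theorem testFun_induction {V : Set Plane} (hVne : V.Nonempty) (Good : (Plane → ℂ) → Prop)
    (hsplit : ∀ A κ, TestFun V A → ContDiff ℝ ∞ κ → Good (fun y => κ y * A y) →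
      Good (fun y => (1 - κ y) * A y) → Good A)
    (hloc : ∀ y ∈ V, ∃ V₀, IsOpen V₀ ∧ y ∈ V₀ ∧ ∀ A, TestFun V A → TestFun V₀ A → Good A)
    {A : Plane → ℂ} (hA : TestFun V A) : Good A := by
  choose! V₀ hV₀ hyV₀ H using hloc
  have hb : ∀ y ∈ V, ∃ κ : Plane → ℂ, TestFun (V₀ y) κ ∧ ∃ N, IsOpen N ∧ y ∈ N ∧ N ⊆ V₀ y ∧
      ∀ z ∈ N, κ z = 1 := fun y hy => exists_bump (hV₀ y hy) (hyV₀ y hy)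
  choose! κ hκ N hN hyN _ hκ1 using hb
  -- Induction on the number of neighbourhoods covering the support. One bump is split off, and the
  -- remainder is supported off the neighbourhood where this bump is 1.
  have key : ∀ (s : Finset Plane) (A : Plane → ℂ), (∀ y ∈ s, y ∈ V) → TestFun V A →
      tsupport A ⊆ ⋃ y ∈ s, N y → Good A := by
    intro s
    induction s using Finset.induction_on with
    | empty =>
      intro A _ hA hs
      obtain ⟨y, hy⟩ := hVne
      refine H y hy A hA ⟨hA.smooth, hA.compact, fun z hz => ?_⟩
      simpa using hs hz
    | insert y s _ ih =>
      intro A hsV hA hs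
      have hy := hsV y (Finset.mem_insert_self y s)
      refine hsplit A (κ y) hA (hκ y hy).smooth ?_ ?_
      · refine H y hy _ (hA.mul_smooth (hκ y hy).smooth) ?_
        refine ⟨(hκ y hy).smooth.mul hA.smooth, hA.compact.mul_left, ?_⟩
        exact (tsupport_mul_subset_left).trans (hκ y hy).subset
      · refine ih _ (fun z hz => hsV z (Finset.mem_insert_of_mem hz))
          (hA.mul_smooth (contDiff_const.sub (hκ y hy).smooth)) fun z hz => ?_
        have h1 : z ∈ tsupport A := tsupport_mul_subset_right hz
        have h2 : z ∉ N y := by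
          intro hzN
          have h4 : Function.support (fun w => (1 - κ y w) * A w) ⊆ (N y)ᶜ :=
            fun w hw hwN => hw (by simp [hκ1 y hy w hwN])
          exact closure_minimal h4 (hN y hy).isClosed_compl hz hzN
        have h3 := hs h1
        rw [Finset.set_biUnion_insert] at h3
        exact h3.resolve_left h2
  obtain ⟨t, htA, hts⟩ := hA.compact.isCompact.elim_nhds_subcover N
    fun y hy => (hN y (hA.subset hy)).mem_nhds (hyN y (hA.subset hy))
  exact key t A (fun y hy => hA.subset (htA y hy)) hA hts

namespace SingularChart

variable {L : LagrangianSurface} {C : SingularChart L} {θ : ℝ} {κ : ChartType} {V : Set Plane}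

theorem stdIntegrand_add {A B : Plane → ℂ} (h : ℝ) (phase : Plane → ℝ) (q : Plane) :
    C.stdIntegrand κ V (fun y => A y + B y) h phase q =
      C.stdIntegrand κ V A h phase q + C.stdIntegrand κ V B h phase q := by
  by_cases hq : q ∈ C.stdCoord κ '' V
  · simp only [stdIntegrand, indicator_of_mem hq]
    ring
  · simp only [stdIntegrand, indicator_of_notMem hq, add_zero]

theorem stdIntegrand_zero (h : ℝ) (phase : Plane → ℝ) (q : Plane) :
    C.stdIntegrand κ V (fun _ => 0) h phase q = 0 := by
  by_cases hq : q ∈ C.stdCoord κ '' V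
  · simp [stdIntegrand]
  · simp only [stdIntegrand, indicator_of_notMem hq]

theorem stdOp_zero (m : ℤ) (h : ℝ) (x : Plane) : C.stdOp κ V m (fun _ => 0) h x = 0 := by
  cases κ <;> simp [stdOp, stdIntegrand_zero]

/-- The integrands of the standard operator are test functions. -/
def HasTestIntegrand (C : SingularChart L) (κ : ChartType) (V : Set Plane) (A : Plane → ℂ) :
    Prop :=
  ∀ (h : ℝ) (phase : Plane → ℝ), ContDiffOn ℝ ∞ phase C.D →
    TestFun univ (C.stdIntegrand κ V A h phase)

theorem contDiffOn_dot_sub (x : Plane) {E : Plane → Plane} (hE : ContDiffOn ℝ ∞ E C.D) :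
    ContDiffOn ℝ ∞ (fun y => dot (E y) (x - C.X y)) C.D := by
  have h1 : ContDiffOn ℝ ∞ (fun y => x - C.X y) C.D := contDiffOn_const.sub C.contDiffOn_X
  exact (hE.fst.mul h1.fst).add (hE.snd.mul h1.snd)

theorem stdOp_add {A B : Plane → ℂ} (hA : C.HasTestIntegrand κ V A)
    (hB : C.HasTestIntegrand κ V B) (m : ℤ) (h : ℝ) (x : Plane) :
    C.stdOp κ V m (fun y => A y + B y) h x = C.stdOp κ V m A h x + C.stdOp κ V m B h x := by
  cases κ with
  | position => simp only [stdOp, stdIntegrand_add, mul_add]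
  | mixed θ =>
    have h1 : ContDiffOn ℝ ∞
        (fun y => dot (frame₂ θ) (C.P y) * dot (frame₂ θ) (x - C.X y)) C.D := by
      have h2 := (dotL (frame₂ θ)).contDiff.comp_contDiffOn C.contDiffOn_P
      exact h2.mul (contDiffOn_dot_sub x contDiffOn_const)
    simp only [stdOp, stdIntegrand_add]
    rw [integral_add ((hA h _ h1).slice_integrable _) ((hB h _ h1).slice_integrable _)]
    ring
  | momentum =>
    have h1 := contDiffOn_dot_sub x C.contDiffOn_P
    simp only [stdOp, stdIntegrand_add]
    rw [integral_add ((hA h _ h1).smooth.continuous.integrable_of_hasCompactSupport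
      (hA h _ h1).compact) ((hB h _ h1).smooth.continuous.integrable_of_hasCompactSupport
      (hB h _ h1).compact)]
    ring

/-- Near one point a smooth local inverse is at hand; `testFun_induction` later extends the property
to all amplitudes on `V`. -/
theorem exists_hasTestIntegrand (hV : C.IsStdChart κ V) {y₀ : Plane} (hy₀ : y₀ ∈ V) :
    ∃ V₀, IsOpen V₀ ∧ y₀ ∈ V₀ ∧ ∀ A, TestFun V₀ A → Function.support A ⊆ V →
      C.HasTestIntegrand κ V A := by
  have hVD := hV.subset.trans C.G_subset
  obtain ⟨Y, V₀, O, M, hV₀, hyV₀⟩ := exists_localInverse hV.isOpen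
    ((contDiffOn_stdCoord κ).mono hVD) hy₀ (hV.jac_ne_zero y₀ hy₀)
  refine ⟨V₀, M.isOpen_source, hyV₀, fun A hA hAV h phase hp => ?_⟩
  have hb := M.push (testFun_stdAmp M.isOpen_source (hV₀.trans hVD)
    (fun y hy => hV.jac_ne_zero y (hV₀ hy)) hA)
  have e : C.stdIntegrand κ V A h phase = fun q => osc h ((Y q).1 + phase (Y q)) *
      O.indicator (fun q => C.stdAmp κ A (Y q)) q := funext fun q =>
    C.stdIntegrand_eq hV.injOn M (ℓ := id) Function.injective_id (fun y _ => rfl) hA hAV h phase q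
  rw [e]
  refine (hb.mul_smoothOn M.isOpen_target ?_).mono (subset_univ _)
  exact (contDiff_osc h).comp_contDiffOn (M.smooth.fst.contDiffOn.add
    (hp.comp M.smooth.contDiffOn fun q hq => hVD (hV₀ (M.mapsTo_inv hq))))

/-- Cut-offs on the surface act on angle amplitudes through the coordinates (τ(x, ψ), ψ), also away
from the critical set. -/
theorem IsAngleAmp.mul {A : Plane → ℂ} {a : Plane × ℝ → ℂ} (ha : C.IsAngleAmp A a)
    (hA : tsupport A ⊆ C.G) {f : Plane → ℂ} (hf : ContDiffOn ℝ ∞ f C.G) :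
    C.IsAngleAmp (fun y => f y * A y) (fun z => f (C.coords z) * a z) := by
  have hWG : IsOpen (C.W ∩ C.coords ⁻¹' C.G) :=
    (contDiffOn_coords (C := C)).continuousOn.isOpen_inter_preimage C.W_open C.G_open
  have ha' : TestFun (C.W ∩ C.coords ⁻¹' C.G) a :=
    ⟨ha.testFun.smooth, ha.testFun.compact,
      fun z hz => ⟨ha.testFun.subset hz, hA (ha.supp z hz)⟩⟩
  refine ⟨(ha'.mul_smoothOn hWG (hf.comp ((contDiffOn_coords (C := C)).mono inter_subset_left)
    fun z hz => hz.2)).mono inter_subset_left, fun y hy => ?_, fun z hz => ?_⟩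
  · rw [(crit_of_mem hy).2, ha.eq y hy]
    ring
  · have hcl : IsClosed (tsupport a ∩ C.coords ⁻¹' tsupport (fun y => f y * A y)) :=
      ((contDiffOn_coords (C := C)).continuousOn.mono ha.testFun.subset).preimage_isClosed_of_isClosed
        (isClosed_tsupport a) (isClosed_tsupport _)
    refine (closure_minimal (fun w hw => ?_) hcl hz).2
    have hwa : w ∈ tsupport a := subset_tsupport a (right_ne_zero_of_mul hw)
    refine ⟨hwa, ?_⟩
    have h1 := ha.supp w hwa
    have h2 : ∀ᶠ y in 𝓝 (C.coords w), f y ≠ 0 :=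
      (hf.continuousOn.continuousAt (C.G_open.mem_nhds (hA h1))).eventually_ne
        (left_ne_zero_of_mul hw)
    refine mem_closure_iff_frequently.2 (((mem_closure_iff_frequently.1 h1).and_eventually
      h2).mono fun y hy => ?_)
    exact mul_ne_zero hy.2 hy.1

theorem angleInt_add {a b : Plane × ℝ → ℂ} (ha : TestFun C.W a) (hb : TestFun C.W b) (m : ℤ)
    (h : ℝ) (p : Plane) :
    C.angleInt m (fun z => a z + b z) h p = C.angleInt m a h p + C.angleInt m b h p := by
  rw [angleInt, oscInt_add C.W_open C.tau_smooth ha hb, mul_add]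
  rfl

variable {a₀ u₀ : L.carrier} {γ : Path a₀ u₀} {m m' : ℤ}

/-- The angle integral is equal to the standard operator in a standard chart. -/
theorem asymp_angleInt_stdOp (hV : C.IsStdChart κ V) (hu₀ : (u₀ : Phase) ∈ C.r '' C.G)
    (hm : C.HasIndex γ m) (hm' : C.HasStdIndex κ V γ m') {A : Plane → ℂ} (hA : TestFun V A)
    {a : Plane × ℝ → ℂ} (ha : C.IsAngleAmp A a) :
    Asymp (C.angleInt m a) (C.stdOp κ V m' A) := by
  -- The first half of the property accompanies the induction because additivity of the standard
  -- operator needs integrable integrands.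
  have key := testFun_induction hV.connected.nonempty (fun A => C.HasTestIntegrand κ V A ∧
    ∀ a, C.IsAngleAmp A a → Asymp (C.angleInt m a) (C.stdOp κ V m' A)) ?_ ?_ hA
  · exact key.2 a ha
  · intro A ρ hA hρ h1 h2
    have eA : (fun y => ρ y * A y + (1 - ρ y) * A y) = A := by
      funext y
      ring
    refine ⟨fun h phase hp => ?_, fun a ha => ?_⟩
    · have h3 := (h1.1 h phase hp).add (h2.1 h phase hp)
      simp only [← stdIntegrand_add, eA] at h3
      exact h3
    · have hAG := hA.subset.trans hV.subset
      have ha1 := ha.mul hAG hρ.contDiffOn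
      have ha2 := ha.mul hAG (f := fun y => 1 - ρ y) (contDiff_const.sub hρ).contDiffOn
      refine ((h1.2 _ ha1).add (h2.2 _ ha2)).congr (fun h _ p => ?_) fun h _ p => ?_
      · rw [← angleInt_add ha1.testFun ha2.testFun]
        congr 1
        funext z
        ring
      · rw [← stdOp_add h1.1 h2.1, eA]
  · intro y hy
    obtain ⟨V₁, hV₁, hyV₁, H₁⟩ := exists_hasTestIntegrand hV hy
    obtain ⟨V₂, hV₂, hyV₂, H₂⟩ := exists_asymp_angleInt_stdOp hV hu₀ hm hm' hy
    refine ⟨V₁ ∩ V₂, hV₁.inter hV₂, ⟨hyV₁, hyV₂⟩, fun A hA hA₀ => ?_⟩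
    have hs := (subset_tsupport A).trans hA.subset
    exact ⟨H₁ A (hA₀.mono inter_subset_left) hs, H₂ A (hA₀.mono inter_subset_right) hs⟩

/-- The angle integral is equal to the standard operator glued by a partition of unity. -/
theorem asymp_angleInt_stdGlobalOp {ι : Type*} {κ : ι → ChartType} {V : ι → Set Plane}
    {m' : ι → ℤ} {e : ι → Plane → ℝ} (hV : ∀ k, C.IsStdChart (κ k) (V k))
    (hu₀ : (u₀ : Phase) ∈ C.r '' C.G) (hm : C.HasIndex γ m)
    (hm' : ∀ k, C.HasStdIndex (κ k) (V k) γ (m' k)) (he : IsPartition C.G V e)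
    {A : Plane → ℂ} (hA : TestFun C.G A) {a : Plane × ℝ → ℂ} (ha : C.IsAngleAmp A a) :
    Asymp (C.angleInt m a) (C.stdGlobalOp κ V m' e A) := by
  -- Local finiteness and compactness of the support leave finitely many terms.
  have hfin : {k | ∃ z ∈ tsupport A, e k z ≠ 0}.Finite := by
    refine hA.compact.isCompact.induction_on (p := fun t => {k | ∃ z ∈ t, e k z ≠ 0}.Finite)
      (by simp) (fun s t hst ht => ht.subset fun k ⟨z, hz, h⟩ => ⟨z, hst hz, h⟩)
      (fun s t hs ht => (hs.union ht).subset fun k ⟨z, hz, h⟩ => hz.imp (⟨z, ·, h⟩) (⟨z, ·, h⟩))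
      fun y hy => ?_
    obtain ⟨O, hO, hf⟩ := he.locallyFinite y (hA.subset hy)
    exact ⟨O, mem_nhdsWithin_of_mem_nhds hO, hf⟩
  set s := hfin.toFinset with hs
  have hes : ∀ k ∉ s, ∀ z ∈ tsupport A, e k z = 0 := by
    intro k hk z hz
    by_contra h0
    exact hk (hfin.mem_toFinset.2 ⟨z, hz, h0⟩)
  have hesm : ∀ k, ContDiffOn ℝ ∞ (fun y => (e k y : ℂ)) C.G := fun k =>
    Complex.ofRealCLM.contDiff.comp_contDiffOn (he.smooth k)
  have hak := fun k => ha.mul hA.subset (hesm k)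
  have hAk : ∀ k, TestFun (V k) fun y => (e k y : ℂ) * A y := by
    intro k
    have h1 := hA.mul_smoothOn C.G_open (hesm k)
    refine ⟨h1.smooth, h1.compact, fun y hy => he.subordinate k ⟨?_, h1.subset hy⟩⟩
    refine closure_mono (fun z hz => ?_) (tsupport_mul_subset_left hy)
    exact fun h0 => hz (by simp [h0])
  have hmain := fun k => asymp_angleInt_stdOp (hV k) hu₀ hm (hm' k) (hAk k) (hak k)
  have hsum : ∀ t : Finset ι, TestFun C.W (fun z => ∑ k ∈ t, (e k (C.coords z) : ℂ) * a z) ∧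
      Asymp (C.angleInt m fun z => ∑ k ∈ t, (e k (C.coords z) : ℂ) * a z) fun h x => ∑ k ∈ t,
        C.stdOp (κ k) (V k) (m' k) (fun y => (e k y : ℂ) * A y) h x := by
    intro t
    classical
    induction t using Finset.induction_on with
    | empty =>
      refine ⟨by simpa using ha.testFun.mul_smooth (contDiff_const (c := (0 : ℂ))), ?_⟩
      refine (Asymp.refl (u := fun _ _ => 0) fun h _ => continuous_const).congr
        (fun h _ p => ?_) fun h _ p => ?_
      · simp [angleInt, oscInt]
      · simp
    | insert k t hk ih =>
      refine ⟨?_, (hmain k |>.add ih.2).congr (fun h _ p => ?_) fun h _ p => ?_⟩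
      · simp only [Finset.sum_insert hk]
        exact (hak k).testFun.add ih.1
      · simp only [Finset.sum_insert hk]
        exact angleInt_add (hak k).testFun ih.1 m h p
      · rw [Finset.sum_insert hk]
  refine (hsum s).2.congr (fun h _ p => ?_) fun h _ p => ?_
  · congr 1
    funext z
    by_cases hz : a z = 0
    · simp [hz]
    · have hzA := ha.supp z (subset_tsupport a hz)
      have h1 := he.sum_eq_one _ (hA.subset hzA)
      rw [finsum_eq_sum_of_support_subset (s := s) _ (fun k hk => by
        by_contra hn
        exact hk (hes k hn _ hzA))] at h1
      rw [← Finset.sum_mul, ← Complex.ofReal_sum, h1]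
      simp
  · rw [stdGlobalOp]
    refine finsum_eq_sum_of_support_subset _ fun k hk => ?_
    by_contra hn
    refine hk ?_
    have h0 : (fun y => (e k y : ℂ) * A y) = fun _ => 0 := by
      funext y
      by_cases hy : y ∈ tsupport A
      · simp [hes k hn y hy]
      · simp [image_eq_zero_of_notMem_tsupport hy]
    beta_reduce
    rw [h0, stdOp_zero]

/-- The angle operator is an angle integral with a compactly supported amplitude. -/
theorem exists_angleAmp {A : Plane → ℂ} (hA : TestFun C.G A) {χ : Plane × ℝ → ℝ} {N : Set Plane}
    (hχ : C.Admissible A χ N) (m : ℤ) : ∃ a, C.IsAngleAmp A a ∧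
      ∀ h, ∀ x ∈ N, C.angleOp χ m A h x = C.angleInt m a h x := by
  set K := {z ∈ C.W | z.1 ∈ N ∧ z ∈ tsupport χ ∧ (C.tau z, z.2) ∈ tsupport A} with hK
  have hXc : ContinuousOn (fun y => ((C.X y, y.2) : Plane × ℝ)) (tsupport A) :=
    (C.contDiffOn_X.continuousOn.mono (hA.subset.trans C.G_subset)).prodMk
      continuous_snd.continuousOn
  have hK' := hA.compact.isCompact.image_of_continuousOn hXc
  -- ζ = 1 on `K`, so nothing changes for x in N, and also over the whole support of `A`, whose
  -- positions need not lie in N, so the amplitude is right on the critical set.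
  obtain ⟨ζ, hζ, hζ1⟩ := exists_testFun_one (hχ.compact.union hK') C.W_open (by
    rintro z (hz | ⟨y, hy, rfl⟩)
    · exact hz.1
    · exact (crit_of_mem (hA.subset hy)).1.1)
  have hcoords := contDiffOn_coords (C := C)
  have hmaps : MapsTo C.coords C.W C.D := fun z hz => C.tau_mem z hz
  have hd : ∀ z ∈ C.W, C.detP (C.coords z) ≠ 0 := by
    intro z hz
    have h := C.det_ne_zero z hz
    rw [detP, fderiv_P (hmaps hz)]
    exact h
  have hsq : ContDiffOn ℝ ∞
      (fun z => Real.sqrt |C.mu (C.coords z) * C.detP (C.coords z)|) C.W :=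
    contDiffOn_sqrt_abs ((contDiffOn_mu.comp hcoords hmaps).mul
      (contDiffOn_detP.comp hcoords hmaps)) fun z hz => mul_ne_zero (mu_ne_zero (hmaps hz)) (hd z hz)
  set f : Plane × ℝ → ℂ := fun z => (χ z : ℂ) * A (C.coords z) *
    (Real.sqrt |C.mu (C.coords z) * C.detP (C.coords z)| : ℂ) with hf
  have hfs : ContDiffOn ℝ ∞ f C.W :=
    ((Complex.ofRealCLM.contDiff.comp_contDiffOn hχ.smooth).mul
      (hA.smooth.comp_contDiffOn hcoords)).mul (Complex.ofRealCLM.contDiff.comp_contDiffOn hsq)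
  refine ⟨fun z => f z * ζ z, ⟨hζ.mul_smoothOn C.W_open hfs, fun y hy => ?_, fun z hz => ?_⟩,
    fun h x hx => ?_⟩
  · rw [hf]
    beta_reduce
    rw [(crit_of_mem hy).2]
    by_cases hyA : y ∈ tsupport A
    · rw [hζ1 _ (Or.inr ⟨y, hyA, rfl⟩), (hχ.eq_one y hyA).self_of_nhds]
      push_cast
      ring
    · rw [image_eq_zero_of_notMem_tsupport hyA]
      ring
  · have hcl : IsClosed (tsupport ζ ∩ C.coords ⁻¹' tsupport A) :=
      (hcoords.continuousOn.mono hζ.subset).preimage_isClosed_of_isClosed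
        (isClosed_tsupport ζ) (isClosed_tsupport _)
    refine (closure_minimal (fun w hw => ?_) hcl hz).2
    exact ⟨subset_tsupport ζ (right_ne_zero_of_mul hw), subset_tsupport A
      (right_ne_zero_of_mul (left_ne_zero_of_mul (left_ne_zero_of_mul hw)))⟩
  · rw [angleOp, angleInt, oscInt, amp, mul_left_comm, ← mul_assoc]
    congr 2
    funext ψ
    by_cases hz : (x, ψ) ∈ C.W
    · rw [indicator_of_mem hz]
      by_cases hfz : (χ (x, ψ) : ℂ) * A (C.coords (x, ψ)) = 0
      · have h0 : f (x, ψ) = 0 := by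
          rw [hf]
          beta_reduce
          rw [hfz, zero_mul]
        have h1 : (χ (x, ψ) : ℂ) * A (C.tau (x, ψ), ψ) = 0 := hfz
        rw [h0, zero_mul, mul_zero, mul_right_comm (χ (x, ψ) : ℂ), h1]
        ring
      · have hzK : (x, ψ) ∈ K := by
          refine ⟨hz, hx, subset_tsupport χ ?_, subset_tsupport A (right_ne_zero_of_mul hfz)⟩
          exact fun h0 => left_ne_zero_of_mul hfz (by simp [h0])
        rw [hζ1 _ (Or.inl hzK), mul_one]
        simp only [hf, osc, coords]
        ring
    · rw [indicator_of_notMem hz]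
      rw [hζ.eq_zero hz, mul_zero, mul_zero]

end SingularChart

/-- The given operator agrees with its regularized form only over N, where the norm is bounded by
that over the plane. -/
theorem Asymp.eqModO {u v w : ℝ → Plane → ℂ} (h : Asymp u v) {N : Set Plane}
    (hN : MeasurableSet N) (hw : ∀ h, ∀ x ∈ N, w h x = u h x) : EqModO N w v := by
  obtain ⟨c, -, H⟩ := h.small
  refine ⟨c, 1, one_pos, fun t ht ht1 => ?_⟩
  have h1 : (fun x => w t x - v t x) =ᵐ[volume.restrict N] fun x => u t x - v t x :=
    (ae_restrict_iff' hN).2 (Eventually.of_forall fun x hx => by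
      beta_reduce
      rw [hw t x hx])
  rw [eLpNorm_congr_ae h1]
  exact (eLpNorm_mono_measure _ Measure.restrict_le_self).trans (H t ht ht1.le)

theorem IsTestFun.testFun {G : Set Plane} {A : Plane → ℂ} (h : IsTestFun G A) : TestFun G A :=
  ⟨h.smooth, h.compact, h.subset⟩

end

end MaslovOperator

end

theorem theorem3 (L : MaslovOperator.LagrangianSurface) (C : MaslovOperator.SingularChart L)
    (a₀ u₀ : L.carrier) (ha₀ : L.IsRegularPt a₀) (hu₀ : (u₀ : MaslovOperator.Phase) ∈ C.r '' C.G)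
    (γ : Path a₀ u₀) (m : ℤ) (hm : C.HasIndex γ m) :
    -- agreement with the standard local operator in every standard chart
    (∀ (κ : MaslovOperator.ChartType) (V : Set MaslovOperator.Plane) (m' : ℤ),
      C.IsStdChart κ V → C.HasStdIndex κ V γ m' →
      ∀ A : MaslovOperator.Plane → ℂ, MaslovOperator.IsTestFun V A →
      ∀ (χ : MaslovOperator.Plane × ℝ → ℝ) (N : Set MaslovOperator.Plane),
        C.Admissible A χ N →
        MaslovOperator.EqModO N (C.angleOp χ m A) (C.stdOp κ V m' A)) ∧
    -- agreement with the standard operator glued over an atlas of standard charts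
    (∀ {ι : Type*} (κ : ι → MaslovOperator.ChartType) (V : ι → Set MaslovOperator.Plane)
      (m' : ι → ℤ) (e : ι → MaslovOperator.Plane → ℝ),
      (∀ k, C.IsStdChart (κ k) (V k)) → (∀ k, C.HasStdIndex (κ k) (V k) γ (m' k)) →
      MaslovOperator.IsPartition C.G V e →
      ∀ A : MaslovOperator.Plane → ℂ, MaslovOperator.IsTestFun C.G A →
      ∀ (χ : MaslovOperator.Plane × ℝ → ℝ) (N : Set MaslovOperator.Plane),
        C.Admissible A χ N →
        MaslovOperator.EqModO N (C.angleOp χ m A) (C.stdGlobalOp κ V m' e A)) ∧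
    -- agreement of the Maslov indices
    (∀ (θ : ℝ) (V : Set MaslovOperator.Plane) (m' : ℤ),
      C.IsStdChart (.mixed θ) V → (∃ y ∈ V, L.IsFocalPt (C.r y)) →
      C.HasStdIndex (.mixed θ) V γ m' → m ≡ m' [ZMOD 4]) := by

  refine ⟨fun κ V m' hV hm' A hA χ N hχ => ?_, fun κ V m' e hV hm' he A hA χ N hχ => ?_,
    fun θ V m' hV ⟨y, hy, hf⟩ hm' => ?_⟩
  · have hA' : MaslovOperator.TestFun V A := hA.testFun
    obtain ⟨a, ha, e⟩ := MaslovOperator.SingularChart.exists_angleAmp (hA'.mono hV.subset) hχ m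
    exact (MaslovOperator.SingularChart.asymp_angleInt_stdOp hV hu₀ hm hm' hA' ha).eqModO
      hχ.measurable e
  · obtain ⟨a, ha, e'⟩ := MaslovOperator.SingularChart.exists_angleAmp hA.testFun hχ m
    exact (MaslovOperator.SingularChart.asymp_angleInt_stdGlobalOp hV hu₀ hm hm' he hA.testFun
      ha).eqModO hχ.measurable e'
  -- At the focal point det(P, P_ψ) and the mixed Jacobian have the same sign, which gives equality
  -- and not only congruence.
  · have hG := hV.subset hy
    have hpos := (MaslovOperator.SingularChart.mixed_at_focal hG
      (MaslovOperator.SingularChart.focal_jacDet (C.G_subset hG) hf) (hV.jac_ne_zero y hy)).2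
    rw [MaslovOperator.SingularChart.index_eq_of_focal hV hu₀ hm hm' hy hpos]
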